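/- **Setting.** For every length $N$ let $\mathbf x\in\mathbb R^N$ be a random vector with IID entries, whose common law does not depend on $N$ and satisfies $\mathrm E\{x_n^2\}=1$, $\mathrm E\{x_n^4\}<\infty$. Let $\mathbf V$ be a Haar-distributed $N\times N$ orthogonal matrix and $\boldsymbol{\mathcal X}=\mathbf V\mathbf x$. The local estimators are separable-IID: for $t\ge 1$, $$[\gamma_t(\mathbf a)]_n=\gamma_t(a_n;r^\gamma_n),\qquad [\phi_t(\mathbf a)]_n=\phi_t(a_n;r^\phi_n),$$ where the scalar functions on the right are measurable and do not depend on $N$ and $n$, and where $r^\gamma_n$ is a measurable function (not depending on $N$ and $n$) of $(\mathcal X_n,w^\gamma_n)$ and $r^\phi_n$ one of $(x_n,w^\phi_n)$, with IID noises $w^\gamma_n$ and $w^\phi_n$ whose laws do not depend on $N$. The generic iterative process is, for $t\ge1$, $$\hat{\boldsymbol{\mathcal X}}{}^{\rm out}_t=\gamma_t(\hat{\boldsymbol{\mathcal X}}{}^{\rm in}_{t-1}),\quad \hat{\mathbf x}^{\rm out}_t=\phi_t(\hat{\mathbf x}^{\rm in}_{t-1}),\quad \hat{\mathbf x}^{\rm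 in}_t=\mathbf V^{\rm T}\hat{\boldsymbol{\mathcal X}}{}^{\rm out}_t,\quad \hat{\boldsymbol{\mathcal X}}{}^{\rm in}_t=\mathbf V\hat{\mathbf x}^{\rm out}_t,$$ started from $\hat{\boldsymbol{\mathcal X}}{}^{\rm in}_0=a\boldsymbol{\mathcal X}+\mathbf g_0$ and $\hat{\mathbf x}^{\rm in}_0=b\,\mathbf x+\mathbf f_0$ with constants $a,b$ and with $\mathbf g_0,\mathbf f_0$ having IID centred Gaussian entries of fixed variances (possibly zero, so that the trivial start $\mathbf 0,\mathbf 0$ is included). $\mathbf V,\mathbf x,\mathbf w^\gamma,\mathbf w^\phi,\mathbf g_0,\mathbf f_0$ are mutually independent. For each $t$ the entries of $\hat{\boldsymbol{\mathcal X}}{}^{\rm out}_t$ and $\hat{\mathbf x}^{\rm out}_t$ have finite fourth moments, and their squares are uniformly integrable over all $N$ and all positions $n$ (both hold, e.g., if the fourth moments are bounded uniformly in $N$ and $n$). The Gram–Schmidt (GS) error of $\hat{\mathbf s}$ with respect to $\mathbf s$ is $\hat{\mathbf s}-\alpha\mathbf s$ with $\alpha=\frac1N\mathrm E\{\hat{\mathbf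 s}^{\rm T}\mathbf s\}$. Let $\mathbf g^{\rm in}_t,\mathbf g^{\rm out}_t$ be the GS errors of $\hat{\boldsymbol{\mathcal X}}{}^{\rm in}_t,\hat{\boldsymbol{\mathcal X}}{}^{\rm out}_t$ with respect to $\boldsymbol{\mathcal X}$, and $\mathbf f^{\rm in}_t,\mathbf f^{\rm out}_t$ those of $\hat{\mathbf x}^{\rm in}_t,\hat{\mathbf x}^{\rm out}_t$ with respect to $\mathbf x$. The estimators are called orthogonal at iteration $t$ if, in the limit $N\to\infty$, $$\tfrac1N\mathrm E\{(\mathbf g^{\rm in}_{t-1})^{\rm T}\mathbf g^{\rm out}_t\}\to0,\qquad \tfrac1N\mathrm E\{(\mathbf f^{\rm in}_{t-1})^{\rm T}\mathbf f^{\rm out}_t\}\to0$$ (in particular if these expectations vanish for every $N$). For sequences of random vectors $\mathbf a,\mathbf b\in\mathbb R^N$, write $\frac1N\mathbf a^{\rm T}\mathbf b\overset{\rm LLN}{\longrightarrow}0$ if 1. $\frac1N\mathbf a^{\rm T}\mathbf b\to0$ in probability as $N\to\infty$; and 2. whenever $\liminf_N\frac1N\mathrm E\|\mathbf a\|^2>0$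 and $\liminf_N\frac1N\mathrm E\|\mathbf b\|^2>0$, $\mathbf a$ and $\mathbf b$ are LLN-orthogonal, that is: $\mathrm E\|\mathbf a\|^2$ and $\mathrm E\|\mathbf b\|^2$ are nonzero for all large $N$; $\max_n|\mathrm E\{a_nb_n\}|\to0$ as $N\to\infty$; $\mathrm{Var}\{a_nb_n\}$ is finite for all $N$ and $n$; and for all $\delta,\varepsilon>0$ there is an $N'$ with $$\Pr\left(\frac{(\mathbf a^{\rm T}\mathbf b)^2}{\mathrm E\{\|\mathbf a\|^2\}\,\mathrm E\{\|\mathbf b\|^2\}}<\varepsilon\right)\ge1-\delta\qquad\text{for all }N>N'.$$ **Theorem.** If $\gamma_t$ and $\phi_t$ are orthogonal for all $t\ge1$ (and separable-IID, as above), then for all $t\ge1$ and $0\le t'<t$ $$\tfrac1N(\mathbf g^{\rm in}_{t'})^{\rm T}\mathbf g^{\rm out}_t\overset{\rm LLN}{\longrightarrow}0,\quad \tfrac1N(\mathbf f^{\rm in}_{t'})^{\rm T}\mathbf f^{\rm out}_t\overset{\rm LLN}{\longrightarrow}0,\quad \tfrac1N\boldsymbol{\mathcal X}^{\rm T}\mathbf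 g^{\rm out}_t\overset{\rm LLN}{\longrightarrow}0,\quad \tfrac1N\mathbf x^{\rm T}\mathbf f^{\rm out}_t\overset{\rm LLN}{\longrightarrow}0 .$$ -/

import Mathlib

open MeasureTheory ProbabilityTheory Filter Topology
open scoped NNReal ENNReal Matrix

namespace OAMP

/-! ### Gram-Schmidt models and LLN-orthogonality

A random vector of length `N` is a map `Ω → Fin N → ℝ`.  A sequence of random vectors, one for
every length `N`, is a map `∀ N, Ω → Fin N → ℝ`. -/

section GramSchmidt

variable {Ω : Type*} [MeasurableSpace Ω]

/-- The Gram-Schmidt coefficient `α = (1/N) E{x̂ᵀ x}` of `x̂` with respect to `x`. -/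
noncomputable def gsCoeff (P : Measure Ω) {N : ℕ} (x xhat : Ω → Fin N → ℝ) : ℝ :=
  (1 / (N : ℝ)) * ∫ ω, xhat ω ⬝ᵥ x ω ∂P

/-- The Gram-Schmidt error `ξ = x̂ - α x` in the GS model `x̂ = α x + ξ`. -/
noncomputable def gsError (P : Measure Ω) {N : ℕ} (x xhat : Ω → Fin N → ℝ) : Ω → Fin N → ℝ :=
  fun ω => xhat ω - gsCoeff P x xhat • x ω

/-- The total power `E{‖a‖²}` of a random vector (Euclidean norm). -/
noncomputable def power (P : Measure Ω) {N : ℕ} (a : Ω → Fin N → ℝ) : ℝ :=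
  ∫ ω, a ω ⬝ᵥ a ω ∂P

/-- The average entry-wise power `(1/N) E{‖a‖²}` stays away from zero as `N → ∞`. -/
def NonvanishingPower (P : Measure Ω) (a : ∀ N, Ω → Fin N → ℝ) : Prop :=
  ∃ c : ℝ, 0 < c ∧ ∀ᶠ N : ℕ in atTop, c ≤ (1 / (N : ℝ)) * power P (a N)

/-- LLN-orthogonality of two sequences of random vectors: for large `N` both have nonzero power,
`E{a_n b_n}` is zero in the limit `N → ∞` (uniformly in the position `n`), `Var{a_n b_n}` is
finite, and for all `δ, ε > 0` there is an `N'` such that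
`Pr((aᵀb)² / (E{‖a‖²} E{‖b‖²}) < ε) ≥ 1 - δ` for all `N > N'`. -/
structure LLNOrthogonal (P : Measure Ω) (a b : ∀ N, Ω → Fin N → ℝ) : Prop where
  power_left : ∀ᶠ N : ℕ in atTop, power P (a N) ≠ 0
  power_right : ∀ᶠ N : ℕ in atTop, power P (b N) ≠ 0
  mean : ∀ ε : ℝ, 0 < ε → ∀ᶠ N : ℕ in atTop, ∀ n : Fin N, |∫ ω, a N ω n * b N ω n ∂P| < ε
  var : ∀ (N : ℕ) (n : Fin N), MemLp (fun ω => a N ω n * b N ω n) 2 P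
  lln : ∀ δ : ℝ, 0 < δ → ∀ ε : ℝ, 0 < ε → ∃ N' : ℕ, ∀ N : ℕ, N' < N →
    1 - δ ≤ P.real {ω | (a N ω ⬝ᵥ b N ω) ^ 2 / (power P (a N) * power P (b N)) < ε}

/-- The relation `(1/N) aᵀb → 0` (LLN) for sequences whose power is allowed to vanish: the
normalized inner product tends to zero in probability, and `a`, `b` are LLN-orthogonal
as soon as neither of them has vanishing power (LLN-orthogonality proper is void for,
e.g., the zero vector). -/
def LLNLimitZero (P : Measure Ω) (a b : ∀ N, Ω → Fin N → ℝ) : Prop :=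
  TendstoInMeasure P (fun (N : ℕ) ω => (1 / (N : ℝ)) * (a N ω ⬝ᵥ b N ω)) atTop (fun _ => 0) ∧
  (NonvanishingPower P a → NonvanishingPower P b → LLNOrthogonal P a b)

/-- The estimator which maps the message `input` to the message `output` is orthogonal (with
respect to the signal `s`): the expected inner product of its input and output GS errors is zero.
The expectation is normalized by `N` and the equation is required in the limit `N → ∞`. -/
def IsOrthogonalEstimator (P : Measure Ω) (s input output : ∀ N, Ω → Fin N → ℝ) : Prop :=
  Tendsto (fun N : ℕ => (1 / (N : ℝ)) *
    ∫ ω, gsError P (s N) (input N) ω ⬝ᵥ gsError P (s N) (output N) ω ∂P) atTop (𝓝 0)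

/-- A random orthogonal matrix is Haar distributed: its law is invariant under multiplication by
every fixed orthogonal matrix. -/
def IsHaarDistributed (P : Measure Ω) {N : ℕ}
    (V : Ω → Matrix.orthogonalGroup (Fin N) ℝ) : Prop :=
  AEMeasurable (fun ω i j => (V ω : Matrix (Fin N) (Fin N) ℝ) i j) P ∧
  ∀ U : Matrix.orthogonalGroup (Fin N) ℝ,
    P.map (fun ω i j => ((U * V ω : Matrix.orthogonalGroup (Fin N) ℝ) :
        Matrix (Fin N) (Fin N) ℝ) i j) =
      P.map (fun ω i j => (V ω : Matrix (Fin N) (Fin N) ℝ) i j)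

end GramSchmidt

/-! ### The generic iterative process -/

/-- The separable vector function whose `n`-th scalar function is the member `h · (r n)`, selected
by the datum `r n`, of the ensemble of scalar functions `h`. -/
def separable {R : Type*} {N : ℕ} (h : ℝ → R → ℝ) (r : Fin N → R) (a : Fin N → ℝ) : Fin N → ℝ :=
  fun n => h (a n) (r n)

/-- The input messages `(X̂ᵢₙ t, x̂ᵢₙ t)` of the generic iterative process. -/
def gipIn {N : ℕ} (V : Matrix (Fin N) (Fin N) ℝ) (γ φ : ℕ → (Fin N → ℝ) → (Fin N → ℝ))
    (X0 x0 : Fin N → ℝ) : ℕ → (Fin N → ℝ) × (Fin N → ℝ)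
  | 0 => (X0, x0)
  | t + 1 =>
    (V *ᵥ φ (t + 1) (gipIn V γ φ X0 x0 t).2, Vᵀ *ᵥ γ (t + 1) (gipIn V γ φ X0 x0 t).1)

/-- The output messages `(X̂ₒᵤₜ t, x̂ₒᵤₜ t)` of the generic iterative process; they are meaningful
for `t ≥ 1`. -/
def gipOut {N : ℕ} (V : Matrix (Fin N) (Fin N) ℝ) (γ φ : ℕ → (Fin N → ℝ) → (Fin N → ℝ))
    (X0 x0 : Fin N → ℝ) : ℕ → (Fin N → ℝ) × (Fin N → ℝ)
  | 0 => 0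
  | t + 1 => (γ (t + 1) (gipIn V γ φ X0 x0 t).1, φ (t + 1) (gipIn V γ φ X0 x0 t).2)

/-- The data of the iterative estimation of `x` and `𝒳 = V x`, for every length `N`.

* `γ t`, `φ t` are the ensembles of scalar functions of the local estimators at iteration `t`;
  the member used at position `n` is selected by the observation `r n`.
* The observations are `rΓ n = obsΓ (𝒳 n) (wΓ n)` and `rΦ n = obsΦ (x n) (wΦ n)`, with noises
  `wΓ`, `wΦ`.  (Randomness of the estimators that is not an observation is part of the noise.)
* The initial messages are `X̂ᵢₙ 0 = αΓ 𝒳 + g0` and `x̂ᵢₙ 0 = αΦ x + f0`. -/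
structure System (Ω WΓ WΦ RΓ RΦ : Type*) where
  γ : ℕ → ℝ → RΓ → ℝ
  φ : ℕ → ℝ → RΦ → ℝ
  obsΓ : ℝ → WΓ → RΓ
  obsΦ : ℝ → WΦ → RΦ
  αΓ : ℝ
  αΦ : ℝ
  V : ∀ N, Ω → Matrix.orthogonalGroup (Fin N) ℝ
  x : ∀ N, Ω → Fin N → ℝ
  wΓ : ∀ N, Ω → Fin N → WΓ
  wΦ : ∀ N, Ω → Fin N → WΦ
  g0 : ∀ N, Ω → Fin N → ℝ
  f0 : ∀ N, Ω → Fin N → ℝ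

namespace System

variable {Ω WΓ WΦ RΓ RΦ : Type*}

/-- The transformed signal `𝒳 = V x`. -/
def X (S : System Ω WΓ WΦ RΓ RΦ) (N : ℕ) (ω : Ω) : Fin N → ℝ :=
  (S.V N ω : Matrix (Fin N) (Fin N) ℝ) *ᵥ S.x N ω

/-- The local estimator `γ_t` as a (random) separable vector function. -/
def estΓ (S : System Ω WΓ WΦ RΓ RΦ) (N : ℕ) (ω : Ω) (t : ℕ) : (Fin N → ℝ) → (Fin N → ℝ) :=
  separable (S.γ t) (fun n => S.obsΓ (S.X N ω n) (S.wΓ N ω n))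

/-- The local estimator `φ_t` as a (random) separable vector function. -/
def estΦ (S : System Ω WΓ WΦ RΓ RΦ) (N : ℕ) (ω : Ω) (t : ℕ) : (Fin N → ℝ) → (Fin N → ℝ) :=
  separable (S.φ t) (fun n => S.obsΦ (S.x N ω n) (S.wΦ N ω n))

/-- The initial message `X̂ᵢₙ 0`. -/
def initΓ (S : System Ω WΓ WΦ RΓ RΦ) (N : ℕ) (ω : Ω) : Fin N → ℝ :=
  S.αΓ • S.X N ω + S.g0 N ω

/-- The initial message `x̂ᵢₙ 0`. -/
def initΦ (S : System Ω WΓ WΦ RΓ RΦ) (N : ℕ) (ω : Ω) : Fin N → ℝ :=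
  S.αΦ • S.x N ω + S.f0 N ω

/-- `X̂ᵢₙ t`, the message into `γ_{t+1}`. -/
def XIn (S : System Ω WΓ WΦ RΓ RΦ) (t N : ℕ) (ω : Ω) : Fin N → ℝ :=
  (gipIn (S.V N ω : Matrix (Fin N) (Fin N) ℝ) (S.estΓ N ω) (S.estΦ N ω)
    (S.initΓ N ω) (S.initΦ N ω) t).1

/-- `x̂ᵢₙ t`, the message into `φ_{t+1}`. -/
def xIn (S : System Ω WΓ WΦ RΓ RΦ) (t N : ℕ) (ω : Ω) : Fin N → ℝ :=
  (gipIn (S.V N ω : Matrix (Fin N) (Fin N) ℝ) (S.estΓ N ω) (S.estΦ N ω)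
    (S.initΓ N ω) (S.initΦ N ω) t).2

/-- `X̂ₒᵤₜ t`, the message out of `γ_t`. -/
def XOut (S : System Ω WΓ WΦ RΓ RΦ) (t N : ℕ) (ω : Ω) : Fin N → ℝ :=
  (gipOut (S.V N ω : Matrix (Fin N) (Fin N) ℝ) (S.estΓ N ω) (S.estΦ N ω)
    (S.initΓ N ω) (S.initΦ N ω) t).1

/-- `x̂ₒᵤₜ t`, the message out of `φ_t`. -/
def xOut (S : System Ω WΓ WΦ RΓ RΦ) (t N : ℕ) (ω : Ω) : Fin N → ℝ :=
  (gipOut (S.V N ω : Matrix (Fin N) (Fin N) ℝ) (S.estΓ N ω) (S.estΦ N ω)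
    (S.initΓ N ω) (S.initΦ N ω) t).2

variable [MeasurableSpace Ω]

/-- The GS error `gᵢₙ t` of `X̂ᵢₙ t` with respect to `𝒳`. -/
noncomputable def gIn (S : System Ω WΓ WΦ RΓ RΦ) (P : Measure Ω) (t N : ℕ) : Ω → Fin N → ℝ :=
  gsError P (S.X N) (S.XIn t N)

/-- The GS error `gₒᵤₜ t` of `X̂ₒᵤₜ t` with respect to `𝒳`. -/
noncomputable def gOut (S : System Ω WΓ WΦ RΓ RΦ) (P : Measure Ω) (t N : ℕ) : Ω → Fin N → ℝ :=
  gsError P (S.X N) (S.XOut t N)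

/-- The GS error `fᵢₙ t` of `x̂ᵢₙ t` with respect to `x`. -/
noncomputable def fIn (S : System Ω WΓ WΦ RΓ RΦ) (P : Measure Ω) (t N : ℕ) : Ω → Fin N → ℝ :=
  gsError P (S.x N) (S.xIn t N)

/-- The GS error `fₒᵤₜ t` of `x̂ₒᵤₜ t` with respect to `x`. -/
noncomputable def fOut (S : System Ω WΓ WΦ RΓ RΦ) (P : Measure Ω) (t N : ℕ) : Ω → Fin N → ℝ :=
  gsError P (S.x N) (S.xOut t N)

variable [MeasurableSpace WΓ] [MeasurableSpace WΦ] [MeasurableSpace RΓ] [MeasurableSpace RΦ]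

/-- The standing assumptions on the random system, with separable-IID local estimators.

* All scalar functions are measurable.
* The law `μx` of the entries of `x` has second moment one and a finite fourth moment.
* For every `N`, the rows `(x n, wΦ n, f0 n, wΓ n, g0 n)` are IID with independent components;
  `f0 n` and `g0 n` are centred Gaussian (variance zero is allowed).
* `V` is Haar distributed and independent of all of these.
* The entries of the output messages have finite fourth moments, and their squares are uniformly
  integrable (over all lengths `N` and positions `n`), for each iteration `t`. -/
structure IsModel (S : System Ω WΓ WΦ RΓ RΦ) (P : Measure Ω) (μx : Measure ℝ)
    (νΓ : Measure WΓ) (νΦ : Measure WΦ) (vΓ vΦ : ℝ≥0) : Prop where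
  measurable_γ : ∀ t, Measurable (Function.uncurry (S.γ t))
  measurable_φ : ∀ t, Measurable (Function.uncurry (S.φ t))
  measurable_obsΓ : Measurable (Function.uncurry S.obsΓ)
  measurable_obsΦ : Measurable (Function.uncurry S.obsΦ)
  normalized : ∫ s, s ^ 2 ∂μx = 1
  fourth_moment : MemLp (fun s : ℝ => s) 4 μx
  iid : ∀ N, HasLaw
    (fun ω (n : Fin N) => (S.x N ω n, S.wΦ N ω n, S.f0 N ω n, S.wΓ N ω n, S.g0 N ω n))
    (Measure.pi fun _ : Fin N =>
      μx.prod (νΦ.prod ((gaussianReal 0 vΦ).prod (νΓ.prod (gaussianReal 0 vΓ))))) P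
  haar : ∀ N, IsHaarDistributed P (S.V N)
  indep : ∀ N, IndepFun
    (fun ω i j => (S.V N ω : Matrix (Fin N) (Fin N) ℝ) i j)
    (fun ω (n : Fin N) => (S.x N ω n, S.wΦ N ω n, S.f0 N ω n, S.wΓ N ω n, S.g0 N ω n)) P
  memLp_XOut : ∀ t N (n : Fin N), MemLp (fun ω => S.XOut t N ω n) 4 P
  memLp_xOut : ∀ t N (n : Fin N), MemLp (fun ω => S.xOut t N ω n) 4 P
  unifInt_XOut : ∀ t, UniformIntegrable
    (fun (p : Σ N : ℕ, Fin N) ω => S.XOut t p.1 ω p.2) 2 P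
  unifInt_xOut : ∀ t, UniformIntegrable
    (fun (p : Σ N : ℕ, Fin N) ω => S.xOut t p.1 ω p.2) 2 P

end System

end OAMP

/-!
The messages of the iteration are handled by revealing the Haar matrix `V` one column at a time.
Conditionally on the event that `V` maps the vectors `A 0, …, A (m - 1)` to `B 0, …, B (m - 1)`, the
matrix is Haar distributed on a coset of the stabilizer of these vectors (`CosetHaar`,
`CosetHaar.reveal`).  Hence the image of one more vector `a`, which may depend on everything revealed
before, has the law of `freshImage`: the image of the projection of `a` onto the span of the `A l`,
which is determined, plus the norm of the residual of `a` times the direction of the residual of an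
independent standard Gaussian vector (`CosetHaar.lintegral_image`, `CosetHaar.lintegral_resample`).

The data and the revealed vectors at position `n` form a row.  By induction on the number of revealed
vectors, the empirical law of the rows converges to a limit law (`RowState`, `rowState_image`).
Since the estimators are only measurable, weak convergence is of no use: the empirical laws have to
converge on every measurable set, and null sets of the limit law have to be avoided by all rows
(`RowLLN`, `RowState`).  If the residual of the new vector does not vanish in the limit, this
follows from mean square closeness to a linear form plus Gaussian noise, because the entries of the
fresh image have conditional densities bounded uniformly in the length at all positions
(`antilipschitz_freshImage`, `DensityBound.rowLLN`).  If it vanishes in the limit, then with high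
probability it vanishes exactly, because null sets are avoided
(`StepData.eventually_inpRes_eq`).

In the limit law, a message that was obtained as an image under `V` or `Vᵀ` is a multiple of the
signal plus a Gaussian variable, and all these variables and the initial noise are jointly Gaussian,
independent of the signal and of the noise of the estimators (`GaussRep`).  An estimator is
a function of a single one of them and of the signal and the noise.  If its Gram-Schmidt error is
uncorrelated with this variable, then, by reflection invariance of the Gaussian law, it is
uncorrelated with all of them (`GaussRep.integral_eq_zero`).  This is the step from orthogonality to
the input of the same iteration to orthogonality to the inputs of all earlier ones.  The invariant
`Inv`, preserved by `Inv.step`, records it: on either side of the process, the Gaussian parts of the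
columns that are images of vectors of the other side are uncorrelated with the parts of the
estimator outputs that are orthogonal to the signal.  It holds along the whole process
(`Estimators.IsOrthogonal.exists_inv`).

Uniform integrability of the squares turns limits in probability into limits of expectations and
conversely allows orthogonality in expectation to be used in the limit law
(`MeanUI.tendsto_integral`, `Inv.tendsto_gsErr`).  The entrywise expectations do not depend on the
position, since the law of the process is invariant under permutations of the positions
(`Equivariant.integral_mul_eq`).  The results hold for a canonical probability space and are carried
over to a random system with the same law (`System.IsModel.map_canon`, `LLNLimitZero.of_tendsto`).
-/

set_option linter.unusedSectionVars false

namespace OAMP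

/-! ### Euclidean norm and orthogonal residuals -/

section LinearAlgebra

lemma measurable_smul' {α κ : Type*} [MeasurableSpace α] {f : α → ℝ} {g : α → κ → ℝ}
    (hf : Measurable f) (hg : Measurable g) : Measurable fun a => f a • g a :=
  measurable_pi_lambda _ fun i => hf.mul ((measurable_pi_apply i).comp hg)

variable {ι : Type*} [Fintype ι]

/-- The Euclidean norm of a plain coordinate vector. -/
noncomputable def nrm (v : ι → ℝ) : ℝ := √(v ⬝ᵥ v)

lemma dot_self_nonneg (v : ι → ℝ) : 0 ≤ v ⬝ᵥ v :=
  Finset.sum_nonneg fun i _ => mul_self_nonneg (v i)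

lemma dot_self_eq_sum (v : ι → ℝ) : v ⬝ᵥ v = ∑ i, v i ^ 2 := by
  simp [dotProduct, sq]

lemma nrm_nonneg (v : ι → ℝ) : 0 ≤ nrm v := Real.sqrt_nonneg _

lemma nrm_sq (v : ι → ℝ) : nrm v ^ 2 = v ⬝ᵥ v := Real.sq_sqrt (dot_self_nonneg v)

lemma nrm_eq_norm (v : ι → ℝ) : nrm v = ‖WithLp.toLp 2 v‖ := by
  rw [EuclideanSpace.norm_eq, nrm, dot_self_eq_sum]
  simp

lemma nrm_add_le (v w : ι → ℝ) : nrm (v + w) ≤ nrm v + nrm w := by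
  simp only [nrm_eq_norm, WithLp.toLp_add]
  exact norm_add_le _ _

lemma nrm_smul (t : ℝ) (v : ι → ℝ) : nrm (t • v) = |t| * nrm v := by
  simp only [nrm_eq_norm, WithLp.toLp_smul, norm_smul, Real.norm_eq_abs]

lemma nrm_zero : nrm (0 : ι → ℝ) = 0 := by simp [nrm]

lemma nrm_eq_zero {v : ι → ℝ} : nrm v = 0 ↔ v = 0 := by
  rw [nrm, Real.sqrt_eq_zero (dot_self_nonneg v), dotProduct_self_eq_zero]

lemma abs_dot_le (v w : ι → ℝ) : |v ⬝ᵥ w| ≤ nrm v * nrm w := by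
  refine Real.abs_le_sqrt ?_ |>.trans (Real.sqrt_mul (dot_self_nonneg v) _).le
  simpa [dotProduct, sq] using Finset.sum_mul_sq_le_sq_mul_sq Finset.univ v w

lemma dot_sub_self (v w : ι → ℝ) :
    (v - w) ⬝ᵥ (v - w) = v ⬝ᵥ v - 2 * (v ⬝ᵥ w) + w ⬝ᵥ w := by
  simp only [sub_dotProduct, dotProduct_sub, dotProduct_comm w v]
  ring

/-- The residual of `v` after orthogonal projection onto the span of `c 0, …, c (m - 1)`, computed
by the Gram-Schmidt recursion (a zero residual of `c m` contributes nothing, as `x / 0 = 0`). -/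
noncomputable def res (c : ℕ → ι → ℝ) : ℕ → (ι → ℝ) → ι → ℝ
  | 0, v => v
  | m + 1, v => res c m v -
      ((res c m (c m) ⬝ᵥ v) / (res c m (c m) ⬝ᵥ res c m (c m))) • res c m (c m)

variable (c : ℕ → ι → ℝ)

lemma res_add (m : ℕ) (v w : ι → ℝ) : res c m (v + w) = res c m v + res c m w := by
  induction m with
  | zero => rfl
  | succ m ih =>
    simp only [res, ih, dotProduct_add, add_div, add_smul]
    abel

lemma res_smul (m : ℕ) (t : ℝ) (v : ι → ℝ) : res c m (t • v) = t • res c m v := by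
  induction m with
  | zero => rfl
  | succ m ih =>
    simp only [res, ih, dotProduct_smul, smul_eq_mul, mul_div_assoc, smul_sub, mul_smul]

lemma res_sub (m : ℕ) (v w : ι → ℝ) : res c m (v - w) = res c m v - res c m w := by
  have h := res_add c m (v - w) w
  rw [sub_add_cancel] at h
  rw [h, add_sub_cancel_right]

lemma res_zero (m : ℕ) : res c m 0 = 0 := by
  have h := res_smul c m 0 0
  simpa using h

lemma dot_res_comm (m : ℕ) (v w : ι → ℝ) : res c m v ⬝ᵥ w = v ⬝ᵥ res c m w := by
  induction m with
  | zero => rfl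
  | succ m ih =>
    simp only [res, sub_dotProduct, dotProduct_sub, smul_dotProduct, dotProduct_smul, ih,
      smul_eq_mul]
    rw [dotProduct_comm v (res c m (c m))]
    ring

lemma res_res (m : ℕ) (v : ι → ℝ) : res c m (res c m v) = res c m v := by
  induction m generalizing v with
  | zero => rfl
  | succ m ih =>
    simp only [res]
    set u := res c m (c m) with hu
    have hu' : res c m u = u := ih (c m)
    have h1 : u ⬝ᵥ res c m v = u ⬝ᵥ v := by rw [← dot_res_comm, hu']
    rw [res_sub, res_smul, ih, hu', dotProduct_sub, dotProduct_smul, h1, smul_eq_mul]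
    by_cases h0 : u ⬝ᵥ u = 0
    · simp [h0]
    · rw [div_mul_cancel₀ _ h0]
      simp

lemma res_dot_res (m : ℕ) (v w : ι → ℝ) : res c m v ⬝ᵥ res c m w = v ⬝ᵥ res c m w := by
  rw [dot_res_comm, res_res]

lemma res_col {m l : ℕ} (hl : l < m) : res c m (c l) = 0 := by
  induction m with
  | zero => omega
  | succ m ih =>
    rcases Nat.lt_succ_iff_lt_or_eq.1 hl with h | rfl
    · simp only [res, ih h]
      rw [dot_res_comm, ih h]
      simp
    · simp only [res]
      by_cases h0 : res c l (c l) ⬝ᵥ res c l (c l) = 0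
      · rw [dotProduct_self_eq_zero.1 h0]
        simp
      · rw [dot_res_comm c l (c l) (c l), ← res_dot_res c l (c l) (c l), div_self h0]
        simp

lemma res_dot_col {m l : ℕ} (hl : l < m) (v : ι → ℝ) : res c m v ⬝ᵥ c l = 0 := by
  rw [dot_res_comm, res_col c hl, dotProduct_zero]

lemma exists_sub_res_eq (m : ℕ) (v : ι → ℝ) :
    ∃ k : ℕ → ℝ, v - res c m v = ∑ l ∈ Finset.range m, k l • c l := by
  induction m generalizing v with
  | zero => exact ⟨0, by simp [res]⟩
  | succ m ih =>
    obtain ⟨k, hk⟩ := ih v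
    obtain ⟨k', hk'⟩ := ih (c m)
    set t := (res c m (c m) ⬝ᵥ v) / (res c m (c m) ⬝ᵥ res c m (c m)) with ht
    refine ⟨fun l => if l < m then k l - t * k' l else t, ?_⟩
    rw [Finset.sum_range_succ, Finset.sum_congr rfl (g := fun l => k l • c l - t • k' l • c l)]
    · rw [Finset.sum_sub_distrib, ← Finset.smul_sum, ← hk, ← hk']
      simp only [res, lt_irrefl, if_false, ← ht, smul_sub]
      abel
    · intro l hl
      simp only [if_pos (Finset.mem_range.1 hl), sub_smul, mul_smul]

/-- The residual only depends on the part of `v` outside the span. -/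
lemma res_sub_sum (m : ℕ) (v : ι → ℝ) (k : ℕ → ℝ) :
    res c m (v - ∑ l ∈ Finset.range m, k l • c l) = res c m v := by
  have : res c m (∑ l ∈ Finset.range m, k l • c l) = 0 := by
    have h : ∀ s : Finset ℕ, s ⊆ Finset.range m → res c m (∑ l ∈ s, k l • c l) = 0 := by
      intro s
      induction s using Finset.induction with
      | empty => intro _; simp [res_zero]
      | insert a s ha ih =>
        intro hs
        rw [Finset.sum_insert ha, res_add, res_smul,
          res_col c (Finset.mem_range.1 (hs (Finset.mem_insert_self a s))),
          ih ((Finset.subset_insert a s).trans hs)]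
        simp
    exact h _ subset_rfl
  rw [res_sub, this, sub_zero]

lemma dot_self_eq_res_add (m : ℕ) (v : ι → ℝ) :
    v ⬝ᵥ v = res c m v ⬝ᵥ res c m v + (v - res c m v) ⬝ᵥ (v - res c m v) := by
  rw [dot_sub_self, res_dot_res]
  ring

lemma res_congr {c c' : ℕ → ι → ℝ} {m : ℕ} (h : ∀ l < m, c l = c' l) (v : ι → ℝ) :
    res c m v = res c' m v := by
  induction m generalizing v with
  | zero => rfl
  | succ m ih =>
    have ih' := ih (fun l hl => h l (hl.trans m.lt_succ_self))
    simp only [res, ih', h m m.lt_succ_self]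

lemma dot_mulVec_of_orth [DecidableEq ι] {V : Matrix ι ι ℝ} (hV : Vᵀ * V = 1) (v w : ι → ℝ) :
    (V *ᵥ v) ⬝ᵥ (V *ᵥ w) = v ⬝ᵥ w := by
  rw [Matrix.dotProduct_mulVec, Matrix.vecMul_mulVec, hV, Matrix.vecMul_one]

lemma nrm_mulVec_of_orth [DecidableEq ι] {V : Matrix ι ι ℝ} (hV : Vᵀ * V = 1) (v : ι → ℝ) :
    nrm (V *ᵥ v) = nrm v := by
  rw [nrm, nrm, dot_mulVec_of_orth hV]

lemma mulVec_res [DecidableEq ι] {V : Matrix ι ι ℝ} (hV : Vᵀ * V = 1) {c c' : ℕ → ι → ℝ} {m : ℕ}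
    (h : ∀ l < m, V *ᵥ c l = c' l) (v : ι → ℝ) :
    V *ᵥ res c m v = res c' m (V *ᵥ v) := by
  induction m generalizing v with
  | zero => rfl
  | succ m ih =>
    have ih' := ih (fun l hl => h l (hl.trans m.lt_succ_self))
    simp only [res]
    rw [Matrix.mulVec_sub, Matrix.mulVec_smul, ih', ih', h m m.lt_succ_self,
      ← dot_mulVec_of_orth hV (res c m (c m)) v,
      ← dot_mulVec_of_orth hV (res c m (c m)) (res c m (c m)), ih', h m m.lt_succ_self]

lemma measurable_dot {α : Type*} [MeasurableSpace α] {f g : α → ι → ℝ} (hf : Measurable f)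
    (hg : Measurable g) : Measurable fun a => f a ⬝ᵥ g a := by
  simp only [dotProduct]
  exact Finset.measurable_sum _ fun i _ =>
    ((measurable_pi_apply i).comp hf).mul ((measurable_pi_apply i).comp hg)

lemma measurable_nrm {α : Type*} [MeasurableSpace α] {f : α → ι → ℝ} (hf : Measurable f) :
    Measurable fun a => nrm (f a) := (measurable_dot hf hf).sqrt

lemma measurable_res {α : Type*} [MeasurableSpace α] {c : α → ℕ → ι → ℝ} {v : α → ι → ℝ}
    (hc : Measurable c) (hv : Measurable v) (m : ℕ) : Measurable fun a => res (c a) m (v a) := by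
  induction m generalizing v with
  | zero => exact hv
  | succ m ih =>
    simp only [res]
    have h := ih ((measurable_pi_apply m).comp hc)
    exact (ih hv).sub (measurable_smul' ((measurable_dot h hv).div (measurable_dot h h)) h)

/-- The unit vector in the direction of `v` (zero if `v = 0`). -/
noncomputable def unitVec (v : ι → ℝ) : ι → ℝ := (nrm v)⁻¹ • v

lemma nrm_unitVec {v : ι → ℝ} (hv : v ≠ 0) : nrm (unitVec v) = 1 := by
  have h : nrm v ≠ 0 := fun h => hv (nrm_eq_zero.1 h)
  rw [unitVec, nrm_smul, abs_of_nonneg (inv_nonneg.2 (nrm_nonneg v)), inv_mul_cancel₀ h]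

lemma measurable_unitVec {α : Type*} [MeasurableSpace α] {f : α → ι → ℝ} (hf : Measurable f) :
    Measurable fun a => unitVec (f a) := measurable_smul' (measurable_nrm hf).inv hf

/-- The reflection in the hyperplane orthogonal to `u`, as a matrix (the identity if `u = 0`). -/
noncomputable def reflMat [DecidableEq ι] (u : ι → ℝ) : Matrix ι ι ℝ :=
  1 - (2 / (u ⬝ᵥ u)) • Matrix.vecMulVec u u

lemma reflMat_mulVec [DecidableEq ι] (u v : ι → ℝ) :
    reflMat u *ᵥ v = v - (2 * (u ⬝ᵥ v) / (u ⬝ᵥ u)) • u := by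
  rw [reflMat, Matrix.sub_mulVec, Matrix.one_mulVec, Matrix.smul_mulVec, Matrix.vecMulVec_mulVec]
  ext i
  simp
  ring

lemma reflMat_orth [DecidableEq ι] (u : ι → ℝ) : (reflMat u)ᵀ * reflMat u = 1 := by
  have hT : (reflMat u)ᵀ = reflMat u := by
    simp [reflMat, Matrix.transpose_sub, Matrix.transpose_smul, Matrix.transpose_vecMulVec]
  rw [hT]
  apply Matrix.ext_of_mulVec_single
  intro i
  rw [← Matrix.mulVec_mulVec, Matrix.one_mulVec, reflMat_mulVec, reflMat_mulVec, dotProduct_sub,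
    dotProduct_smul, smul_eq_mul]
  by_cases h0 : u ⬝ᵥ u = 0
  · simp [h0]
  · rw [div_mul_cancel₀ _ h0]
    ext k
    simp
    ring

end LinearAlgebra

/-! ### Standard Gaussian vectors -/

section Gaussian

variable {ι : Type*} [Fintype ι]

/-- The law of a vector with IID standard Gaussian entries. -/
noncomputable def stdG (ι : Type*) [Fintype ι] : Measure (ι → ℝ) :=
  Measure.pi fun _ : ι => gaussianReal 0 1

instance : IsProbabilityMeasure (stdG ι) := by unfold stdG; infer_instance

lemma measurable_mulVec (V : Matrix ι ι ℝ) : Measurable fun z : ι → ℝ => V *ᵥ z :=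
  measurable_pi_lambda _ fun _ => measurable_dot measurable_const measurable_id

/-- The standard Gaussian law is invariant under orthogonal matrices. -/
lemma stdG_map_orth [DecidableEq ι] {V : Matrix ι ι ℝ} (hV : Vᵀ * V = 1) :
    (stdG ι).map (fun z => V *ᵥ z) = stdG ι := by
  have hV' : V * Vᵀ = 1 := mul_eq_one_comm.1 hV
  let e : EuclideanSpace ℝ ι ≃ₗᵢ[ℝ] EuclideanSpace ℝ ι :=
    { toFun := fun z => WithLp.toLp 2 (V *ᵥ WithLp.ofLp z)
      invFun := fun z => WithLp.toLp 2 (Vᵀ *ᵥ WithLp.ofLp z)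
      map_add' := fun x y => by simp [Matrix.mulVec_add]
      map_smul' := fun t x => by simp [Matrix.mulVec_smul]
      left_inv := fun x => by simp [Matrix.mulVec_mulVec, hV]
      right_inv := fun x => by simp [Matrix.mulVec_mulVec, hV']
      norm_map' := fun x => by
        have := nrm_mulVec_of_orth hV (WithLp.ofLp x)
        rw [nrm_eq_norm, nrm_eq_norm] at this
        exact this }
  have h := stdGaussian_map e
  rw [← map_pi_eq_stdGaussian, Measure.map_map e.continuous.measurable (by fun_prop)] at h
  have h2 := congrArg (fun μ => μ.map (WithLp.ofLp : EuclideanSpace ℝ ι → ι → ℝ)) h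
  simp only at h2
  rw [Measure.map_map (by fun_prop) (e.continuous.measurable.comp (by fun_prop)),
    Measure.map_map (by fun_prop) (by fun_prop)] at h2
  have e1 : (WithLp.ofLp ∘ (⇑e ∘ WithLp.toLp 2) : (ι → ℝ) → ι → ℝ) = fun z => V *ᵥ z := by
    ext z i; rfl
  have e2 : (WithLp.ofLp ∘ (WithLp.toLp 2) : (ι → ℝ) → ι → ℝ) = id := by ext z i; rfl
  rw [e1, e2, Measure.map_id] at h2
  exact h2

/-- Fubini in one coordinate: a bound for the integral over each coordinate line bounds the whole
integral. -/
lemma lintegral_stdG_le_of_slice [DecidableEq ι] (n : ι) {f : (ι → ℝ) → ℝ≥0∞} (hf : Measurable f)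
    {C : ℝ≥0∞} (h : ∀ z, ∫⁻ ζ, f (Function.update z n ζ) ∂(gaussianReal 0 1) ≤ C) :
    ∫⁻ z, f z ∂(stdG ι) ≤ C := by
  have h1 : ∫⁻ z, f z ∂(stdG ι) ≤ ∫⁻ _, C ∂(stdG ι) := by
    unfold stdG
    refine lintegral_le_of_lmarginal_le (μ := fun _ : ι => gaussianReal 0 1) {n} hf
      measurable_const ?_
    intro z
    rw [lmarginal_singleton, lmarginal_singleton]
    simpa using h z
  simpa using h1

lemma gaussianReal_le_volume : gaussianReal 0 1 ≤ (volume : Measure ℝ) := by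
  rw [gaussianReal_of_var_ne_zero _ one_ne_zero]
  calc volume.withDensity (gaussianPDF 0 1) ≤ volume.withDensity 1 := by
        refine withDensity_mono (Eventually.of_forall fun x => ?_)
        rw [gaussianPDF, Pi.one_apply]
        refine ENNReal.ofReal_le_one.2 ?_
        rw [gaussianPDFReal]
        have h1 : (√(2 * Real.pi * ((1 : ℝ≥0) : ℝ)))⁻¹ ≤ 1 := by
          refine inv_le_one_of_one_le₀ (Real.one_le_sqrt.2 ?_)
          have := Real.pi_gt_three
          simp
          linarith
        have h2 : Real.exp (-(x - 0) ^ 2 / (2 * ((1 : ℝ≥0) : ℝ))) ≤ 1 := by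
          rw [Real.exp_le_one_iff]
          simp only [sub_zero, NNReal.coe_one, mul_one]
          have := sq_nonneg x
          linarith
        exact mul_le_one₀ h1 (Real.exp_pos _).le h2
    _ = volume := by simp [withDensity_one]

/-- Hyperplanes through the origin are null sets of the standard Gaussian law. -/
lemma stdG_dot_eq_zero [DecidableEq ι] {w : ι → ℝ} (hw : w ≠ 0) :
    stdG ι {z | z ⬝ᵥ w = 0} = 0 := by
  obtain ⟨i, hi⟩ : ∃ i, w i ≠ 0 := by
    by_contra! h
    exact hw (funext h)
  have hm : MeasurableSet {z : ι → ℝ | z ⬝ᵥ w = 0} :=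
    measurableSet_eq_fun (measurable_dot measurable_id measurable_const) measurable_const
  rw [← lintegral_indicator_one hm, ← nonpos_iff_eq_zero]
  refine lintegral_stdG_le_of_slice i (measurable_one.indicator hm) fun z => ?_
  have hs : {ζ : ℝ | Function.update z i ζ ⬝ᵥ w = 0} ⊆
      {-(Function.update z i 0 ⬝ᵥ w) / w i} := by
    intro ζ hζ
    have : Function.update z i ζ = Function.update z i 0 + ζ • Pi.single i 1 := by
      ext k
      by_cases hk : k = i
      · subst hk; simp
      · simp [hk]
    simp only [Set.mem_ofPred_eq] at hζ
    rw [this, add_dotProduct, smul_dotProduct, single_dotProduct, smul_eq_mul] at hζ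
    rw [Set.mem_singleton_iff, eq_div_iff hi]
    linarith
  have hz : (gaussianReal 0 1) {ζ : ℝ | Function.update z i ζ ⬝ᵥ w = 0} = 0 := by
    have := nullSingletonClass_gaussianReal (μ := 0) (v := 1) one_ne_zero
    exact measure_mono_null hs (measure_singleton _)
  have hm' : MeasurableSet {ζ : ℝ | Function.update z i ζ ⬝ᵥ w = 0} :=
    (measurable_update z) hm
  rw [← hz, ← lintegral_indicator_one hm']
  rfl

end Gaussian

/-! ### Haar measure on stabilizers in the orthogonal group -/

section Haar

/-- A closed subgroup `K` of a compact group carries a probability measure that is invariant under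
`K` from both sides. -/
lemma exists_biinvariant {G : Type*} [Group G] [TopologicalSpace G] [IsTopologicalGroup G]
    [CompactSpace G] [MeasurableSpace G] [BorelSpace G] (K : Subgroup G)
    (hK : IsClosed (K : Set G)) :
    ∃ η : Measure G, IsProbabilityMeasure η ∧ (∀ᵐ Q ∂η, Q ∈ K) ∧
      (∀ Q ∈ K, η.map (fun L => Q * L) = η) ∧ (∀ Q ∈ K, η.map (fun L => L * Q) = η) := by
  have : CompactSpace K := isCompact_iff_compactSpace.1 hK.isCompact
  let : MeasurableSpace K := borel K
  have : BorelSpace K := ⟨rfl⟩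
  let μ : Measure K := Measure.haarMeasure ⊤
  have hprob : IsProbabilityMeasure μ := ⟨Measure.haarMeasure_self⟩
  have hc : Measurable (Subtype.val : K → G) := continuous_subtype_val.measurable
  have hl : ∀ Q : K, μ.map (fun L => Q * L) = μ := fun Q => map_mul_left_eq_self μ Q
  have hr : ∀ Q : K, μ.map (fun L => L * Q) = μ := by
    intro Q
    have hm : Measurable fun L : K => L * Q := (continuous_mul_const Q).measurable
    have : IsProbabilityMeasure (μ.map fun L => L * Q) :=
      Measure.isProbabilityMeasure_map hm.aemeasurable
    have : (μ.map fun L => L * Q).IsHaarMeasure := Measure.isHaarMeasure_map_mul_right μ Q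
    exact Measure.isHaarMeasure_eq_of_isProbabilityMeasure _ _
  refine ⟨μ.map Subtype.val, Measure.isProbabilityMeasure_map hc.aemeasurable, ?_, ?_, ?_⟩
  · refine (ae_map_iff (p := fun Q => Q ∈ K) hc.aemeasurable hK.measurableSet).2 ?_
    exact Eventually.of_forall fun x => x.2
  · intro Q hQ
    rw [Measure.map_map (continuous_const_mul Q).measurable hc]
    conv_rhs => rw [← hl ⟨Q, hQ⟩, Measure.map_map hc (continuous_const_mul _).measurable]
    rfl
  · intro Q hQ
    rw [Measure.map_map (continuous_mul_const Q).measurable hc]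
    conv_rhs => rw [← hr ⟨Q, hQ⟩, Measure.map_map hc (continuous_mul_const _).measurable]
    rfl

variable {ι : Type*} [Fintype ι] [DecidableEq ι]

/-- The orthogonal group carries its Borel σ-algebra. -/
instance : MeasurableSpace (Matrix.orthogonalGroup ι ℝ) := borel _

instance : BorelSpace (Matrix.orthogonalGroup ι ℝ) := ⟨rfl⟩

lemma orth_transpose_mul (V : Matrix.orthogonalGroup ι ℝ) : (V.1)ᵀ * V.1 = 1 :=
  (Matrix.mem_orthogonalGroup_iff' ι ℝ).1 V.2

lemma orth_mul_transpose (V : Matrix.orthogonalGroup ι ℝ) : V.1 * (V.1)ᵀ = 1 :=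
  (Matrix.mem_orthogonalGroup_iff ι ℝ).1 V.2

lemma orth_inv_val (V : Matrix.orthogonalGroup ι ℝ) : (V⁻¹).1 = (V.1)ᵀ := rfl

instance : CompactSpace (Matrix.orthogonalGroup ι ℝ) := by
  have hcl : IsClosed {M : Matrix ι ι ℝ | M ∈ Matrix.orthogonalGroup ι ℝ} := by
    have : {M : Matrix ι ι ℝ | M ∈ Matrix.orthogonalGroup ι ℝ} = {M | M * Mᵀ = 1} := by
      ext M
      exact Matrix.mem_orthogonalGroup_iff ι ℝ
    rw [this]
    exact isClosed_eq (by fun_prop) continuous_const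
  have hc : IsCompact {M : Matrix ι ι ℝ | M ∈ Matrix.orthogonalGroup ι ℝ} := by
    have hbox : IsCompact (Set.univ.pi fun _ : ι => Set.univ.pi fun _ : ι => Set.Icc (-1 : ℝ) 1) :=
      isCompact_univ_pi fun _ => isCompact_univ_pi fun _ => isCompact_Icc
    refine IsCompact.of_isClosed_subset hbox hcl fun M hM => ?_
    intro i _ j _
    have := entry_norm_bound_of_unitary (𝕜 := ℝ) hM i j
    rw [Real.norm_eq_abs] at this
    exact abs_le.1 this
  exact isCompact_iff_compactSpace.1 hc

lemma continuous_orth_val : Continuous fun V : Matrix.orthogonalGroup ι ℝ => V.1 :=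
  continuous_subtype_val

instance : SecondCountableTopology (Matrix.orthogonalGroup ι ℝ) := by
  have : SecondCountableTopology (Matrix ι ι ℝ) :=
    inferInstanceAs (SecondCountableTopology (ι → ι → ℝ))
  exact TopologicalSpace.Subtype.secondCountableTopology {M : Matrix ι ι ℝ | M ∈ Matrix.orthogonalGroup ι ℝ}

lemma measurable_orth_apply (i k : ι) :
    Measurable fun V : Matrix.orthogonalGroup ι ℝ => V.1 i k := by
  refine Continuous.measurable ?_
  exact (continuous_apply k).comp ((continuous_apply i).comp continuous_orth_val)

lemma measurable_orth_mulVec {α : Type*} [MeasurableSpace α]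
    {V : α → Matrix.orthogonalGroup ι ℝ} {v : α → ι → ℝ} (hV : Measurable V) (hv : Measurable v) :
    Measurable fun x => (V x).1 *ᵥ v x := by
  refine measurable_pi_lambda _ fun i => ?_
  refine measurable_dot (f := fun x => (V x).1 i) ?_ hv
  exact measurable_pi_lambda _ fun k => (measurable_orth_apply i k).comp hV

lemma measurable_orth_transpose_mulVec {α : Type*} [MeasurableSpace α]
    {V : α → Matrix.orthogonalGroup ι ℝ} {v : α → ι → ℝ} (hV : Measurable V) (hv : Measurable v) :
    Measurable fun x => ((V x).1)ᵀ *ᵥ v x := by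
  refine measurable_pi_lambda _ fun i => ?_
  refine measurable_dot (f := fun x => ((V x).1)ᵀ i) ?_ hv
  exact measurable_pi_lambda _ fun k => (measurable_orth_apply k i).comp hV

/-- The orthogonal matrices fixing the vectors `c 0, …, c (m - 1)`. -/
def fixer (m : ℕ) (c : ℕ → ι → ℝ) : Subgroup (Matrix.orthogonalGroup ι ℝ) where
  carrier := {Q | ∀ l < m, Q.1 *ᵥ c l = c l}
  mul_mem' := by
    intro P Q hP hQ l hl
    change (P.1 * Q.1) *ᵥ c l = c l
    rw [← Matrix.mulVec_mulVec, hQ l hl, hP l hl]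
  one_mem' := by
    intro l hl
    change (1 : Matrix ι ι ℝ) *ᵥ c l = c l
    rw [Matrix.one_mulVec]
  inv_mem' := by
    intro Q hQ l hl
    rw [orth_inv_val]
    conv_lhs => rw [← hQ l hl]
    rw [Matrix.mulVec_mulVec, orth_transpose_mul, Matrix.one_mulVec]

lemma mem_fixer {m : ℕ} {c : ℕ → ι → ℝ} {Q : Matrix.orthogonalGroup ι ℝ} :
    Q ∈ fixer m c ↔ ∀ l < m, Q.1 *ᵥ c l = c l := Iff.rfl

lemma isClosed_fixer (m : ℕ) (c : ℕ → ι → ℝ) :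
    IsClosed (fixer m c : Set (Matrix.orthogonalGroup ι ℝ)) := by
  have : (fixer m c : Set (Matrix.orthogonalGroup ι ℝ)) =
      ⋂ l, ⋂ (_ : l < m), {Q | Q.1 *ᵥ c l = c l} := by
    ext Q
    simp [mem_fixer]
  rw [this]
  refine isClosed_iInter fun l => isClosed_iInter fun _ => isClosed_eq ?_ continuous_const
  exact continuous_orth_val.matrix_mulVec continuous_const

/-- `ν` is the Haar measure on the coset of orthogonal matrices that map `A l` to `B l` for
`l < m`, described by its invariance properties. -/
structure CosetHaar (m : ℕ) (A B : ℕ → ι → ℝ) (ν : Measure (Matrix.orthogonalGroup ι ℝ)) :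
    Prop where
  prob : IsProbabilityMeasure ν
  supp : ∀ᵐ V ∂ν, ∀ l < m, V.1 *ᵥ A l = B l
  left : ∀ Q ∈ fixer m B, ν.map (fun V => Q * V) = ν
  right : ∀ Q ∈ fixer m A, ν.map (fun V => V * Q) = ν

lemma measurable_orth_mul {α : Type*} [MeasurableSpace α]
    {V W : α → Matrix.orthogonalGroup ι ℝ} (hV : Measurable V) (hW : Measurable W) :
    Measurable fun x => V x * W x := hV.mul hW

lemma measurable_orth_inv :
    Measurable fun V : Matrix.orthogonalGroup ι ℝ => V⁻¹ := measurable_inv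

/-- Inversion of the matrix exchanges the two families of vectors. -/
lemma CosetHaar.inv {m : ℕ} {A B : ℕ → ι → ℝ} {ν : Measure (Matrix.orthogonalGroup ι ℝ)}
    (h : CosetHaar m A B ν) : CosetHaar m B A (ν.map fun V => V⁻¹) := by
  have hi := measurable_orth_inv (ι := ι)
  have := h.prob
  refine ⟨Measure.isProbabilityMeasure_map hi.aemeasurable, ?_, ?_, ?_⟩
  · have hm : MeasurableSet {V : Matrix.orthogonalGroup ι ℝ | ∀ l < m, V.1 *ᵥ B l = A l} := by
      simp only [Set.ofPred_forall]
      refine MeasurableSet.iInter fun l => MeasurableSet.iInter fun _ => ?_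
      exact measurableSet_eq_fun (measurable_orth_mulVec measurable_id measurable_const)
        measurable_const
    rw [ae_map_iff hi.aemeasurable hm]
    filter_upwards [h.supp] with V hV l hl
    rw [orth_inv_val, ← hV l hl, Matrix.mulVec_mulVec, orth_transpose_mul, Matrix.one_mulVec]
  · intro Q hQ
    rw [Measure.map_map (measurable_const_mul Q) hi]
    conv_rhs => rw [← h.right Q⁻¹ (inv_mem hQ), Measure.map_map hi (measurable_mul_const _)]
    congr 1
    ext1 V
    simp
  · intro Q hQ
    rw [Measure.map_map (measurable_mul_const Q) hi]
    conv_rhs => rw [← h.left Q⁻¹ (inv_mem hQ), Measure.map_map hi (measurable_const_mul _)]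
    congr 1
    ext1 V
    simp

/-- Disintegration of the coset measure when the image of one more vector `a` is revealed. -/
lemma CosetHaar.reveal {m : ℕ} {A B : ℕ → ι → ℝ} {ν : Measure (Matrix.orthogonalGroup ι ℝ)}
    (h : CosetHaar m A B ν) (a : ι → ℝ) :
    ∃ κ : Matrix.orthogonalGroup ι ℝ → Measure (Matrix.orthogonalGroup ι ℝ),
      (∀ F : Matrix.orthogonalGroup ι ℝ → ℝ≥0∞, Measurable F →
        ∫⁻ V, F V ∂ν = ∫⁻ V, ∫⁻ W, F W ∂(κ V) ∂ν) ∧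
      ∀ᵐ V ∂ν, CosetHaar (m + 1) (Function.update A m a) (Function.update B m (V.1 *ᵥ a)) (κ V) := by
  have := h.prob
  obtain ⟨η, hη, hsupp, hleft, hright⟩ :=
    exists_biinvariant (fixer (m + 1) (Function.update A m a)) (isClosed_fixer _ _)
  have hA : ∀ Q ∈ fixer (m + 1) (Function.update A m a), Q ∈ fixer m A := by
    intro Q hQ l hl
    have := hQ l (hl.trans m.lt_succ_self)
    rwa [Function.update_of_ne hl.ne] at this
  -- given the image of `a` under `V`, the matrix is `V` times a Haar distributed element of the
  -- stabilizer of the extended family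
  refine ⟨fun V => η.map fun Y => V * Y, fun F hF => ?_, ?_⟩
  · have h1 : ∀ V : Matrix.orthogonalGroup ι ℝ,
        ∫⁻ W, F W ∂(η.map fun Y => V * Y) = ∫⁻ Y, F (V * Y) ∂η := fun V =>
      lintegral_map hF (measurable_const_mul V)
    simp only [h1]
    rw [lintegral_lintegral_swap (f := fun V Y => F (V * Y))
      (hF.comp (measurable_fst.mul measurable_snd)).aemeasurable]
    have h2 : ∀ᵐ Y ∂η, ∫⁻ V, F (V * Y) ∂ν = ∫⁻ V, F V ∂ν := by
      filter_upwards [hsupp] with Y hY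
      conv_rhs => rw [← h.right Y (hA Y hY), lintegral_map hF (measurable_mul_const Y)]
    rw [lintegral_congr_ae h2]
    simp
  · filter_upwards [h.supp] with V hV
    have key : ∀ Y ∈ fixer (m + 1) (Function.update A m a), ∀ l < m + 1,
        (V * Y).1 *ᵥ Function.update A m a l = Function.update B m (V.1 *ᵥ a) l := by
      intro Y hY l hl
      change (V.1 * Y.1) *ᵥ _ = _
      rw [← Matrix.mulVec_mulVec, hY l hl]
      rcases Nat.lt_succ_iff_lt_or_eq.1 hl with hl' | rfl
      · rw [Function.update_of_ne hl'.ne, Function.update_of_ne hl'.ne, hV l hl']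
      · simp
    refine ⟨Measure.isProbabilityMeasure_map (measurable_const_mul V).aemeasurable, ?_, ?_, ?_⟩
    · refine (ae_map_iff (measurable_const_mul V).aemeasurable ?_).2 ?_
      · simp only [Set.ofPred_forall]
        refine MeasurableSet.iInter fun l => MeasurableSet.iInter fun _ => ?_
        exact measurableSet_eq_fun (measurable_orth_mulVec measurable_id measurable_const)
          measurable_const
      · filter_upwards [hsupp] with Y hY
        exact key Y hY
    · intro Q hQ
      rw [Measure.map_map (measurable_const_mul Q) (measurable_const_mul V)]
      -- conjugation by `V` carries the stabilizer of the images to that of the vectors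
      have hQ' : V⁻¹ * Q * V ∈ fixer (m + 1) (Function.update A m a) := by
        intro l hl
        have k1 := key 1 (one_mem _) l hl
        rw [mul_one] at k1
        change (V⁻¹.1 * Q.1 * V.1) *ᵥ _ = _
        rw [← Matrix.mulVec_mulVec, ← Matrix.mulVec_mulVec, k1, hQ l hl, ← k1, orth_inv_val,
          Matrix.mulVec_mulVec, orth_transpose_mul, Matrix.one_mulVec]
      conv_rhs => rw [← hleft _ hQ', Measure.map_map (measurable_const_mul V)
        (measurable_const_mul _)]
      congr 1
      ext1 Y
      simp [mul_assoc]
    · intro Q hQ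
      rw [Measure.map_map (measurable_mul_const Q) (measurable_const_mul V)]
      conv_rhs => rw [← hright _ hQ, Measure.map_map (measurable_const_mul V)
        (measurable_mul_const _)]
      congr 1
      ext1 Y
      simp [mul_assoc]

/-- Disintegration of the coset measure when the image of one more vector `b` under the transpose is
revealed. -/
lemma CosetHaar.reveal_inv {m : ℕ} {A B : ℕ → ι → ℝ}
    {ν : Measure (Matrix.orthogonalGroup ι ℝ)} (h : CosetHaar m A B ν) (b : ι → ℝ) :
    ∃ κ : Matrix.orthogonalGroup ι ℝ → Measure (Matrix.orthogonalGroup ι ℝ),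
      (∀ F : Matrix.orthogonalGroup ι ℝ → ℝ≥0∞, Measurable F →
        ∫⁻ V, F V ∂ν = ∫⁻ V, ∫⁻ W, F W ∂(κ V) ∂ν) ∧
      ∀ᵐ V ∂ν, CosetHaar (m + 1) (Function.update A m (V.1ᵀ *ᵥ b)) (Function.update B m b)
        (κ V) := by
  have hi := measurable_orth_inv (ι := ι)
  obtain ⟨κ, hκ, hc⟩ := h.inv.reveal b
  have hiae : ∀ {p : Matrix.orthogonalGroup ι ℝ → Prop},
      (∀ᵐ V ∂(ν.map fun V => V⁻¹), p V) → ∀ᵐ V ∂ν, p V⁻¹ := fun hp => ae_of_ae_map hi.aemeasurable hp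
  have hinv : (ν.map fun V => V⁻¹).map (fun V => V⁻¹) = ν := by
    rw [Measure.map_map hi hi]
    have : ((fun V : Matrix.orthogonalGroup ι ℝ => V⁻¹) ∘ fun V => V⁻¹) = id := by
      ext1 V; simp
    rw [this, Measure.map_id]
  refine ⟨fun V => (κ V⁻¹).map fun W => W⁻¹, fun F hF => ?_, ?_⟩
  · have h1 := hκ (fun V => F V⁻¹) (hF.comp hi)
    conv_lhs => rw [← hinv, lintegral_map hF hi, h1]
    have h3 : ∀ V, ∫⁻ W, F W ∂((κ V⁻¹).map fun W => W⁻¹) = ∫⁻ W, F W⁻¹ ∂(κ V⁻¹) := fun V =>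
      lintegral_map hF hi
    simp only [h3]
    have h4 := lintegral_map_equiv (μ := ν) (fun V => ∫⁻ W, F W⁻¹ ∂(κ V))
      (MeasurableEquiv.inv (Matrix.orthogonalGroup ι ℝ))
    exact h4
  · filter_upwards [hiae hc] with V hV
    exact hV.inv

end Haar

/-! ### The revealing process -/

section Reveal

variable {ι : Type*}

lemma measurable_update_col {α : Type*} [MeasurableSpace α] {c : α → ℕ → ι → ℝ} {v : α → ι → ℝ}
    (hc : Measurable c) (hv : Measurable v) (m : ℕ) :
    Measurable fun x => Function.update (c x) m (v x) := by
  refine measurable_pi_lambda _ fun l => ?_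
  by_cases hl : l = m
  · subst hl
    simpa using hv
  · simp only [Function.update_of_ne hl]
    exact (measurable_pi_apply l).comp hc

variable [Fintype ι]

/-- One step of revealing `V`: if `side`, the vector `v` and its image `V v` become column `m` of
the two families, otherwise `Vᵀ v` and `v`. -/
def revealStep (V : Matrix ι ι ℝ) (side : Bool) (m : ℕ) (v : ι → ℝ)
    (s : (ℕ → ι → ℝ) × (ℕ → ι → ℝ)) : (ℕ → ι → ℝ) × (ℕ → ι → ℝ) :=
  if side then (Function.update s.1 m v, Function.update s.2 m (V *ᵥ v))
  else (Function.update s.1 m (Vᵀ *ᵥ v), Function.update s.2 m v)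

/-- `k` successive revealing steps, starting with column `m` from the families `s`.  The vector
used in a step is chosen by `strat` from the columns known so far. -/
def revealRun (V : Matrix ι ι ℝ) (side : ℕ → Bool)
    (strat : ℕ → (ℕ → ι → ℝ) × (ℕ → ι → ℝ) → ι → ℝ) :
    ℕ → ℕ → (ℕ → ι → ℝ) × (ℕ → ι → ℝ) → (ℕ → ι → ℝ) × (ℕ → ι → ℝ)
  | _, 0, s => s
  | m, k + 1, s => revealRun V side strat (m + 1) k (revealStep V (side m) m (strat m s) s)

lemma revealRun_succ (V : Matrix ι ι ℝ) (side : ℕ → Bool)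
    (strat : ℕ → (ℕ → ι → ℝ) × (ℕ → ι → ℝ) → ι → ℝ) (m k : ℕ)
    (s : (ℕ → ι → ℝ) × (ℕ → ι → ℝ)) :
    revealRun V side strat m (k + 1) s =
      revealStep V (side (m + k)) (m + k) (strat (m + k) (revealRun V side strat m k s))
        (revealRun V side strat m k s) := by
  induction k generalizing m s with
  | zero => rfl
  | succ k ih =>
    rw [revealRun, ih, show m + 1 + k = m + (k + 1) by omega]
    rfl

end Reveal

/-! ### Resampling the image of a vector under a partially revealed Haar matrix -/

section Resample

variable {ι : Type*} [Fintype ι] [DecidableEq ι]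

/-- The surrogate for `V a` when `V` is only known to map `A l` to `B l` for `l < m`: the part of
`a` in the span of the `A l` is mapped by `V`, the rest is replaced by a vector of the same norm in
the direction of the part of `z` orthogonal to the `B l`. -/
noncomputable def freshImage (V : Matrix ι ι ℝ) (A B : ℕ → ι → ℝ) (m : ℕ) (a z : ι → ℝ) : ι → ℝ :=
  V *ᵥ (a - res A m a) + nrm (res A m a) • unitVec (res B m z)

lemma measurable_freshImage {α : Type*} [MeasurableSpace α]
    {V : α → Matrix.orthogonalGroup ι ℝ} {A B : α → ℕ → ι → ℝ} {a z : α → ι → ℝ}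
    (hV : Measurable V) (hA : Measurable A) (hB : Measurable B) (m : ℕ) (ha : Measurable a)
    (hz : Measurable z) :
    Measurable fun x => freshImage (V x).1 (A x) (B x) m (a x) (z x) := by
  have h := measurable_res hA ha m
  exact (measurable_orth_mulVec hV (ha.sub h)).add
    (measurable_smul' (measurable_nrm h) (measurable_unitVec (measurable_res hB hz m)))

lemma reflMat_mem_fixer {m : ℕ} {B : ℕ → ι → ℝ} {u : ι → ℝ} (hu : res B m u = u) :
    (⟨reflMat u, (Matrix.mem_orthogonalGroup_iff' ι ℝ).2 (reflMat_orth u)⟩ :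
      Matrix.orthogonalGroup ι ℝ) ∈ fixer m B := by
  intro l hl
  change reflMat u *ᵥ B l = B l
  have : u ⬝ᵥ B l = 0 := by rw [← hu]; exact res_dot_col B hl u
  rw [reflMat_mulVec, this]
  simp

/-- The stabilizer acts transitively on spheres in the orthogonal complement. -/
lemma exists_mem_fixer_mulVec_eq {m : ℕ} {B : ℕ → ι → ℝ} {w w' : ι → ℝ} (hw : res B m w = w)
    (hw' : res B m w' = w') (h : nrm w = nrm w') :
    ∃ Q ∈ fixer m B, Q.1 *ᵥ w' = w := by
  refine ⟨_, reflMat_mem_fixer (u := w' - w) (by rw [res_sub, hw, hw']), ?_⟩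
  change reflMat (w' - w) *ᵥ w' = w
  have e : w' ⬝ᵥ w' = w ⬝ᵥ w := by rw [← nrm_sq, ← nrm_sq, h]
  rw [reflMat_mulVec]
  by_cases h0 : (w' - w) ⬝ᵥ (w' - w) = 0
  · have := dotProduct_self_eq_zero.1 h0
    rw [this]
    simpa using sub_eq_zero.1 this
  · have : 2 * ((w' - w) ⬝ᵥ w') / ((w' - w) ⬝ᵥ (w' - w)) = 1 := by
      rw [div_eq_one_iff_eq h0, dot_sub_self, sub_dotProduct, dotProduct_comm w w']
      linarith
    rw [this, one_smul, sub_sub_cancel]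

/-- The law of the image `V a` of a single vector.  The image of the residual of `a` and the
surrogate for it have the same norm, and both have laws that are invariant under the stabilizer of
`B`, which acts transitively on the vectors of this norm orthogonal to the columns. -/
lemma CosetHaar.lintegral_image {m : ℕ} {A B : ℕ → ι → ℝ}
    {ν : Measure (Matrix.orthogonalGroup ι ℝ)} (h : CosetHaar m A B ν) (a : ι → ℝ)
    {F : (ι → ℝ) → ℝ≥0∞} (hF : Measurable F) :
    ∫⁻ V, F (V.1 *ᵥ a) ∂ν = ∫⁻ V, ∫⁻ z, F (freshImage V.1 A B m a z) ∂(stdG ι) ∂ν := by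
  have hprob := h.prob
  obtain ⟨k, hk⟩ := exists_sub_res_eq A m a
  set w := res A m a with hwdef
  set κ : ι → ℝ := ∑ l ∈ Finset.range m, k l • B l with hκ
  have hVκ : ∀ᵐ V ∂ν, V.1 *ᵥ (a - w) = κ := by
    filter_upwards [h.supp] with V hV
    rw [hk, hκ, Matrix.mulVec_sum]
    refine Finset.sum_congr rfl fun l hl => ?_
    rw [Matrix.mulVec_smul, hV l (Finset.mem_range.1 hl)]
  have hVa : ∀ᵐ V ∂ν, V.1 *ᵥ a = κ + V.1 *ᵥ w := by
    filter_upwards [hVκ] with V hV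
    rw [← hV, ← Matrix.mulVec_add, sub_add_cancel]
  -- if `a` lies in the span of the columns, then its image is determined
  by_cases hw0 : w = 0
  · refine lintegral_congr_ae ?_
    filter_upwards with V
    simp only [freshImage, ← hwdef, hw0, nrm_zero, zero_smul, add_zero, sub_zero]
    simp
  obtain ⟨η, hη, hsupp, -, hright⟩ := exists_biinvariant (fixer m B) (isClosed_fixer m B)
  let F0 : (ι → ℝ) → ℝ≥0∞ := fun v => F (κ + v)
  have hF0 : Measurable F0 := hF.comp (measurable_const.add measurable_id)
  -- by transitivity, averaging over the stabilizer depends only on the norm of `v`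
  have hconst : ∀ v v' : ι → ℝ, res B m v = v → res B m v' = v' → nrm v = nrm v' →
      ∫⁻ L, F0 (L.1 *ᵥ v) ∂η = ∫⁻ L, F0 (L.1 *ᵥ v') ∂η := by
    intro v v' hv hv' hvv
    obtain ⟨Q, hQ, rfl⟩ := exists_mem_fixer_mulVec_eq hv hv' hvv
    have hm : Measurable fun L : Matrix.orthogonalGroup ι ℝ => F0 (L.1 *ᵥ v') :=
      hF0.comp (measurable_orth_mulVec measurable_id measurable_const)
    conv_rhs => rw [← hright Q hQ, lintegral_map hm (measurable_mul_const Q)]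
    refine lintegral_congr fun L => ?_
    change _ = F0 ((L.1 * Q.1) *ᵥ v')
    rw [← Matrix.mulVec_mulVec]
  have hres : ∀ᵐ V ∂ν, res B m (V.1 *ᵥ w) = V.1 *ᵥ w := by
    filter_upwards [h.supp] with V hV
    rw [← mulVec_res (orth_transpose_mul V) hV, hwdef, res_res]
  obtain ⟨V0, hV0⟩ := hres.exists
  set w0 := V0.1 *ᵥ w with hw0def
  have hn0 : nrm w0 = nrm w := nrm_mulVec_of_orth (orth_transpose_mul V0) w
  have hw00 : w0 ≠ 0 := by
    intro h0
    rw [h0, nrm_zero] at hn0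
    exact hw0 (nrm_eq_zero.1 hn0.symm)
  -- average over the stabilizer, using left invariance of `ν`
  have hL : ∫⁻ V, F (V.1 *ᵥ a) ∂ν = ∫⁻ L, F0 (L.1 *ᵥ w0) ∂η := by
    calc ∫⁻ V, F (V.1 *ᵥ a) ∂ν = ∫⁻ V, F0 (V.1 *ᵥ w) ∂ν :=
          lintegral_congr_ae (hVa.mono fun V hV => by simp only [hV, F0])
      _ = ∫⁻ L, ∫⁻ V, F0 (L.1 *ᵥ V.1 *ᵥ w) ∂ν ∂η := by
          have : ∀ᵐ L ∂η, ∫⁻ V, F0 (L.1 *ᵥ V.1 *ᵥ w) ∂ν = ∫⁻ V, F0 (V.1 *ᵥ w) ∂ν := by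
            filter_upwards [hsupp] with L hLf
            have hm : Measurable fun V : Matrix.orthogonalGroup ι ℝ => F0 (V.1 *ᵥ w) :=
              hF0.comp (measurable_orth_mulVec measurable_id measurable_const)
            conv_rhs => rw [← h.left L hLf, lintegral_map hm (measurable_const_mul L)]
            refine lintegral_congr fun V => ?_
            change _ = F0 ((L.1 * V.1) *ᵥ w)
            rw [← Matrix.mulVec_mulVec]
          rw [lintegral_congr_ae this]
          simp
      _ = ∫⁻ V, ∫⁻ L, F0 (L.1 *ᵥ V.1 *ᵥ w) ∂η ∂ν := by
          refine lintegral_lintegral_swap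
            (f := fun (L V : Matrix.orthogonalGroup ι ℝ) => F0 (L.1 *ᵥ V.1 *ᵥ w)) ?_
          exact (hF0.comp (measurable_orth_mulVec measurable_fst
            (measurable_orth_mulVec measurable_snd measurable_const))).aemeasurable
      _ = ∫⁻ _V, ∫⁻ L, F0 (L.1 *ᵥ w0) ∂η ∂ν := by
          refine lintegral_congr_ae ?_
          filter_upwards [hres] with V hV
          refine hconst _ _ hV hV0 ?_
          rw [hn0, nrm_mulVec_of_orth (orth_transpose_mul V)]
      _ = _ := by simp
  -- average over the stabilizer, using rotation invariance of the Gaussian law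
  have hR : ∫⁻ z, F0 (nrm w • unitVec (res B m z)) ∂(stdG ι) = ∫⁻ L, F0 (L.1 *ᵥ w0) ∂η := by
    have hmz : Measurable fun z : ι → ℝ => nrm w • unitVec (res B m z) :=
      measurable_smul' measurable_const
        (measurable_unitVec (measurable_res measurable_const measurable_id m))
    calc ∫⁻ z, F0 (nrm w • unitVec (res B m z)) ∂(stdG ι)
        = ∫⁻ L, ∫⁻ z, F0 (L.1 *ᵥ (nrm w • unitVec (res B m z))) ∂(stdG ι) ∂η := by
          have : ∀ᵐ L ∂η, ∫⁻ z, F0 (L.1 *ᵥ (nrm w • unitVec (res B m z))) ∂(stdG ι) =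
              ∫⁻ z, F0 (nrm w • unitVec (res B m z)) ∂(stdG ι) := by
            filter_upwards [hsupp] with L hLf
            conv_rhs => rw [← stdG_map_orth (orth_transpose_mul L),
              lintegral_map (f := fun z => F0 (nrm w • unitVec (res B m z)))
                (hF0.comp hmz) (measurable_mulVec _)]
            refine lintegral_congr fun z => ?_
            rw [← mulVec_res (orth_transpose_mul L) hLf, unitVec, unitVec,
              nrm_mulVec_of_orth (orth_transpose_mul L), Matrix.mulVec_smul, Matrix.mulVec_smul]
          rw [lintegral_congr_ae this]
          simp
      _ = ∫⁻ z, ∫⁻ L, F0 (L.1 *ᵥ (nrm w • unitVec (res B m z))) ∂η ∂(stdG ι) := by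
          refine lintegral_lintegral_swap (f := fun (L : Matrix.orthogonalGroup ι ℝ) z =>
            F0 (L.1 *ᵥ (nrm w • unitVec (res B m z)))) ?_
          exact (hF0.comp (measurable_orth_mulVec measurable_fst
            (hmz.comp measurable_snd))).aemeasurable
      _ = ∫⁻ _z, ∫⁻ L, F0 (L.1 *ᵥ w0) ∂η ∂(stdG ι) := by
          -- a vanishing residual would make `z` orthogonal to `w0`
          have hz : ∀ᵐ z ∂(stdG ι), res B m z ≠ 0 := by
            rw [ae_iff]
            refine measure_mono_null ?_ (stdG_dot_eq_zero hw00)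
            intro z hz
            simp only [ne_eq, not_not, Set.mem_ofPred_eq] at hz ⊢
            rw [← hV0, ← dot_res_comm, hz, zero_dotProduct]
          refine lintegral_congr_ae ?_
          filter_upwards [hz] with z hz
          refine hconst _ _ ?_ hV0 ?_
          · rw [unitVec, res_smul, res_smul, res_res]
          · rw [nrm_smul, nrm_unitVec hz, hn0, mul_one, abs_of_nonneg (nrm_nonneg w)]
      _ = _ := by simp
  rw [hL, ← hR]
  have : ∀ᵐ V ∂ν, ∫⁻ z, F (freshImage V.1 A B m a z) ∂(stdG ι) =
      ∫⁻ z, F0 (nrm w • unitVec (res B m z)) ∂(stdG ι) := by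
    filter_upwards [hVκ] with V hV
    simp only [freshImage, ← hwdef, hV, F0]
  rw [lintegral_congr_ae this]
  simp

/-! ### Resampling along the revealing process -/

lemma measurable_revealStep {α : Type*} [MeasurableSpace α] {V : α → Matrix.orthogonalGroup ι ℝ}
    {v : α → ι → ℝ} {s : α → (ℕ → ι → ℝ) × (ℕ → ι → ℝ)} (hV : Measurable V) (hv : Measurable v)
    (hs : Measurable s) (side : Bool) (m : ℕ) :
    Measurable fun x => revealStep (V x).1 side m (v x) (s x) := by
  cases side
  · simp only [revealStep, Bool.false_eq_true, if_false]
    exact (measurable_update_col hs.fst (measurable_orth_transpose_mulVec hV hv) m).prodMk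
      (measurable_update_col hs.snd hv m)
  · simp only [revealStep, if_true]
    exact (measurable_update_col hs.fst hv m).prodMk
      (measurable_update_col hs.snd (measurable_orth_mulVec hV hv) m)

lemma measurable_revealRun {α : Type*} [MeasurableSpace α] {V : α → Matrix.orthogonalGroup ι ℝ}
    {strat : α → ℕ → (ℕ → ι → ℝ) × (ℕ → ι → ℝ) → ι → ℝ} (hV : Measurable V)
    (hstrat : ∀ m, Measurable fun q : α × ((ℕ → ι → ℝ) × (ℕ → ι → ℝ)) => strat q.1 m q.2)
    (side : ℕ → Bool) {s : α → (ℕ → ι → ℝ) × (ℕ → ι → ℝ)} (hs : Measurable s) (m k : ℕ) :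
    Measurable fun x => revealRun (V x).1 side (strat x) m k (s x) := by
  induction k with
  | zero => exact hs
  | succ k ih =>
    simp only [revealRun_succ]
    exact measurable_revealStep hV ((hstrat _).comp (measurable_id.prodMk ih)) ih _ _

/-- The image of the next vector can be resampled without changing its joint law with all the
columns revealed before. -/
theorem CosetHaar.lintegral_resample (side : ℕ → Bool)
    {strat : ℕ → (ℕ → ι → ℝ) × (ℕ → ι → ℝ) → ι → ℝ} (hstrat : ∀ m, Measurable (strat m))
    {F : ((ℕ → ι → ℝ) × (ℕ → ι → ℝ)) × (ι → ℝ) → ℝ≥0∞} (hF : Measurable F)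
    {a : (ℕ → ι → ℝ) × (ℕ → ι → ℝ) → ι → ℝ} (ha : Measurable a) (k : ℕ) {m : ℕ}
    {A B : ℕ → ι → ℝ} {ν : Measure (Matrix.orthogonalGroup ι ℝ)} (h : CosetHaar m A B ν) :
    ∫⁻ V, F (revealRun V.1 side strat m k (A, B),
        V.1 *ᵥ a (revealRun V.1 side strat m k (A, B))) ∂ν =
      ∫⁻ V, ∫⁻ z, F (revealRun V.1 side strat m k (A, B),
        freshImage V.1 (revealRun V.1 side strat m k (A, B)).1
          (revealRun V.1 side strat m k (A, B)).2 (m + k)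
          (a (revealRun V.1 side strat m k (A, B))) z) ∂(stdG ι) ∂ν := by
  induction k generalizing m A B ν with
  | zero =>
    exact h.lintegral_image (a (A, B)) (F := fun v => F ((A, B), v))
      (hF.comp (measurable_const.prodMk measurable_id))
  | succ k ih =>
    have hrun : ∀ j, Measurable fun V : Matrix.orthogonalGroup ι ℝ =>
        revealRun V.1 side strat m j (A, B) := fun j =>
      measurable_revealRun measurable_id (fun m => (hstrat m).comp measurable_snd) side
        measurable_const m j
    have hrun' : Measurable fun q : Matrix.orthogonalGroup ι ℝ × (ι → ℝ) =>
        revealRun q.1.1 side strat m (k + 1) (A, B) := (hrun (k + 1)).comp measurable_fst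
    -- measurability of the two integrands, needed for the disintegration
    have hL : Measurable fun V : Matrix.orthogonalGroup ι ℝ =>
        F (revealRun V.1 side strat m (k + 1) (A, B),
          V.1 *ᵥ a (revealRun V.1 side strat m (k + 1) (A, B))) :=
      hF.comp ((hrun _).prodMk (measurable_orth_mulVec measurable_id (ha.comp (hrun _))))
    have hR : Measurable fun V : Matrix.orthogonalGroup ι ℝ =>
        ∫⁻ z, F (revealRun V.1 side strat m (k + 1) (A, B),
          freshImage V.1 (revealRun V.1 side strat m (k + 1) (A, B)).1
            (revealRun V.1 side strat m (k + 1) (A, B)).2 (m + (k + 1))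
            (a (revealRun V.1 side strat m (k + 1) (A, B))) z) ∂(stdG ι) := by
      refine Measurable.lintegral_prod_right' (f := fun q : Matrix.orthogonalGroup ι ℝ × (ι → ℝ) =>
        F (revealRun q.1.1 side strat m (k + 1) (A, B),
          freshImage q.1.1 (revealRun q.1.1 side strat m (k + 1) (A, B)).1
            (revealRun q.1.1 side strat m (k + 1) (A, B)).2 (m + (k + 1))
            (a (revealRun q.1.1 side strat m (k + 1) (A, B))) q.2)) ?_
      exact hF.comp (hrun'.prodMk (measurable_freshImage measurable_fst hrun'.fst hrun'.snd _
        (ha.comp hrun') measurable_snd))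
    -- reveal the first column, and use the induction hypothesis for each of its values
    cases hs : side m
    · obtain ⟨κ, hκ, hc⟩ := h.reveal_inv (strat m (A, B))
      rw [hκ _ hL, hκ _ hR]
      refine lintegral_congr_ae ?_
      filter_upwards [hc] with V hV
      have := ih hV
      have e : ∀ᵐ W ∂(κ V), W.1ᵀ *ᵥ strat m (A, B) = V.1ᵀ *ᵥ strat m (A, B) := by
        filter_upwards [hV.supp] with W hW
        have h1 := hW m m.lt_succ_self
        simp only [Function.update_self] at h1
        conv_lhs => rw [← h1]
        rw [Matrix.mulVec_mulVec, orth_transpose_mul, Matrix.one_mulVec]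
      have hstep : ∀ᵐ W ∂(κ V), revealRun W.1 side strat m (k + 1) (A, B) =
          revealRun W.1 side strat (m + 1) k (Function.update A m (V.1ᵀ *ᵥ strat m (A, B)),
            Function.update B m (strat m (A, B))) := by
        filter_upwards [e] with W hW
        simp [revealRun, revealStep, hs, hW]
      rw [lintegral_congr_ae (g := fun W => F (revealRun W.1 side strat (m + 1) k
          (Function.update A m (V.1ᵀ *ᵥ strat m (A, B)), Function.update B m (strat m (A, B))),
          W.1 *ᵥ a (revealRun W.1 side strat (m + 1) k
          (Function.update A m (V.1ᵀ *ᵥ strat m (A, B)),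
            Function.update B m (strat m (A, B))))))
          (hstep.mono fun W hW => by simp only [hW]), this]
      refine lintegral_congr_ae (hstep.mono fun W hW => ?_)
      simp only [hW, show m + 1 + k = m + (k + 1) by omega]
    · obtain ⟨κ, hκ, hc⟩ := h.reveal (strat m (A, B))
      rw [hκ _ hL, hκ _ hR]
      refine lintegral_congr_ae ?_
      filter_upwards [hc] with V hV
      have := ih hV
      have e : ∀ᵐ W ∂(κ V), W.1 *ᵥ strat m (A, B) = V.1 *ᵥ strat m (A, B) := by
        filter_upwards [hV.supp] with W hW
        have h1 := hW m m.lt_succ_self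
        simpa only [Function.update_self] using h1
      have hstep : ∀ᵐ W ∂(κ V), revealRun W.1 side strat m (k + 1) (A, B) =
          revealRun W.1 side strat (m + 1) k (Function.update A m (strat m (A, B)),
            Function.update B m (V.1 *ᵥ strat m (A, B))) := by
        filter_upwards [e] with W hW
        simp [revealRun, revealStep, hs, hW]
      rw [lintegral_congr_ae (g := fun W => F (revealRun W.1 side strat (m + 1) k
          (Function.update A m (strat m (A, B)), Function.update B m (V.1 *ᵥ strat m (A, B))),
          W.1 *ᵥ a (revealRun W.1 side strat (m + 1) k
          (Function.update A m (strat m (A, B)),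
            Function.update B m (V.1 *ᵥ strat m (A, B))))))
          (hstep.mono fun W hW => by simp only [hW]), this]
      refine lintegral_congr_ae (hstep.mono fun W hW => ?_)
      simp only [hW, show m + 1 + k = m + (k + 1) by omega]

end Resample

/-! ### Events of probability tending to one -/

section Whp

variable {Ω : ℕ → Type*} [∀ N, MeasurableSpace (Ω N)]

/-- The filter of events that hold with probability tending to one.  Convergence in probability to
a constant is convergence along this filter. -/
def whp (P : ∀ N, Measure (Ω N)) : Filter (Σ N, Ω N) where
  sets := {E | Tendsto (fun N => P N {ω | (⟨N, ω⟩ : Σ N, Ω N) ∉ E}) atTop (𝓝 0)}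
  univ_sets := by simp
  sets_of_superset := by
    intro E F hE hEF
    refine tendsto_of_tendsto_of_tendsto_of_le_of_le tendsto_const_nhds hE (fun _ => zero_le) ?_
    exact fun N => measure_mono fun ω h h' => h (hEF h')
  inter_sets := by
    intro E F hE hF
    have h := Tendsto.add hE hF
    rw [add_zero] at h
    refine tendsto_of_tendsto_of_tendsto_of_le_of_le tendsto_const_nhds h (fun _ => zero_le) ?_
    intro N
    refine le_trans (measure_mono ?_) (measure_union_le _ _)
    intro ω h
    by_contra h'
    simp only [Set.mem_union, Set.mem_ofPred_eq, not_or, not_not] at h'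
    exact h h'

variable {P : ∀ N, Measure (Ω N)}

lemma eventually_whp {p : (Σ N, Ω N) → Prop} :
    (∀ᶠ q in whp P, p q) ↔ Tendsto (fun N => P N {ω | ¬ p ⟨N, ω⟩}) atTop (𝓝 0) := Iff.rfl

lemma eventually_whp_iff {p : (Σ N, Ω N) → Prop} :
    (∀ᶠ q in whp P, p q) ↔
      ∀ δ : ℝ, 0 < δ → ∀ᶠ N in atTop, P N {ω | ¬ p ⟨N, ω⟩} ≤ ENNReal.ofReal δ := by
  rw [eventually_whp, ENNReal.tendsto_nhds_zero]
  constructor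
  · intro h δ hδ
    exact h _ (ENNReal.ofReal_pos.2 hδ)
  · intro h ε hε
    by_cases ht : ε = ⊤
    · exact Eventually.of_forall fun N => ht ▸ le_top
    · have := h ε.toReal (ENNReal.toReal_pos hε.ne' ht)
      rwa [ENNReal.ofReal_toReal ht] at this

instance [∀ N, IsProbabilityMeasure (P N)] : (whp P).NeBot := by
  refine ⟨fun h => ?_⟩
  have h1 : ∀ᶠ q in whp P, False := by rw [h]; exact eventually_bot
  rw [eventually_whp] at h1
  simp only [not_false_eq_true, Set.ofPred_true, measure_univ] at h1
  exact one_ne_zero (tendsto_nhds_unique tendsto_const_nhds h1)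

lemma eventually_whp_of_atTop {p : ℕ → Prop} (h : ∀ᶠ N in atTop, p N) :
    ∀ᶠ q in whp P, p q.1 := by
  rw [eventually_whp]
  refine tendsto_const_nhds.congr' ?_
  filter_upwards [h] with N hN
  simp [hN]

lemma tendsto_whp_fst : Tendsto (fun q : Σ N, Ω N => q.1) (whp P) atTop :=
  fun s hs => eventually_whp_of_atTop (p := fun N => N ∈ s) hs

lemma tendsto_whp_iff {Y : (Σ N, Ω N) → ℝ} {c : ℝ} :
    Tendsto Y (whp P) (𝓝 c) ↔ ∀ ε > 0, ∀ᶠ q in whp P, |Y q - c| < ε := by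
  rw [Metric.tendsto_nhds]
  simp only [Real.dist_eq]

lemma measure_le_of_lintegral {α : Type*} [MeasurableSpace α] (μ : Measure α) {f : α → ℝ}
    (hf : Measurable f) {ε : ℝ} (hε : 0 < ε) :
    μ {x | ε ≤ f x} ≤ (∫⁻ x, ENNReal.ofReal (f x) ∂μ) / ENNReal.ofReal ε := by
  refine le_trans (measure_mono ?_) (meas_ge_le_lintegral_div hf.ennreal_ofReal.aemeasurable
    (ENNReal.ofReal_pos.2 hε).ne' ENNReal.ofReal_ne_top)
  intro x hx
  exact ENNReal.ofReal_le_ofReal hx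

/-- Markov's inequality: convergence to zero in mean implies convergence in probability. -/
lemma tendsto_whp_zero_of_lintegral {Y : (Σ N, Ω N) → ℝ} (hm : ∀ N, Measurable fun ω => Y ⟨N, ω⟩)
    (hY : ∀ q, 0 ≤ Y q)
    (h : Tendsto (fun N => ∫⁻ ω, ENNReal.ofReal (Y ⟨N, ω⟩) ∂(P N)) atTop (𝓝 0)) :
    Tendsto Y (whp P) (𝓝 0) := by
  rw [tendsto_whp_iff]
  intro ε hε
  rw [eventually_whp]
  have h2 := ENNReal.Tendsto.div_const (b := ENNReal.ofReal ε) h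
    (Or.inr (ENNReal.ofReal_pos.2 hε).ne')
  rw [ENNReal.zero_div] at h2
  refine tendsto_of_tendsto_of_tendsto_of_le_of_le tendsto_const_nhds h2 (fun _ => zero_le) ?_
  intro N
  refine le_trans (measure_mono ?_) (measure_le_of_lintegral (P N) (hm N) hε)
  intro ω hω
  simpa [abs_of_nonneg (hY _)] using hω

/-- A variable that is arbitrarily close, with probability arbitrarily close to one, to variables
that converge in probability, converges in probability. -/
lemma tendsto_whp_of_approx {Y : (Σ N, Ω N) → ℝ} {c : ℝ}
    (h : ∀ ε > 0, ∀ δ > 0, ∃ (Z : (Σ N, Ω N) → ℝ) (c' : ℝ), Tendsto Z (whp P) (𝓝 c') ∧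
      |c' - c| ≤ ε ∧ ∀ᶠ N in atTop, P N {ω | ε < |Y ⟨N, ω⟩ - Z ⟨N, ω⟩|} ≤ ENNReal.ofReal δ) :
    Tendsto Y (whp P) (𝓝 c) := by
  rw [tendsto_whp_iff]
  intro ε hε
  rw [eventually_whp_iff]
  intro δ hδ
  obtain ⟨Z, c', hZ, hc, hYZ⟩ := h (ε / 3) (by positivity) (δ / 2) (by positivity)
  have hZ' := eventually_whp_iff.1 (tendsto_whp_iff.1 hZ (ε / 3) (by positivity)) (δ / 2)
    (by positivity)
  filter_upwards [hYZ, hZ'] with N h1 h2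
  calc P N {ω | ¬ |Y ⟨N, ω⟩ - c| < ε}
      ≤ P N ({ω | ε / 3 < |Y ⟨N, ω⟩ - Z ⟨N, ω⟩|} ∪ {ω | ¬ |Z ⟨N, ω⟩ - c'| < ε / 3}) := by
        refine measure_mono fun ω hω => ?_
        by_contra hn
        simp only [Set.mem_union, Set.mem_ofPred_eq, not_or, not_lt] at hn hω
        have := abs_sub_le (Y ⟨N, ω⟩) (Z ⟨N, ω⟩) c
        have := abs_sub_le (Z ⟨N, ω⟩) c' c
        linarith [hn.1, hn.2]
    _ ≤ ENNReal.ofReal (δ / 2) + ENNReal.ofReal (δ / 2) :=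
        (measure_union_le _ _).trans (add_le_add h1 h2)
    _ = ENNReal.ofReal δ := by
        rw [← ENNReal.ofReal_add (by positivity) (by positivity), add_halves]

/-- Adding an independent coordinate does not change the probability of events. -/
lemma tendsto_whp_prod_fst {Z : ℕ → Type*} [∀ N, MeasurableSpace (Z N)]
    {Q : ∀ N, Measure (Z N)} [∀ N, IsProbabilityMeasure (Q N)] [∀ N, SFinite (P N)] :
    Tendsto (fun q : Σ N, Ω N × Z N => (⟨q.1, q.2.1⟩ : Σ N, Ω N))
      (whp fun N => (P N).prod (Q N)) (whp P) := by
  intro E hE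
  change Tendsto _ _ _ at hE
  change Tendsto _ _ _
  refine tendsto_of_tendsto_of_tendsto_of_le_of_le tendsto_const_nhds hE (fun _ => zero_le) ?_
  intro N
  have h1 : ((P N).prod (Q N)).map Prod.fst = P N := by simp
  calc ((P N).prod (Q N)) _
      ≤ (((P N).prod (Q N)).map Prod.fst) {ω | (⟨N, ω⟩ : Σ N, Ω N) ∉ E} :=
        Measure.le_map_apply measurable_fst.aemeasurable _
    _ = _ := by rw [h1]

/-- Events with the same probabilities are simultaneously likely. -/
lemma eventually_whp_congr {Ω' : ℕ → Type*} [∀ N, MeasurableSpace (Ω' N)]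
    {P' : ∀ N, Measure (Ω' N)} {X : ℕ → Type*} [∀ N, MeasurableSpace (X N)]
    {f : ∀ N, Ω N → X N} {f' : ∀ N, Ω' N → X N} (hf : ∀ N, Measurable (f N))
    (hf' : ∀ N, Measurable (f' N)) (h : ∀ N, (P N).map (f N) = (P' N).map (f' N))
    {p : ∀ N, X N → Prop} (hp : ∀ N, MeasurableSet {x | p N x})
    (hw : ∀ᶠ q in whp P', p q.1 (f' q.1 q.2)) : ∀ᶠ q in whp P, p q.1 (f q.1 q.2) := by
  rw [eventually_whp] at hw ⊢
  refine hw.congr fun N => ?_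
  have h1 : P N {ω | ¬ p N (f N ω)} = (P N).map (f N) {x | p N x}ᶜ :=
    (Measure.map_apply (hf N) (hp N).compl).symm
  have h2 : P' N {ω | ¬ p N (f' N ω)} = (P' N).map (f' N) {x | p N x}ᶜ :=
    (Measure.map_apply (hf' N) (hp N).compl).symm
  rw [h1, h2, h N]

end Whp

/-! ### Averages over positions -/

section Average

/-- The average of the entries of a vector. -/
noncomputable def avg {N : ℕ} (v : Fin N → ℝ) : ℝ := (N : ℝ)⁻¹ * ∑ n, v n

variable {N : ℕ}

lemma avg_mono {v w : Fin N → ℝ} (h : ∀ n, v n ≤ w n) : avg v ≤ avg w :=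
  mul_le_mul_of_nonneg_left (Finset.sum_le_sum fun n _ => h n) (by positivity)

lemma avg_nonneg {v : Fin N → ℝ} (h : ∀ n, 0 ≤ v n) : 0 ≤ avg v :=
  mul_nonneg (by positivity) (Finset.sum_nonneg fun n _ => h n)

lemma avg_add (v w : Fin N → ℝ) : avg (fun n => v n + w n) = avg v + avg w := by
  simp [avg, Finset.sum_add_distrib, mul_add]

lemma avg_sub (v w : Fin N → ℝ) : avg (fun n => v n - w n) = avg v - avg w := by
  simp [avg, Finset.sum_sub_distrib, mul_sub]

lemma avg_const_mul (t : ℝ) (v : Fin N → ℝ) : avg (fun n => t * v n) = t * avg v := by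
  simp only [avg, ← Finset.mul_sum]
  ring

lemma avg_sum {κ : Type*} (s : Finset κ) (v : κ → Fin N → ℝ) :
    avg (fun n => ∑ i ∈ s, v i n) = ∑ i ∈ s, avg (v i) := by
  simp only [avg]
  rw [Finset.sum_comm, Finset.mul_sum]

lemma avg_le_of_le {v : Fin N → ℝ} {C : ℝ} (hC : 0 ≤ C) (h : ∀ n, v n ≤ C) : avg v ≤ C := by
  rcases Nat.eq_zero_or_pos N with rfl | hN
  · simpa [avg] using hC
  · refine (avg_mono h).trans (le_of_eq ?_)
    have : (N : ℝ) ≠ 0 := by positivity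
    simp [avg, this]

lemma abs_avg_le (v : Fin N → ℝ) : |avg v| ≤ avg fun n => |v n| := by
  rw [avg, abs_mul, abs_of_nonneg (by positivity : (0 : ℝ) ≤ (N : ℝ)⁻¹)]
  exact mul_le_mul_of_nonneg_left (Finset.abs_sum_le_sum_abs _ _) (by positivity)

lemma abs_avg_le_of_le {v : Fin N → ℝ} {C : ℝ} (hC : 0 ≤ C) (h : ∀ n, |v n| ≤ C) : |avg v| ≤ C :=
  (abs_avg_le v).trans (avg_le_of_le hC h)

lemma avg_mul_eq_dot (v w : Fin N → ℝ) : avg (fun n => v n * w n) = (N : ℝ)⁻¹ * (v ⬝ᵥ w) := rfl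

lemma measurable_avg {α : Type*} [MeasurableSpace α] {v : α → Fin N → ℝ} (hv : Measurable v) :
    Measurable fun x => avg (v x) :=
  measurable_const.mul (Finset.measurable_sum _ fun n _ => (measurable_pi_apply n).comp hv)

lemma measurable_avg' {α : Type*} [MeasurableSpace α] {v : Fin N → α → ℝ}
    (hv : ∀ n, Measurable (v n)) : Measurable fun x => avg fun n => v n x :=
  measurable_avg (measurable_pi_lambda _ hv)

/-- The absolute value of `x`, cut off to zero unless it exceeds `M`. -/
noncomputable def tailPart (M x : ℝ) : ℝ := if M < |x| then |x| else 0

lemma tailPart_nonneg (M x : ℝ) : 0 ≤ tailPart M x := by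
  unfold tailPart; split_ifs <;> simp

lemma tailPart_le_abs (M x : ℝ) : tailPart M x ≤ |x| := by
  unfold tailPart; split_ifs <;> simp

lemma tailPart_mono {M x y : ℝ} (h : |x| ≤ |y|) : tailPart M x ≤ tailPart M y := by
  unfold tailPart
  split_ifs with h1 h2
  · exact h
  · exact absurd (h1.trans_le h) h2
  · exact abs_nonneg _
  · exact le_rfl

lemma tailPart_anti {M M' : ℝ} (h : M ≤ M') (x : ℝ) : tailPart M' x ≤ tailPart M x := by
  unfold tailPart
  split_ifs with h1 h2
  · exact le_rfl
  · exact absurd (h.trans_lt h1) h2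
  · exact abs_nonneg _
  · exact le_rfl

lemma tailPart_add_le (M x y : ℝ) :
    tailPart (2 * M) (x + y) ≤ 2 * tailPart M x + 2 * tailPart M y := by
  have hx := tailPart_nonneg M x
  have hy := tailPart_nonneg M y
  by_cases h : 2 * M < |x + y|
  · have hxy := abs_add_le x y
    rw [tailPart, if_pos h]
    rcases le_total |x| |y| with hle | hle
    · have : tailPart M y = |y| := if_pos (by linarith)
      linarith
    · have : tailPart M x = |x| := if_pos (by linarith)
      linarith
  · rw [tailPart, if_neg h]
    positivity

lemma abs_le_add_tailPart {M : ℝ} (hM : 0 ≤ M) (x : ℝ) : |x| ≤ M + tailPart M x := by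
  unfold tailPart
  split_ifs with h
  · linarith
  · linarith

lemma tailPart_mul (M t x : ℝ) (ht : 0 < |t|) :
    tailPart (|t| * M) (t * x) = |t| * tailPart M x := by
  simp only [tailPart, abs_mul, mul_lt_mul_iff_right₀ ht]
  split_ifs <;> simp

lemma measurable_tailPart (M : ℝ) : Measurable (tailPart M) := by
  unfold tailPart
  exact Measurable.ite (measurableSet_lt measurable_const continuous_abs.measurable)
    continuous_abs.measurable measurable_const

end Average

/-! ### Uniform integrability of random arrays, in probability -/

section UIArr

variable {Ω : ℕ → Type*} [∀ N, MeasurableSpace (Ω N)] {P : ∀ N, Measure (Ω N)}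

/-- A random array is uniformly integrable in probability: the empirical averages of the parts of
its entries above a high level are small with high probability. -/
def UIArr (P : ∀ N, Measure (Ω N)) (y : ∀ q : Σ N, Ω N, Fin q.1 → ℝ) : Prop :=
  ∀ ε > 0, ∀ δ > 0, ∃ M : ℝ, 0 ≤ M ∧ ∀ᶠ N in atTop,
    P N {ω | ε < avg fun n => tailPart M (y ⟨N, ω⟩ n)} ≤ ENNReal.ofReal δ

variable {y y' : ∀ q : Σ N, Ω N, Fin q.1 → ℝ}

lemma UIArr.mono (h : UIArr P y') (hle : ∀ q n, |y q n| ≤ |y' q n|) : UIArr P y := by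
  intro ε hε δ hδ
  obtain ⟨M, hM, h⟩ := h ε hε δ hδ
  refine ⟨M, hM, h.mono fun N hN => (measure_mono fun ω hω => ?_).trans hN⟩
  exact lt_of_lt_of_le hω (avg_mono fun n => tailPart_mono (hle _ n))

lemma UIArr.add (h : UIArr P y) (h' : UIArr P y') : UIArr P fun q n => y q n + y' q n := by
  intro ε hε δ hδ
  obtain ⟨M, hM, h⟩ := h (ε / 4) (by positivity) (δ / 2) (by positivity)
  obtain ⟨M', hM', h'⟩ := h' (ε / 4) (by positivity) (δ / 2) (by positivity)
  refine ⟨2 * max M M', by positivity, ?_⟩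
  filter_upwards [h, h'] with N h1 h2
  calc P N {ω | ε < avg fun n => tailPart (2 * max M M') (y ⟨N, ω⟩ n + y' ⟨N, ω⟩ n)}
      ≤ P N ({ω | ε / 4 < avg fun n => tailPart M (y ⟨N, ω⟩ n)} ∪
          {ω | ε / 4 < avg fun n => tailPart M' (y' ⟨N, ω⟩ n)}) := by
        refine measure_mono fun ω hω => ?_
        by_contra hn
        simp only [Set.mem_union, Set.mem_ofPred_eq, not_or, not_lt] at hn hω
        have key : avg (fun n => tailPart (2 * max M M') (y ⟨N, ω⟩ n + y' ⟨N, ω⟩ n)) ≤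
            avg fun n => 2 * tailPart M (y ⟨N, ω⟩ n) + 2 * tailPart M' (y' ⟨N, ω⟩ n) := by
          refine avg_mono fun n => (tailPart_add_le _ _ _).trans ?_
          have e1 := tailPart_anti (le_max_left M M') (y ⟨N, ω⟩ n)
          have e2 := tailPart_anti (le_max_right M M') (y' ⟨N, ω⟩ n)
          linarith
        rw [avg_add, avg_const_mul, avg_const_mul] at key
        linarith [hn.1, hn.2]
    _ ≤ ENNReal.ofReal (δ / 2) + ENNReal.ofReal (δ / 2) :=
        (measure_union_le _ _).trans (add_le_add h1 h2)
    _ = ENNReal.ofReal δ := by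
        rw [← ENNReal.ofReal_add (by positivity) (by positivity), add_halves]

lemma UIArr.zero : UIArr P fun _ _ => 0 := by
  intro ε hε δ hδ
  refine ⟨0, le_rfl, Eventually.of_forall fun N => ?_⟩
  simp [tailPart, avg, not_lt.2 hε.le]

lemma UIArr.const_mul (h : UIArr P y) (t : ℝ) : UIArr P fun q n => t * y q n := by
  rcases eq_or_ne t 0 with rfl | ht
  · simpa using UIArr.zero
  have ht' : 0 < |t| := abs_pos.2 ht
  intro ε hε δ hδ
  obtain ⟨M, hM, h⟩ := h (ε / |t|) (by positivity) δ hδ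
  refine ⟨|t| * M, by positivity, h.mono fun N hN => (measure_mono fun ω hω => ?_).trans hN⟩
  simp only [Set.mem_ofPred_eq, tailPart_mul _ _ _ ht', avg_const_mul] at hω ⊢
  rw [div_lt_iff₀ ht']
  linarith

lemma UIArr.of_avg_tendsto (h : Tendsto (fun q => avg fun n => |y q n|) (whp P) (𝓝 0)) :
    UIArr P y := by
  intro ε hε δ hδ
  refine ⟨0, le_rfl, ?_⟩
  filter_upwards [eventually_whp_iff.1 (tendsto_whp_iff.1 h ε hε) δ hδ] with N hN
  refine (measure_mono fun ω hω => ?_).trans hN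
  simp only [Set.mem_ofPred_eq, sub_zero, not_lt] at hω ⊢
  refine (hω.le.trans (avg_mono fun n => tailPart_le_abs 0 _)).trans (le_abs_self _)

/-- A random array is uniformly integrable in mean: the expected averages of the parts of its
entries above a high level are small, uniformly in the length. -/
def MeanUIArr (P : ∀ N, Measure (Ω N)) (y : ∀ q : Σ N, Ω N, Fin q.1 → ℝ) : Prop :=
  ∀ ε > 0, ∃ M : ℝ, 0 ≤ M ∧ ∀ N,
    ∫⁻ ω, ENNReal.ofReal (avg fun n : Fin N => tailPart M (y ⟨N, ω⟩ n)) ∂(P N) ≤ ENNReal.ofReal ε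

lemma MeanUIArr.uiArr (h : MeanUIArr P y) (hm : ∀ N (n : Fin N), Measurable fun ω => y ⟨N, ω⟩ n) :
    UIArr P y := by
  intro ε hε δ hδ
  obtain ⟨M, hM, h⟩ := h (ε * δ) (by positivity)
  refine ⟨M, hM, Eventually.of_forall fun N => ?_⟩
  let f : Ω N → ℝ := fun ω => avg fun n : Fin N => tailPart M (y ⟨N, ω⟩ n)
  have hmeas : Measurable f := measurable_avg' fun n => (measurable_tailPart M).comp (hm N n)
  have hlt : P N {ω | ε < f ω} ≤ P N {ω | ε ≤ f ω} := measure_mono fun ω (hω : ε < f ω) => hω.le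
  have hfin : (∫⁻ ω, ENNReal.ofReal (f ω) ∂(P N)) / ENNReal.ofReal ε ≤
      ENNReal.ofReal (ε * δ) / ENNReal.ofReal ε := ENNReal.div_le_div_right (h N) _
  rw [← ENNReal.ofReal_div_of_pos hε, mul_div_cancel_left₀ _ hε.ne'] at hfin
  exact hlt.trans ((measure_le_of_lintegral (P N) hmeas hε).trans hfin)

lemma UIArr.mul_of_sq (h : UIArr P fun q n => y q n ^ 2) (h' : UIArr P fun q n => y' q n ^ 2) :
    UIArr P fun q n => y q n * y' q n := by
  refine (h.add h').mono fun q n => ?_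
  rw [abs_of_nonneg (by positivity : 0 ≤ y q n ^ 2 + y' q n ^ 2), abs_mul]
  nlinarith [sq_abs (y q n), sq_abs (y' q n), sq_nonneg (|y q n| - |y' q n|), sq_nonneg (y q n),
    sq_nonneg (y' q n)]

lemma UIArr.sq_add (h : UIArr P fun q n => y q n ^ 2) (h' : UIArr P fun q n => y' q n ^ 2) :
    UIArr P fun q n => (y q n + y' q n) ^ 2 := by
  refine ((h.const_mul 2).add (h'.const_mul 2)).mono fun q n => ?_
  rw [abs_of_nonneg (by positivity), abs_of_nonneg (by positivity)]
  nlinarith [sq_nonneg (y q n - y' q n)]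

lemma UIArr.sq_const_mul (h : UIArr P fun q n => y q n ^ 2) (t : ℝ) :
    UIArr P fun q n => (t * y q n) ^ 2 := by
  simp only [mul_pow]
  exact h.const_mul _

lemma UIArr.sq_sum {κ : Type*} (s : Finset κ) {f : κ → ∀ q : Σ N, Ω N, Fin q.1 → ℝ}
    (h : ∀ i ∈ s, UIArr P fun q n => f i q n ^ 2) :
    UIArr P fun q n => (∑ i ∈ s, f i q n) ^ 2 := by
  classical
  induction s using Finset.induction with
  | empty => simpa using UIArr.zero
  | insert a s ha ih =>
    simp only [Finset.sum_insert ha]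
    exact (h a (Finset.mem_insert_self a s)).sq_add
      (ih fun i hi => h i (Finset.mem_insert_of_mem hi))

lemma UIArr.prod_fst {Z : ℕ → Type*} [∀ N, MeasurableSpace (Z N)] [∀ N, SFinite (P N)]
    {Q : ∀ N, Measure (Z N)} [∀ N, IsProbabilityMeasure (Q N)] (h : UIArr P y) :
    UIArr (fun N => (P N).prod (Q N))
      fun (q : Σ N, Ω N × Z N) n => y ⟨q.1, q.2.1⟩ n := by
  intro ε hε δ hδ
  obtain ⟨M, hM, h⟩ := h ε hε δ hδ
  refine ⟨M, hM, h.mono fun N hN => le_trans ?_ hN⟩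
  have h1 : ((P N).prod (Q N)).map Prod.fst = P N := by simp
  calc ((P N).prod (Q N)) _
      ≤ (((P N).prod (Q N)).map Prod.fst) {ω | ε < avg fun n => tailPart M (y ⟨N, ω⟩ n)} :=
        Measure.le_map_apply measurable_fst.aemeasurable _
    _ = _ := by rw [h1]

/-- No single entry of a uniformly integrable array contributes to the average. -/
lemma UIArr.eventually_le (h : UIArr P y) {ε : ℝ} (hε : 0 < ε) :
    ∀ᶠ q in whp P, ∀ n, |y q n| ≤ ε * q.1 := by
  rw [eventually_whp_iff]
  intro δ hδ
  obtain ⟨M, hM, h⟩ := h (ε / 2) (by positivity) δ hδ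
  filter_upwards [h, (tendsto_natCast_atTop_atTop (R := ℝ)).eventually_ge_atTop (2 * M / ε),
    eventually_gt_atTop 0] with N hN hN2 hN0
  refine (measure_mono fun ω hω => ?_).trans hN
  simp only [Set.mem_ofPred_eq, not_forall, not_le] at hω ⊢
  obtain ⟨n, hn⟩ := hω
  have hN0' : (0 : ℝ) < N := by exact_mod_cast hN0
  have h1 : tailPart M (y ⟨N, ω⟩ n) ≤ ∑ n, tailPart M (y ⟨N, ω⟩ n) :=
    Finset.single_le_sum (fun i _ => tailPart_nonneg M (y ⟨N, ω⟩ i)) (Finset.mem_univ n)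
  have h2 := abs_le_add_tailPart hM (y ⟨N, ω⟩ n)
  have h3 : M ≤ ε / 2 * N := by
    rw [div_le_iff₀ hε] at hN2
    linarith
  rw [avg, lt_inv_mul_iff₀ hN0']
  nlinarith

end UIArr

/-! ### Empirical laws of rows -/

section RowLaw

variable {Ω : ℕ → Type*} [∀ N, MeasurableSpace (Ω N)] {P : ∀ N, Measure (Ω N)}
variable {R : Type*}

/-- The fraction of positions whose row lies in `O`. -/
noncomputable def frac {N : ℕ} (O : Set R) (r : Fin N → R) : ℝ :=
  avg fun n => O.indicator (fun _ => (1 : ℝ)) (r n)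

lemma frac_nonneg {N : ℕ} (O : Set R) (r : Fin N → R) : 0 ≤ frac O r :=
  avg_nonneg fun _ => Set.indicator_nonneg (fun _ _ => zero_le_one) _

variable [MeasurableSpace R]

lemma measurable_frac {N : ℕ} {α : Type*} [MeasurableSpace α] {O : Set R} (hO : MeasurableSet O)
    {r : α → Fin N → R} (hr : Measurable r) : Measurable fun x => frac O (r x) :=
  measurable_avg' fun n => (measurable_const.indicator hO).comp ((measurable_pi_apply n).comp hr)

/-- The empirical law of the rows `r` converges to `μ` in probability, on every measurable set. -/
def RowLLN (P : ∀ N, Measure (Ω N)) (r : ∀ q : Σ N, Ω N, Fin q.1 → R) (μ : Measure R) : Prop :=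
  ∀ O, MeasurableSet O → Tendsto (fun q => frac O (r q)) (whp P) (𝓝 (μ.real O))

variable {r : ∀ q : Σ N, Ω N, Fin q.1 → R} {μ : Measure R}

/-- Averages of a bounded function over the rows converge.  The function is approximated uniformly
by simple functions. -/
lemma RowLLN.tendsto_avg_of_bounded [IsProbabilityMeasure μ] (h : RowLLN P r μ) {ψ : R → ℝ}
    (hψ : Measurable ψ) {C : ℝ} (hC : ∀ x, |ψ x| ≤ C) :
    Tendsto (fun q => avg fun n => ψ (r q n)) (whp P) (𝓝 (∫ x, ψ x ∂μ)) := by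
  refine tendsto_whp_of_approx fun ε hε δ hδ => ?_
  obtain ⟨k, hk⟩ := exists_nat_one_div_lt hε
  have hk0 : (0 : ℝ) < k + 1 := by positivity
  -- discretize the values of `ψ` with mesh `1 / (k + 1)`
  let fl : R → ℤ := fun x => ⌊(k + 1) * ψ x⌋
  have hfl : Measurable fl := Int.measurable_floor.comp (measurable_const.mul hψ)
  let ψk : R → ℝ := fun x => (fl x : ℝ) / (k + 1)
  have hψk : ∀ x, |ψ x - ψk x| ≤ ε := by
    intro x
    have h1 := Int.floor_le ((k + 1) * ψ x)
    have h2 := Int.lt_floor_add_one ((k + 1) * ψ x)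
    refine le_trans ?_ hk.le
    have : ψ x - ψk x = ((k + 1) * ψ x - fl x) / (k + 1) := by
      simp only [ψk]; field_simp
    rw [this, abs_div, abs_of_pos hk0]
    gcongr
    rw [abs_le]
    constructor <;> simp only [fl] <;> linarith
  let L : ℤ := ⌈(k + 1) * C⌉ + 1
  have hmem : ∀ x, fl x ∈ Finset.Icc (-L) L := by
    intro x
    have h1 := Int.floor_le ((k + 1) * ψ x)
    have h2 := Int.lt_floor_add_one ((k + 1) * ψ x)
    have h3 := Int.le_ceil ((k + 1) * C)
    have h4 := abs_le.1 (hC x)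
    have h5 : (k + 1) * ψ x ≤ (k + 1) * C := by gcongr; exact h4.2
    have h6 : (k + 1) * (-C) ≤ (k + 1) * ψ x := by gcongr; exact h4.1
    rw [Finset.mem_Icc]
    constructor
    · have : (-(L : ℝ)) ≤ fl x := by simp only [L, fl]; push_cast; linarith
      exact_mod_cast this
    · have : (fl x : ℝ) ≤ L := by simp only [L, fl]; push_cast; linarith
      exact_mod_cast this
  have hsum : ∀ x, ψk x = ∑ i ∈ Finset.Icc (-L) L,
      ((i : ℝ) / (k + 1)) * (fl ⁻¹' {i}).indicator (fun _ => (1 : ℝ)) x := by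
    intro x
    rw [Finset.sum_eq_single (fl x)]
    · simp [ψk]
    · intro i _ hi
      rw [Set.indicator_of_notMem (by simpa using hi.symm), mul_zero]
    · intro h; exact absurd (hmem x) h
  have hms : ∀ i : ℤ, MeasurableSet (fl ⁻¹' {i}) := fun i => hfl (measurableSet_singleton i)
  have hint : ∀ i : ℤ, Integrable ((fl ⁻¹' {i}).indicator (fun _ => (1 : ℝ))) μ := fun i =>
    (integrable_const _).indicator (hms i)
  have hψi : Integrable ψ μ := Integrable.of_bound hψ.aestronglyMeasurable C
    (Eventually.of_forall fun x => by simpa using hC x)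
  refine ⟨fun q => avg fun n => ψk (r q n), ∫ x, ψk x ∂μ, ?_, ?_, ?_⟩
  · simp only [hsum]
    rw [integral_finsetSum _ fun i _ => (hint i).const_mul _]
    simp only [avg_sum, avg_const_mul]
    refine tendsto_finsetSum _ fun i _ => ?_
    rw [integral_const_mul, integral_indicator_const _ (hms i), smul_eq_mul, mul_one]
    exact (h _ (hms i)).const_mul _
  · have hki : Integrable ψk μ := by
      have : ψk = fun x => ∑ i ∈ Finset.Icc (-L) L,
        ((i : ℝ) / (k + 1)) * (fl ⁻¹' {i}).indicator (fun _ => (1 : ℝ)) x := funext hsum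
      rw [this]
      exact integrable_finsetSum _ fun i _ => (hint i).const_mul _
    rw [← integral_sub hki hψi]
    refine (norm_integral_le_of_norm_le_const (μ := μ) (f := fun x => ψk x - ψ x) (C := ε) (Eventually.of_forall fun x => ?_)).trans ?_
    · rw [Real.norm_eq_abs, abs_sub_comm]
      exact hψk x
    · simp
  · refine Eventually.of_forall fun N => ?_
    have : {ω | ε < |(avg fun n => ψ (r ⟨N, ω⟩ n)) - avg fun n => ψk (r ⟨N, ω⟩ n)|} = ∅ := by
      ext ω
      simp only [Set.mem_ofPred_eq, Set.mem_empty_iff_false, iff_false, not_lt]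
      rw [← avg_sub]
      exact abs_avg_le_of_le hε.le fun n => hψk _
    rw [this]
    simp

/-- Uniform integrability of `ψ` along the rows passes to the limit law. -/
lemma RowLLN.integrable [IsProbabilityMeasure μ] [∀ N, IsProbabilityMeasure (P N)]
    (h : RowLLN P r μ) {ψ : R → ℝ} (hψ : Measurable ψ) (hui : UIArr P fun q n => ψ (r q n)) :
    Integrable ψ μ := by
  obtain ⟨M, hM, hT⟩ := hui 1 one_pos (1 / 2) (by norm_num)
  have hmin : ∀ K : ℕ, Measurable fun x => min |ψ x| K := fun K =>
    (continuous_abs.measurable.comp hψ).min measurable_const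
  have hb : ∀ (K : ℕ) (x : R), |min |ψ x| (K : ℝ)| ≤ K := fun K x => by
    rw [abs_of_nonneg (by positivity)]
    exact min_le_right _ _
  -- Otherwise the average of the truncations exceeds `M + 1` with high probability.  The part up to
  -- `M` contributes at most `M`, and the rest exceeds `1` with probability at most `1 / 2`.
  have hK : ∀ K : ℕ, ∫ x, min |ψ x| K ∂μ ≤ M + 2 := by
    intro K
    by_contra! hlt
    have h1 := h.tendsto_avg_of_bounded (hmin K) (hb K)
    have h2 : ∀ᶠ q in whp P, M + 1 < avg fun n => min |ψ (r q n)| (K : ℝ) :=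
      h1.eventually (lt_mem_nhds (by linarith))
    obtain ⟨N, hN1, hN2⟩ := ((eventually_whp_iff.1 h2 (1 / 4) (by norm_num)).and hT).exists
    have hcov : (Set.univ : Set (Ω N)) ⊆
        {ω | ¬ M + 1 < avg fun n => min |ψ (r ⟨N, ω⟩ n)| (K : ℝ)} ∪
        {ω | 1 < avg fun n => tailPart M (ψ (r ⟨N, ω⟩ n))} := by
      intro ω _
      by_contra hn
      simp only [Set.mem_union, Set.mem_ofPred_eq, not_or, not_lt] at hn
      have h3 : (avg fun n => min |ψ (r ⟨N, ω⟩ n)| (K : ℝ)) ≤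
          avg fun n => M + tailPart M (ψ (r ⟨N, ω⟩ n)) :=
        avg_mono fun n => (min_le_left _ _).trans (abs_le_add_tailPart hM _)
      rw [avg_add] at h3
      have h4 : avg (fun _ : Fin N => M) ≤ M := avg_le_of_le hM fun _ => le_rfl
      linarith [hn.1, hn.2]
    have := (measure_mono hcov).trans ((measure_union_le _ _).trans (add_le_add hN1 hN2))
    rw [measure_univ, ← ENNReal.ofReal_add (by norm_num) (by norm_num),
      ENNReal.one_le_ofReal] at this
    norm_num at this
  refine ⟨hψ.aestronglyMeasurable, ?_⟩
  have hl : ∫⁻ x, ‖ψ x‖ₑ ∂μ = ⨆ K : ℕ, ∫⁻ x, ENNReal.ofReal (min |ψ x| K) ∂μ := by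
    rw [← lintegral_iSup (fun K => (hmin K).ennreal_ofReal)]
    · refine lintegral_congr fun x => ?_
      rw [Real.enorm_eq_ofReal_abs]
      refine le_antisymm ?_ (iSup_le fun K => ENNReal.ofReal_le_ofReal (min_le_left _ _))
      obtain ⟨K, hK⟩ := exists_nat_ge |ψ x|
      refine le_iSup_of_le K (ENNReal.ofReal_le_ofReal ?_)
      rw [min_eq_left hK]
    · intro K K' hKK x
      exact ENNReal.ofReal_le_ofReal (min_le_min_left _ (by exact_mod_cast hKK))
  rw [HasFiniteIntegral, hl]
  refine lt_of_le_of_lt (iSup_le fun K => ?_) (ENNReal.ofReal_lt_top (r := M + 2))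
  rw [← ofReal_integral_eq_lintegral_ofReal]
  · exact ENNReal.ofReal_le_ofReal (hK K)
  · exact Integrable.of_bound (hmin K).aestronglyMeasurable K
      (Eventually.of_forall fun x => by simpa using hb K x)
  · exact Eventually.of_forall fun x => by positivity

/-- Averages of a function over the rows converge, if its values are uniformly integrable. -/
lemma RowLLN.tendsto_avg [IsProbabilityMeasure μ] [∀ N, IsProbabilityMeasure (P N)]
    (h : RowLLN P r μ) {ψ : R → ℝ} (hψ : Measurable ψ) (hui : UIArr P fun q n => ψ (r q n)) :
    Tendsto (fun q => avg fun n => ψ (r q n)) (whp P) (𝓝 (∫ x, ψ x ∂μ)) := by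
  have hint := h.integrable hψ hui
  refine tendsto_whp_of_approx fun ε hε δ hδ => ?_
  obtain ⟨M, hM, hT⟩ := hui ε hε δ hδ
  -- a truncation level that is good for the array and for the limit law
  have hlim : Tendsto (fun K : ℕ => ∫ x, tailPart K (ψ x) ∂μ) atTop (𝓝 0) := by
    have := tendsto_integral_of_dominated_convergence (μ := μ)
      (F := fun (K : ℕ) x => tailPart K (ψ x)) (f := fun _ => 0) (fun x => |ψ x|)
      (fun K => ((measurable_tailPart K).comp hψ).aestronglyMeasurable) hint.abs
      (fun K => Eventually.of_forall fun x => by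
        rw [Real.norm_eq_abs, abs_of_nonneg (tailPart_nonneg _ _)]
        exact tailPart_le_abs _ _)
      (Eventually.of_forall fun x => by
        refine tendsto_const_nhds.congr' ?_
        filter_upwards [(tendsto_natCast_atTop_atTop (R := ℝ)).eventually_ge_atTop |ψ x|] with K hK
        rw [tailPart, if_neg (not_lt.2 hK)])
    simpa using this
  obtain ⟨K, hKM, hKε⟩ := (((tendsto_natCast_atTop_atTop (R := ℝ)).eventually_ge_atTop M).and
    (hlim.eventually (gt_mem_nhds hε))).exists
  let ψK : R → ℝ := fun x => if (K : ℝ) < |ψ x| then 0 else ψ x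
  have hψK : Measurable ψK := Measurable.ite
    (measurableSet_lt measurable_const (continuous_abs.measurable.comp hψ)) measurable_const hψ
  have hdiff : ∀ x, |ψ x - ψK x| = tailPart K (ψ x) := by
    intro x
    simp only [ψK, tailPart]
    split_ifs <;> simp
  have hbd : ∀ x, |ψK x| ≤ K := by
    intro x
    simp only [ψK]
    split_ifs with h1
    · simp
    · exact not_lt.1 h1
  refine ⟨fun q => avg fun n => ψK (r q n), ∫ x, ψK x ∂μ,
    h.tendsto_avg_of_bounded hψK hbd, ?_, ?_⟩
  · have hKi : Integrable ψK μ := Integrable.of_bound hψK.aestronglyMeasurable K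
      (Eventually.of_forall fun x => by simpa using hbd x)
    rw [abs_sub_comm, ← integral_sub hint hKi]
    refine (abs_integral_le_integral_abs).trans ?_
    simp only [hdiff]
    exact hKε.le
  · refine hT.mono fun N hN => (measure_mono fun ω hω => ?_).trans hN
    simp only [Set.mem_ofPred_eq] at hω ⊢
    rw [← avg_sub] at hω
    refine hω.trans_le ((abs_avg_le _).trans (avg_mono fun n => ?_))
    rw [hdiff]
    exact tailPart_anti hKM _

/-- A measurable function of the rows transports the empirical law. -/
lemma RowLLN.map {R' : Type*} [MeasurableSpace R'] (h : RowLLN P r μ) {g : R → R'}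
    (hg : Measurable g) : RowLLN P (fun q n => g (r q n)) (μ.map g) := by
  intro O hO
  rw [map_measureReal_apply hg hO]
  refine (h _ (hg hO)).congr fun q => ?_
  simp only [frac, Set.indicator]
  rfl

lemma RowLLN.congr (h : RowLLN P r μ) {r' : ∀ q : Σ N, Ω N, Fin q.1 → R}
    (he : ∀ᶠ q in whp P, r' q = r q) : RowLLN P r' μ := fun O hO =>
  (h O hO).congr' (he.mono fun _ hq => (congrArg (frac O) hq).symm)

/-- Measurability of an array of rows, for every length. -/
def RowMeas (r : ∀ q : Σ N, Ω N, Fin q.1 → R) : Prop :=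
  ∀ N, Measurable (β := Fin N → R) fun ω => r ⟨N, ω⟩

/-- The law of the array of rows of length `N`. -/
noncomputable def rowLaw (P : ∀ N, Measure (Ω N)) (r : ∀ q : Σ N, Ω N, Fin q.1 → R) (N : ℕ) :
    Measure (Fin N → R) :=
  (P N).map fun ω => r ⟨N, ω⟩

lemma RowLLN.congr_law {Ω' : ℕ → Type*} [∀ N, MeasurableSpace (Ω' N)]
    {P' : ∀ N, Measure (Ω' N)} {r' : ∀ q : Σ N, Ω' N, Fin q.1 → R}
    (hr : RowMeas r)
    (hr' : RowMeas r')
    (hlaw : ∀ N, rowLaw P r N = rowLaw P' r' N)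
    (h : RowLLN P' r' μ) : RowLLN P r μ := by
  intro O hO
  have h' := h O hO
  rw [tendsto_whp_iff] at h' ⊢
  intro ε hε
  refine eventually_whp_congr (X := fun N => Fin N → R) (f := fun N ω => r ⟨N, ω⟩)
    (f' := fun N ω => r' ⟨N, ω⟩) hr hr' hlaw
    (p := fun N v => |frac O v - μ.real O| < ε) ?_ (h' ε hε)
  intro N
  exact measurableSet_lt
    (continuous_abs.measurable.comp ((measurable_frac hO measurable_id).sub measurable_const))
    measurable_const

lemma UIArr.congr_law {Ω' : ℕ → Type*} [∀ N, MeasurableSpace (Ω' N)]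
    {P' : ∀ N, Measure (Ω' N)} {r' : ∀ q : Σ N, Ω' N, Fin q.1 → R}
    (hr : RowMeas r)
    (hr' : RowMeas r')
    (hlaw : ∀ N, rowLaw P r N = rowLaw P' r' N)
    {ψ : R → ℝ} (hψ : Measurable ψ) (h : UIArr P' fun q n => ψ (r' q n)) :
    UIArr P fun q n => ψ (r q n) := by
  intro ε hε δ hδ
  obtain ⟨M, hM, h⟩ := h ε hε δ hδ
  refine ⟨M, hM, h.mono fun N hN => le_trans (le_of_eq ?_) hN⟩
  have hm : MeasurableSet {v : Fin N → R | ε < avg fun n => tailPart M (ψ (v n))} :=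
    measurableSet_lt measurable_const (measurable_avg' fun n =>
      (measurable_tailPart M).comp (hψ.comp (measurable_pi_apply n)))
  have h1 := Measure.map_apply (μ := P N) (hr N) hm
  have h2 := Measure.map_apply (μ := P' N) (hr' N) hm
  exact h1.symm.trans ((DFunLike.congr_fun (hlaw N) _).trans h2)

end RowLaw

/-! ### Adding an independent Gaussian entry to every row -/

section FreshGaussian

variable {Ω : ℕ → Type*} [∀ N, MeasurableSpace (Ω N)] {P : ∀ N, Measure (Ω N)}
  [∀ N, IsProbabilityMeasure (P N)]
variable {R : Type*} [MeasurableSpace R]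

/-- The probability spaces `P N`, extended by an independent standard Gaussian vector. -/
noncomputable def withGauss (P : ∀ N, Measure (Ω N)) (N : ℕ) : Measure (Ω N × (Fin N → ℝ)) :=
  (P N).prod (stdG (Fin N))

instance (N : ℕ) : IsProbabilityMeasure (withGauss P N) := by unfold withGauss; infer_instance

/-- The original sample point. -/
abbrev base (q : Σ N, Ω N × (Fin N → ℝ)) : Σ N, Ω N := ⟨q.1, q.2.1⟩

lemma tendsto_base : Tendsto base (whp (withGauss P)) (whp P) := tendsto_whp_prod_fst

lemma UIArr.base {y : ∀ q : Σ N, Ω N, Fin q.1 → ℝ} (h : UIArr P y) :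
    UIArr (withGauss P) (fun q => y (OAMP.base q)) := h.prod_fst

/-- The mean square deviation of an average of independent bounded variables. -/
lemma lintegral_sq_avg_sub_le {Z : Type*} [MeasurableSpace Z] (ν : Measure Z)
    [IsProbabilityMeasure ν] {N : ℕ} {f : Fin N → Z → ℝ} (hf : ∀ n, Measurable (f n))
    (h01 : ∀ n x, 0 ≤ f n x ∧ f n x ≤ 1) :
    ∫⁻ z, ENNReal.ofReal ((avg (fun n => f n (z n)) -
      avg fun n => ∫ ζ, f n ζ ∂ν) ^ 2) ∂(Measure.pi fun _ : Fin N => ν) ≤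
      ENNReal.ofReal ((N : ℝ)⁻¹) := by
  have hb : ∀ n x, |f n x| ≤ 1 := fun n x => by
    rw [abs_of_nonneg (h01 n x).1]; exact (h01 n x).2
  have hL : ∀ n, MemLp (f n) 2 ν := fun n =>
    MemLp.of_bound (hf n).aestronglyMeasurable 1 (Eventually.of_forall fun x => by
      simpa using hb n x)
  have hmp : ∀ n : Fin N, MeasurePreserving (Function.eval n) (Measure.pi fun _ : Fin N => ν) ν :=
    fun n => measurePreserving_eval (fun _ : Fin N => ν) n
  have hLn : ∀ n, MemLp (fun z : Fin N → Z => f n (z n)) 2 (Measure.pi fun _ : Fin N => ν) := fun n =>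
    (hL n).comp_measurePreserving (hmp n)
  set S : (Fin N → Z) → ℝ := ∑ n, fun z => f n (z n) with hS
  have hSL : MemLp S 2 (Measure.pi fun _ : Fin N => ν) := memLp_finsetSum' _ fun n _ => hLn n
  have hSE : (Measure.pi fun _ : Fin N => ν)[S] = ∑ n, ∫ ζ, f n ζ ∂ν := by
    have : S = fun z => ∑ n, f n (z n) := by ext z; simp [hS]
    rw [this, integral_finsetSum _ fun n _ => (hLn n).integrable one_le_two]
    refine Finset.sum_congr rfl fun n _ => ?_
    have h1 := integral_map (hmp n).aemeasurable (f := f n)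
      ((hmp n).map_eq.symm ▸ (hf n).aestronglyMeasurable)
    rw [(hmp n).map_eq] at h1
    exact h1.symm
  have hvar : Var[S; Measure.pi fun _ : Fin N => ν] ≤ N := by
    have h1 : Var[S; Measure.pi fun _ : Fin N => ν] = ∑ n, Var[f n; ν] :=
      variance_sum_pi hL
    rw [h1]
    calc ∑ n, Var[f n; ν] ≤ ∑ _n : Fin N, (1 : ℝ) := by
          refine Finset.sum_le_sum fun n _ => ?_
          refine (variance_le_expectation_sq (hf n).aestronglyMeasurable).trans ?_
          refine (integral_mono_of_nonneg (Eventually.of_forall fun x => sq_nonneg _)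
            (integrable_const 1) (Eventually.of_forall fun x => ?_)).trans (by simp)
          simp only [Pi.pow_apply]
          have := h01 n x
          nlinarith
      _ = N := by simp
  have hpt : ∀ z : Fin N → Z, (avg (fun n => f n (z n)) -
      avg fun n => ∫ ζ, f n ζ ∂ν) ^ 2 =
      ((N : ℝ)⁻¹) ^ 2 * (S z - (Measure.pi fun _ : Fin N => ν)[S]) ^ 2 := by
    intro z
    rw [hSE, hS, avg, avg, Finset.sum_apply]
    ring
  simp only [hpt]
  rw [← ofReal_integral_eq_lintegral_ofReal, integral_const_mul, ← variance_eq_integral]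
  · refine ENNReal.ofReal_le_ofReal ?_
    rcases Nat.eq_zero_or_pos N with rfl | hN
    · simp
    · have : (0 : ℝ) < N := by exact_mod_cast hN
      calc ((N : ℝ)⁻¹) ^ 2 * Var[S; Measure.pi fun _ : Fin N => ν] ≤ ((N : ℝ)⁻¹) ^ 2 * N := by gcongr
        _ = (N : ℝ)⁻¹ := by field_simp
  · exact hSL.aestronglyMeasurable.aemeasurable
  · exact ((hSL.sub (memLp_const _)).integrable_sq).const_mul _
  · exact Eventually.of_forall fun z => by positivity

/-- The empirical law of the rows with independent Gaussian entries appended. -/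
lemma RowLLN.withGauss {r : ∀ q : Σ N, Ω N, Fin q.1 → R} {μ : Measure R} [IsProbabilityMeasure μ]
    (h : RowLLN P r μ) (hr : RowMeas r) :
    RowLLN (withGauss P) (fun q n => (r (OAMP.base q) n, q.2.2 n))
      (μ.prod (gaussianReal 0 1)) := by
  intro O hO
  -- the conditional probability of `O`, given the row
  let p : R → ℝ := fun x => ∫ ζ, O.indicator (fun _ => (1 : ℝ)) (x, ζ) ∂(gaussianReal 0 1)
  have hind : Measurable (O.indicator fun _ => (1 : ℝ)) := measurable_const.indicator hO
  have h01 : ∀ x, 0 ≤ O.indicator (fun _ => (1 : ℝ)) x ∧ O.indicator (fun _ => (1 : ℝ)) x ≤ 1 :=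
    fun x => ⟨Set.indicator_nonneg (fun _ _ => zero_le_one) _,
      Set.indicator_le_self' (fun _ _ => zero_le_one) x⟩
  have hpm : Measurable p := (hind.stronglyMeasurable.integral_prod_right').measurable
  have hpb : ∀ x, |p x| ≤ 1 := by
    intro x
    refine (norm_integral_le_of_norm_le_const (μ := gaussianReal 0 1)
      (f := fun ζ => O.indicator (fun _ => (1 : ℝ)) (x, ζ)) (C := 1)
      (Eventually.of_forall fun ζ => ?_)).trans (by simp)
    rw [Real.norm_eq_abs, abs_of_nonneg (h01 _).1]
    exact (h01 _).2
  have h1 := (h.tendsto_avg_of_bounded hpm hpb).comp (tendsto_base (P := P))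
  have hint : ∫ x, p x ∂μ = (μ.prod (gaussianReal 0 1)).real O := by
    rw [← integral_indicator_one hO, integral_prod]
    · rfl
    · exact (integrable_const _).indicator hO
  rw [hint] at h1
  have hN : ∀ N, Measurable fun w : Ω N × (Fin N → ℝ) =>
      ((frac O fun n => (r ⟨N, w.1⟩ n, w.2 n)) - avg fun n : Fin N => p (r ⟨N, w.1⟩ n)) ^ 2 := by
    intro N
    have hrn : ∀ n : Fin N, Measurable fun w : Ω N × (Fin N → ℝ) => r ⟨N, w.1⟩ n := fun n =>
      (measurable_pi_apply n).comp ((hr N).comp measurable_fst)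
    refine (Measurable.sub ?_ ?_).pow_const 2
    · exact measurable_frac hO (measurable_pi_lambda _ fun n => (hrn n).prodMk
        ((measurable_pi_apply n).comp measurable_snd))
    · exact measurable_avg' fun n => hpm.comp (hrn n)
  -- given the rows, the fraction has mean `avg p` and variance at most `1 / N`
  have h2 : Tendsto (fun q : Σ N, Ω N × (Fin N → ℝ) =>
      ((frac O fun n => (r (OAMP.base q) n, q.2.2 n)) -
        avg fun n => p (r (OAMP.base q) n)) ^ 2)
      (whp (OAMP.withGauss P)) (𝓝 0) := by
    refine tendsto_whp_zero_of_lintegral hN (fun q => sq_nonneg _) ?_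
    have hlim : Tendsto (fun N : ℕ => ENNReal.ofReal ((N : ℝ)⁻¹)) atTop (𝓝 0) := by
      have := ENNReal.tendsto_ofReal (tendsto_inv_atTop_nhds_zero_nat (𝕜 := ℝ))
      simpa using this
    refine tendsto_of_tendsto_of_tendsto_of_le_of_le tendsto_const_nhds hlim (fun _ => zero_le) ?_
    intro N
    simp only
    refine (lintegral_prod _ (hN N).ennreal_ofReal.aemeasurable).le.trans ?_
    calc _ ≤ ∫⁻ _ω, ENNReal.ofReal ((N : ℝ)⁻¹) ∂(P N) := by
          refine lintegral_mono fun ω => ?_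
          exact lintegral_sq_avg_sub_le (gaussianReal 0 1)
            (f := fun n ζ => O.indicator (fun _ => (1 : ℝ)) (r ⟨N, ω⟩ n, ζ))
            (fun n => hind.comp (measurable_const.prodMk measurable_id)) (fun n x => h01 _)
      _ = _ := by simp
  have h3 : Tendsto (fun q : Σ N, Ω N × (Fin N → ℝ) =>
      (frac O fun n => (r (OAMP.base q) n, q.2.2 n)) - avg fun n => p (r (OAMP.base q) n))
      (whp (OAMP.withGauss P)) (𝓝 0) := by
    have := h2.sqrt
    simp only [Real.sqrt_zero, Real.sqrt_sq_eq_abs] at this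
    exact (tendsto_zero_iff_abs_tendsto_zero _).2 this
  have h4 := h3.add h1
  rw [zero_add] at h4
  refine h4.congr fun q => ?_
  simp only [Function.comp_apply]
  exact sub_add_cancel _ _

/-- Arrays with entries of one integrable law are uniformly integrable. -/
lemma MeanUIArr.of_measurePreserving {Z : Type*} [MeasurableSpace Z] {ν : Measure Z} {f : Z → ℝ}
    (hf : Measurable f) (hint : Integrable f ν) {X : ∀ q : Σ N, Ω N, Fin q.1 → Z}
    (hX : ∀ N (n : Fin N), MeasurePreserving (fun ω => X ⟨N, ω⟩ n) (P N) ν) :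
    MeanUIArr P fun q n => f (X q n) := by
  intro ε hε
  have hlim : Tendsto (fun K : ℕ => ∫ x, tailPart K (f x) ∂ν) atTop (𝓝 0) := by
    have := tendsto_integral_of_dominated_convergence (μ := ν)
      (F := fun (K : ℕ) x => tailPart K (f x)) (f := fun _ => 0) (fun x => |f x|)
      (fun K => ((measurable_tailPart K).comp hf).aestronglyMeasurable)
      hint.abs
      (fun K => Eventually.of_forall fun x => by
        rw [Real.norm_eq_abs, abs_of_nonneg (tailPart_nonneg _ _)]
        exact tailPart_le_abs _ _)
      (Eventually.of_forall fun x => by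
        refine tendsto_const_nhds.congr' ?_
        filter_upwards [(tendsto_natCast_atTop_atTop (R := ℝ)).eventually_ge_atTop |f x|]
          with K hK
        rw [tailPart, if_neg (not_lt.2 hK)])
    simpa using this
  obtain ⟨K, hK⟩ := (hlim.eventually (gt_mem_nhds hε)).exists
  refine ⟨K, by positivity, fun N => ?_⟩
  have hm : Measurable fun x : Z => tailPart K (f x) := (measurable_tailPart K).comp hf
  have hti : Integrable (fun x : Z => tailPart K (f x)) ν :=
    hint.abs.mono' hm.aestronglyMeasurable (Eventually.of_forall fun x => by
      rw [Real.norm_eq_abs, abs_of_nonneg (tailPart_nonneg _ _)]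
      exact tailPart_le_abs _ _)
  have hIn : ∀ n : Fin N, Integrable (fun w : Ω N => tailPart K (f (X ⟨N, w⟩ n))) (P N) :=
    fun n => (hX N n).integrable_comp_of_integrable hti
  have hE : ∀ n : Fin N, ∫ w, tailPart K (f (X ⟨N, w⟩ n)) ∂(P N) =
      ∫ x, tailPart K (f x) ∂ν := by
    intro n
    rw [← (hX N n).map_eq, integral_map (hX N n).aemeasurable hm.aestronglyMeasurable]
  rw [← ofReal_integral_eq_lintegral_ofReal]
  · refine ENNReal.ofReal_le_ofReal ?_
    simp only [avg]
    rw [integral_const_mul, integral_finsetSum _ fun n _ => hIn n]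
    simp only [hE]
    exact (avg_le_of_le (integral_nonneg fun x => tailPart_nonneg _ _) fun _ => le_rfl).trans hK.le
  · exact (integrable_finsetSum _ fun n _ => hIn n).const_mul _
  · exact Eventually.of_forall fun w => avg_nonneg fun n => tailPart_nonneg _ _

lemma uiArr_gauss_sq : UIArr (withGauss P) (fun q n => q.2.2 n ^ 2) := by
  have h : MeanUIArr (withGauss P) (fun q n => q.2.2 n ^ 2) :=
    MeanUIArr.of_measurePreserving (f := fun x : ℝ => x ^ 2) (measurable_id.pow_const 2)
      (memLp_id_gaussianReal 2).integrable_sq fun N n =>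
        (measurePreserving_eval (fun _ : Fin N => gaussianReal 0 1) n).comp measurePreserving_snd
  exact h.uiArr fun N n => ((measurable_pi_apply n).comp measurable_snd).pow_const 2

end FreshGaussian

/-! ### Absolute continuity of the fresh image -/

/-- A function that does not contract distances by more than a factor `L` does not contract volumes
by more than this factor. -/
lemma volume_le_of_antilipschitz {S : Set ℝ} {f : ℝ → ℝ} {L : ℝ≥0}
    (h : ∀ x ∈ S, ∀ y ∈ S, |x - y| ≤ L * |f x - f y|) :
    volume S ≤ L * volume (f '' S) := by
  have hinj : Set.InjOn f S := by
    intro x hx y hy hxy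
    have := h x hx y hy
    rw [hxy, sub_self, abs_zero, mul_zero] at this
    exact sub_eq_zero.1 (abs_eq_zero.1 (le_antisymm this (abs_nonneg _)))
  let g := Function.invFunOn f S
  have hg : ∀ x ∈ S, g (f x) = x := fun x hx => hinj.leftInvOn_invFunOn hx
  have hlip : LipschitzOnWith L g (f '' S) := by
    refine LipschitzOnWith.of_dist_le_mul ?_
    rintro _ ⟨x, hx, rfl⟩ _ ⟨y, hy, rfl⟩
    rw [hg x hx, hg y hy, Real.dist_eq, Real.dist_eq]
    exact h x hx y hy
  have him : g '' (f '' S) = S := by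
    rw [← Set.image_comp]
    exact (Set.image_congr hg).trans (Set.image_id' S)
  have := hlip.hausdorffMeasure_image_le (d := 1) zero_le_one
  rw [him, hausdorffMeasure_real] at this
  simpa using this

/-- The positions, for a Gaussian vector `z`, at which an entry of the normalized residual of `z`
has a bounded density, given the other entries of `z`.  The basis vector at the position must not be
close to the span of the columns, so that the entry of the residual of `z` moves with the entry of
`z`; and this entry must be small compared to the norm, so that normalization does not undo the
motion. -/
def GoodAt {N : ℕ} (s α : ℝ) (B : ℕ → Fin N → ℝ) (m : ℕ) (z : Fin N → ℝ) (n : Fin N) : Prop :=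
  √N * s / 2 ≤ α ∧ 1 / 2 ≤ res B m (Pi.single n 1) ⬝ᵥ res B m (Pi.single n 1) ∧
    N / 2 ≤ res B m z ⬝ᵥ res B m z ∧ res B m z ⬝ᵥ res B m z ≤ 2 * N ∧
    res B m z n ^ 2 ≤ N / 16

lemma measurableSet_goodAt {α : Type*} [MeasurableSpace α] {N : ℕ} (s : ℝ) {a : α → ℝ}
    (ha : Measurable a) {B : α → ℕ → Fin N → ℝ} (hB : Measurable B) (m : ℕ)
    {z : α → Fin N → ℝ} (hz : Measurable z) (n : Fin N) :
    MeasurableSet {x | GoodAt s (a x) (B x) m (z x) n} := by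
  have h1 : Measurable fun x => res (B x) m (Pi.single n 1) :=
    measurable_res hB measurable_const m
  have h2 : Measurable fun x => res (B x) m (z x) := measurable_res hB hz m
  have h3 : Measurable fun x => res (B x) m (z x) n := (measurable_pi_apply n).comp h2
  exact (measurableSet_le measurable_const ha).inter
    ((measurableSet_le measurable_const (measurable_dot h1 h1)).inter
    ((measurableSet_le measurable_const (measurable_dot h2 h2)).inter
    ((measurableSet_le (measurable_dot h2 h2) measurable_const).inter
    (measurableSet_le (h3.pow_const 2) measurable_const))))

/-- An entry of a vector and its variation after normalization: `Y`, `Y'` are values of the entry,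
`p`, `p'` the corresponding norms, and `M` is the square root of the length.  The norm changes by at
most `5 / 7` of the change of the entry, and the entry is at most `M / 4`, so normalization keeps at
least half of the variation. -/
lemma abs_sub_mul_le_of_normalized {M p p' Y Y' π : ℝ} (hM : 0 < M) (hp : 7 / 10 * M ≤ p)
    (hp' : 7 / 10 * M ≤ p') (hY : |Y| ≤ M / 4) (hY' : |Y'| ≤ M / 4) (hπ : 1 / 2 ≤ π)
    (h : π * (p ^ 2 - p' ^ 2) = (Y - Y') * (Y + Y')) :
    |Y - Y'| * M ≤ 2 * |Y * p' - Y' * p| := by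
  have hd := abs_nonneg (Y - Y')
  have hδ := abs_nonneg (p - p')
  have h1 : π * (p + p') * |p - p'| = |Y - Y'| * |Y + Y'| := by
    rw [← abs_mul, ← h, show p ^ 2 - p' ^ 2 = (p + p') * (p - p') by ring, abs_mul, abs_mul,
      abs_of_pos (by linarith : 0 < π), abs_of_pos (by linarith : 0 < p + p')]
    ring
  have h2 : |Y + Y'| ≤ M / 2 := (abs_add_le _ _).trans (by linarith)
  have h3 : 7 / 10 * M ≤ π * (p + p') := by nlinarith
  have h4 : 7 / 10 * M * |p - p'| ≤ |Y - Y'| * (M / 2) := by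
    calc 7 / 10 * M * |p - p'| ≤ π * (p + p') * |p - p'| := by gcongr
      _ = |Y - Y'| * |Y + Y'| := h1
      _ ≤ _ := by gcongr
  have h5 : |p - p'| ≤ 5 / 7 * |Y - Y'| := by
    refine le_of_mul_le_mul_left ?_ (by positivity : 0 < 7 / 10 * M)
    linarith
  have h6 : |Y - Y'| * p' ≤ |Y * p' - Y' * p| + |Y'| * |p - p'| := by
    rw [← abs_of_pos (by linarith : 0 < p'), ← abs_mul, ← abs_mul,
      abs_of_pos (by linarith : 0 < p')]
    calc |(Y - Y') * p'| = |(Y * p' - Y' * p) + Y' * (p - p')| := by ring_nf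
      _ ≤ _ := abs_add_le _ _
  have h7 : |Y'| * |p - p'| ≤ M / 4 * (5 / 7 * |Y - Y'|) := by gcongr
  have h8 : |Y - Y'| * (7 / 10 * M) ≤ |Y - Y'| * p' := by gcongr
  nlinarith

lemma res_update_sub {N : ℕ} (B : ℕ → Fin N → ℝ) (m : ℕ) (z : Fin N → ℝ) (n : Fin N) (ζ ζ' : ℝ) :
    res B m (Function.update z n ζ) =
      res B m (Function.update z n ζ') + (ζ - ζ') • res B m (Pi.single n 1) := by
  rw [← res_smul, ← res_add]
  congr 1
  ext i
  by_cases hi : i = n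
  · subst hi; simp
  · simp [hi]

/-- As the Gaussian entry at a good position varies, the entry of the fresh image at this position
moves at a rate of at least `s / 20`. -/
lemma antilipschitz_freshImage {N : ℕ} {s α : ℝ} (hs : 0 < s) (κ : Fin N → ℝ)
    (B : ℕ → Fin N → ℝ) (m : ℕ) (z : Fin N → ℝ) (n : Fin N) (ζ ζ' : ℝ)
    (h : GoodAt s α B m (Function.update z n ζ) n)
    (h' : GoodAt s α B m (Function.update z n ζ') n) :
    |ζ - ζ'| ≤ 20 / s * |(κ + α • unitVec (res B m (Function.update z n ζ))) n -
      (κ + α • unitVec (res B m (Function.update z n ζ'))) n| := by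
  have hN : (0 : ℝ) < N := by exact_mod_cast Fin.pos n
  have hy := res_update_sub B m z n ζ ζ'
  obtain ⟨hα, hπ, hl, hu, hn⟩ := h
  obtain ⟨-, -, hl', hu', hn'⟩ := h'
  set y := res B m (Function.update z n ζ) with hydef
  set y' := res B m (Function.update z n ζ') with hydef'
  set r := res B m (Pi.single n 1) with hr
  have hry : ∀ v : Fin N → ℝ, r ⬝ᵥ res B m v = res B m v n := by
    intro v
    rw [hr, dot_res_comm, res_res, single_one_dotProduct]
  have hrn : r n = r ⬝ᵥ r := (hry _).symm
  set π := r ⬝ᵥ r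
  set M := √(N : ℝ) with hMdef
  have hM : 0 < M := Real.sqrt_pos.2 hN
  have hM2 : M ^ 2 = N := Real.sq_sqrt hN.le
  rw [← nrm_sq, ← hM2] at hl hu hl' hu'
  rw [← hM2] at hn hn'
  have hp : 7 / 10 * M ≤ nrm y := by
    refine abs_le_of_sq_le_sq' ?_ (nrm_nonneg y) |>.2
    nlinarith
  have hp' : 7 / 10 * M ≤ nrm y' := by
    refine abs_le_of_sq_le_sq' ?_ (nrm_nonneg y') |>.2
    nlinarith
  have hq : nrm y ≤ 3 / 2 * M := by
    refine abs_le_of_sq_le_sq' ?_ (by positivity) |>.2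
    nlinarith
  have hq' : nrm y' ≤ 3 / 2 * M := by
    refine abs_le_of_sq_le_sq' ?_ (by positivity) |>.2
    nlinarith
  have hY : |y n| ≤ M / 4 := abs_le_of_sq_le_sq (by linarith) (by positivity)
  have hY' : |y' n| ≤ M / 4 := abs_le_of_sq_le_sq (by linarith) (by positivity)
  -- the residual of `z` moves in the direction of the residual `r` of the basis vector, and its
  -- inner product with `r` is its entry at the position `n`
  have hYY : y n - y' n = (ζ - ζ') * π := by
    rw [hy, Pi.add_apply, Pi.smul_apply, smul_eq_mul, hrn]; ring
  have hpp : π * (nrm y ^ 2 - nrm y' ^ 2) = (y n - y' n) * (y n + y' n) := by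
    rw [nrm_sq, nrm_sq, hYY]
    have e1 : r ⬝ᵥ y = y n := hry _
    have e2 : r ⬝ᵥ y' = y' n := hry _
    have e3 : y ⬝ᵥ y = y' ⬝ᵥ y + (ζ - ζ') * (r ⬝ᵥ y) := by
      conv_lhs => rw [show y ⬝ᵥ y = (y' + (ζ - ζ') • r) ⬝ᵥ y by rw [← hy]]
      rw [add_dotProduct, smul_dotProduct, smul_eq_mul]
    have e4 : y' ⬝ᵥ y = y' ⬝ᵥ y' + (ζ - ζ') * (r ⬝ᵥ y') := by
      conv_lhs => rw [hy]
      rw [dotProduct_add, dotProduct_smul, smul_eq_mul, dotProduct_comm y' r]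
    rw [e3, e4, e1, e2]
    ring
  have key := abs_sub_mul_le_of_normalized hM hp hp' hY hY' hπ hpp
  have hpos : 0 < nrm y := by nlinarith
  have hpos' : 0 < nrm y' := by nlinarith
  have hdiff : (κ + α • unitVec y) n - (κ + α • unitVec y') n =
      α * ((y n * nrm y' - y' n * nrm y) / (nrm y * nrm y')) := by
    simp only [unitVec, Pi.add_apply, Pi.smul_apply, smul_eq_mul]
    field_simp
    ring
  have hαpos : 0 < α := lt_of_lt_of_le (by positivity) hα
  rw [hdiff, abs_mul, abs_div, abs_of_pos hαpos, abs_of_pos (by positivity : 0 < nrm y * nrm y')]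
  have h1 : |ζ - ζ'| * (1 / 2) ≤ |y n - y' n| := by
    rw [hYY, abs_mul, abs_of_pos (by linarith : 0 < π)]
    gcongr
  -- both norms are at most `3 / 2 * M`
  have h2 : |y n - y' n| * M / 2 / (9 / 4 * M ^ 2) ≤
      |y n * nrm y' - y' n * nrm y| / (nrm y * nrm y') := by
    have e1 : nrm y * nrm y' ≤ 9 / 4 * M ^ 2 := by
      calc nrm y * nrm y' ≤ 3 / 2 * M * (3 / 2 * M) := by gcongr
        _ = 9 / 4 * M ^ 2 := by ring
    have e2 : |y n - y' n| * M / 2 ≤ |y n * nrm y' - y' n * nrm y| := by linarith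
    exact div_le_div₀ (abs_nonneg _) e2 (by positivity) e1
  calc |ζ - ζ'| ≤ 2 * |y n - y' n| := by linarith
    _ ≤ 20 / s * (M * s / 2 * (|y n - y' n| * M / 2 / (9 / 4 * M ^ 2))) := by
        have : 20 / s * (M * s / 2 * (|y n - y' n| * M / 2 / (9 / 4 * M ^ 2))) =
          20 / 9 * |y n - y' n| := by field_simp; ring
        rw [this]
        nlinarith [abs_nonneg (y n - y' n)]
    _ ≤ 20 / s * (α * (|y n * nrm y' - y' n * nrm y| / (nrm y * nrm y'))) := by gcongr

/-- At good positions the entries of the fresh image have a density bounded by `20 / s`. -/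
lemma stdG_freshImage_le {N : ℕ} {s α : ℝ} (hs : 0 < s) (κ : Fin N → ℝ) {B : ℕ → Fin N → ℝ}
    (m : ℕ) (n : Fin N) {T : Set ℝ} (hT : MeasurableSet T) :
    stdG (Fin N) {z | GoodAt s α B m z n ∧ (κ + α • unitVec (res B m z)) n ∈ T} ≤
      ENNReal.ofReal (20 / s) * volume T := by
  have hres : Measurable fun z : Fin N → ℝ => res B m z :=
    measurable_res measurable_const measurable_id m
  have hb : Measurable fun z : Fin N → ℝ => (κ + α • unitVec (res B m z)) n :=
    (measurable_pi_apply n).comp (measurable_const.add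
      (measurable_smul' measurable_const (measurable_unitVec hres)))
  have hS : MeasurableSet
      {z | GoodAt s α B m z n ∧ (κ + α • unitVec (res B m z)) n ∈ T} :=
    (measurableSet_goodAt s measurable_const measurable_const m measurable_id n).inter (hb hT)
  rw [← lintegral_indicator_one hS]
  refine lintegral_stdG_le_of_slice n (measurable_one.indicator hS) fun z => ?_
  have hup : Measurable fun ζ : ℝ => Function.update z n ζ := measurable_update z
  have hS' := hup hS
  calc ∫⁻ ζ, _ ∂(gaussianReal 0 1)
      = gaussianReal 0 1 ((fun ζ : ℝ => Function.update z n ζ) ⁻¹'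
          {z | GoodAt s α B m z n ∧ (κ + α • unitVec (res B m z)) n ∈ T}) := by
        rw [← lintegral_indicator_one hS']
        rfl
    _ ≤ volume _ := gaussianReal_le_volume _
    _ ≤ (Real.toNNReal (20 / s)) * volume ((fun ζ : ℝ =>
          (κ + α • unitVec (res B m (Function.update z n ζ))) n) '' _) := by
        refine volume_le_of_antilipschitz fun ζ hζ ζ' hζ' => ?_
        rw [Real.coe_toNNReal _ (by positivity)]
        exact antilipschitz_freshImage hs κ B m z n ζ ζ' hζ.1 hζ'.1
    _ ≤ ENNReal.ofReal (20 / s) * volume T := by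
        gcongr
        · exact le_rfl
        · rintro _ ⟨ζ, hζ, rfl⟩
          exact hζ.2

/-! ### Empirical laws of rows with a new entry of bounded density -/

section BoundedDensity

lemma frac_union_of_disjoint {R : Type*} {N : ℕ} {O O' : Set R} (h : Disjoint O O')
    (r : Fin N → R) : frac (O ∪ O') r = frac O r + frac O' r := by
  rw [frac, frac, frac, ← avg_add]
  congr 1
  funext n
  rw [Set.indicator_union_of_disjoint h]

lemma frac_univ {R : Type*} {N : ℕ} (hN : N ≠ 0) (r : Fin N → R) : frac Set.univ r = 1 := by
  have : (N : ℝ) ≠ 0 := by exact_mod_cast hN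
  simp [frac, avg, this]

lemma ofReal_avg {N : ℕ} {v : Fin N → ℝ} (h : ∀ n, 0 ≤ v n) :
    ENNReal.ofReal (avg v) = ENNReal.ofReal ((N : ℝ)⁻¹) * ∑ n, ENNReal.ofReal (v n) := by
  rw [avg, ENNReal.ofReal_mul (by positivity), ENNReal.ofReal_sum_of_nonneg fun n _ => h n]

variable {Ω : ℕ → Type*} [∀ N, MeasurableSpace (Ω N)] {P : ∀ N, Measure (Ω N)}

lemma eventually_whp_of_ae {p : (Σ N, Ω N) → Prop} (h : ∀ N, ∀ᵐ ω ∂(P N), p ⟨N, ω⟩) :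
    ∀ᶠ q in whp P, p q := by
  rw [eventually_whp]
  refine tendsto_const_nhds.congr fun N => ?_
  exact (ae_iff.1 (h N)).symm

variable [∀ N, IsProbabilityMeasure (P N)] {R : Type*} [MeasurableSpace R]

/-- Rows `x` extended by a new entry `b`, which is a function of independent Gaussian variables and
has a density bounded by `L`, position by position, on the likely event `Good`. -/
structure DensityBound (P : ∀ N, Measure (Ω N)) (b : ∀ q : Σ N, Ω N × (Fin N → ℝ), Fin q.1 → ℝ)
    (Good : ∀ q : Σ N, Ω N × (Fin N → ℝ), Fin q.1 → Prop) (L : ℝ) : Prop where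
  meas : RowMeas b
  good : ∀ᶠ q in whp (withGauss P), ∀ n, Good q n
  good_meas : ∀ N (n : Fin N), MeasurableSet {w | Good ⟨N, w⟩ n}
  density : ∀ N (ω : Ω N) (n : Fin N) (T : Set ℝ), MeasurableSet T →
    stdG (Fin N) {z | Good ⟨N, (ω, z)⟩ n ∧ b ⟨N, (ω, z)⟩ n ∈ T} ≤ ENNReal.ofReal L * volume T

/-- The conditional bound, given a row `x`, on the probability that the extended row lies in `O`. -/
noncomputable def sliceBound (L : ℝ) (O : Set (R × ℝ)) (x : R) : ℝ :=
  (min 1 (ENNReal.ofReal L * volume (Prod.mk x ⁻¹' O))).toReal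

lemma sliceBound_nonneg (L : ℝ) (O : Set (R × ℝ)) (x : R) : 0 ≤ sliceBound L O x :=
  ENNReal.toReal_nonneg

lemma sliceBound_le_one (L : ℝ) (O : Set (R × ℝ)) (x : R) : sliceBound L O x ≤ 1 := by
  refine (ENNReal.toReal_mono ENNReal.one_ne_top (min_le_left _ _)).trans (by simp)

lemma measurable_sliceBound (L : ℝ) {O : Set (R × ℝ)} (hO : MeasurableSet O) :
    Measurable (sliceBound L O) :=
  (measurable_const.min (measurable_const.mul (measurable_measure_prodMk_left hO))).ennreal_toReal

lemma ofReal_sliceBound (L : ℝ) (O : Set (R × ℝ)) (x : R) :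
    ENNReal.ofReal (sliceBound L O x) =
      min 1 (ENNReal.ofReal L * volume (Prod.mk x ⁻¹' O)) :=
  ENNReal.ofReal_toReal (ne_top_of_le_ne_top ENNReal.one_ne_top (min_le_left _ _))

variable {x : ∀ q : Σ N, Ω N, Fin q.1 → R} {b : ∀ q : Σ N, Ω N × (Fin N → ℝ), Fin q.1 → ℝ}
  {Good : ∀ q : Σ N, Ω N × (Fin N → ℝ), Fin q.1 → Prop} {L : ℝ} {μ : Measure R}

lemma RowMeas.apply (hx : RowMeas x) (N : ℕ) (n : Fin N) : Measurable fun ω => x ⟨N, ω⟩ n :=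
  (measurable_pi_apply n).comp (hx N)

lemma DensityBound.measurableSet (h : DensityBound P b Good L) (hx : RowMeas x)
    {O : Set (R × ℝ)} (hO : MeasurableSet O) (N : ℕ) (n : Fin N) :
    MeasurableSet {w : Ω N × (Fin N → ℝ) | Good ⟨N, w⟩ n ∧ (x ⟨N, w.1⟩ n, b ⟨N, w⟩ n) ∈ O} :=
  (h.good_meas N n).inter ((((hx.apply N n).comp measurable_fst).prodMk (h.meas.apply N n)) hO)

/-- The fraction of good positions at which the extended row lies in `O`. -/
noncomputable def goodFrac (x : ∀ q : Σ N, Ω N, Fin q.1 → R)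
    (b : ∀ q : Σ N, Ω N × (Fin N → ℝ), Fin q.1 → ℝ)
    (Good : ∀ q : Σ N, Ω N × (Fin N → ℝ), Fin q.1 → Prop) (O : Set (R × ℝ)) (N : ℕ)
    (w : Ω N × (Fin N → ℝ)) : ℝ :=
  avg fun n : Fin N => {w : Ω N × (Fin N → ℝ) |
    Good ⟨N, w⟩ n ∧ (x ⟨N, w.1⟩ n, b ⟨N, w⟩ n) ∈ O}.indicator (fun _ => (1 : ℝ)) w

lemma DensityBound.measurable_goodFrac (h : DensityBound P b Good L) (hx : RowMeas x)
    {O : Set (R × ℝ)} (hO : MeasurableSet O) (N : ℕ) : Measurable (goodFrac x b Good O N) :=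
  measurable_avg' fun n => measurable_const.indicator (h.measurableSet hx hO N n)

/-- Given the rows `x`, the fraction of good positions with extended row in `O` is bounded in mean
by the average of the slice bounds. -/
lemma DensityBound.lintegral_goodFrac_le (h : DensityBound P b Good L) (hx : RowMeas x)
    {O : Set (R × ℝ)} (hO : MeasurableSet O) (N : ℕ) :
    ∫⁻ w, ENNReal.ofReal (goodFrac x b Good O N w) ∂(withGauss P N) ≤
      ∫⁻ ω, ENNReal.ofReal (avg fun n : Fin N => sliceBound L O (x ⟨N, ω⟩ n)) ∂(P N) := by
  have hm := (h.measurable_goodFrac hx hO N).ennreal_ofReal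
  refine (lintegral_prod _ hm.aemeasurable).le.trans (lintegral_mono fun ω => ?_)
  have hS : ∀ n : Fin N, MeasurableSet {z : Fin N → ℝ |
      Good ⟨N, (ω, z)⟩ n ∧ (x ⟨N, ω⟩ n, b ⟨N, (ω, z)⟩ n) ∈ O} := fun n =>
    (measurable_prodMk_left (x := ω)) (h.measurableSet hx hO N n)
  rw [ofReal_avg fun n => sliceBound_nonneg _ _ _]
  calc ∫⁻ z, ENNReal.ofReal (goodFrac x b Good O N (ω, z)) ∂(stdG (Fin N))
      = ∫⁻ z, ENNReal.ofReal ((N : ℝ)⁻¹) * ∑ n : Fin N, ({z : Fin N → ℝ |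
          Good ⟨N, (ω, z)⟩ n ∧ (x ⟨N, ω⟩ n, b ⟨N, (ω, z)⟩ n) ∈ O}.indicator 1 z : ℝ≥0∞)
          ∂(stdG (Fin N)) := by
        refine lintegral_congr fun z => ?_
        rw [goodFrac, ofReal_avg fun n => Set.indicator_nonneg (fun _ _ => zero_le_one) _]
        congr 1
        refine Finset.sum_congr rfl fun n _ => ?_
        by_cases hz : Good ⟨N, (ω, z)⟩ n ∧ (x ⟨N, ω⟩ n, b ⟨N, (ω, z)⟩ n) ∈ O
        · rw [Set.indicator_of_mem (by exact hz), Set.indicator_of_mem (by exact hz)]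
          simp
        · rw [Set.indicator_of_notMem (by exact hz), Set.indicator_of_notMem (by exact hz)]
          simp
    _ = ENNReal.ofReal ((N : ℝ)⁻¹) * ∑ n : Fin N, stdG (Fin N) {z : Fin N → ℝ |
          Good ⟨N, (ω, z)⟩ n ∧ (x ⟨N, ω⟩ n, b ⟨N, (ω, z)⟩ n) ∈ O} := by
        rw [lintegral_const_mul _ (Finset.measurable_sum _ fun n _ =>
          measurable_one.indicator (hS n)), lintegral_finsetSum _ fun n _ =>
          measurable_one.indicator (hS n)]
        simp only [lintegral_indicator_one (hS _)]
    _ ≤ _ := by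
        gcongr with n
        rw [ofReal_sliceBound]
        refine le_min prob_le_one ?_
        exact h.density N ω n (Prod.mk (x ⟨N, ω⟩ n) ⁻¹' O) (measurable_prodMk_left hO)

/-- Sets whose slices are Lebesgue null are avoided by all extended rows. -/
lemma DensityBound.eventually_notMem (h : DensityBound P b Good L) (hx : RowMeas x)
    (hnull : ∀ E, MeasurableSet E → μ E = 0 → ∀ᶠ q in whp P, ∀ n, x q n ∉ E)
    {O : Set (R × ℝ)} (hO : MeasurableSet O)
    (hO0 : ∀ᵐ y ∂μ, volume (Prod.mk y ⁻¹' O) = 0) :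
    ∀ᶠ q in whp (withGauss P), ∀ n, (x (base q) n, b q n) ∉ O := by
  -- the rows over which the slice of `O` is not null form a null set
  let E : Set R := {y | volume (Prod.mk y ⁻¹' O) ≠ 0}
  have hE : MeasurableSet E :=
    (measurable_measure_prodMk_left hO) (measurableSet_singleton 0).compl
  have h1 := (tendsto_base (P := P)).eventually (hnull E hE (ae_iff.1 hO0))
  have h2 : ∀ᶠ q in whp (withGauss P), ∀ n : Fin q.1,
      ¬ (x (base q) n ∉ E ∧ Good q n ∧ (x (base q) n, b q n) ∈ O) := by
    refine eventually_whp_of_ae fun N => ?_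
    refine ae_all_iff.2 fun n : Fin N => ?_
    have hW : MeasurableSet {w : Ω N × (Fin N → ℝ) | x ⟨N, w.1⟩ n ∉ E ∧ Good ⟨N, w⟩ n ∧
        (x ⟨N, w.1⟩ n, b ⟨N, w⟩ n) ∈ O} :=
      (((hx.apply N n).comp measurable_fst) hE.compl).inter (h.measurableSet hx hO N n)
    rw [ae_iff]
    simp only [not_not]
    refine (Measure.measure_prod_null (μ := P N) (ν := stdG (Fin N)) hW).2 (Eventually.of_forall fun ω => ?_)
    by_cases hω : x ⟨N, ω⟩ n ∈ E
    · have : Prod.mk ω ⁻¹' {w : Ω N × (Fin N → ℝ) | x ⟨N, w.1⟩ n ∉ E ∧ Good ⟨N, w⟩ n ∧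
        (x ⟨N, w.1⟩ n, b ⟨N, w⟩ n) ∈ O} = ∅ := by
        ext z
        simp [hω]
      beta_reduce
      rw [this, measure_empty, Pi.zero_apply]
    · have hv : volume (Prod.mk (x ⟨N, ω⟩ n) ⁻¹' O) = 0 := by
        by_contra hv
        exact hω hv
      have hd := h.density N ω n (Prod.mk (x ⟨N, ω⟩ n) ⁻¹' O) (measurable_prodMk_left hO)
      rw [hv, mul_zero] at hd
      exact measure_mono_null (fun z hz => hz.2) (le_antisymm hd zero_le)
  filter_upwards [h1, h2, h.good] with q q1 q2 q3 n hn
  exact q2 n ⟨q1 n, q3 n, hn⟩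

variable [IsProbabilityMeasure μ]

/-- Decreasing sets of extended rows with empty intersection eventually contain few rows, if the
last entries are bounded. -/
lemma DensityBound.goodFrac_small (h : DensityBound P b Good L) (hx : RowMeas x)
    (hlln : RowLLN P x μ) {O : ℕ → Set (R × ℝ)} (hO : ∀ k, MeasurableSet (O k))
    (hanti : Antitone O) (hempty : ⋂ k, O k = ∅) {K : ℝ} (hK : ∀ k, ∀ p ∈ O k, |p.2| ≤ K)
    {ε δ : ℝ} (hε : 0 < ε) (hδ : 0 < δ) :
    ∀ᶠ k in atTop, ∀ᶠ N in atTop,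
      withGauss P N {w | ε ≤ goodFrac x b Good (O k) N w} ≤ ENNReal.ofReal δ := by
  -- dominated convergence: the slices decrease to the empty set and have finite volume
  have hlim : Tendsto (fun k => ∫ y, sliceBound L (O k) y ∂μ) atTop (𝓝 0) := by
    have := tendsto_integral_of_dominated_convergence (μ := μ)
      (F := fun k y => sliceBound L (O k) y) (f := fun _ => 0) (fun _ => 1)
      (fun k => (measurable_sliceBound L (hO k)).aestronglyMeasurable) (integrable_const 1)
      (fun k => Eventually.of_forall fun y => by
        rw [Real.norm_eq_abs, abs_of_nonneg (sliceBound_nonneg _ _ _)]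
        exact sliceBound_le_one _ _ _)
      (Eventually.of_forall fun y => by
        have hv : Tendsto (fun k => volume (Prod.mk y ⁻¹' O k)) atTop (𝓝 0) := by
          have := tendsto_measure_iInter_atTop (μ := (volume : Measure ℝ))
            (s := fun k => Prod.mk y ⁻¹' O k)
            (fun k => (measurable_prodMk_left (hO k)).nullMeasurableSet)
            (fun i j hij => Set.preimage_mono (hanti hij))
            ⟨0, ne_top_of_le_ne_top (b := volume (Set.Icc (-K) K)) (by simp)
              (measure_mono fun t ht => abs_le.1 (hK 0 _ ht))⟩
          rwa [← Set.preimage_iInter, hempty, Set.preimage_empty, measure_empty] at this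
        have h2 := ENNReal.Tendsto.const_mul (a := ENNReal.ofReal L) hv
          (Or.inr ENNReal.ofReal_ne_top)
        rw [mul_zero] at h2
        have h3 := (tendsto_const_nhds (x := (1 : ℝ≥0∞)) (f := atTop)).min h2
        rw [min_eq_right zero_le_one] at h3
        have h4 := (ENNReal.tendsto_toReal ENNReal.zero_ne_top).comp h3
        rw [ENNReal.toReal_zero] at h4
        exact h4)
    simpa using this
  have hη : 0 < ε * δ / 2 := by positivity
  filter_upwards [hlim.eventually (gt_mem_nhds hη)] with k hk
  have h1 := hlln.tendsto_avg_of_bounded (measurable_sliceBound L (hO k)) (C := 1) fun y => by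
    rw [abs_of_nonneg (sliceBound_nonneg _ _ _)]
    exact sliceBound_le_one _ _ _
  have h2 := eventually_whp_iff.1 (h1.eventually (gt_mem_nhds hk)) _ hη
  filter_upwards [h2] with N hN
  -- Markov inequality; the average of the slice bounds is at most one, and small except on `A`
  refine (measure_le_of_lintegral _ (h.measurable_goodFrac hx (hO k) N) hε).trans ?_
  have hmA : Measurable fun ω => avg fun n : Fin N => sliceBound L (O k) (x ⟨N, ω⟩ n) :=
    measurable_avg' fun n => (measurable_sliceBound L (hO k)).comp (hx.apply N n)
  set A : Set (Ω N) := {ω | ¬ (avg fun n : Fin N => sliceBound L (O k) (x ⟨N, ω⟩ n)) < ε * δ / 2}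
    with hA
  have hAm : MeasurableSet A := (measurableSet_lt hmA measurable_const).compl
  have h3 : ∫⁻ ω, ENNReal.ofReal (avg fun n : Fin N => sliceBound L (O k) (x ⟨N, ω⟩ n)) ∂(P N) ≤
      ENNReal.ofReal (ε * δ) := by
    calc _ ≤ ∫⁻ ω, (ENNReal.ofReal (ε * δ / 2) + A.indicator 1 ω) ∂(P N) := by
          refine lintegral_mono fun ω => ?_
          by_cases hω : ω ∈ A
          · rw [Set.indicator_of_mem hω]
            refine le_add_left ?_
            rw [Pi.one_apply, ENNReal.ofReal_le_one]
            exact avg_le_of_le zero_le_one fun n => sliceBound_le_one _ _ _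
          · refine le_add_right (ENNReal.ofReal_le_ofReal (not_not.1 hω).le)
      _ = ENNReal.ofReal (ε * δ / 2) + P N A := by
          rw [lintegral_add_left measurable_const, lintegral_indicator_one hAm]
          simp
      _ ≤ ENNReal.ofReal (ε * δ / 2) + ENNReal.ofReal (ε * δ / 2) := by gcongr
      _ = _ := by rw [← ENNReal.ofReal_add hη.le hη.le, add_halves]
  calc _ ≤ ENNReal.ofReal (ε * δ) / ENNReal.ofReal ε :=
        ENNReal.div_le_div_right ((h.lintegral_goodFrac_le hx (hO k) N).trans h3) _
    _ = ENNReal.ofReal δ := by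
        rw [← ENNReal.ofReal_div_of_pos hε, mul_div_cancel_left₀ _ hε.ne']

/-- Extended rows have the same limit law as nearby ones on rectangles `E × (-∞, t]`.  The limit law
has no atom at `t`, so that few rows cross the boundary of the half-line. -/
lemma tendsto_frac_rectangle {lam : Measure (R × ℝ)} [IsProbabilityMeasure lam]
    {b₀ : ∀ q : Σ N, Ω N × (Fin N → ℝ), Fin q.1 → ℝ}
    (hb₀ : RowLLN (withGauss P) (fun q n => (x (base q) n, b₀ q n)) lam)
    (hatom : ∀ t : ℝ, lam (Prod.snd ⁻¹' {t}) = 0)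
    (hclose : Tendsto (fun q => avg fun n => (b q n - b₀ q n) ^ 2) (whp (withGauss P)) (𝓝 0))
    {E : Set R} (hE : MeasurableSet E) (t : ℝ) :
    Tendsto (fun q => frac (E ×ˢ Set.Iic t) fun n => (x (base q) n, b q n)) (whp (withGauss P))
      (𝓝 (lam.real (E ×ˢ Set.Iic t))) := by
  have hS : ∀ u : ℝ, MeasurableSet (E ×ˢ Set.Iic u : Set (R × ℝ)) := fun u =>
    hE.prod measurableSet_Iic
  -- continuity of the limit law in `t`, from both sides
  have hup : Tendsto (fun k : ℕ => lam.real (E ×ˢ Set.Iic (t + 1 / ((k : ℝ) + 1)))) atTop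
      (𝓝 (lam.real (E ×ˢ Set.Iic t))) := by
    have hinter : ⋂ k : ℕ, (E ×ˢ Set.Iic (t + 1 / ((k : ℝ) + 1)) : Set (R × ℝ)) =
        E ×ˢ Set.Iic t := by
      ext p
      simp only [Set.mem_iInter, Set.mem_prod, Set.mem_Iic]
      constructor
      · intro hp
        refine ⟨(hp 0).1, le_of_forall_pos_lt_add fun ε hε => ?_⟩
        obtain ⟨k, hk⟩ := exists_nat_one_div_lt hε
        linarith [(hp k).2]
      · intro hp k
        have : (0 : ℝ) < 1 / ((k : ℝ) + 1) := by positivity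
        exact ⟨hp.1, by linarith [hp.2]⟩
    have := tendsto_measure_iInter_atTop (μ := lam)
      (s := fun k : ℕ => (E ×ˢ Set.Iic (t + 1 / ((k : ℝ) + 1)) : Set (R × ℝ)))
      (fun k => (hS _).nullMeasurableSet)
      (fun i j hij => Set.prod_mono le_rfl (Set.Iic_subset_Iic.2 (by gcongr)))
      ⟨0, measure_ne_top _ _⟩
    rw [hinter] at this
    exact (ENNReal.tendsto_toReal (measure_ne_top _ _)).comp this
  have hdown : Tendsto (fun k : ℕ => lam.real (E ×ˢ Set.Iic (t - 1 / ((k : ℝ) + 1)))) atTop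
      (𝓝 (lam.real (E ×ˢ Set.Iic t))) := by
    have hunion : ⋃ k : ℕ, (E ×ˢ Set.Iic (t - 1 / ((k : ℝ) + 1)) : Set (R × ℝ)) =
        E ×ˢ Set.Iio t := by
      ext p
      simp only [Set.mem_iUnion, Set.mem_prod, Set.mem_Iic, Set.mem_Iio]
      constructor
      · rintro ⟨k, hp1, hp2⟩
        have : (0 : ℝ) < 1 / ((k : ℝ) + 1) := by positivity
        exact ⟨hp1, by linarith⟩
      · rintro ⟨hp1, hp2⟩
        obtain ⟨k, hk⟩ := exists_nat_one_div_lt (sub_pos.2 hp2)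
        exact ⟨k, hp1, by linarith⟩
    have := tendsto_measure_iUnion_atTop (μ := lam)
      (s := fun k : ℕ => (E ×ˢ Set.Iic (t - 1 / ((k : ℝ) + 1)) : Set (R × ℝ)))
      (fun i j hij => Set.prod_mono le_rfl (Set.Iic_subset_Iic.2 (by gcongr)))
    rw [hunion] at this
    have he : lam (E ×ˢ Set.Iio t) = lam (E ×ˢ Set.Iic t) := by
      refine le_antisymm (measure_mono (Set.prod_mono le_rfl Set.Iio_subset_Iic_self)) ?_
      calc lam (E ×ˢ Set.Iic t) ≤ lam (E ×ˢ Set.Iio t ∪ Prod.snd ⁻¹' {t}) := by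
            refine measure_mono ?_
            rintro p ⟨hp1, hp2⟩
            rcases lt_or_eq_of_le (Set.mem_Iic.1 hp2) with h | h
            · exact Or.inl ⟨hp1, h⟩
            · exact Or.inr h
        _ ≤ lam (E ×ˢ Set.Iio t) + 0 := (measure_union_le _ _).trans (by rw [hatom])
        _ = _ := add_zero _
    rw [he] at this
    exact (ENNReal.tendsto_toReal (measure_ne_top _ _)).comp this
  -- comparison of the two fractions
  have hcmp : ∀ (q : Σ N, Ω N × (Fin N → ℝ)) (b b' : Fin q.1 → ℝ) (u η : ℝ), 0 < η →
      frac (E ×ˢ Set.Iic u) (fun n => (x (base q) n, b n)) ≤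
        frac (E ×ˢ Set.Iic (u + η)) (fun n => (x (base q) n, b' n)) +
          (η ^ 2)⁻¹ * avg fun n => (b n - b' n) ^ 2 := by
    intro q b b' u η hη
    rw [← avg_const_mul, frac, frac, ← avg_add]
    refine avg_mono fun n => ?_
    have hpos : 0 ≤ (η ^ 2)⁻¹ * (b n - b' n) ^ 2 := by positivity
    by_cases h1 : (x (base q) n, b n) ∈ (E ×ˢ Set.Iic u : Set (R × ℝ))
    · by_cases h2 : (x (base q) n, b' n) ∈ (E ×ˢ Set.Iic (u + η) : Set (R × ℝ))
      · rw [Set.indicator_of_mem h1, Set.indicator_of_mem h2]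
        linarith
      · rw [Set.indicator_of_mem h1, Set.indicator_of_notMem h2, zero_add,
          ← div_eq_inv_mul, le_div_iff₀ (by positivity), one_mul]
        have h3 : b n ≤ u := h1.2
        have h4 : u + η < b' n := not_le.1 fun h => h2 ⟨h1.1, h⟩
        nlinarith
    · rw [Set.indicator_of_notMem h1]
      have := Set.indicator_nonneg (s := (E ×ˢ Set.Iic (u + η) : Set (R × ℝ)))
        (f := fun _ => (1 : ℝ)) (fun _ _ => zero_le_one) (x (base q) n, b' n)
      linarith
  rw [tendsto_whp_iff]
  intro ε hε
  obtain ⟨k, hk1, hk2⟩ := ((tendsto_order.1 hup).2 (lam.real (E ×ˢ Set.Iic t) + ε / 3)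
    (by linarith)).and ((tendsto_order.1 hdown).1 (lam.real (E ×ˢ Set.Iic t) - ε / 3)
    (by linarith)) |>.exists
  set η : ℝ := 1 / ((k : ℝ) + 1) with hη
  have hη0 : 0 < η := by positivity
  have hc := hclose.const_mul ((η ^ 2)⁻¹)
  rw [mul_zero] at hc
  have h1 := hb₀ _ (hS (t + η))
  have h2 := hb₀ _ (hS (t - η))
  filter_upwards [(tendsto_order.1 hc).2 (ε / 3) (by positivity),
    (tendsto_order.1 h1).2 (lam.real (E ×ˢ Set.Iic (t + η)) + ε / 3) (by linarith),
    (tendsto_order.1 h2).1 (lam.real (E ×ˢ Set.Iic (t - η)) - ε / 3) (by linarith)]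
    with q q1 q2 q3
  have c1 := hcmp q (b q) (b₀ q) t η hη0
  have c2 := hcmp q (b₀ q) (b q) (t - η) η hη0
  rw [sub_add_cancel] at c2
  have c3 : (fun n => (b₀ q n - b q n) ^ 2) = fun n => (b q n - b₀ q n) ^ 2 := by
    funext n; ring
  rw [c3] at c2
  rw [abs_lt]
  constructor <;> linarith

/-- Extended rows have the same limit law as nearby ones, if the new entries have a bounded
density.  Convergence on rectangles is extended to all measurable sets; for a countable disjoint
union, the density bound provides the uniform smallness of the tails. -/
theorem DensityBound.rowLLN (h : DensityBound P b Good L) (hx : RowMeas x) (hlln : RowLLN P x μ)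
    {lam : Measure (R × ℝ)} [IsProbabilityMeasure lam]
    {b₀ : ∀ q : Σ N, Ω N × (Fin N → ℝ), Fin q.1 → ℝ}
    (hb₀ : RowLLN (withGauss P) (fun q n => (x (base q) n, b₀ q n)) lam)
    (hatom : ∀ t : ℝ, lam (Prod.snd ⁻¹' {t}) = 0)
    (hclose : Tendsto (fun q => avg fun n => (b q n - b₀ q n) ^ 2) (whp (withGauss P)) (𝓝 0)) :
    RowLLN (withGauss P) (fun q n => (x (base q) n, b q n)) lam := by
  -- rectangles `E × (-∞, t]` generate the σ-algebra
  have hgen : (Prod.instMeasurableSpace : MeasurableSpace (R × ℝ)) =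
      MeasurableSpace.generateFrom (Set.image2 (· ×ˢ ·) {E : Set R | MeasurableSet E}
        (Set.range (Set.Iic : ℝ → Set ℝ))) := by
    refine (generateFrom_eq_prod MeasurableSpace.generateFrom_measurableSet
      ((borel_eq_generateFrom_Iic ℝ).symm.trans (BorelSpace.measurable_eq (α := ℝ)).symm)
      isCountablySpanning_measurableSet ?_).symm
    refine ⟨fun k : ℕ => Set.Iic (k : ℝ), fun k => ⟨k, rfl⟩, ?_⟩
    refine Set.eq_univ_of_forall fun y => Set.mem_iUnion.2 ?_
    obtain ⟨k, hk⟩ := exists_nat_ge y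
    exact ⟨k, hk⟩
  have hpi : IsPiSystem (Set.image2 (· ×ˢ ·) {E : Set R | MeasurableSet E}
      (Set.range (Set.Iic : ℝ → Set ℝ))) :=
    MeasurableSpace.isPiSystem_measurableSet.prod isPiSystem_Iic
  -- rows with a large new entry are rare
  have hlarge : ∀ ε > 0, ∃ K : ℝ, ∀ᶠ q in whp (withGauss P),
      frac {p : R × ℝ | K < |p.2|} (fun n => (x (base q) n, b q n)) < ε := by
    intro ε hε
    have hanti : Antitone fun k : ℕ => {p : R × ℝ | (k : ℝ) < |p.2|} := fun i j hij p hp =>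
      lt_of_le_of_lt (by exact_mod_cast hij : (i : ℝ) ≤ j) hp
    have hms : ∀ k : ℝ, MeasurableSet {p : R × ℝ | k < |p.2|} := fun k =>
      measurableSet_lt measurable_const (continuous_abs.measurable.comp measurable_snd)
    have hlim := tendsto_measure_iInter_atTop (μ := lam)
      (s := fun k : ℕ => {p : R × ℝ | (k : ℝ) < |p.2|})
      (fun k => (hms _).nullMeasurableSet) hanti ⟨0, measure_ne_top _ _⟩
    have hemp : ⋂ k : ℕ, {p : R × ℝ | (k : ℝ) < |p.2|} = ∅ := by
      refine Set.eq_empty_of_forall_notMem fun p hp => ?_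
      obtain ⟨k, hk⟩ := exists_nat_ge |p.2|
      exact absurd (Set.mem_iInter.1 hp k) (not_lt.2 hk)
    rw [hemp, measure_empty] at hlim
    have hlim' := (ENNReal.tendsto_toReal ENNReal.zero_ne_top).comp hlim
    rw [ENNReal.toReal_zero] at hlim'
    obtain ⟨k, hk⟩ := ((tendsto_order.1 hlim').2 (ε / 2) (by positivity)).exists
    refine ⟨k + 1, ?_⟩
    filter_upwards [(tendsto_order.1 (hb₀ _ (hms k))).2 (ε / 2) hk,
      (tendsto_order.1 hclose).2 (ε / 2) (by positivity)] with q q1 q2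
    refine lt_of_le_of_lt ?_ (by linarith : frac {p : R × ℝ | (k : ℝ) < |p.2|}
      (fun n => (x (base q) n, b₀ q n)) + (avg fun n => (b q n - b₀ q n) ^ 2) < ε)
    rw [frac, frac, ← avg_add]
    refine avg_mono fun n => ?_
    by_cases h1 : (k : ℝ) + 1 < |b q n|
    · by_cases h2 : (k : ℝ) < |b₀ q n|
      · rw [Set.indicator_of_mem (by exact h1), Set.indicator_of_mem (by exact h2)]
        linarith [sq_nonneg (b q n - b₀ q n)]
      · rw [Set.indicator_of_mem (by exact h1), Set.indicator_of_notMem (by exact h2), zero_add]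
        have h3 : 1 ≤ |b q n - b₀ q n| := by
          have := abs_sub_abs_le_abs_sub (b q n) (b₀ q n)
          linarith [not_lt.1 h2]
        nlinarith [sq_abs (b q n - b₀ q n)]
    · rw [Set.indicator_of_notMem (by exact h1)]
      have := Set.indicator_nonneg (s := {p : R × ℝ | (k : ℝ) < |p.2|})
        (f := fun _ => (1 : ℝ)) (fun _ _ => zero_le_one) (x (base q) n, b₀ q n)
      linarith [sq_nonneg (b q n - b₀ q n)]
  -- sets that decrease to the empty set contain few rows
  have hsmall : ∀ O : ℕ → Set (R × ℝ), (∀ k, MeasurableSet (O k)) → Antitone O → ⋂ k, O k = ∅ →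
      ∀ ε > 0, ∀ δ > 0, ∀ᶠ k in atTop, ∀ᶠ N in atTop, withGauss P N
        {w | ε < frac (O k) (fun n : Fin N => (x ⟨N, w.1⟩ n, b ⟨N, w⟩ n))} ≤
          ENNReal.ofReal δ := by
    intro O hO hanti hemp ε hε δ hδ
    obtain ⟨K, hK⟩ := hlarge (ε / 2) (by positivity)
    let O' : ℕ → Set (R × ℝ) := fun k => O k ∩ {p | |p.2| ≤ K}
    have hO' : ∀ k, MeasurableSet (O' k) := fun k => (hO k).inter
      (measurableSet_le (continuous_abs.measurable.comp measurable_snd) measurable_const)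
    have hsm := h.goodFrac_small hx hlln hO' (fun i j hij => Set.inter_subset_inter_left _
      (hanti hij)) (Set.eq_empty_of_subset_empty (hemp ▸ Set.iInter_mono fun k =>
        Set.inter_subset_left)) (fun k p hp => hp.2) (ε := ε / 2) (by positivity)
        (δ := δ / 2) (by positivity)
    filter_upwards [hsm] with k hk
    filter_upwards [hk, eventually_whp_iff.1 (hK.and h.good) (δ / 2) (by positivity)] with N h1 h2
    refine le_trans (measure_mono (t := {w | ε / 2 ≤ goodFrac x b Good (O' k) N w} ∪
      {w | ¬ (frac {p : R × ℝ | K < |p.2|} (fun n : Fin N => (x ⟨N, w.1⟩ n, b ⟨N, w⟩ n)) < ε / 2 ∧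
        ∀ n : Fin N, Good ⟨N, w⟩ n)}) ?_) ((measure_union_le _ _).trans ((add_le_add h1 h2).trans ?_))
    · intro w hw
      by_contra hn
      simp only [Set.mem_union, Set.mem_ofPred_eq, not_or, not_not, not_le] at hn hw
      obtain ⟨hn1, hn2, hn3⟩ := hn
      have hle : frac (O k) (fun n : Fin N => (x ⟨N, w.1⟩ n, b ⟨N, w⟩ n)) ≤
          goodFrac x b Good (O' k) N w +
            frac {p : R × ℝ | K < |p.2|} (fun n : Fin N => (x ⟨N, w.1⟩ n, b ⟨N, w⟩ n)) := by
        rw [goodFrac, frac, frac, ← avg_add]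
        refine avg_mono fun n => ?_
        by_cases h3 : (x ⟨N, w.1⟩ n, b ⟨N, w⟩ n) ∈ O k
        · by_cases h4 : K < |b ⟨N, w⟩ n|
          · rw [Set.indicator_of_mem h3,
              Set.indicator_of_mem (s := {p : R × ℝ | K < |p.2|}) (by exact h4)]
            have := Set.indicator_nonneg (s := {w : Ω N × (Fin N → ℝ) |
              Good ⟨N, w⟩ n ∧ (x ⟨N, w.1⟩ n, b ⟨N, w⟩ n) ∈ O' k})
              (f := fun _ => (1 : ℝ)) (fun _ _ => zero_le_one) w
            linarith
          · rw [Set.indicator_of_mem h3, Set.indicator_of_mem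
              (s := {w : Ω N × (Fin N → ℝ) |
              Good ⟨N, w⟩ n ∧ (x ⟨N, w.1⟩ n, b ⟨N, w⟩ n) ∈ O' k})
              (by exact ⟨hn3 n, h3, not_lt.1 h4⟩)]
            have := Set.indicator_nonneg (s := {p : R × ℝ | K < |p.2|})
              (f := fun _ => (1 : ℝ)) (fun _ _ => zero_le_one) (x ⟨N, w.1⟩ n, b ⟨N, w⟩ n)
            linarith
        · rw [Set.indicator_of_notMem h3]
          exact add_nonneg (Set.indicator_nonneg (fun _ _ => zero_le_one) _)
            (Set.indicator_nonneg (fun _ _ => zero_le_one) _)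
      linarith
    · rw [← ENNReal.ofReal_add (by positivity) (by positivity), add_halves]
  intro O hO
  induction O, hO using MeasurableSpace.induction_on_inter hgen hpi with
  | empty =>
    simp only [measureReal_empty]
    refine tendsto_const_nhds.congr fun q => ?_
    simp [frac, avg]
  | basic O hO =>
    obtain ⟨E, hE, _, ⟨t, rfl⟩, rfl⟩ := hO
    exact tendsto_frac_rectangle hb₀ hatom hclose hE t
  | compl O hO ih =>
    rw [probReal_compl_eq_one_sub hO]
    refine (tendsto_const_nhds.sub ih).congr' ?_
    filter_upwards [eventually_whp_of_atTop (P := withGauss P) (eventually_ne_atTop 0)] with q hq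
    rw [← frac_univ hq (fun n => (x (base q) n, b q n)), ← Set.union_compl_self O,
      frac_union_of_disjoint disjoint_compl_right]
    ring
  | iUnion f hd hf ih =>
    refine tendsto_whp_of_approx fun ε hε δ hδ => ?_
    -- the union is a finite one up to a tail, which contains few rows
    let T : ℕ → Set (R × ℝ) := fun k => ⋃ i ≥ k, f i
    have hTm : ∀ k, MeasurableSet (T k) := fun k =>
      MeasurableSet.iUnion fun i => MeasurableSet.iUnion fun _ => hf i
    have hTa : Antitone T := fun i j hij => Set.iUnion_mono fun l =>
      Set.iUnion_mono' fun hl => ⟨hij.trans hl, le_rfl⟩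
    have hTe : ⋂ k, T k = ∅ := by
      refine Set.eq_empty_of_forall_notMem fun p hp => ?_
      rw [Set.mem_iInter] at hp
      obtain ⟨i, -, hi⟩ := Set.mem_iUnion₂.1 (hp 0)
      obtain ⟨j, hj, hj'⟩ := Set.mem_iUnion₂.1 (hp (i + 1))
      exact Set.disjoint_left.1 (hd (by omega : i ≠ j)) hi hj'
    have hdec : ∀ k, ⋃ i, f i = (⋃ i ∈ Finset.range k, f i) ∪ T k := by
      intro k
      ext p
      simp only [Set.mem_iUnion, Set.mem_union, T, Finset.mem_range, exists_prop]
      constructor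
      · rintro ⟨i, hi⟩
        rcases lt_or_ge i k with h1 | h1
        · exact Or.inl ⟨i, h1, hi⟩
        · exact Or.inr ⟨i, h1, hi⟩
      · rintro (⟨i, -, hi⟩ | ⟨i, -, hi⟩) <;> exact ⟨i, hi⟩
    have hdisj : ∀ k, Disjoint (⋃ i ∈ Finset.range k, f i) (T k) := by
      intro k
      rw [Set.disjoint_left]
      intro p h1 h2
      obtain ⟨i, hi, hi'⟩ := Set.mem_iUnion₂.1 h1
      obtain ⟨j, hj, hj'⟩ := Set.mem_iUnion₂.1 h2
      have := Finset.mem_range.1 hi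
      exact Set.disjoint_left.1 (hd (by omega : i ≠ j)) hi' hj'
    have hfin : ∀ (k : ℕ) (q : Σ N, Ω N × (Fin N → ℝ)),
        frac (⋃ i ∈ Finset.range k, f i) (fun n => (x (base q) n, b q n)) =
          ∑ i ∈ Finset.range k, frac (f i) (fun n => (x (base q) n, b q n)) := by
      intro k q
      induction k with
      | zero => simp [frac, avg]
      | succ k ihk =>
        rw [Finset.sum_range_succ, ← ihk, Finset.range_add_one, Finset.set_biUnion_insert,
          Set.union_comm, frac_union_of_disjoint]
        refine (hdisj k).mono_right fun p hp => Set.mem_iUnion₂.2 ⟨k, le_rfl, hp⟩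
    have hsum : Tendsto (fun k => ∑ i ∈ Finset.range k, lam.real (f i)) atTop
        (𝓝 (lam.real (⋃ i, f i))) := by
      have h1 : HasSum (fun i => lam.real (f i)) (lam.real (⋃ i, f i)) := by
        rw [measureReal_def, measure_iUnion hd hf, ENNReal.tsum_toReal_eq fun i => measure_ne_top _ _]
        exact ENNReal.hasSum_toReal (by rw [← measure_iUnion hd hf]; exact measure_ne_top lam _)
      exact h1.tendsto_sum_nat
    obtain ⟨k, hk1, hk2⟩ := ((Metric.tendsto_nhds.1 hsum ε hε).and
      (hsmall T hTm hTa hTe ε hε δ hδ)).exists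
    refine ⟨fun q => ∑ i ∈ Finset.range k, frac (f i) (fun n => (x (base q) n, b q n)), _,
      tendsto_finsetSum _ fun i _ => ih i, hk1.le, ?_⟩
    refine hk2.mono fun N hN => (measure_mono fun w hw => ?_).trans hN
    refine lt_of_lt_of_eq (b := |(frac (⋃ i, f i) fun n : Fin N => (x ⟨N, w.1⟩ n, b ⟨N, w⟩ n)) -
      ∑ i ∈ Finset.range k, frac (f i) fun n : Fin N => (x ⟨N, w.1⟩ n, b ⟨N, w⟩ n)|) hw ?_
    have e := hfin k ⟨N, w⟩
    simp only at e
    rw [← e, hdec k, frac_union_of_disjoint (hdisj k), add_sub_cancel_left,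
      abs_of_nonneg (frac_nonneg _ _)]

end BoundedDensity

/-! ### Residuals of random vectors -/

section Residual

variable {Ω : ℕ → Type*} [∀ N, MeasurableSpace (Ω N)] {P : ∀ N, Measure (Ω N)}

/-- The norm of a vector, normalized by the square root of its length. -/
noncomputable def nn {N : ℕ} (v : Fin N → ℝ) : ℝ := nrm v / √N

lemma nn_nonneg {N : ℕ} (v : Fin N → ℝ) : 0 ≤ nn v := div_nonneg (nrm_nonneg _) (Real.sqrt_nonneg _)

lemma nn_sq {N : ℕ} (v : Fin N → ℝ) : nn v ^ 2 = (N : ℝ)⁻¹ * (v ⬝ᵥ v) := by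
  rw [nn, div_pow, nrm_sq, Real.sq_sqrt (Nat.cast_nonneg N), div_eq_inv_mul]

lemma nn_add_le {N : ℕ} (v w : Fin N → ℝ) : nn (v + w) ≤ nn v + nn w := by
  rw [nn, nn, nn, ← add_div]
  exact div_le_div_of_nonneg_right (nrm_add_le v w) (Real.sqrt_nonneg _)

lemma nn_smul {N : ℕ} (t : ℝ) (v : Fin N → ℝ) : nn (t • v) = |t| * nn v := by
  rw [nn, nn, nrm_smul, mul_div_assoc]

/-- With high probability the first `j` columns are uniformly linearly independent, modulo columns
that are redundant: the projection of a vector onto their span is controlled by its inner products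
with the columns, which have norms of order `√N`. -/
def GramBound (P : ∀ N, Measure (Ω N)) (A : ∀ q : Σ N, Ω N, ℕ → Fin q.1 → ℝ) (j : ℕ) : Prop :=
  ∃ M : ℝ, 0 ≤ M ∧ ∀ᶠ q in whp P, ∀ v : Fin q.1 → ℝ,
    nrm (v - res (A q) j v) ≤ M / √q.1 * ∑ l ∈ Finset.range j, |A q l ⬝ᵥ v|

variable {A B : ∀ q : Σ N, Ω N, ℕ → Fin q.1 → ℝ} {j : ℕ} {ρ : ∀ q : Σ N, Ω N, Fin q.1 → ℝ}

lemma GramBound.zero : GramBound P A 0 :=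
  ⟨0, le_rfl, Eventually.of_forall fun q v => by simp [res, nrm_zero]⟩

/-- A vector that is asymptotically orthogonal to the columns is close to its residual. -/
lemma GramBound.tendsto (h : GramBound P A j) {s : ℝ} (hs : 0 ≤ s)
    (h1 : ∀ l < j, Tendsto (fun q => (q.1 : ℝ)⁻¹ * (A q l ⬝ᵥ ρ q)) (whp P) (𝓝 0))
    (h2 : Tendsto (fun q => (q.1 : ℝ)⁻¹ * (ρ q ⬝ᵥ ρ q)) (whp P) (𝓝 (s ^ 2))) :
    Tendsto (fun q => nn (ρ q - res (A q) j (ρ q))) (whp P) (𝓝 0) ∧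
      Tendsto (fun q => nn (res (A q) j (ρ q))) (whp P) (𝓝 s) := by
  obtain ⟨M, hM, h⟩ := h
  have hlim : Tendsto (fun q : Σ N, Ω N => M * ∑ l ∈ Finset.range j,
      |(q.1 : ℝ)⁻¹ * (A q l ⬝ᵥ ρ q)|) (whp P) (𝓝 0) := by
    have : Tendsto (fun q : Σ N, Ω N => ∑ l ∈ Finset.range j,
        |(q.1 : ℝ)⁻¹ * (A q l ⬝ᵥ ρ q)|) (whp P) (𝓝 (∑ _l ∈ Finset.range j, |(0 : ℝ)|)) :=
      tendsto_finsetSum _ fun l hl => (h1 l (Finset.mem_range.1 hl)).abs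
    simpa using this.const_mul M
  have hA : Tendsto (fun q => nn (ρ q - res (A q) j (ρ q))) (whp P) (𝓝 0) := by
    refine squeeze_zero' (Eventually.of_forall fun q => nn_nonneg _) ?_ hlim
    filter_upwards [h] with q hq
    rw [nn]
    calc nrm (ρ q - res (A q) j (ρ q)) / √q.1
        ≤ M / √q.1 * (∑ l ∈ Finset.range j, |A q l ⬝ᵥ ρ q|) / √q.1 := by gcongr; exact hq _
      _ = M * ((∑ l ∈ Finset.range j, |A q l ⬝ᵥ ρ q|) / (√q.1 * √q.1)) := by ring
      _ = _ := by
        rw [Real.mul_self_sqrt (Nat.cast_nonneg _), Finset.sum_div]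
        congr 1
        refine Finset.sum_congr rfl fun l _ => ?_
        rw [abs_mul, abs_of_nonneg (by positivity : (0 : ℝ) ≤ (q.1 : ℝ)⁻¹), div_eq_inv_mul]
  refine ⟨hA, ?_⟩
  have hsq : Tendsto (fun q => nn (res (A q) j (ρ q)) ^ 2) (whp P) (𝓝 (s ^ 2)) := by
    have := h2.sub (hA.pow 2)
    rw [zero_pow two_ne_zero, sub_zero] at this
    refine this.congr fun q => ?_
    rw [nn_sq, nn_sq, dot_self_eq_res_add (A q) j (ρ q)]
    ring
  have := hsq.sqrt
  simpa only [Real.sqrt_sq (nn_nonneg _), Real.sqrt_sq hs] using this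

lemma res_succ_eq {ι : Type*} [Fintype ι] (c : ℕ → ι → ℝ) (m : ℕ) (v : ι → ℝ) :
    res c (m + 1) v = res c m v -
      ((res c m (c m) ⬝ᵥ v) / (res c m (c m) ⬝ᵥ res c m (c m))) • res c m (c m) := rfl

/-- Adding a redundant column. -/
lemma GramBound.succ_of_eq_zero (h : GramBound P A j)
    (h0 : ∀ᶠ q in whp P, res (A q) j (A q j) = 0) : GramBound P A (j + 1) := by
  obtain ⟨M, hM, h⟩ := h
  refine ⟨M, hM, ?_⟩
  filter_upwards [h, h0] with q hq hq0 v
  rw [res_succ_eq, hq0, smul_zero, sub_zero]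
  refine (hq v).trans ?_
  rw [Finset.sum_range_succ]
  gcongr
  linarith [abs_nonneg (A q j ⬝ᵥ v)]

/-- Adding a column of bounded normalized norm whose residual is bounded away from zero. -/
lemma GramBound.succ_of_pos (h : GramBound P A j) {s C : ℝ} (hs : 0 < s) (hC : 0 ≤ C)
    (hCA : ∀ᶠ q in whp P, nn (A q j) ≤ C)
    (h0 : ∀ᶠ q in whp P, s ≤ nn (res (A q) j (A q j))) : GramBound P A (j + 1) := by
  obtain ⟨M, hM, h⟩ := h
  refine ⟨M * (1 + C / s) + s⁻¹, by positivity, ?_⟩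
  filter_upwards [h, h0, hCA, eventually_whp_of_atTop (P := P) (eventually_gt_atTop 0)]
    with q hq hq0 hqC hN v
  have hR : 0 < √(q.1 : ℝ) := Real.sqrt_pos.2 (by exact_mod_cast hN)
  rw [nn, le_div_iff₀ hR] at hq0
  rw [nn, div_le_iff₀ hR] at hqC
  set u := res (A q) j (A q j) with hu
  have hun : 0 < nrm u := lt_of_lt_of_le (by positivity) hq0
  set S := ∑ l ∈ Finset.range j, |A q l ⬝ᵥ v| with hS
  have hS0 : 0 ≤ S := Finset.sum_nonneg fun _ _ => abs_nonneg _
  have h1 : |u ⬝ᵥ v| ≤ |A q j ⬝ᵥ v| + M / √q.1 * S * (C * √q.1) := by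
    have e : u ⬝ᵥ v = A q j ⬝ᵥ v - A q j ⬝ᵥ (v - res (A q) j v) := by
      rw [hu, dot_res_comm, dotProduct_sub]; ring
    rw [e]
    refine (abs_sub _ _).trans ?_
    gcongr
    calc |A q j ⬝ᵥ (v - res (A q) j v)| ≤ nrm (A q j) * nrm (v - res (A q) j v) := abs_dot_le _ _
      _ ≤ (C * √q.1) * (M / √q.1 * S) :=
          mul_le_mul hqC (hq v) (nrm_nonneg _) (by positivity)
      _ = _ := by ring
  have h2 : nrm (((u ⬝ᵥ v) / (u ⬝ᵥ u)) • u) = |u ⬝ᵥ v| / nrm u := by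
    rw [nrm_smul, ← nrm_sq, abs_div, abs_of_pos (by positivity : 0 < nrm u ^ 2)]
    field_simp
  have h3 : v - res (A q) (j + 1) v = (v - res (A q) j v) + ((u ⬝ᵥ v) / (u ⬝ᵥ u)) • u := by
    rw [res_succ_eq]
    abel
  rw [h3, Finset.sum_range_succ]
  refine (nrm_add_le _ _).trans ?_
  rw [h2]
  calc nrm (v - res (A q) j v) + |u ⬝ᵥ v| / nrm u
      ≤ M / √q.1 * S + (|A q j ⬝ᵥ v| + M / √q.1 * S * (C * √q.1)) / (s * √q.1) := by
        gcongr
        exact hq v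
    _ = M * (1 + C / s) / √q.1 * S + s⁻¹ / √q.1 * |A q j ⬝ᵥ v| := by
        field_simp
        ring
    _ ≤ M * (1 + C / s) / √q.1 * S + s⁻¹ / √q.1 * |A q j ⬝ᵥ v| +
          (M * (1 + C / s) / √q.1 * |A q j ⬝ᵥ v| + s⁻¹ / √q.1 * S) := by
        have : 0 ≤ M * (1 + C / s) / √q.1 * |A q j ⬝ᵥ v| + s⁻¹ / √q.1 * S := by positivity
        linarith
    _ = _ := by ring

/-- The bound only depends on the inner products of the columns. -/
lemma GramBound.of_isometry (h : GramBound P A j)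
    (hV : ∀ q, ∃ V : Matrix.orthogonalGroup (Fin q.1) ℝ, ∀ l < j, V.1 *ᵥ A q l = B q l) :
    GramBound P B j := by
  obtain ⟨M, hM, h⟩ := h
  refine ⟨M, hM, ?_⟩
  filter_upwards [h] with q hq v
  obtain ⟨V, hV⟩ := hV q
  have hv : V.1 *ᵥ (V.1ᵀ *ᵥ v) = v := by
    rw [Matrix.mulVec_mulVec, orth_mul_transpose, Matrix.one_mulVec]
  have h1 : v - res (B q) j v = V.1 *ᵥ (V.1ᵀ *ᵥ v - res (A q) j (V.1ᵀ *ᵥ v)) := by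
    rw [Matrix.mulVec_sub, mulVec_res (orth_transpose_mul V) hV, hv]
  rw [h1, nrm_mulVec_of_orth (orth_transpose_mul V)]
  refine (hq _).trans (le_of_eq ?_)
  congr 1
  refine Finset.sum_congr rfl fun l hl => ?_
  rw [← hV l (Finset.mem_range.1 hl)]
  conv_rhs => rw [← hv]
  rw [dot_mulVec_of_orth (orth_transpose_mul V)]

lemma GramBound.congr (h : GramBound P A j) (hAB : ∀ q, ∀ l < j, A q l = B q l) :
    GramBound P B j := by
  refine h.of_isometry fun q => ⟨1, fun l hl => ?_⟩
  rw [← hAB q l hl]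
  exact Matrix.one_mulVec _

end Residual

/-! ### States of rows -/

section RowState

variable {Ω : ℕ → Type*} [∀ N, MeasurableSpace (Ω N)] {P : ∀ N, Measure (Ω N)}
variable {D : Type*}

/-- The columns of an array of rows. -/
def cols (r : ∀ q : Σ N, Ω N, Fin q.1 → D × (ℕ → ℝ)) (q : Σ N, Ω N) (l : ℕ) : Fin q.1 → ℝ :=
  fun n => (r q n).2 l

/-- Replace column `j` of a row. -/
def insCol (j : ℕ) (p : (D × (ℕ → ℝ)) × ℝ) : D × (ℕ → ℝ) := (p.1.1, Function.update p.1.2 j p.2)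

/-- Linear combinations of the first `j` columns. -/
def linForm (c : ℕ → ℝ) (j : ℕ) (x : D × (ℕ → ℝ)) : ℝ := ∑ l ∈ Finset.range j, c l * x.2 l

lemma linForm_cols (r : ∀ q : Σ N, Ω N, Fin q.1 → D × (ℕ → ℝ)) (c : ℕ → ℝ) (j : ℕ)
    (q : Σ N, Ω N) :
    (fun n => linForm c j (r q n)) = ∑ l ∈ Finset.range j, c l • cols r q l := by
  funext n
  simp [linForm, cols]

variable [MeasurableSpace D]

lemma measurable_insCol (j : ℕ) : Measurable (insCol (D := D) j) := by
  refine (measurable_fst.comp measurable_fst).prodMk (measurable_pi_lambda _ fun l => ?_)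
  by_cases hl : l = j
  · subst hl
    simpa using measurable_snd
  · simp only [Function.update_of_ne hl]
    exact (measurable_pi_apply l).comp (measurable_snd.comp measurable_fst)

lemma measurable_coord (l : ℕ) : Measurable fun x : D × (ℕ → ℝ) => x.2 l :=
  (measurable_pi_apply l).comp measurable_snd

lemma measurable_linForm (c : ℕ → ℝ) (j : ℕ) : Measurable (linForm (D := D) c j) :=
  Finset.measurable_sum _ fun l _ => measurable_const.mul (measurable_coord l)

/-- The rows `r` behave like independent samples of the law `μ`: convergence of the empirical law,
avoidance of null sets, and uniform integrability of the squared columns. -/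
structure RowState (P : ∀ N, Measure (Ω N)) (r : ∀ q : Σ N, Ω N, Fin q.1 → D × (ℕ → ℝ))
    (μ : Measure (D × (ℕ → ℝ))) : Prop where
  prob : IsProbabilityMeasure μ
  meas : RowMeas r
  lln : RowLLN P r μ
  null : ∀ O, MeasurableSet O → μ O = 0 → ∀ᶠ q in whp P, ∀ n, r q n ∉ O
  ui : ∀ i, UIArr P fun q n => (r q n).2 i ^ 2

variable {r : ∀ q : Σ N, Ω N, Fin q.1 → D × (ℕ → ℝ)} {μ : Measure (D × (ℕ → ℝ))}

lemma RowState.measurable_cols (h : RowState P r μ) (N : ℕ) :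
    Measurable (β := ℕ → Fin N → ℝ) fun ω => cols r ⟨N, ω⟩ :=
  measurable_pi_lambda _ fun l => measurable_pi_lambda _ fun n =>
    (measurable_coord l).comp (h.meas.apply N n)

lemma RowState.ui_lin (h : RowState P r μ) (c : ℕ → ℝ) (j : ℕ) :
    UIArr P fun q n => linForm c j (r q n) ^ 2 :=
  UIArr.sq_sum _ fun l _ => (h.ui l).sq_const_mul (c l)

lemma RowState.memLp_of_ui [∀ N, IsProbabilityMeasure (P N)] (h : RowState P r μ)
    {ψ : D × (ℕ → ℝ) → ℝ} (hψ : Measurable ψ) (hui : UIArr P fun q n => ψ (r q n) ^ 2) :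
    MemLp ψ 2 μ := by
  have := h.prob
  rw [memLp_two_iff_integrable_sq hψ.aestronglyMeasurable]
  exact h.lln.integrable (hψ.pow_const 2) hui

lemma RowState.memLp_coord [∀ N, IsProbabilityMeasure (P N)] (h : RowState P r μ) (i : ℕ) :
    MemLp (fun x => x.2 i) 2 μ :=
  h.memLp_of_ui (measurable_coord i) (h.ui i)

/-- The state of the rows after column `j` has been replaced by a function of the rows. -/
lemma RowState.map (h : RowState P r μ) {ψ : D × (ℕ → ℝ) → ℝ} (hψ : Measurable ψ)
    (hui : UIArr P fun q n => ψ (r q n) ^ 2) (j : ℕ) :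
    RowState P (fun q n => insCol j (r q n, ψ (r q n))) (μ.map fun x => insCol j (x, ψ x)) := by
  have hp := h.prob
  have hm : Measurable fun x : D × (ℕ → ℝ) => insCol j (x, ψ x) :=
    (measurable_insCol j).comp (measurable_id.prodMk hψ)
  have h1 : RowMeas (fun (q : Σ N, Ω N) (n : Fin q.1) => insCol j (r q n, ψ (r q n))) := fun N =>
    measurable_pi_lambda _ fun n : Fin N => hm.comp (h.meas.apply N n)
  have h2 := h.lln.map hm
  have h3 : ∀ O, MeasurableSet O → μ.map (fun x => insCol j (x, ψ x)) O = 0 →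
      ∀ᶠ q in whp P, ∀ n, insCol j (r q n, ψ (r q n)) ∉ O := by
    intro O hO hO0
    rw [Measure.map_apply hm hO] at hO0
    exact h.null _ (hm hO) hO0
  refine ⟨Measure.isProbabilityMeasure_map hm.aemeasurable, h1, h2, h3, fun i => ?_⟩
  by_cases hi : i = j
  · subst hi
    simpa [insCol] using hui
  · simpa [insCol, Function.update_of_ne hi] using h.ui i

/-- Being in a given state is a property of the laws of the arrays of rows. -/
lemma RowState.congr_law {Ω' : ℕ → Type*} [∀ N, MeasurableSpace (Ω' N)]
    {P' : ∀ N, Measure (Ω' N)} {r' : ∀ q : Σ N, Ω' N, Fin q.1 → D × (ℕ → ℝ)}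
    (hr : RowMeas r) (hlaw : ∀ N, rowLaw P r N = rowLaw P' r' N) (h : RowState P' r' μ) :
    RowState P r μ := by
  refine ⟨h.prob, hr, h.lln.congr_law hr h.meas hlaw, fun O hO hO0 => ?_, fun i => ?_⟩
  · have h1 := h.null O hO hO0
    refine eventually_whp_congr (X := fun N => Fin N → D × (ℕ → ℝ)) (f := fun N ω => r ⟨N, ω⟩)
      (f' := fun N ω => r' ⟨N, ω⟩) hr h.meas hlaw
      (p := fun N v => ∀ n, v n ∉ O) ?_ h1
    intro N
    rw [Set.ofPred_forall]
    exact MeasurableSet.iInter fun n => ((measurable_pi_apply n) hO).compl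
  · exact UIArr.congr_law hr h.meas hlaw (ψ := fun x => x.2 i ^ 2)
      ((measurable_coord i).pow_const 2) (h.ui i)

end RowState

/-! ### The state of the rows after a fresh image -/

section Step

variable {Ω : ℕ → Type*} [∀ N, MeasurableSpace (Ω N)] {P : ∀ N, Measure (Ω N)}
  [∀ N, IsProbabilityMeasure (P N)]
variable {DA DB : Type*} [MeasurableSpace DA] [MeasurableSpace DB]
variable {rA : ∀ q : Σ N, Ω N, Fin q.1 → DA × (ℕ → ℝ)}
  {rB : ∀ q : Σ N, Ω N, Fin q.1 → DB × (ℕ → ℝ)} {μA : Measure (DA × (ℕ → ℝ))}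
  {μB : Measure (DB × (ℕ → ℝ))} {V : ∀ N, Ω N → Matrix.orthogonalGroup (Fin N) ℝ} {j : ℕ}
  {ψ : DA × (ℕ → ℝ) → ℝ} {c : ℕ → ℝ} {s : ℝ}

/-- The hypotheses of a revealing step: `V` maps the first `j` columns of `rA` to those of `rB`, and
`c`, `s` are the coefficients and the distance of the projection of the new vector `ψ (rA n)` onto
the columns, in the limit law. -/
structure StepData (P : ∀ N, Measure (Ω N)) (rA : ∀ q : Σ N, Ω N, Fin q.1 → DA × (ℕ → ℝ))
    (rB : ∀ q : Σ N, Ω N, Fin q.1 → DB × (ℕ → ℝ)) (μA : Measure (DA × (ℕ → ℝ)))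
    (μB : Measure (DB × (ℕ → ℝ))) (V : ∀ N, Ω N → Matrix.orthogonalGroup (Fin N) ℝ) (j : ℕ)
    (ψ : DA × (ℕ → ℝ) → ℝ) (c : ℕ → ℝ) (s : ℝ) : Prop where
  stA : RowState P rA μA
  stB : RowState P rB μB
  gram : GramBound P (cols rA) j
  measV : ∀ N, Measurable (V N)
  maps : ∀ q : Σ N, Ω N, ∀ l < j, (V q.1 q.2).1 *ᵥ cols rA q l = cols rB q l
  measψ : Measurable ψ
  uiψ : UIArr P fun q n => ψ (rA q n) ^ 2
  s_nonneg : 0 ≤ s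
  normal : ∀ i < j, ∫ x, x.2 i * (ψ x - linForm c j x) ∂μA = 0
  dist : ∫ x, (ψ x - linForm c j x) ^ 2 ∂μA = s ^ 2

/-- The vector to be multiplied by `V`. -/
def inp (rA : ∀ q : Σ N, Ω N, Fin q.1 → DA × (ℕ → ℝ)) (ψ : DA × (ℕ → ℝ) → ℝ) (q : Σ N, Ω N) :
    Fin q.1 → ℝ := fun n => ψ (rA q n)

/-- The part of the input vector that is orthogonal to the columns in the limit law. -/
def inpRes (rA : ∀ q : Σ N, Ω N, Fin q.1 → DA × (ℕ → ℝ)) (ψ : DA × (ℕ → ℝ) → ℝ) (c : ℕ → ℝ)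
    (j : ℕ) (q : Σ N, Ω N) : Fin q.1 → ℝ := fun n => ψ (rA q n) - linForm c j (rA q n)

/-- The surrogate for the image of the input vector, with an independent Gaussian vector. -/
noncomputable def fresh (rA : ∀ q : Σ N, Ω N, Fin q.1 → DA × (ℕ → ℝ))
    (rB : ∀ q : Σ N, Ω N, Fin q.1 → DB × (ℕ → ℝ))
    (V : ∀ N, Ω N → Matrix.orthogonalGroup (Fin N) ℝ) (j : ℕ) (ψ : DA × (ℕ → ℝ) → ℝ)
    (q : Σ N, Ω N × (Fin N → ℝ)) : Fin q.1 → ℝ :=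
  freshImage (V q.1 q.2.1).1 (cols rA (base q)) (cols rB (base q)) j (inp rA ψ (base q)) q.2.2

/-- The first approximation of the fresh image. -/
def freshLin (rB : ∀ q : Σ N, Ω N, Fin q.1 → DB × (ℕ → ℝ)) (c : ℕ → ℝ) (j : ℕ) (s : ℝ)
    (q : Σ N, Ω N × (Fin N → ℝ)) : Fin q.1 → ℝ :=
  fun n => linForm c j (rB (base q) n) + s * q.2.2 n

lemma inpRes_eq (q : Σ N, Ω N) : inpRes rA ψ c j q =
    inp rA ψ q - ∑ l ∈ Finset.range j, c l • cols rA q l := by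
  rw [← linForm_cols]
  rfl

/-- The next column, as a function of a row and an independent Gaussian variable. -/
def pairMap {D : Type*} (c : ℕ → ℝ) (s : ℝ) (j : ℕ) (p : (D × (ℕ → ℝ)) × ℝ) :
    (D × (ℕ → ℝ)) × ℝ := (p.1, linForm c j p.1 + s * p.2)

lemma measurable_pairMap {D : Type*} [MeasurableSpace D] (c : ℕ → ℝ) (s : ℝ) (j : ℕ) :
    Measurable (pairMap (D := D) c s j) :=
  measurable_fst.prodMk (((measurable_linForm c j).comp measurable_fst).add
    (measurable_const.mul measurable_snd))

/-- The limit law of a row and its next column. -/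
noncomputable def pairLaw {D : Type*} [MeasurableSpace D] (c : ℕ → ℝ) (s : ℝ) (j : ℕ)
    (μ : Measure (D × (ℕ → ℝ))) : Measure ((D × (ℕ → ℝ)) × ℝ) :=
  (μ.prod (gaussianReal 0 1)).map (pairMap c s j)

lemma isProbabilityMeasure_pairLaw {D : Type*} [MeasurableSpace D] (c : ℕ → ℝ) (s : ℝ) (j : ℕ)
    (μ : Measure (D × (ℕ → ℝ))) [IsProbabilityMeasure μ] :
    IsProbabilityMeasure (pairLaw c s j μ) :=
  Measure.isProbabilityMeasure_map (measurable_pairMap c s j).aemeasurable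

/-- The limit law of the rows after a revealing step. -/
noncomputable def stepLaw {D : Type*} [MeasurableSpace D] (c : ℕ → ℝ) (s : ℝ) (j : ℕ)
    (μ : Measure (D × (ℕ → ℝ))) : Measure (D × (ℕ → ℝ)) :=
  (pairLaw c s j μ).map (insCol j)

namespace StepData

variable (h : StepData P rA rB μA μB V j ψ c s)
include h

lemma ui_inpRes : UIArr P fun q n => inpRes rA ψ c j q n ^ 2 := by
  have := h.uiψ.sq_add ((h.stA.ui_lin c j).sq_const_mul (-1))
  refine this.mono fun q n => le_of_eq ?_
  rw [inpRes]
  ring_nf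

lemma res_inp (q : Σ N, Ω N) :
    res (cols rA q) j (inp rA ψ q) = res (cols rA q) j (inpRes rA ψ c j q) := by
  rw [inpRes_eq, res_sub_sum]

/-- The input vector, minus its limiting linear combination of the columns, is close to its
residual, and its normalized norm tends to `s`. -/
lemma tendsto_inpRes :
    Tendsto (fun q => nn (inpRes rA ψ c j q - res (cols rA q) j (inpRes rA ψ c j q)))
      (whp P) (𝓝 0) ∧
    Tendsto (fun q => nn (res (cols rA q) j (inpRes rA ψ c j q))) (whp P) (𝓝 s) := by
  have hprob := h.stA.prob
  have hm : Measurable fun x => ψ x - linForm c j x := h.measψ.sub (measurable_linForm c j)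
  refine h.gram.tendsto h.s_nonneg (fun l hl => ?_) ?_
  · have h1 := h.stA.lln.tendsto_avg (ψ := fun x => x.2 l * (ψ x - linForm c j x))
      ((measurable_coord l).mul hm) ((h.stA.ui l).mul_of_sq h.ui_inpRes)
    rw [h.normal l hl] at h1
    exact h1
  · have h1 := h.stA.lln.tendsto_avg (ψ := fun x => (ψ x - linForm c j x) ^ 2)
      (hm.pow_const 2) h.ui_inpRes
    rw [h.dist] at h1
    refine h1.congr fun q => ?_
    rw [← avg_mul_eq_dot]
    simp only [sq]
    rfl

lemma gramB : GramBound P (cols rB) j :=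
  h.gram.of_isometry fun q => ⟨V q.1 q.2, h.maps q⟩

lemma gramB' : GramBound (withGauss P) (fun q => cols rB (base q)) j := by
  obtain ⟨M, hM, hg⟩ := h.gramB
  exact ⟨M, hM, (tendsto_base (P := P)).eventually hg⟩

lemma tendsto_avg_gauss (l : ℕ) : Tendsto (fun q : Σ N, Ω N × (Fin N → ℝ) =>
    (q.1 : ℝ)⁻¹ * (cols rB (base q) l ⬝ᵥ q.2.2)) (whp (withGauss P)) (𝓝 0) := by
  have hprob := h.stB.prob
  have hl := h.stB.lln.withGauss h.stB.meas
  have hu : UIArr (withGauss P) fun (q : Σ N, Ω N × (Fin N → ℝ)) n =>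
      (rB (base q) n).2 l * q.2.2 n := (h.stB.ui l).base.mul_of_sq uiArr_gauss_sq
  have h1 := hl.tendsto_avg (ψ := fun p : (DB × (ℕ → ℝ)) × ℝ => p.1.2 l * p.2)
    (((measurable_coord l).comp measurable_fst).mul measurable_snd) hu
  have h2 : ∫ p : (DB × (ℕ → ℝ)) × ℝ, p.1.2 l * p.2 ∂(μB.prod (gaussianReal 0 1)) = 0 := by
    rw [integral_prod_mul (fun x : DB × (ℕ → ℝ) => x.2 l) (fun z : ℝ => z)]
    simp [integral_id_gaussianReal]
  rw [h2] at h1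
  exact h1

lemma tendsto_avg_gauss_sq : Tendsto (fun q : Σ N, Ω N × (Fin N → ℝ) =>
    (q.1 : ℝ)⁻¹ * (q.2.2 ⬝ᵥ q.2.2)) (whp (withGauss P)) (𝓝 (1 ^ 2)) := by
  have hprob := h.stB.prob
  have hl := h.stB.lln.withGauss h.stB.meas
  have h1 := hl.tendsto_avg (ψ := fun p : (DB × (ℕ → ℝ)) × ℝ => p.2 ^ 2)
    (measurable_snd.pow_const 2) uiArr_gauss_sq
  have h2 : ∫ p : (DB × (ℕ → ℝ)) × ℝ, p.2 ^ 2 ∂(μB.prod (gaussianReal 0 1)) = 1 := by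
    rw [integral_fun_snd (fun z : ℝ => z ^ 2)]
    have := variance_id_gaussianReal (μ := 0) (v := 1)
    rw [variance_eq_integral measurable_id.aemeasurable] at this
    simpa [integral_id_gaussianReal] using this
  rw [h2] at h1
  rw [one_pow]
  refine h1.congr fun q => ?_
  rw [← avg_mul_eq_dot]
  simp only [sq]

lemma tendsto_gauss :
    Tendsto (fun q : Σ N, Ω N × (Fin N → ℝ) =>
      nn (q.2.2 - res (cols rB (base q)) j q.2.2)) (whp (withGauss P)) (𝓝 0) ∧
    Tendsto (fun q : Σ N, Ω N × (Fin N → ℝ) =>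
      nn (res (cols rB (base q)) j q.2.2)) (whp (withGauss P)) (𝓝 1) :=
  GramBound.tendsto (P := withGauss P) (A := fun q => cols rB (base q)) (ρ := fun q => q.2.2)
    h.gramB' zero_le_one (fun l _ => h.tendsto_avg_gauss l) h.tendsto_avg_gauss_sq

lemma meas_fresh : RowMeas (fresh rA rB V j ψ) := by
  intro N
  refine measurable_freshImage ((h.measV N).comp measurable_fst)
    ((h.stA.measurable_cols N).comp measurable_fst)
    ((h.stB.measurable_cols N).comp measurable_fst) j ?_ measurable_snd
  exact measurable_pi_lambda _ fun n : Fin N =>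
    h.measψ.comp ((h.stA.meas.apply N n).comp measurable_fst)

/-- The distance of the fresh image from its first approximation: the part of the input residual in
the span of the columns, the error in the norm, and the part of the Gaussian vector in the span of
the columns. -/
lemma nn_fresh_sub_le (q : Σ N, Ω N × (Fin N → ℝ)) :
    nn (fresh rA rB V j ψ q - freshLin rB c j s q) ≤
      nn (inpRes rA ψ c j (base q) - res (cols rA (base q)) j (inpRes rA ψ c j (base q))) +
      |nn (res (cols rA (base q)) j (inpRes rA ψ c j (base q))) -
        s * nn (res (cols rB (base q)) j q.2.2)| +
      s * nn (q.2.2 - res (cols rB (base q)) j q.2.2) := by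
  set ρ := inpRes rA ψ c j (base q) with hρ
  set w := res (cols rA (base q)) j ρ with hw
  set y := res (cols rB (base q)) j q.2.2 with hy
  set U := V q.1 q.2.1 with hU
  have h1 : fresh rA rB V j ψ q - freshLin rB c j s q =
      U.1 *ᵥ (ρ - w) + (nrm w • unitVec y - s • y) + (-s) • (q.2.2 - y) := by
    have e1 : inp rA ψ (base q) = ρ + ∑ l ∈ Finset.range j, c l • cols rA (base q) l := by
      rw [hρ, inpRes_eq, sub_add_cancel]
    have e2 : U.1 *ᵥ (∑ l ∈ Finset.range j, c l • cols rA (base q) l) =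
        ∑ l ∈ Finset.range j, c l • cols rB (base q) l := by
      rw [Matrix.mulVec_sum]
      refine Finset.sum_congr rfl fun l hl => ?_
      rw [Matrix.mulVec_smul, h.maps (base q) l (Finset.mem_range.1 hl)]
    have e3 : freshLin rB c j s q =
        (∑ l ∈ Finset.range j, c l • cols rB (base q) l) + s • q.2.2 := by
      rw [← linForm_cols]
      rfl
    have e4 : inp rA ψ (base q) - w = (ρ - w) + ∑ l ∈ Finset.range j, c l • cols rA (base q) l := by
      rw [e1]
      abel
    have e5 : fresh rA rB V j ψ q = U.1 *ᵥ (inp rA ψ (base q) - w) + nrm w • unitVec y := by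
      rw [fresh, freshImage, h.res_inp]
    rw [e5, e3, e4, Matrix.mulVec_add, e2]
    module
  have h2 : nn (nrm w • unitVec y - s • y) ≤ |nn w - s * nn y| := by
    have e : nrm (nrm w • unitVec y - s • y) ≤ |nrm w - s * nrm y| := by
      by_cases hy0 : y = 0
      · rw [hy0]
        simp [unitVec, nrm_zero]
      · have hn : nrm y ≠ 0 := fun h => hy0 (nrm_eq_zero.1 h)
        have : nrm w • unitVec y - s • y = (nrm w - s * nrm y) • unitVec y := by
          rw [unitVec, sub_smul, mul_smul, smul_smul (nrm y), mul_inv_cancel₀ hn, one_smul]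
        rw [this, nrm_smul, nrm_unitVec hy0, mul_one]
    rw [nn, nn, nn, mul_div_assoc', ← sub_div, abs_div, abs_of_nonneg (Real.sqrt_nonneg _)]
    exact div_le_div_of_nonneg_right e (Real.sqrt_nonneg _)
  rw [h1]
  refine (nn_add_le _ _).trans (add_le_add ((nn_add_le _ _).trans (add_le_add ?_ h2)) ?_)
  · rw [nn, nn, nrm_mulVec_of_orth (orth_transpose_mul U)]
  · rw [nn_smul, abs_neg, abs_of_nonneg h.s_nonneg]

/-- The fresh image is close to its first approximation in mean square. -/
lemma tendsto_fresh_sub :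
    Tendsto (fun q => avg fun n => (fresh rA rB V j ψ q n - freshLin rB c j s q n) ^ 2)
      (whp (withGauss P)) (𝓝 0) := by
  obtain ⟨h1, h2⟩ := h.tendsto_inpRes
  obtain ⟨h3, h4⟩ := h.tendsto_gauss
  have h1' := h1.comp (tendsto_base (P := P))
  have h2' := h2.comp (tendsto_base (P := P))
  have hb := (h1'.add (h2'.sub (h4.const_mul s)).abs).add (h3.const_mul s)
  rw [mul_one, sub_self, abs_zero, mul_zero, add_zero, add_zero] at hb
  have := squeeze_zero (fun q => nn_nonneg _) h.nn_fresh_sub_le hb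
  have h5 := this.pow 2
  rw [zero_pow two_ne_zero] at h5
  refine h5.congr fun q => ?_
  rw [nn_sq, ← avg_mul_eq_dot]
  simp only [Pi.sub_apply, sq]

lemma ui_fresh : UIArr (withGauss P) fun q n => fresh rA rB V j ψ q n ^ 2 := by
  have h1 : UIArr (withGauss P) fun q n =>
      (fresh rA rB V j ψ q n - freshLin rB c j s q n) ^ 2 := by
    refine UIArr.of_avg_tendsto (h.tendsto_fresh_sub.congr fun q => ?_)
    exact congrArg avg (funext fun n => (abs_of_nonneg (sq_nonneg _)).symm)
  have h2 : UIArr (withGauss P) fun q n => freshLin rB c j s q n ^ 2 :=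
    ((h.stB.ui_lin c j).base).sq_add (uiArr_gauss_sq.sq_const_mul s)
  have h3 := h1.sq_add h2
  simpa only [sub_add_cancel] using h3

/-- With high probability all positions are good, if the residual does not vanish in the limit. -/
lemma eventually_goodAt (hs : 0 < s) : ∀ᶠ q in whp (withGauss P), ∀ n : Fin q.1,
    GoodAt s (nrm (res (cols rA (base q)) j (inp rA ψ (base q)))) (cols rB (base q)) j q.2.2 n := by
  obtain ⟨-, h2⟩ := h.tendsto_inpRes
  obtain ⟨h3, h4⟩ := h.tendsto_gauss
  have h2' := h2.comp (tendsto_base (P := P))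
  obtain ⟨M, hM, hg⟩ := h.gramB'
  -- The squares of the entries of the columns are at most `ε * N`.  With this `ε` the projection of
  -- a basis vector onto the span of the columns has norm at most `1 / 2`.
  set ε : ℝ := (1 / (2 * (M * j + 1))) ^ 2 with hε
  have hε0 : 0 < ε := by positivity
  have hB : ∀ᶠ q in whp (withGauss P), ∀ l ∈ Finset.range j, ∀ n,
      |cols rB (base q) l n ^ 2| ≤ ε * q.1 := by
    rw [Finset.eventually_all]
    exact fun l _ => (h.stB.ui l).base.eventually_le hε0
  have h4' := h4.pow 2
  rw [one_pow] at h4'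
  filter_upwards [(tendsto_order.1 h2').1 (s / 2) (by linarith), hg, hB,
    (tendsto_order.1 h4').1 (1 / 2) (by norm_num), (tendsto_order.1 h4').2 2 (by norm_num),
    (tendsto_order.1 h3).2 (1 / 8) (by norm_num),
    (uiArr_gauss_sq (P := P)).eventually_le (by norm_num : (0 : ℝ) < 1 / 64)]
    with q q1 q2 q3 q4 q5 q6 q7 n
  have hN : (0 : ℝ) < q.1 := by exact_mod_cast Fin.pos n
  have hR : 0 < √(q.1 : ℝ) := Real.sqrt_pos.2 hN
  have hR2 : √(q.1 : ℝ) ^ 2 = q.1 := Real.sq_sqrt hN.le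
  refine ⟨?_, ?_, ?_, ?_, ?_⟩
  · rw [h.res_inp]
    simp only [Function.comp_apply, nn] at q1
    rw [lt_div_iff₀ hR] at q1
    linarith
  · set e : Fin q.1 → ℝ := Pi.single n 1 with he
    have hee : e ⬝ᵥ e = 1 := by simp [he]
    have h1 : nrm (e - res (cols rB (base q)) j e) ≤ 1 / 2 := by
      refine (q2 e).trans ?_
      have hterm : ∀ l ∈ Finset.range j,
          |cols rB (base q) l ⬝ᵥ e| ≤ 1 / (2 * (M * j + 1)) * √q.1 := by
        intro l hl
        rw [he, dotProduct_single_one]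
        refine abs_le_of_sq_le_sq ?_ (by positivity)
        rw [mul_pow, hR2, ← hε]
        exact (le_abs_self _).trans (q3 l hl n)
      calc M / √q.1 * ∑ l ∈ Finset.range j, |cols rB (base q) l ⬝ᵥ e|
          ≤ M / √q.1 * ∑ _l ∈ Finset.range j, 1 / (2 * (M * j + 1)) * √q.1 := by
            gcongr with l hl
            exact hterm l hl
        _ = M * j / (M * j + 1) * (1 / 2) := by
            rw [Finset.sum_const, Finset.card_range, nsmul_eq_mul]
            field_simp
        _ ≤ 1 * (1 / 2) := by
            gcongr
            rw [div_le_one (by positivity)]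
            linarith
        _ = 1 / 2 := one_mul _
    have h2 := dot_self_eq_res_add (cols rB (base q)) j e
    rw [hee, ← nrm_sq (e - _)] at h2
    have h3 := nrm_nonneg (e - res (cols rB (base q)) j e)
    nlinarith
  · rw [nn_sq, inv_mul_eq_div, lt_div_iff₀ hN] at q4
    linarith
  · rw [nn_sq, inv_mul_eq_div, div_lt_iff₀ hN] at q5
    linarith
  · have h1 : (q.2.2 n - res (cols rB (base q)) j q.2.2 n) ^ 2 ≤ q.1 / 64 := by
      have e1 : (q.2.2 n - res (cols rB (base q)) j q.2.2 n) ^ 2 ≤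
          nrm (q.2.2 - res (cols rB (base q)) j q.2.2) ^ 2 := by
        rw [nrm_sq, dot_self_eq_sum]
        exact Finset.single_le_sum (f := fun i => (q.2.2 - res (cols rB (base q)) j q.2.2) i ^ 2)
          (fun i _ => sq_nonneg _) (Finset.mem_univ n)
      have e2 : nrm (q.2.2 - res (cols rB (base q)) j q.2.2) < 1 / 8 * √q.1 := by
        rw [nn, div_lt_iff₀ hR] at q6
        exact q6
      have e3 := nrm_nonneg (q.2.2 - res (cols rB (base q)) j q.2.2)
      nlinarith
    have h2 := q7 n
    rw [abs_of_nonneg (sq_nonneg _)] at h2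
    have h3 : res (cols rB (base q)) j q.2.2 n =
        q.2.2 n - (q.2.2 n - res (cols rB (base q)) j q.2.2 n) := by ring
    rw [h3]
    nlinarith [sq_nonneg (q.2.2 n + (q.2.2 n - res (cols rB (base q)) j q.2.2 n))]

/-- The entries of the fresh image have a bounded density, if the residual does not vanish in the
limit. -/
lemma densityBound (hs : 0 < s) : DensityBound P (fresh rA rB V j ψ)
    (fun q n => GoodAt s (nrm (res (cols rA (base q)) j (inp rA ψ (base q)))) (cols rB (base q)) j
      q.2.2 n) (20 / s) := by
  refine ⟨h.meas_fresh, h.eventually_goodAt hs, fun N n => ?_, fun N ω n T hT => ?_⟩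
  · have hA : Measurable (β := ℕ → Fin N → ℝ) fun w : Ω N × (Fin N → ℝ) => cols rA ⟨N, w.1⟩ :=
      (h.stA.measurable_cols N).comp measurable_fst
    have hB : Measurable (β := ℕ → Fin N → ℝ) fun w : Ω N × (Fin N → ℝ) => cols rB ⟨N, w.1⟩ :=
      (h.stB.measurable_cols N).comp measurable_fst
    have hi : Measurable (β := Fin N → ℝ) fun w : Ω N × (Fin N → ℝ) => inp rA ψ ⟨N, w.1⟩ :=
      measurable_pi_lambda _ fun n : Fin N =>
        h.measψ.comp ((h.stA.meas.apply N n).comp measurable_fst)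
    exact measurableSet_goodAt s (measurable_nrm (measurable_res hA hi j)) hB j measurable_snd n
  · exact stdG_freshImage_le hs ((V N ω).1 *ᵥ (inp rA ψ ⟨N, ω⟩ -
      res (cols rA ⟨N, ω⟩) j (inp rA ψ ⟨N, ω⟩))) (α := nrm (res (cols rA ⟨N, ω⟩) j
      (inp rA ψ ⟨N, ω⟩))) (B := cols rB ⟨N, ω⟩) j n hT

lemma lln_freshLin : RowLLN (withGauss P) (fun q n => (rB (base q) n, freshLin rB c j s q n))
    (pairLaw c s j μB) := by
  have hprob := h.stB.prob
  have h1 := h.stB.lln.withGauss h.stB.meas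
  have h2 : RowLLN (withGauss P) (fun q n => pairMap c s j (rB (base q) n, q.2.2 n))
      (pairLaw c s j μB) := h1.map (measurable_pairMap c s j)
  exact h2

/-- If the input vector is a linear combination of the columns in the limit law, then it is so
exactly, with high probability. -/
lemma eventually_inpRes_eq (hs : s = 0) : ∀ᶠ q in whp P, inpRes rA ψ c j q = 0 := by
  have hprob := h.stA.prob
  have hm : Measurable fun x => ψ x - linForm c j x := h.measψ.sub (measurable_linForm c j)
  have h0 : μA {x | ψ x - linForm c j x ≠ 0} = 0 := by
    have hi : Integrable (fun x => (ψ x - linForm c j x) ^ 2) μA :=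
      (h.stA.memLp_of_ui hm h.ui_inpRes).integrable_sq
    have h1 := h.dist
    rw [hs, zero_pow two_ne_zero, integral_eq_zero_iff_of_nonneg (fun x => sq_nonneg _) hi] at h1
    refine measure_mono_null (fun x hx => ?_) (ae_iff.1 h1)
    simpa using hx
  filter_upwards [h.stA.null _ (hm (measurableSet_singleton 0).compl) h0] with q hq
  funext n
  by_contra hn
  exact hq n hn

/-- If the residual vanishes in the limit, then the fresh image is a linear combination of the
columns. -/
lemma eventually_fresh_eq (hs : s = 0) :
    ∀ᶠ q in whp (withGauss P), fresh rA rB V j ψ q = freshLin rB c j s q := by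
  filter_upwards [(tendsto_base (P := P)).eventually (h.eventually_inpRes_eq hs),
    eventually_whp_of_atTop (P := withGauss P) (eventually_gt_atTop 0)] with q h2 q2
  have h3 := h.nn_fresh_sub_le q
  have hz : nn (0 : Fin q.1 → ℝ) = 0 := by rw [nn, nrm_zero, zero_div]
  rw [h2, res_zero, sub_zero, hs, zero_mul, zero_mul, sub_zero, hz, abs_zero,
    add_zero, add_zero, nn, div_le_iff₀ (Real.sqrt_pos.2 (by exact_mod_cast q2)), zero_mul] at h3
  rw [hs]
  exact sub_eq_zero.1 (nrm_eq_zero.1 (le_antisymm h3 (nrm_nonneg _)))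

/-- The empirical law of the rows together with the fresh image.  If `s = 0`, the fresh image is
equal to its first approximation; otherwise it is close to it, and its entries have a bounded
density. -/
lemma lln_fresh : RowLLN (withGauss P) (fun q n => (rB (base q) n, fresh rA rB V j ψ q n))
    (pairLaw c s j μB) := by
  have hprob := h.stB.prob
  have hprob' := isProbabilityMeasure_pairLaw c s j μB
  rcases h.s_nonneg.eq_or_lt with hs | hs
  · refine h.lln_freshLin.congr ?_
    filter_upwards [h.eventually_fresh_eq hs.symm] with q hq
    rw [hq]
  · refine (h.densityBound hs).rowLLN h.stB.meas h.stB.lln h.lln_freshLin (fun t => ?_)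
      h.tendsto_fresh_sub
    have hS : MeasurableSet (Prod.snd ⁻¹' {t} : Set ((DB × (ℕ → ℝ)) × ℝ)) :=
      measurable_snd (measurableSet_singleton t)
    rw [pairLaw, Measure.map_apply (measurable_pairMap c s j) hS]
    refine (Measure.measure_prod_null (measurable_pairMap c s j hS)).2
      (Eventually.of_forall fun y => ?_)
    refine measure_mono_null (t := {(t - linForm c j y) / s}) (fun z hz => ?_)
      (gaussianReal_le_volume.absolutelyContinuous (measure_singleton _))
    have hz' : linForm c j y + s * z = t := hz
    rw [Set.mem_singleton_iff, eq_div_iff hs.ne']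
    linarith

/-- Null sets of the limit law are avoided by the rows together with the fresh image.  As for the
empirical law, the case `s = 0` is exact and the other one follows from the bounded density. -/
lemma null_fresh {O : Set ((DB × (ℕ → ℝ)) × ℝ)} (hO : MeasurableSet O)
    (hO0 : pairLaw c s j μB O = 0) :
    ∀ᶠ q in whp (withGauss P), ∀ n, (rB (base q) n, fresh rA rB V j ψ q n) ∉ O := by
  have hprob := h.stB.prob
  rw [pairLaw, Measure.map_apply (measurable_pairMap c s j) hO,
    Measure.measure_prod_null (measurable_pairMap c s j hO)] at hO0
  rcases h.s_nonneg.eq_or_lt with hs | hs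
  · have hm : Measurable fun y : DB × (ℕ → ℝ) => (y, linForm c j y) :=
      measurable_id.prodMk (measurable_linForm c j)
    have h1 := h.stB.null _ (hm hO) (by
      refine measure_mono_null (fun y hy => ?_) (ae_iff.1 hO0)
      have : (Prod.mk y ⁻¹' (pairMap c s j ⁻¹' O) : Set ℝ) = Set.univ := by
        refine Set.eq_univ_of_forall fun z => ?_
        change (y, linForm c j y + s * z) ∈ O
        rw [← hs, zero_mul, add_zero]
        exact hy
      simp [this])
    filter_upwards [(tendsto_base (P := P)).eventually h1, h.eventually_fresh_eq hs.symm]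
      with q q1 q2 n hn
    rw [q2, freshLin, ← hs, zero_mul, add_zero] at hn
    exact q1 n hn
  · refine (h.densityBound hs).eventually_notMem h.stB.meas h.stB.null hO ?_
    filter_upwards [hO0] with y hy
    have hv : volume (Prod.mk y ⁻¹' (pairMap c s j ⁻¹' O) : Set ℝ) = 0 :=
      gaussianReal_absolutelyContinuous' 0 one_ne_zero hy
    have he : (Prod.mk y ⁻¹' (pairMap c s j ⁻¹' O) : Set ℝ) =
        (s * ·) ⁻¹' ((linForm c j y + ·) ⁻¹' (Prod.mk y ⁻¹' O)) := rfl
    rw [he, Real.volume_preimage_mul_left hs.ne', measure_preimage_add, mul_eq_zero] at hv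
    rcases hv with hv | hv
    · simp [hs.ne'] at hv
    · exact hv

/-- The state of the rows after the surrogate image has been put into column `j`. -/
lemma rowState_fresh : RowState (withGauss P)
    (fun q n => insCol j (rB (base q) n, fresh rA rB V j ψ q n)) (stepLaw c s j μB) := by
  have hprob := h.stB.prob
  have hprob' := isProbabilityMeasure_pairLaw c s j μB
  have h1 : RowMeas (fun (q : Σ N, Ω N × (Fin N → ℝ)) (n : Fin q.1) =>
      insCol j (rB (base q) n, fresh rA rB V j ψ q n)) := fun N =>
    measurable_pi_lambda _ fun n : Fin N => (measurable_insCol j).comp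
      (((h.stB.meas.apply N n).comp measurable_fst).prodMk (h.meas_fresh.apply N n))
  have h2 := h.lln_fresh.map (measurable_insCol j)
  have h3 : ∀ O, MeasurableSet O → stepLaw c s j μB O = 0 → ∀ᶠ q in whp (withGauss P),
      ∀ n, insCol j (rB (base q) n, fresh rA rB V j ψ q n) ∉ O := by
    intro O hO hO0
    rw [stepLaw, Measure.map_apply (measurable_insCol j) hO] at hO0
    exact h.null_fresh ((measurable_insCol j) hO) hO0
  refine ⟨Measure.isProbabilityMeasure_map (measurable_insCol j).aemeasurable, h1, h2, h3,
    fun i => ?_⟩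
  by_cases hi : i = j
  · subst hi
    simpa [insCol] using h.ui_fresh
  · simpa [insCol, Function.update_of_ne hi] using (h.stB.ui i).base

/-- The columns on the input side remain uniformly independent when the input vector is added: it is
redundant if `s = 0`, and otherwise its residual is bounded away from zero. -/
lemma gram_succ : GramBound P (cols fun q n => insCol j (rA q n, ψ (rA q n))) (j + 1) := by
  have hprob := h.stA.prob
  have hA : ∀ q : Σ N, Ω N, ∀ l < j,
      cols rA q l = cols (fun q n => insCol j (rA q n, ψ (rA q n))) q l := by
    intro q l hl
    funext n
    simp [cols, insCol, Function.update_of_ne hl.ne]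
  have hj : ∀ q : Σ N, Ω N,
      cols (fun q n => insCol j (rA q n, ψ (rA q n))) q j = inp rA ψ q := by
    intro q
    funext n
    simp [cols, insCol, inp]
  have hr : ∀ q : Σ N, Ω N, res (cols (fun q n => insCol j (rA q n, ψ (rA q n))) q) j
      (cols (fun q n => insCol j (rA q n, ψ (rA q n))) q j) =
      res (cols rA q) j (inpRes rA ψ c j q) := by
    intro q
    rw [hj, ← res_congr (hA q), h.res_inp]
  have hg := h.gram.congr hA
  obtain ⟨-, h2⟩ := h.tendsto_inpRes
  rcases h.s_nonneg.eq_or_lt with hs | hs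
  · refine hg.succ_of_eq_zero ?_
    filter_upwards [h.eventually_inpRes_eq hs.symm] with q h2
    rw [hr, h2, res_zero]
  · have h3 := h.stA.lln.tendsto_avg (ψ := fun x => ψ x ^ 2) (h.measψ.pow_const 2) h.uiψ
    have h4 : Tendsto (fun q => nn (inp rA ψ q)) (whp P) (𝓝 √(∫ x, ψ x ^ 2 ∂μA)) := by
      have h5 : Tendsto (fun q => nn (inp rA ψ q) ^ 2) (whp P) (𝓝 (∫ x, ψ x ^ 2 ∂μA)) := by
        refine h3.congr fun q => ?_
        rw [nn_sq, ← avg_mul_eq_dot]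
        simp only [sq]
        rfl
      have := h5.sqrt
      simpa only [Real.sqrt_sq (nn_nonneg _)] using this
    refine hg.succ_of_pos (s := s / 2) (C := √(∫ x, ψ x ^ 2 ∂μA) + 1) (by positivity)
      (by positivity) ?_ ?_
    · filter_upwards [(tendsto_order.1 h4).2 _ (lt_add_one _)] with q q1
      rw [hj]
      exact q1.le
    · filter_upwards [(tendsto_order.1 h2).1 (s / 2) (by linarith)] with q q1
      rw [hr]
      exact q1.le

/-- The state of the rows after a revealing step. -/
theorem rowState_image
    (hres : ∀ N, rowLaw P (fun q n => insCol j (rB q n, ((V q.1 q.2).1 *ᵥ inp rA ψ q) n)) N =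
      rowLaw (withGauss P) (fun q n => insCol j (rB (base q) n, fresh rA rB V j ψ q n)) N) :
    RowState P (fun q n => insCol j (rB q n, ((V q.1 q.2).1 *ᵥ inp rA ψ q) n))
      (stepLaw c s j μB) := by
  refine RowState.congr_law (fun N => ?_) hres h.rowState_fresh
  have hi : Measurable (β := Fin N → ℝ) fun ω : Ω N => inp rA ψ ⟨N, ω⟩ :=
    measurable_pi_lambda _ fun n : Fin N => h.measψ.comp (h.stA.meas.apply N n)
  have hVi : Measurable (β := Fin N → ℝ) fun ω : Ω N => (V N ω).1 *ᵥ inp rA ψ ⟨N, ω⟩ :=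
    measurable_orth_mulVec (h.measV N) hi
  exact measurable_pi_lambda _ fun n : Fin N => (measurable_insCol j).comp
    ((h.stB.meas.apply N n).prodMk ((measurable_pi_apply n).comp hVi))

end StepData

end Step

/-! ### Gaussian representation of the limit law -/

section Reflection

/-- A Gaussian variable has mean zero, given an orthogonal Gaussian variable. -/
lemma integral_dot_mul_eq_zero {Θ : Type*} [MeasurableSpace Θ] (θ : Measure Θ)
    [IsProbabilityMeasure θ] {k : ℕ} {u v : Fin k → ℝ} (huv : u ⬝ᵥ v = 0) {H : ℝ × Θ → ℝ}
    (hH : Measurable H) :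
    ∫ p, (u ⬝ᵥ p.2) * H (v ⬝ᵥ p.2, p.1) ∂(θ.prod (stdG (Fin k))) = 0 := by
  by_cases hu : u ⬝ᵥ u = 0
  · rw [dotProduct_self_eq_zero.1 hu]
    simp
  -- the reflection in the hyperplane orthogonal to `u` changes the sign of the first factor and
  -- fixes the second one
  have hmap : (θ.prod (stdG (Fin k))).map (Prod.map id (reflMat u *ᵥ ·)) =
      θ.prod (stdG (Fin k)) := by
    have h1 : IsProbabilityMeasure ((stdG (Fin k)).map (reflMat u *ᵥ ·)) :=
      Measure.isProbabilityMeasure_map (measurable_mulVec _).aemeasurable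
    rw [← Measure.map_prod_map _ _ measurable_id (measurable_mulVec _), Measure.map_id,
      stdG_map_orth (reflMat_orth u)]
  have hm : Measurable fun p : Θ × (Fin k → ℝ) => (u ⬝ᵥ p.2) * H (v ⬝ᵥ p.2, p.1) :=
    (measurable_dot measurable_const measurable_snd).mul
      (hH.comp ((measurable_dot measurable_const measurable_snd).prodMk measurable_fst))
  have h1 : ∫ p, (u ⬝ᵥ p.2) * H (v ⬝ᵥ p.2, p.1) ∂(θ.prod (stdG (Fin k))) =
      -∫ p, (u ⬝ᵥ p.2) * H (v ⬝ᵥ p.2, p.1) ∂(θ.prod (stdG (Fin k))) := by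
    conv_lhs => rw [← hmap]
    rw [integral_map (measurable_id.prodMap (measurable_mulVec _)).aemeasurable
      hm.aestronglyMeasurable, ← integral_neg]
    refine integral_congr_ae (Eventually.of_forall fun p => ?_)
    have e1 : u ⬝ᵥ (reflMat u *ᵥ p.2) = -(u ⬝ᵥ p.2) := by
      rw [reflMat_mulVec, dotProduct_sub, dotProduct_smul, smul_eq_mul]
      field_simp
      ring
    have e2 : v ⬝ᵥ (reflMat u *ᵥ p.2) = v ⬝ᵥ p.2 := by
      rw [reflMat_mulVec, dotProduct_sub, dotProduct_smul, dotProduct_comm v u, huv]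
      simp
    simp only [Prod.map_fst, Prod.map_snd, id_eq, e1, e2]
    ring
  linarith

variable {W : Type*} [MeasurableSpace W]

/-- The part of column `i` that is orthogonal to the signal, if `β i` is the correlation with the
signal (column `0`). -/
def gcoord {D : Type*} (β : ℕ → ℝ) (i : ℕ) (x : D × (ℕ → ℝ)) : ℝ := x.2 i - β i * x.2 0

/-- The Gaussian variables of a row: the noise of the initial message (position `0`) and, for the
columns in `I`, the parts orthogonal to the signal. -/
def gvec (I : Finset ℕ) (β : ℕ → ℝ) (x : (W × ℝ) × (ℕ → ℝ)) (i : ℕ) : ℝ :=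
  if i = 0 then x.1.2 else if i ∈ I then gcoord β i x else 0

/-- The signal and the noise of a row. -/
def sigNoise (x : (W × ℝ) × (ℕ → ℝ)) : ℝ × W := (x.2 0, x.1.1)

lemma measurable_gcoord {D : Type*} [MeasurableSpace D] (β : ℕ → ℝ) (i : ℕ) :
    Measurable (gcoord (D := D) β i) :=
  (measurable_coord i).sub (measurable_const.mul (measurable_coord 0))

lemma measurable_gvec_apply (I : Finset ℕ) (β : ℕ → ℝ) (i : ℕ) :
    Measurable fun x : (W × ℝ) × (ℕ → ℝ) => gvec I β x i := by
  unfold gvec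
  split_ifs
  · exact measurable_snd.comp measurable_fst
  · exact measurable_gcoord β i
  · exact measurable_const

lemma measurable_gvec (I : Finset ℕ) (β : ℕ → ℝ) : Measurable (gvec (W := W) I β) :=
  measurable_pi_lambda _ fun i => measurable_gvec_apply I β i

lemma measurable_sigNoise : Measurable (sigNoise (W := W)) :=
  (measurable_coord 0).prodMk (measurable_fst.comp measurable_fst)

/-- Under the law `μ` the Gaussian variables of a row are jointly Gaussian (linear images of a
standard Gaussian vector), and independent of the signal and the noise. -/
def GaussRep (μ : Measure ((W × ℝ) × (ℕ → ℝ))) (I : Finset ℕ) (β : ℕ → ℝ) : Prop :=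
  ∃ (θ : Measure (ℝ × W)) (k : ℕ) (e : ℕ → Fin k → ℝ), IsProbabilityMeasure θ ∧
    μ.map (fun x => (sigNoise x, gvec I β x)) =
      (θ.prod (stdG (Fin k))).map fun p => (p.1, fun i => e i ⬝ᵥ p.2)

lemma measurable_gaussMap {Θ : Type*} [MeasurableSpace Θ] {k : ℕ} (e : ℕ → Fin k → ℝ) :
    Measurable fun p : Θ × (Fin k → ℝ) => (p.1, fun i => e i ⬝ᵥ p.2) :=
  measurable_fst.prodMk
    (measurable_pi_lambda _ fun _ => measurable_dot measurable_const measurable_snd)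

variable {μ : Measure ((W × ℝ) × (ℕ → ℝ))} {I : Finset ℕ} {β : ℕ → ℝ}

/-- If a function of one Gaussian variable and of the signal and noise is uncorrelated with this
Gaussian variable, then it is uncorrelated with all of them. -/
lemma GaussRep.integral_eq_zero (h : GaussRep μ I β) {H : ℝ × (ℝ × W) → ℝ} (hH : Measurable H)
    (hg : ∀ i, MemLp (fun x => gvec I β x i) 2 μ) (p : ℕ)
    (hH2 : MemLp (fun x => H (gvec I β x p, sigNoise x)) 2 μ)
    (hp : ∫ x, gvec I β x p * H (gvec I β x p, sigNoise x) ∂μ = 0) (i : ℕ) :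
    ∫ x, gvec I β x i * H (gvec I β x p, sigNoise x) ∂μ = 0 := by
  obtain ⟨θ, k, e, hθ, he⟩ := h
  have hΦ : Measurable fun x : (W × ℝ) × (ℕ → ℝ) => (sigNoise x, gvec I β x) :=
    measurable_sigNoise.prodMk (measurable_gvec I β)
  have hF : ∀ i, Measurable fun q : (ℝ × W) × (ℕ → ℝ) => q.2 i * H (q.2 p, q.1) := fun i =>
    (measurable_coord i).mul (hH.comp ((measurable_coord p).prodMk measurable_fst))
  have hE := measurable_gaussMap (Θ := ℝ × W) e
  have hI : ∀ i, ∫ x, gvec I β x i * H (gvec I β x p, sigNoise x) ∂μ =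
      ∫ q, (e i ⬝ᵥ q.2) * H (e p ⬝ᵥ q.2, q.1) ∂(θ.prod (stdG (Fin k))) := by
    intro i
    have h1 := integral_map (μ := μ) hΦ.aemeasurable (hF i).aestronglyMeasurable
    have h2 := integral_map (μ := θ.prod (stdG (Fin k))) hE.aemeasurable
      (hF i).aestronglyMeasurable
    rw [he] at h1
    exact h1.symm.trans h2
  have hint : ∀ i, Integrable (fun q => (e i ⬝ᵥ q.2) * H (e p ⬝ᵥ q.2, q.1))
      (θ.prod (stdG (Fin k))) := by
    intro i
    have h1 : Integrable (fun x => gvec I β x i * H (gvec I β x p, sigNoise x)) μ :=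
      (hg i).integrable_mul hH2
    have h2 := (integrable_map_measure (μ := μ) (hF i).aestronglyMeasurable hΦ.aemeasurable).2 h1
    rw [he] at h2
    exact (integrable_map_measure (hF i).aestronglyMeasurable hE.aemeasurable).1 h2
  rw [hI] at hp ⊢
  -- `e i` is a multiple of `e p` plus a vector orthogonal to `e p`
  set t := (e i ⬝ᵥ e p) / (e p ⬝ᵥ e p) with ht
  have hu : (e i - t • e p) ⬝ᵥ e p = 0 := by
    rw [sub_dotProduct, smul_dotProduct, smul_eq_mul]
    by_cases h0 : e p ⬝ᵥ e p = 0
    · rw [dotProduct_self_eq_zero.1 h0]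
      simp
    · rw [ht, div_mul_cancel₀ _ h0, sub_self]
  have h0 := integral_dot_mul_eq_zero θ hu hH
  have hsplit : ∀ q : (ℝ × W) × (Fin k → ℝ),
      ((e i - t • e p) ⬝ᵥ q.2) * H (e p ⬝ᵥ q.2, q.1) =
        (e i ⬝ᵥ q.2) * H (e p ⬝ᵥ q.2, q.1) - t * ((e p ⬝ᵥ q.2) * H (e p ⬝ᵥ q.2, q.1)) := by
    intro q
    rw [sub_dotProduct, smul_dotProduct, smul_eq_mul]
    ring
  simp only [hsplit] at h0
  rw [integral_sub (hint i) ((hint p).const_mul t), integral_const_mul, hp, mul_zero,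
    sub_zero] at h0
  exact h0

/-- Adding a Gaussian variable which is a linear combination of the old ones and of an independent
one. -/
lemma GaussRep.extend [IsProbabilityMeasure μ] (h : GaussRep μ I β) {j : ℕ} (hj0 : j ≠ 0)
    (hI0 : 0 ∉ I) (hjI : j ∉ I) (c : ℕ → ℝ) (s b : ℝ) (κ : ℕ → ℝ)
    (hc : ∀ x : (W × ℝ) × (ℕ → ℝ), linForm c j x - b * x.2 0 = ∑ l ∈ I, κ l * gcoord β l x) :
    GaussRep (stepLaw c s j μ) (insert j I) (Function.update β j b) := by
  obtain ⟨θ, k, e, hθ, he⟩ := h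
  -- the new Gaussian variable gets one more standard Gaussian coordinate, which the others do not
  -- use
  let e' : ℕ → Fin (k + 1) → ℝ := fun i =>
    if i = j then Fin.cons s (∑ l ∈ I, κ l • e l) else Fin.cons 0 (e i)
  refine ⟨θ, k + 1, e', hθ, ?_⟩
  let U : ((ℝ × W) × (ℕ → ℝ)) × ℝ → (ℝ × W) × (ℕ → ℝ) := fun q =>
    (q.1.1, Function.update q.1.2 j ((∑ l ∈ I, κ l * q.1.2 l) + s * q.2))
  have hU : Measurable U := by
    have h1 : Measurable fun q : ((ℝ × W) × (ℕ → ℝ)) × ℝ =>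
        (q.1, (∑ l ∈ I, κ l * q.1.2 l) + s * q.2) :=
      measurable_fst.prodMk ((Finset.measurable_sum _ fun l _ => measurable_const.mul
        ((measurable_coord l).comp measurable_fst)).add (measurable_const.mul measurable_snd))
    exact (measurable_insCol (D := ℝ × W) j).comp h1
  have hΦ : Measurable fun x : (W × ℝ) × (ℕ → ℝ) => (sigNoise x, gvec I β x) :=
    measurable_sigNoise.prodMk (measurable_gvec I β)
  have hΦ' : Measurable fun x : (W × ℝ) × (ℕ → ℝ) =>
      (sigNoise x, gvec (insert j I) (Function.update β j b) x) :=
    measurable_sigNoise.prodMk (measurable_gvec _ _)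
  have hE := measurable_gaussMap (Θ := ℝ × W) e
  have hE' := measurable_gaussMap (Θ := ℝ × W) e'
  -- the Gaussian variables of an extended row, in terms of the old ones
  have hrow : ∀ p : ((W × ℝ) × (ℕ → ℝ)) × ℝ,
      (sigNoise (insCol j (pairMap c s j p)),
        gvec (insert j I) (Function.update β j b) (insCol j (pairMap c s j p))) =
      U ((sigNoise p.1, gvec I β p.1), p.2) := by
    intro p
    refine Prod.ext ?_ (funext fun i => ?_)
    · simp [U, sigNoise, insCol, pairMap, Function.update_of_ne hj0.symm]
    · simp only [U, gvec, insCol, pairMap, gcoord, Finset.mem_insert]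
      rcases eq_or_ne i j with rfl | hi
      · simp only [hj0, if_false, true_or, if_true, Function.update_self,
          Function.update_of_ne hj0.symm]
        have h1 := hc p.1
        have h2 : ∑ l ∈ I, κ l * (if l = 0 then p.1.1.2 else
            if l ∈ I then p.1.2 l - β l * p.1.2 0 else 0) = ∑ l ∈ I, κ l * gcoord β l p.1 := by
          refine Finset.sum_congr rfl fun l hl => ?_
          rw [if_neg (fun h0 : l = 0 => hI0 (h0 ▸ hl)), if_pos hl, gcoord]
        rw [h2]
        linarith
      · simp only [hi, false_or, Function.update_of_ne hi, Function.update_of_ne hj0.symm, gvec,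
          gcoord]
  have h1 : (stepLaw c s j μ).map (fun x =>
      (sigNoise x, gvec (insert j I) (Function.update β j b) x)) =
      ((μ.map fun x => (sigNoise x, gvec I β x)).prod (gaussianReal 0 1)).map U := by
    rw [stepLaw, pairLaw, Measure.map_map hΦ' (measurable_insCol j),
      Measure.map_map (hΦ'.comp (measurable_insCol j)) (measurable_pairMap c s j)]
    conv_rhs => rw [← Measure.map_id (μ := gaussianReal 0 1),
      Measure.map_prod_map _ _ hΦ measurable_id,
      Measure.map_map hU (hΦ.prodMap measurable_id)]
    congr 1
    funext p
    exact hrow p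
  have hsplit : (stdG (Fin (k + 1))).map (fun z => (Fin.tail z, z 0)) =
      (stdG (Fin k)).prod (gaussianReal 0 1) := by
    have h2 := (measurePreserving_piFinSuccAbove (fun _ : Fin (k + 1) => gaussianReal 0 1) 0).map_eq
    have h3 : (stdG (Fin (k + 1))).map (fun z => (z 0, Fin.tail z)) =
        (gaussianReal 0 1).prod (stdG (Fin k)) := h2
    rw [← Measure.prod_swap, ← h3, Measure.map_map measurable_swap]
    · rfl
    · exact (measurable_pi_apply 0).prodMk
        (measurable_pi_lambda _ fun i => measurable_pi_apply i.succ)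
  have htail : Measurable fun z : Fin (k + 1) → ℝ => (Fin.tail z, z 0) :=
    (measurable_pi_lambda _ fun i => measurable_pi_apply i.succ).prodMk (measurable_pi_apply 0)
  have hassoc : (((θ.prod (stdG (Fin k))).map fun p => (p.1, fun i => e i ⬝ᵥ p.2)).prod
      (gaussianReal 0 1)) = (θ.prod (stdG (Fin (k + 1)))).map
        (fun q => ((q.1, fun i => e i ⬝ᵥ Fin.tail q.2), q.2 0)) := by
    have h3 : θ.prod ((stdG (Fin k)).prod (gaussianReal 0 1)) =
        (θ.prod (stdG (Fin (k + 1)))).map (fun q => (q.1, (Fin.tail q.2, q.2 0))) := by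
      rw [← hsplit]
      conv_lhs => rw [← Measure.map_id (μ := θ), Measure.map_prod_map _ _ measurable_id htail]
      rfl
    have h4 : (θ.prod (stdG (Fin k))).prod (gaussianReal 0 1) =
        (θ.prod (stdG (Fin (k + 1)))).map (fun q => ((q.1, Fin.tail q.2), q.2 0)) := by
      have h5 := Measure.prodAssoc_prod (μ := θ) (ν := stdG (Fin k)) (τ := gaussianReal 0 1)
      have h6 : Measurable fun q : (ℝ × W) × (Fin (k + 1) → ℝ) => (q.1, (Fin.tail q.2, q.2 0)) :=
        measurable_fst.prodMk (htail.comp measurable_snd)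
      have h7 := congrArg (Measure.map MeasurableEquiv.prodAssoc.symm) h5
      rw [h3, MeasurableEquiv.map_symm_map, Measure.map_map (MeasurableEquiv.measurable _) h6] at h7
      exact h7
    have h6 : Measurable fun q : (ℝ × W) × (Fin (k + 1) → ℝ) => ((q.1, Fin.tail q.2), q.2 0) :=
      (measurable_fst.prodMk (measurable_fst.comp (htail.comp measurable_snd))).prodMk
        (measurable_snd.comp (htail.comp measurable_snd))
    have h7 := Measure.map_prod_map (θ.prod (stdG (Fin k))) (gaussianReal 0 1) hE measurable_id
    rw [Measure.map_id, h4, Measure.map_map (hE.prodMap measurable_id) h6] at h7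
    exact h7
  have h8 : Measurable fun q : (ℝ × W) × (Fin (k + 1) → ℝ) =>
      ((q.1, fun i => e i ⬝ᵥ Fin.tail q.2), q.2 0) :=
    (measurable_fst.prodMk (measurable_pi_lambda _ fun i =>
      measurable_dot measurable_const (measurable_fst.comp (htail.comp measurable_snd)))).prodMk
      (measurable_snd.comp (htail.comp measurable_snd))
  rw [h1, he, hassoc, Measure.map_map hU h8]
  congr 1
  funext q
  refine Prod.ext rfl (funext fun i => ?_)
  have hdot : ∀ (a : ℝ) (v : Fin k → ℝ), (Fin.cons a v : Fin (k + 1) → ℝ) ⬝ᵥ q.2 =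
      a * q.2 0 + v ⬝ᵥ Fin.tail q.2 := by
    intro a v
    simp [dotProduct, Fin.sum_univ_succ, Fin.tail]
  simp only [Function.comp_apply, U, e']
  rcases eq_or_ne i j with rfl | hi
  · rw [Function.update_self, if_pos rfl, hdot, sum_dotProduct]
    simp only [smul_dotProduct, smul_eq_mul]
    ring
  · rw [Function.update_of_ne hi, if_neg hi, hdot]
    ring

/-- The Gaussian representation does not depend on the columns that are not Gaussian. -/
lemma GaussRep.map_insCol (h : GaussRep μ I β) {j : ℕ} (hj0 : j ≠ 0) (hjI : j ∉ I) (b : ℝ)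
    {ψ : (W × ℝ) × (ℕ → ℝ) → ℝ} (hψ : Measurable ψ) :
    GaussRep (μ.map fun x => insCol j (x, ψ x)) I (Function.update β j b) := by
  obtain ⟨θ, k, e, hθ, he⟩ := h
  refine ⟨θ, k, e, hθ, ?_⟩
  have h1 : Measurable fun x : (W × ℝ) × (ℕ → ℝ) => insCol j (x, ψ x) :=
    (measurable_insCol j).comp (measurable_id.prodMk hψ)
  have h2 : Measurable fun x : (W × ℝ) × (ℕ → ℝ) =>
      (sigNoise x, gvec I (Function.update β j b) x) :=
    measurable_sigNoise.prodMk (measurable_gvec _ _)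
  rw [Measure.map_map h2 h1, ← he]
  congr 1
  funext x
  refine Prod.ext ?_ (funext fun i => ?_)
  · simp [sigNoise, insCol, Function.update_of_ne hj0.symm]
  · simp only [Function.comp_apply, gvec, insCol, gcoord]
    by_cases hi : i = j
    · subst hi
      simp [hj0, hjI]
    · simp [Function.update_of_ne hi, Function.update_of_ne hj0.symm]

end Reflection

section Projection

/-- The coefficients of the orthogonal projection onto the span of finitely many square integrable
functions. -/
lemma exists_projection {α : Type*} [MeasurableSpace α] {μ : Measure α} {φ : α → ℝ}
    (hφ : MemLp φ 2 μ) {g : ℕ → α → ℝ} (I : Finset ℕ) (hg : ∀ i ∈ I, MemLp (g i) 2 μ) :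
    ∃ κ : ℕ → ℝ, ∀ i ∈ I, ∫ x, g i x * (φ x - ∑ l ∈ I, κ l * g l x) ∂μ = 0 := by
  classical
  let G : ℕ → Lp ℝ 2 μ := fun i => if h : i ∈ I then (hg i h).toLp (g i) else 0
  let K : Submodule ℝ (Lp ℝ 2 μ) := Submodule.span ℝ (I.image G : Set (Lp ℝ 2 μ))
  have hfin : FiniteDimensional ℝ K := FiniteDimensional.span_finset ℝ _
  let f : Lp ℝ 2 μ := hφ.toLp φ
  obtain ⟨κ, hκ⟩ : ∃ κ : ℕ → ℝ, (K.starProjection f) = ∑ l ∈ I, κ l • G l := by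
    have h1 : (K.starProjection f) ∈
        Submodule.span ℝ (G '' (I : Set ℕ)) := by
      rw [← Finset.coe_image]
      exact K.starProjection_apply_mem f
    obtain ⟨κ, hκ⟩ := Submodule.mem_span_image_finset_iff_exists_fun' ℝ |>.1 h1
    exact ⟨κ, hκ.symm⟩
  refine ⟨κ, fun i hi => ?_⟩
  have hGi : G i ∈ K := Submodule.subset_span (by
    rw [Finset.coe_image]
    exact ⟨i, hi, rfl⟩)
  have h1 : inner ℝ (G i) (f - (K.starProjection f)) = 0 :=
    Submodule.inner_right_of_mem_orthogonal hGi (K.sub_starProjection_mem_orthogonal f)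
  rw [hκ, L2.inner_def] at h1
  refine Eq.trans (integral_congr_ae ?_) h1
  have hcoe : ∀ l ∈ I, G l =ᵐ[μ] g l := by
    intro l hl
    simp only [G, dif_pos hl]
    exact (hg l hl).coeFn_toLp
  have hsum : (∑ l ∈ I, κ l • G l : Lp ℝ 2 μ) =ᵐ[μ] fun x => ∑ l ∈ I, κ l * g l x := by
    have h2 : ∀ J ⊆ I, (∑ l ∈ J, κ l • G l : Lp ℝ 2 μ) =ᵐ[μ] fun x => ∑ l ∈ J, κ l * g l x := by
      intro J
      induction J using Finset.induction with
      | empty =>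
        intro _
        simp only [Finset.sum_empty]
        exact Lp.coeFn_zero _ _ _
      | insert a J ha ih =>
        intro hJ
        simp only [Finset.sum_insert ha]
        filter_upwards [Lp.coeFn_add (κ a • G a) (∑ l ∈ J, κ l • G l), Lp.coeFn_smul (κ a) (G a),
          hcoe a (hJ (Finset.mem_insert_self a J)),
          ih ((Finset.subset_insert a J).trans hJ)] with x x1 x2 x3 x4
        rw [x1, Pi.add_apply, x2, Pi.smul_apply, x3, x4, smul_eq_mul]
    exact h2 I subset_rfl
  filter_upwards [hcoe i hi, Lp.coeFn_sub f (∑ l ∈ I, κ l • G l), hφ.coeFn_toLp, hsum]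
    with x x1 x2 x3 x4
  rw [x1, x2, Pi.sub_apply, x3, x4]
  simp [mul_comm]

end Projection

/-! ### The invariant of the iterative process -/

section Invariant

lemma linForm_single {D : Type*} {j i : ℕ} (hi : i < j) (x : D × (ℕ → ℝ)) :
    linForm (Pi.single i 1) j x = x.2 i := by
  simp [linForm, Pi.single_apply, hi]

/-- The coefficients of `gcoord β i` as a linear form in the columns. -/
def gcoef (β : ℕ → ℝ) (i l : ℕ) : ℝ := (Pi.single i 1 : ℕ → ℝ) l - β i * (Pi.single 0 1 : ℕ → ℝ) l

lemma linForm_gcoef {D : Type*} (β : ℕ → ℝ) {j i : ℕ} (hj : 0 < j) (hi : i < j)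
    (x : D × (ℕ → ℝ)) : linForm (gcoef β i) j x = gcoord β i x := by
  rw [gcoord, ← linForm_single hi x, ← linForm_single hj x]
  simp only [linForm, gcoef, Finset.mul_sum, ← Finset.sum_sub_distrib]
  refine Finset.sum_congr rfl fun l _ => ?_
  ring

/-- The coefficients of the linear form `b x₀ + ∑ κ l (x l - β l x₀)`, `l ∈ I`. -/
def projCoef (β κ : ℕ → ℝ) (b : ℝ) (I : Finset ℕ) (l : ℕ) : ℝ :=
  (if l ∈ I then κ l else 0) + (b - ∑ i ∈ I, κ i * β i) * (Pi.single 0 1 : ℕ → ℝ) l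

lemma linForm_projCoef {D : Type*} (β κ : ℕ → ℝ) (b : ℝ) {I : Finset ℕ} {j : ℕ} (hj : 0 < j)
    (hI : ∀ l ∈ I, l < j) (x : D × (ℕ → ℝ)) :
    linForm (projCoef β κ b I) j x - b * x.2 0 = ∑ l ∈ I, κ l * gcoord β l x := by
  have h1 : linForm (projCoef β κ b I) j x = (∑ l ∈ I, κ l * x.2 l) +
      (b - ∑ i ∈ I, κ i * β i) * linForm (Pi.single 0 1) j x := by
    simp only [linForm, projCoef, add_mul, Finset.sum_add_distrib, Finset.mul_sum, mul_assoc]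
    congr 1
    have hsub : I ⊆ Finset.range j := fun l hl => Finset.mem_range.2 (hI l hl)
    rw [← Finset.sum_subset hsub fun l _ hl => by rw [if_neg hl, zero_mul]]
    exact Finset.sum_congr rfl fun l hl => by rw [if_pos hl]
  rw [h1, linForm_single hj]
  simp only [gcoord, mul_sub, Finset.sum_sub_distrib, sub_mul, Finset.sum_mul, mul_assoc]
  ring

variable {Ω : ℕ → Type*} [∀ N, MeasurableSpace (Ω N)] {P : ∀ N, Measure (Ω N)}
  [∀ N, IsProbabilityMeasure (P N)]

lemma RowState.tendsto_linForm {D : Type*} [MeasurableSpace D]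
    {r : ∀ q : Σ N, Ω N, Fin q.1 → D × (ℕ → ℝ)} {μ : Measure (D × (ℕ → ℝ))}
    (h : RowState P r μ) (c d : ℕ → ℝ) (j : ℕ) :
    Tendsto (fun q => (q.1 : ℝ)⁻¹ * ((∑ l ∈ Finset.range j, c l • cols r q l) ⬝ᵥ
      ∑ l ∈ Finset.range j, d l • cols r q l)) (whp P)
      (𝓝 (∫ x, linForm c j x * linForm d j x ∂μ)) := by
  have hprob := h.prob
  have h1 := h.lln.tendsto_avg (ψ := fun x => linForm c j x * linForm d j x)
    ((measurable_linForm c j).mul (measurable_linForm d j))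
    ((h.ui_lin c j).mul_of_sq (h.ui_lin d j))
  refine h1.congr fun q => ?_
  rw [← linForm_cols, ← linForm_cols, avg_mul_eq_dot]

/-- Isometric columns have the same second moments in the limit laws. -/
lemma integral_linForm_mul_eq {D D' : Type*} [MeasurableSpace D] [MeasurableSpace D']
    {r : ∀ q : Σ N, Ω N, Fin q.1 → D × (ℕ → ℝ)} {μ : Measure (D × (ℕ → ℝ))}
    {r' : ∀ q : Σ N, Ω N, Fin q.1 → D' × (ℕ → ℝ)} {μ' : Measure (D' × (ℕ → ℝ))}
    (h : RowState P r μ) (h' : RowState P r' μ') {j : ℕ}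
    {V : ∀ N, Ω N → Matrix.orthogonalGroup (Fin N) ℝ}
    (hV : ∀ q : Σ N, Ω N, ∀ l < j, (V q.1 q.2).1 *ᵥ cols r q l = cols r' q l) (c d : ℕ → ℝ) :
    ∫ x, linForm c j x * linForm d j x ∂μ = ∫ x, linForm c j x * linForm d j x ∂μ' := by
  refine tendsto_nhds_unique (h.tendsto_linForm c d j) ((h'.tendsto_linForm c d j).congr ?_)
  intro q
  have hs : ∀ c : ℕ → ℝ, (V q.1 q.2).1 *ᵥ (∑ l ∈ Finset.range j, c l • cols r q l) =
      ∑ l ∈ Finset.range j, c l • cols r' q l := by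
    intro c
    rw [Matrix.mulVec_sum]
    refine Finset.sum_congr rfl fun l hl => ?_
    rw [Matrix.mulVec_smul, hV q l (Finset.mem_range.1 hl)]
  rw [← hs c, ← hs d, dot_mulVec_of_orth (orth_transpose_mul _)]

lemma integral_mul_sub_sum {α : Type*} [MeasurableSpace α] {μ : Measure α} {f φ : α → ℝ}
    {g : ℕ → α → ℝ} {I : Finset ℕ} (hf : MemLp f 2 μ) (hφ : MemLp φ 2 μ)
    (hg : ∀ l ∈ I, MemLp (g l) 2 μ) (κ : ℕ → ℝ) :
    ∫ x, f x * (φ x - ∑ l ∈ I, κ l * g l x) ∂μ =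
      ∫ x, f x * φ x ∂μ - ∑ l ∈ I, κ l * ∫ x, f x * g l x ∂μ := by
  have h1 : ∀ l ∈ I, Integrable (fun x => κ l * (f x * g l x)) μ := fun l hl =>
    (hf.integrable_mul (hg l hl)).const_mul (κ l)
  have h2 : ∀ x, f x * (φ x - ∑ l ∈ I, κ l * g l x) =
      f x * φ x - ∑ l ∈ I, κ l * (f x * g l x) := by
    intro x
    rw [mul_sub, Finset.mul_sum]
    congr 1
    exact Finset.sum_congr rfl fun l _ => by ring
  have h3 : Integrable (fun x => f x * φ x) μ := hf.integrable_mul hφ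
  simp only [h2]
  rw [integral_sub h3 (integrable_finsetSum _ h1), integral_finsetSum _ h1]
  simp only [integral_const_mul]

variable {WA WB : Type*} [MeasurableSpace WA] [MeasurableSpace WB]

/-- The state of the process after `j` columns have been revealed.  The columns in `IA` are images
under `Vᵀ`, and the parts of them that are orthogonal to the signal are Gaussian in the limit law of
the rows `rA`; the columns in `IB` are images under `V`, and Gaussian in the limit law of `rB`.  The
two groups of Gaussian parts are uncorrelated with each other. -/
structure Inv (P : ∀ N, Measure (Ω N)) (rA : ∀ q : Σ N, Ω N, Fin q.1 → (WA × ℝ) × (ℕ → ℝ))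
    (rB : ∀ q : Σ N, Ω N, Fin q.1 → (WB × ℝ) × (ℕ → ℝ))
    (V : ∀ N, Ω N → Matrix.orthogonalGroup (Fin N) ℝ) (μA : Measure ((WA × ℝ) × (ℕ → ℝ)))
    (μB : Measure ((WB × ℝ) × (ℕ → ℝ))) (j : ℕ) (IA IB : Finset ℕ) (β : ℕ → ℝ) : Prop where
  stA : RowState P rA μA
  stB : RowState P rB μB
  gram : GramBound P (cols rA) j
  measV : ∀ N, Measurable (V N)
  maps : ∀ q : Σ N, Ω N, ∀ l < j, (V q.1 q.2).1 *ᵥ cols rA q l = cols rB q l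
  noiseA : UIArr P fun q n => (rA q n).1.2 ^ 2
  noiseB : UIArr P fun q n => (rB q n).1.2 ^ 2
  gaussA : GaussRep μA IA β
  gaussB : GaussRep μB IB β
  pos : 0 < j
  subA : ∀ i ∈ IA, 0 < i ∧ i < j
  subB : ∀ i ∈ IB, 0 < i ∧ i < j
  cover : ∀ i < j, i = 0 ∨ i ∈ IA ∨ i ∈ IB
  beta_zero : β 0 = 1
  beta : ∀ i < j, ∫ x, x.2 i * x.2 0 ∂μA = β i
  cross : ∀ i ∈ IA, ∀ l ∈ IB, ∫ x, gcoord β i x * gcoord β l x ∂μA = 0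
  initA : ∀ l ∈ IB, ∫ x, x.1.2 * gcoord β l x ∂μA = 0
  initB : ∀ i ∈ IA, ∫ x, x.1.2 * gcoord β i x ∂μB = 0

variable {rA : ∀ q : Σ N, Ω N, Fin q.1 → (WA × ℝ) × (ℕ → ℝ)}
  {rB : ∀ q : Σ N, Ω N, Fin q.1 → (WB × ℝ) × (ℕ → ℝ)}
  {V : ∀ N, Ω N → Matrix.orthogonalGroup (Fin N) ℝ} {μA : Measure ((WA × ℝ) × (ℕ → ℝ))}
  {μB : Measure ((WB × ℝ) × (ℕ → ℝ))} {j : ℕ} {IA IB : Finset ℕ} {β : ℕ → ℝ}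

/-- The two sides of the process play the same role. -/
lemma Inv.swap (h : Inv P rA rB V μA μB j IA IB β) :
    Inv P rB rA (fun N ω => (V N ω)⁻¹) μB μA j IB IA β where
  stA := h.stB
  stB := h.stA
  gram := h.gram.of_isometry fun q => ⟨V q.1 q.2, h.maps q⟩
  measV N := measurable_orth_inv.comp (h.measV N)
  maps q l hl := by
    rw [orth_inv_val, ← h.maps q l hl, Matrix.mulVec_mulVec, orth_transpose_mul,
      Matrix.one_mulVec]
  noiseA := h.noiseB
  noiseB := h.noiseA
  gaussA := h.gaussB
  gaussB := h.gaussA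
  pos := h.pos
  subA := h.subB
  subB := h.subA
  cover i hi := by
    rcases h.cover i hi with h | h | h
    exacts [Or.inl h, Or.inr (Or.inr h), Or.inr (Or.inl h)]
  beta_zero := h.beta_zero
  beta i hi := by
    have h1 := integral_linForm_mul_eq h.stA h.stB h.maps (Pi.single i 1) (Pi.single 0 1)
    simp only [linForm_single hi, linForm_single h.pos] at h1
    rw [← h1, h.beta i hi]
  cross l hl i hi := by
    have h1 := integral_linForm_mul_eq h.stA h.stB h.maps (gcoef β i) (gcoef β l)
    simp only [linForm_gcoef β h.pos (h.subA i hi).2, linForm_gcoef β h.pos (h.subB l hl).2] at h1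
    refine (integral_congr_ae (Eventually.of_forall fun x => mul_comm _ _)).trans ?_
    rw [← h1, h.cross i hi l hl]
  initA := h.initB
  initB := h.initA

lemma Inv.memLp_gcoord (h : Inv P rA rB V μA μB j IA IB β) (i : ℕ) :
    MemLp (fun x => gcoord β i x) 2 μA :=
  (h.stA.memLp_coord i).sub ((h.stA.memLp_coord 0).const_mul (β i))

lemma Inv.memLp_noise (h : Inv P rA rB V μA μB j IA IB β) : MemLp (fun x => x.1.2) 2 μA :=
  h.stA.memLp_of_ui (measurable_snd.comp measurable_fst) h.noiseA

lemma Inv.memLp_gvec (h : Inv P rA rB V μA μB j IA IB β) (i : ℕ) :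
    MemLp (fun x => gvec IA β x i) 2 μA := by
  have hp := h.stA.prob
  unfold gvec
  split_ifs
  · exact h.memLp_noise
  · exact h.memLp_gcoord i
  · exact memLp_const 0

/-- By the choice of `β`, the parts `gcoord β i` of the columns are uncorrelated with the signal.
-/
lemma Inv.integral_zero_mul_gcoord (h : Inv P rA rB V μA μB j IA IB β) {i : ℕ} (hi : i < j) :
    ∫ x, x.2 0 * gcoord β i x ∂μA = 0 := by
  have hp := h.stA.prob
  have h0 := h.stA.memLp_coord 0
  have h1 : ∀ x : (WA × ℝ) × (ℕ → ℝ), x.2 0 * gcoord β i x =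
      x.2 i * x.2 0 - β i * (x.2 0 * x.2 0) := by
    intro x; rw [gcoord]; ring
  have h2 : Integrable (fun x : (WA × ℝ) × (ℕ → ℝ) => x.2 i * x.2 0) μA :=
    (h.stA.memLp_coord i).integrable_mul h0
  have h3 : Integrable (fun x : (WA × ℝ) × (ℕ → ℝ) => x.2 0 * x.2 0) μA := h0.integrable_mul h0
  simp only [h1]
  rw [integral_sub h2 (h3.const_mul _),
    integral_const_mul, h.beta i hi, h.beta 0 h.pos, h.beta_zero]
  ring

lemma gcoord_insCol {D : Type*} {i j : ℕ} (hij : i ≠ j) (hj : j ≠ 0) (β : ℕ → ℝ) (b y : ℝ)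
    (x : D × (ℕ → ℝ)) : gcoord (Function.update β j b) i (insCol j (x, y)) = gcoord β i x := by
  simp [gcoord, insCol, Function.update_of_ne hij, Function.update_of_ne hj.symm]

lemma gcoord_insCol_self {D : Type*} {j : ℕ} (hj : j ≠ 0) (β : ℕ → ℝ) (b y : ℝ)
    (x : D × (ℕ → ℝ)) :
    gcoord (Function.update β j b) j (insCol j (x, y)) = y - b * x.2 0 := by
  simp [gcoord, insCol, Function.update_of_ne hj.symm]

/-- The state of the process is preserved by a step whose new vector `ψ` is a function of one
Gaussian variable and of the signal and the noise, if the part of `ψ` orthogonal to the signal is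
uncorrelated with this Gaussian variable. -/
theorem Inv.step (h : Inv P rA rB V μA μB j IA IB β) {ψ : (WA × ℝ) × (ℕ → ℝ) → ℝ}
    (hψ : Measurable ψ) {H : ℝ × (ℝ × WA) → ℝ} (hH : Measurable H) (p : ℕ)
    (hψH : ∀ x, ψ x = H (gvec IA β x p, sigNoise x))
    (hui : UIArr P fun q n => ψ (rA q n) ^ 2)
    (horth : ∫ x, gvec IA β x p * (ψ x - (∫ y, ψ y * y.2 0 ∂μA) * x.2 0) ∂μA = 0)
    (hres : ∀ N, rowLaw P (fun q n => insCol j (rB q n, ((V q.1 q.2).1 *ᵥ inp rA ψ q) n)) N =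
      rowLaw (withGauss P) (fun q n => insCol j (rB (base q) n, fresh rA rB V j ψ q n)) N) :
    ∃ μA' μB', Inv P (fun q n => insCol j (rA q n, ψ (rA q n)))
      (fun q n => insCol j (rB q n, ((V q.1 q.2).1 *ᵥ inp rA ψ q) n)) V μA' μB' (j + 1) IA
      (insert j IB) (Function.update β j (∫ y, ψ y * y.2 0 ∂μA)) := by
  have hpA := h.stA.prob
  have hpB := h.stB.prob
  set b := ∫ y, ψ y * y.2 0 ∂μA with hb
  have hj0 : j ≠ 0 := h.pos.ne'
  have hneA : ∀ i ∈ IA, i ≠ j := fun i hi => (h.subA i hi).2.ne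
  have hneB : ∀ i ∈ IB, i ≠ j := fun i hi => (h.subB i hi).2.ne
  have hψ2 : MemLp ψ 2 μA := h.stA.memLp_of_ui hψ hui
  have h0 : MemLp (fun x : (WA × ℝ) × (ℕ → ℝ) => x.2 0) 2 μA := h.stA.memLp_coord 0
  set φ : (WA × ℝ) × (ℕ → ℝ) → ℝ := fun x => ψ x - b * x.2 0 with hφ
  have hφ2 : MemLp φ 2 μA := hψ2.sub (h0.const_mul b)
  -- the new vector, without the signal, is uncorrelated with all the Gaussian variables
  have hG : ∀ i, ∫ x, gvec IA β x i * φ x ∂μA = 0 := by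
    let H' : ℝ × (ℝ × WA) → ℝ := fun y => H y - b * y.2.1
    have hH' : Measurable H' :=
      hH.sub (measurable_const.mul (measurable_fst.comp measurable_snd))
    have he : ∀ x, H' (gvec IA β x p, sigNoise x) = φ x := by
      intro x
      simp only [H', hφ, hψH, sigNoise]
    have := h.gaussA.integral_eq_zero hH' h.memLp_gvec p (by simpa only [he] using hφ2)
      (by simpa only [he] using horth)
    simpa only [he] using this
  have hg : ∀ i ∈ IA, ∫ x, gcoord β i x * φ x ∂μA = 0 := by
    intro i hi
    have h1 := hG i
    simpa only [gvec, if_neg (h.subA i hi).1.ne', if_pos hi] using h1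
  have hn0 : ∫ x, x.1.2 * φ x ∂μA = 0 := by
    have h1 := hG 0
    simpa only [gvec, if_true] using h1
  have hφ0 : ∫ x, x.2 0 * φ x ∂μA = 0 := by
    have h1 : ∀ x : (WA × ℝ) × (ℕ → ℝ), x.2 0 * φ x = ψ x * x.2 0 - b * (x.2 0 * x.2 0) := by
      intro x; simp only [hφ]; ring
    have h2 : Integrable (fun x : (WA × ℝ) × (ℕ → ℝ) => ψ x * x.2 0) μA := hψ2.integrable_mul h0
    have h3 : Integrable (fun x : (WA × ℝ) × (ℕ → ℝ) => x.2 0 * x.2 0) μA := h0.integrable_mul h0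
    simp only [h1]
    rw [integral_sub h2 (h3.const_mul _), integral_const_mul, ← hb, h.beta 0 h.pos, h.beta_zero]
    ring
  -- the projection onto the Gaussian parts of the columns in `IB`
  obtain ⟨κ, hκ⟩ := exists_projection hφ2 (g := gcoord β) IB fun i _ => h.memLp_gcoord i
  set c : ℕ → ℝ := projCoef β κ b IB
  have hsubB : ∀ l ∈ IB, l < j := fun l hl => (h.subB l hl).2
  have hR : ∀ x, ψ x - linForm c j x = φ x - ∑ l ∈ IB, κ l * gcoord β l x := by
    intro x
    rw [← linForm_projCoef β κ b h.pos hsubB x]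
    simp only [hφ]
    ring
  have hR2 : MemLp (fun x => ψ x - linForm c j x) 2 μA :=
    hψ2.sub (h.stA.memLp_of_ui (measurable_linForm c j) (h.stA.ui_lin c j))
  -- The residual of `ψ` is orthogonal to all columns: to those in `IA` since `φ` and, by `h.cross`,
  -- the parts of the columns in `IB` are uncorrelated with their Gaussian parts, to those in `IB`
  -- by projection.
  have hZ0 : ∫ x, x.2 0 * (ψ x - linForm c j x) ∂μA = 0 := by
    simp only [hR]
    rw [integral_mul_sub_sum h0 hφ2 (fun l _ => h.memLp_gcoord l), hφ0, zero_sub, neg_eq_zero]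
    exact Finset.sum_eq_zero fun l hl => by
      rw [h.integral_zero_mul_gcoord (h.subB l hl).2, mul_zero]
  have hZ : ∀ i < j, ∫ x, x.2 i * (ψ x - linForm c j x) ∂μA = 0 := by
    have key : ∀ i, ∫ x, gcoord β i x * (ψ x - linForm c j x) ∂μA = 0 →
        ∫ x, x.2 i * (ψ x - linForm c j x) ∂μA = 0 := by
      intro i hi
      have h1 : ∀ x : (WA × ℝ) × (ℕ → ℝ), x.2 i * (ψ x - linForm c j x) =
          gcoord β i x * (ψ x - linForm c j x) + β i * (x.2 0 * (ψ x - linForm c j x)) := by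
        intro x; rw [gcoord]; ring
      have h2 : Integrable (fun x => gcoord β i x * (ψ x - linForm c j x)) μA :=
        (h.memLp_gcoord i).integrable_mul hR2
      have h3 : Integrable (fun x => x.2 0 * (ψ x - linForm c j x)) μA := h0.integrable_mul hR2
      simp only [h1]
      rw [integral_add h2 (h3.const_mul _), integral_const_mul, hi, hZ0]
      ring
    intro i hi
    rcases h.cover i hi with rfl | hiA | hiB
    · exact hZ0
    · refine key i ?_
      simp only [hR]
      rw [integral_mul_sub_sum (h.memLp_gcoord i) hφ2 (fun l _ => h.memLp_gcoord l), hg i hiA,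
        zero_sub, neg_eq_zero]
      exact Finset.sum_eq_zero fun l hl => by rw [h.cross i hiA l hl, mul_zero]
    · refine key i ?_
      simp only [hR]
      exact hκ i hiB
  set s := √(∫ x, (ψ x - linForm c j x) ^ 2 ∂μA) with hs
  have hsd : StepData P rA rB μA μB V j ψ c s :=
    { stA := h.stA, stB := h.stB, gram := h.gram, measV := h.measV, maps := h.maps
      measψ := hψ, uiψ := hui, s_nonneg := Real.sqrt_nonneg _, normal := hZ
      dist := (Real.sq_sqrt (integral_nonneg fun x => sq_nonneg _)).symm }
  have hupd : Measurable fun x => insCol j (x, ψ x) :=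
    (measurable_insCol j).comp (measurable_id.prodMk hψ)
  have hinteg : ∀ f g : (WA × ℝ) × (ℕ → ℝ) → ℝ, Measurable f → Measurable g →
      ∫ x, f x * g x ∂(μA.map fun x => insCol j (x, ψ x)) =
        ∫ x, f (insCol j (x, ψ x)) * g (insCol j (x, ψ x)) ∂μA :=
    fun f g hf hg => integral_map hupd.aemeasurable (hf.mul hg).aestronglyMeasurable
  have hnoise : Measurable fun x : (WA × ℝ) × (ℕ → ℝ) => x.1.2 :=
    measurable_snd.comp measurable_fst
  have hnoiseB : Measurable fun x : (WB × ℝ) × (ℕ → ℝ) => x.1.2 :=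
    measurable_snd.comp measurable_fst
  -- on the first side the new column is a function of the row; on the second side it is a linear
  -- form in the columns plus an independent Gaussian variable
  refine ⟨μA.map fun x => insCol j (x, ψ x), stepLaw c s j μB, ?_⟩
  refine
    { stA := h.stA.map hψ hui j
      stB := hsd.rowState_image hres
      gram := hsd.gram_succ
      measV := h.measV
      maps := ?_
      noiseA := h.noiseA
      noiseB := h.noiseB
      gaussA := h.gaussA.map_insCol hj0 (fun hj => hneA j hj rfl) b hψ
      gaussB := h.gaussB.extend hj0 (fun h1 => (h.subB 0 h1).1.ne rfl)
        (fun hj => hneB j hj rfl) c s b κ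
        (linForm_projCoef β κ b h.pos hsubB)
      pos := Nat.succ_pos j
      subA := fun i hi => ⟨(h.subA i hi).1, (h.subA i hi).2.trans (Nat.lt_succ_self j)⟩
      subB := ?_
      cover := ?_
      beta_zero := by rw [Function.update_of_ne hj0.symm, h.beta_zero]
      beta := ?_
      cross := ?_
      initA := ?_
      initB := ?_ }
  · intro q l hl
    rcases (Nat.lt_succ_iff_lt_or_eq.1 hl) with hl | rfl
    · have h1 := h.maps q l hl
      have h2 : cols (fun q n => insCol j (rA q n, ψ (rA q n))) q l = cols rA q l := by
        funext n; simp [cols, insCol, Function.update_of_ne hl.ne]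
      have h3 : cols (fun q n => insCol j (rB q n, ((V q.1 q.2).1 *ᵥ inp rA ψ q) n)) q l =
          cols rB q l := by
        funext n; simp [cols, insCol, Function.update_of_ne hl.ne]
      rw [h2, h3, h1]
    · have h2 : cols (fun q n => insCol l (rA q n, ψ (rA q n))) q l = inp rA ψ q := by
        funext n; simp [cols, insCol, inp]
      have h3 : cols (fun q n => insCol l (rB q n, ((V q.1 q.2).1 *ᵥ inp rA ψ q) n)) q l =
          (V q.1 q.2).1 *ᵥ inp rA ψ q := by
        funext n; simp [cols, insCol]
      rw [h2, h3]
  · intro i hi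
    rcases Finset.mem_insert.1 hi with rfl | hi
    · exact ⟨h.pos, Nat.lt_succ_self _⟩
    · exact ⟨(h.subB i hi).1, (h.subB i hi).2.trans (Nat.lt_succ_self j)⟩
  · intro i hi
    rcases (Nat.lt_succ_iff_lt_or_eq.1 hi) with hi | rfl
    · rcases h.cover i hi with h1 | h1 | h1
      · exact Or.inl h1
      · exact Or.inr (Or.inl h1)
      · exact Or.inr (Or.inr (Finset.mem_insert_of_mem h1))
    · exact Or.inr (Or.inr (Finset.mem_insert_self _ _))
  · intro i hi
    rw [hinteg _ _ (measurable_coord i) (measurable_coord 0)]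
    rcases (Nat.lt_succ_iff_lt_or_eq.1 hi) with hi | rfl
    · simpa [insCol, Function.update_of_ne hi.ne, Function.update_of_ne hj0.symm]
        using h.beta i hi
    · simp [insCol, Function.update_of_ne hj0.symm, hb]
  · intro i hi l hl
    rw [hinteg _ _ (measurable_gcoord _ i) (measurable_gcoord _ l)]
    simp only [gcoord_insCol (hneA i hi) hj0]
    rcases Finset.mem_insert.1 hl with rfl | hl
    · simp only [gcoord_insCol_self hj0]
      exact hg i hi
    · simp only [gcoord_insCol (hneB l hl) hj0]
      exact h.cross i hi l hl
  · intro l hl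
    rw [hinteg _ _ hnoise (measurable_gcoord _ l)]
    rcases Finset.mem_insert.1 hl with rfl | hl
    · simp only [gcoord_insCol_self hj0]
      exact hn0
    · simp only [gcoord_insCol (hneB l hl) hj0]
      exact h.initA l hl
  · intro i hi
    have hm : Measurable fun x : (WB × ℝ) × (ℕ → ℝ) =>
        x.1.2 * gcoord (Function.update β j b) i x :=
      hnoiseB.mul (measurable_gcoord (Function.update β j b) i)
    have hi' : Measurable (insCol (D := WB × ℝ) j) := measurable_insCol j
    rw [stepLaw, pairLaw, Measure.map_map hi' (measurable_pairMap c s j),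
      integral_map (hi'.comp (measurable_pairMap c s j)).aemeasurable hm.aestronglyMeasurable]
    simp only [Function.comp_apply, pairMap, gcoord_insCol (hneA i hi) hj0]
    have h1 := integral_fun_fst (μ := μB) (ν := gaussianReal 0 1)
      (fun x : (WB × ℝ) × (ℕ → ℝ) => x.1.2 * gcoord β i x)
    rw [h.initB i hi] at h1
    simpa [insCol] using h1

end Invariant

/-! ### The canonical probability space of the process -/

section IID

variable {Ω : ℕ → Type*} [∀ N, MeasurableSpace (Ω N)] {P : ∀ N, Measure (Ω N)}
  [∀ N, IsProbabilityMeasure (P N)]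

/-- The empirical law of independent identically distributed rows. -/
lemma RowLLN.of_iid {Z : Type*} [MeasurableSpace Z] (ν : Measure Z) [IsProbabilityMeasure ν]
    {X : ∀ q : Σ N, Ω N, Fin q.1 → Z}
    (hX : ∀ N, MeasurePreserving (β := Fin N → Z) (fun ω => X ⟨N, ω⟩) (P N)
      (Measure.pi fun _ : Fin N => ν)) : RowLLN P X ν := by
  intro O hO
  have hind : Measurable (O.indicator fun _ => (1 : ℝ)) := measurable_const.indicator hO
  have h01 : ∀ x, 0 ≤ O.indicator (fun _ => (1 : ℝ)) x ∧ O.indicator (fun _ => (1 : ℝ)) x ≤ 1 :=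
    fun x => ⟨Set.indicator_nonneg (fun _ _ => zero_le_one) _,
      Set.indicator_le_self' (fun _ _ => zero_le_one) x⟩
  have hint : ∫ x, O.indicator (fun _ => (1 : ℝ)) x ∂ν = ν.real O := integral_indicator_one hO
  have hmZ : ∀ N : ℕ, Measurable fun v : Fin N → Z => (frac O v -
      avg fun _ : Fin N => ν.real O) ^ 2 := fun N =>
    ((measurable_frac hO measurable_id).sub measurable_const).pow_const 2
  have hm : ∀ N, Measurable fun ω : Ω N => (frac O (X ⟨N, ω⟩) -
      avg fun _ : Fin N => ν.real O) ^ 2 := fun N => (hmZ N).comp (hX N).measurable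
  have h2 : Tendsto (fun q : Σ N, Ω N => (frac O (X q) - avg fun _ : Fin q.1 => ν.real O) ^ 2)
      (whp P) (𝓝 0) := by
    refine tendsto_whp_zero_of_lintegral hm (fun q => sq_nonneg _) ?_
    have hlim : Tendsto (fun N : ℕ => ENNReal.ofReal ((N : ℝ)⁻¹)) atTop (𝓝 0) := by
      have := ENNReal.tendsto_ofReal (tendsto_inv_atTop_nhds_zero_nat (𝕜 := ℝ))
      simpa using this
    refine tendsto_of_tendsto_of_tendsto_of_le_of_le tendsto_const_nhds hlim (fun _ => zero_le) ?_
    intro N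
    have h3 := lintegral_sq_avg_sub_le ν (N := N)
      (f := fun _ x => O.indicator (fun _ => (1 : ℝ)) x) (fun _ => hind) (fun _ x => h01 x)
    simp only [hint] at h3
    refine le_trans (le_of_eq ?_) h3
    exact (hX N).lintegral_comp (hmZ N).ennreal_ofReal
  have h3 := h2.sqrt
  simp only [Real.sqrt_zero, Real.sqrt_sq_eq_abs] at h3
  have h4 := ((tendsto_zero_iff_abs_tendsto_zero _).2 h3).add_const (ν.real O)
  rw [zero_add] at h4
  refine h4.congr' ?_
  filter_upwards [eventually_whp_of_atTop (P := P) (eventually_gt_atTop 0)] with q hq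
  have hq' : (q.1 : ℝ) ≠ 0 := by exact_mod_cast hq.ne'
  simp only [avg, Finset.sum_const, Finset.card_univ, Fintype.card_fin, nsmul_eq_mul]
  field_simp
  ring

/-- Independent rows of one law are in the state given by this law. -/
lemma RowState.of_iid {Z D : Type*} [MeasurableSpace Z] [MeasurableSpace D] (ν : Measure Z)
    [IsProbabilityMeasure ν] {X : ∀ q : Σ N, Ω N, Fin q.1 → Z}
    (hX : ∀ N, MeasurePreserving (β := Fin N → Z) (fun ω => X ⟨N, ω⟩) (P N)
      (Measure.pi fun _ : Fin N => ν)) {f : Z → D × (ℕ → ℝ)} (hf : Measurable f)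
    (hL : ∀ i, MemLp (fun z => (f z).2 i) 2 ν) :
    RowState P (fun q n => f (X q n)) (ν.map f) := by
  have hm : ∀ N (n : Fin N), Measurable fun ω : Ω N => X ⟨N, ω⟩ n := fun N n =>
    (measurable_pi_apply n).comp (hX N).measurable
  have hmp : ∀ N (n : Fin N), MeasurePreserving (fun ω => X ⟨N, ω⟩ n) (P N) ν := fun N n =>
    (measurePreserving_eval (fun _ : Fin N => ν) n).comp (hX N)
  refine ⟨Measure.isProbabilityMeasure_map hf.aemeasurable, fun N => ?_,
    (RowLLN.of_iid ν hX).map hf, fun O hO hO0 => ?_, fun i => ?_⟩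
  · exact measurable_pi_lambda _ fun n : Fin N => hf.comp (hm N n)
  · rw [Measure.map_apply hf hO] at hO0
    suffices h2 : ∀ N, ∀ᵐ ω ∂(P N), ∀ n : Fin N, f (X ⟨N, ω⟩ n) ∉ O from eventually_whp_of_ae h2
    refine fun N => ae_all_iff.2 fun n => ?_
    have h1 : P N ((fun ω => X ⟨N, ω⟩ n) ⁻¹' (f ⁻¹' O)) = 0 := by
      rw [(hmp N n).measure_preimage (hf hO).nullMeasurableSet, hO0]
    exact measure_eq_zero_iff_ae_notMem.1 h1
  · have hmi : Measurable fun z : Z => (f z).2 i := (measurable_coord i).comp hf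
    exact (MeanUIArr.of_measurePreserving (hmi.pow_const 2) (hL i).integrable_sq hmp).uiArr
      fun N n => (hmi.pow_const 2).comp (hm N n)

end IID

section Transpose

/-- Exchanging the sides of a revealing process. -/
lemma revealRun_transpose {ι : Type*} [Fintype ι] (V : Matrix ι ι ℝ) (side : ℕ → Bool)
    (strat : ℕ → (ℕ → ι → ℝ) × (ℕ → ι → ℝ) → ι → ℝ) (k m : ℕ)
    (s : (ℕ → ι → ℝ) × (ℕ → ι → ℝ)) :
    (revealRun Vᵀ (fun m => !side m) (fun m s => strat m s.swap) m k s.swap).swap =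
      revealRun V side strat m k s := by
  induction k generalizing m s with
  | zero => simp [revealRun]
  | succ k ih =>
    rw [revealRun, revealRun, ← ih]
    congr 2
    cases h : side m <;> simp [revealStep, Prod.swap]

/-- The image under `Vᵀ` of the next vector can be resampled. -/
lemma CosetHaar.lintegral_resample_transpose {ι : Type*} [Fintype ι] [DecidableEq ι]
    (side : ℕ → Bool) {strat : ℕ → (ℕ → ι → ℝ) × (ℕ → ι → ℝ) → ι → ℝ}
    (hstrat : ∀ m, Measurable (strat m))
    {F : ((ℕ → ι → ℝ) × (ℕ → ι → ℝ)) × (ι → ℝ) → ℝ≥0∞} (hF : Measurable F)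
    {a : (ℕ → ι → ℝ) × (ℕ → ι → ℝ) → ι → ℝ} (ha : Measurable a) (k : ℕ) {m : ℕ}
    {A B : ℕ → ι → ℝ} {ν : Measure (Matrix.orthogonalGroup ι ℝ)} (h : CosetHaar m A B ν) :
    ∫⁻ V, F (revealRun V.1 side strat m k (A, B),
        V.1ᵀ *ᵥ a (revealRun V.1 side strat m k (A, B))) ∂ν =
      ∫⁻ V, ∫⁻ z, F (revealRun V.1 side strat m k (A, B),
        freshImage V.1ᵀ (revealRun V.1 side strat m k (A, B)).2
          (revealRun V.1 side strat m k (A, B)).1 (m + k)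
          (a (revealRun V.1 side strat m k (A, B))) z) ∂(stdG ι) ∂ν := by
  let strat' : ℕ → (ℕ → ι → ℝ) × (ℕ → ι → ℝ) → ι → ℝ := fun m s => strat m s.swap
  have hstrat' : ∀ m, Measurable (strat' m) := fun m => (hstrat m).comp measurable_swap
  let run' : Matrix.orthogonalGroup ι ℝ → (ℕ → ι → ℝ) × (ℕ → ι → ℝ) := fun W =>
    revealRun W.1 (fun m => !side m) strat' m k (B, A)
  have hrun' : Measurable run' := measurable_revealRun measurable_id
    (fun m => (hstrat' m).comp measurable_snd) _ measurable_const m k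
  have hr : ∀ V : Matrix.orthogonalGroup ι ℝ,
      revealRun V.1 side strat m k (A, B) = (run' V⁻¹).swap := fun V =>
    (revealRun_transpose V.1 side strat k m (A, B)).symm
  let F' : ((ℕ → ι → ℝ) × (ℕ → ι → ℝ)) × (ι → ℝ) → ℝ≥0∞ := fun p => F (p.1.swap, p.2)
  have hF' : Measurable F' :=
    hF.comp ((measurable_swap.comp measurable_fst).prodMk measurable_snd)
  have ha' : Measurable fun s : (ℕ → ι → ℝ) × (ℕ → ι → ℝ) => a s.swap := ha.comp measurable_swap
  have h1 := h.inv.lintegral_resample (fun m => !side m) hstrat' hF' ha' k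
  let G₂ : Matrix.orthogonalGroup ι ℝ × (ι → ℝ) → ℝ≥0∞ := fun q =>
    F' (run' q.1, freshImage q.1.1 (run' q.1).1 (run' q.1).2 (m + k) (a (run' q.1).swap) q.2)
  have hG₁ : Measurable fun W : Matrix.orthogonalGroup ι ℝ =>
      F' (run' W, W.1 *ᵥ a (run' W).swap) :=
    hF'.comp (hrun'.prodMk (measurable_orth_mulVec measurable_id (ha'.comp hrun')))
  have hG₂ : Measurable G₂ :=
    hF'.comp ((hrun'.comp measurable_fst).prodMk (measurable_freshImage measurable_fst
      (hrun'.comp measurable_fst).fst (hrun'.comp measurable_fst).snd (m + k)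
      (ha'.comp (hrun'.comp measurable_fst)) measurable_snd))
  have e1 := lintegral_map (μ := ν) hG₁ measurable_orth_inv
  have e2 := lintegral_map (μ := ν) (hG₂.lintegral_prod_right' (ν := stdG ι)) measurable_orth_inv
  simp only [hr]
  exact e1.symm.trans (h1.trans e2)

end Transpose

section Canonical

variable {WA WB : Type*} [MeasurableSpace WA] [MeasurableSpace WB]

/-- The data of one position: signal, noise and initial noise of the first side, noise and initial
noise of the second side. -/
abbrev RowData (WA WB : Type*) := ℝ × (WA × (ℝ × (WB × ℝ)))

/-- The noise and the initial noise of the first side. -/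
def RowData.noiseA (d : RowData WA WB) : WA × ℝ := (d.2.1, d.2.2.1)

/-- The noise and the initial noise of the second side. -/
def RowData.noiseB (d : RowData WA WB) : WB × ℝ := d.2.2.2

lemma measurable_noiseA : Measurable (RowData.noiseA (WA := WA) (WB := WB)) := by
  unfold RowData.noiseA
  fun_prop

lemma measurable_noiseB : Measurable (RowData.noiseB (WA := WA) (WB := WB)) := by
  unfold RowData.noiseB
  fun_prop

/-- The data of all positions and the orthogonal matrix. -/
abbrev Canon (WA WB : Type*) (N : ℕ) :=
  (Fin N → RowData WA WB) × Matrix.orthogonalGroup (Fin N) ℝ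

/-- The Haar probability measure of the orthogonal group. -/
noncomputable def orthHaar (N : ℕ) : Measure (Matrix.orthogonalGroup (Fin N) ℝ) :=
  (exists_biinvariant (⊤ : Subgroup (Matrix.orthogonalGroup (Fin N) ℝ)) isClosed_univ).choose

instance (N : ℕ) : IsProbabilityMeasure (orthHaar N) :=
  (exists_biinvariant (⊤ : Subgroup (Matrix.orthogonalGroup (Fin N) ℝ)) isClosed_univ).choose_spec.1

lemma orthHaar_map_mul_left {N : ℕ} (Q : Matrix.orthogonalGroup (Fin N) ℝ) :
    (orthHaar N).map (fun V => Q * V) = orthHaar N :=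
  (exists_biinvariant (⊤ : Subgroup (Matrix.orthogonalGroup (Fin N) ℝ))
    isClosed_univ).choose_spec.2.2.1 Q trivial

lemma orthHaar_map_mul_right {N : ℕ} (Q : Matrix.orthogonalGroup (Fin N) ℝ) :
    (orthHaar N).map (fun V => V * Q) = orthHaar N :=
  (exists_biinvariant (⊤ : Subgroup (Matrix.orthogonalGroup (Fin N) ℝ))
    isClosed_univ).choose_spec.2.2.2 Q trivial

lemma cosetHaar_orthHaar (N : ℕ) (A B : ℕ → Fin N → ℝ) : CosetHaar 0 A B (orthHaar N) where
  prob := inferInstance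
  supp := Eventually.of_forall fun _ l hl => absurd hl (Nat.not_lt_zero l)
  left Q _ := orthHaar_map_mul_left Q
  right Q _ := orthHaar_map_mul_right Q

/-- Independent rows of law `ρ` and an independent Haar matrix. -/
noncomputable def canonLaw (ρ : Measure (RowData WA WB)) (N : ℕ) : Measure (Canon WA WB N) :=
  (Measure.pi fun _ : Fin N => ρ).prod (orthHaar N)

/-- A revealing strategy in which every vector is a fixed function of the rows on one side. -/
structure Strategy (WA WB : Type*) [MeasurableSpace WA] [MeasurableSpace WB] where
  side : ℕ → Bool
  ψA : ℕ → (WA × ℝ) × (ℕ → ℝ) → ℝ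
  ψB : ℕ → (WB × ℝ) × (ℕ → ℝ) → ℝ
  measurable_ψA : ∀ m, Measurable (ψA m)
  measurable_ψB : ∀ m, Measurable (ψB m)

namespace Strategy

variable (σ : Strategy WA WB)

/-- The vector used in step `m`. -/
def vec {N : ℕ} (d : Fin N → RowData WA WB) (m : ℕ) (s : (ℕ → Fin N → ℝ) × (ℕ → Fin N → ℝ)) :
    Fin N → ℝ := fun n =>
  if σ.side m then σ.ψA m ((d n).noiseA, fun l => s.1 l n)
  else σ.ψB m ((d n).noiseB, fun l => s.2 l n)

/-- Before the first step, column `0` of the first side is the signal. -/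
def start {N : ℕ} (d : Fin N → RowData WA WB) : (ℕ → Fin N → ℝ) × (ℕ → Fin N → ℝ) :=
  (fun l n => if l = 0 then (d n).1 else 0, fun _ _ => 0)

/-- The columns after `k` steps. -/
def run (k : ℕ) (q : Σ N, Canon WA WB N) : (ℕ → Fin q.1 → ℝ) × (ℕ → Fin q.1 → ℝ) :=
  revealRun q.2.2.1 σ.side (σ.vec q.2.1) 0 k (start q.2.1)

/-- The rows of the first side after `k` steps. -/
def rowA (k : ℕ) (q : Σ N, Canon WA WB N) (n : Fin q.1) : (WA × ℝ) × (ℕ → ℝ) :=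
  ((q.2.1 n).noiseA, fun l => (σ.run k q).1 l n)

/-- The rows of the second side after `k` steps. -/
def rowB (k : ℕ) (q : Σ N, Canon WA WB N) (n : Fin q.1) : (WB × ℝ) × (ℕ → ℝ) :=
  ((q.2.1 n).noiseB, fun l => (σ.run k q).2 l n)

variable {σ}

lemma measurable_vec {N : ℕ} (m : ℕ) :
    Measurable fun q : (Fin N → RowData WA WB) × ((ℕ → Fin N → ℝ) × (ℕ → Fin N → ℝ)) =>
      σ.vec q.1 m q.2 := by
  refine measurable_pi_lambda _ fun n => ?_
  have hd : Measurable fun q : (Fin N → RowData WA WB) × ((ℕ → Fin N → ℝ) × (ℕ → Fin N → ℝ)) =>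
      q.1 n := (measurable_pi_apply n).comp measurable_fst
  unfold vec
  split_ifs
  · refine (σ.measurable_ψA m).comp ((measurable_noiseA.comp hd).prodMk
      (measurable_pi_lambda _ fun l => ?_))
    exact (measurable_pi_apply n).comp ((measurable_pi_apply l).comp measurable_snd.fst)
  · refine (σ.measurable_ψB m).comp ((measurable_noiseB.comp hd).prodMk
      (measurable_pi_lambda _ fun l => ?_))
    exact (measurable_pi_apply n).comp ((measurable_pi_apply l).comp measurable_snd.snd)

lemma measurable_start {N : ℕ} :
    Measurable (start : (Fin N → RowData WA WB) → (ℕ → Fin N → ℝ) × (ℕ → Fin N → ℝ)) := by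
  refine Measurable.prodMk ?_ measurable_const
  refine measurable_pi_lambda _ fun l => measurable_pi_lambda _ fun n => ?_
  by_cases hl : l = 0
  · simp only [hl, if_true]
    exact measurable_fst.comp (measurable_pi_apply n)
  · simp only [hl, if_false]
    exact measurable_const

lemma measurable_run (k N : ℕ) : Measurable
    (β := (ℕ → Fin N → ℝ) × (ℕ → Fin N → ℝ)) fun ω : Canon WA WB N => σ.run k ⟨N, ω⟩ :=
  measurable_revealRun (V := fun ω : Canon WA WB N => ω.2) measurable_snd
    (strat := fun ω => σ.vec ω.1)
    (fun m => (measurable_vec m).comp ((measurable_fst.comp measurable_fst).prodMk measurable_snd))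
    σ.side (measurable_start.comp measurable_fst) 0 k

lemma rowMeas_rowA (k : ℕ) : RowMeas (σ.rowA k) := by
  intro N
  refine measurable_pi_lambda _ fun n : Fin N => ?_
  refine (measurable_noiseA.comp ((measurable_pi_apply n).comp measurable_fst)).prodMk
    (measurable_pi_lambda _ fun l => ?_)
  exact (measurable_pi_apply n).comp ((measurable_pi_apply l).comp (measurable_run k N).fst)

lemma rowMeas_rowB (k : ℕ) : RowMeas (σ.rowB k) := by
  intro N
  refine measurable_pi_lambda _ fun n : Fin N => ?_
  refine (measurable_noiseB.comp ((measurable_pi_apply n).comp measurable_fst)).prodMk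
    (measurable_pi_lambda _ fun l => ?_)
  exact (measurable_pi_apply n).comp ((measurable_pi_apply l).comp (measurable_run k N).snd)

lemma run_succ (k : ℕ) (q : Σ N, Canon WA WB N) :
    σ.run (k + 1) q = revealStep q.2.2.1 (σ.side k) k (σ.vec q.2.1 k (σ.run k q)) (σ.run k q) := by
  have := revealRun_succ q.2.2.1 σ.side (σ.vec q.2.1) 0 k (start q.2.1)
  rwa [zero_add] at this

lemma vec_of_side {k : ℕ} (h : σ.side k = true) (q : Σ N, Canon WA WB N) :
    σ.vec q.2.1 k (σ.run k q) = inp (σ.rowA k) (σ.ψA k) q := by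
  funext n
  simp [vec, h, inp, rowA]

lemma vec_of_not_side {k : ℕ} (h : σ.side k = false) (q : Σ N, Canon WA WB N) :
    σ.vec q.2.1 k (σ.run k q) = inp (σ.rowB k) (σ.ψB k) q := by
  funext n
  simp [vec, h, inp, rowB]

lemma insCol_row {D : Type*} {N : ℕ} (e : D) (c : ℕ → Fin N → ℝ) (m : ℕ) (v : Fin N → ℝ)
    (n : Fin N) : ((e, fun l => Function.update c m v l n) : D × (ℕ → ℝ)) =
      insCol m ((e, fun l => c l n), v n) := by
  refine Prod.ext rfl (funext fun l => ?_)
  rcases eq_or_ne l m with rfl | hl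
  · simp [insCol]
  · simp [insCol, Function.update_of_ne hl]

lemma rowA_succ_of_side {k : ℕ} (h : σ.side k = true) :
    σ.rowA (k + 1) = fun q n => insCol k (σ.rowA k q n, σ.ψA k (σ.rowA k q n)) := by
  funext q n
  rw [rowA, run_succ, vec_of_side h]
  simp only [revealStep, h, if_true, insCol_row]
  rfl

lemma rowB_succ_of_side {k : ℕ} (h : σ.side k = true) :
    σ.rowB (k + 1) = fun q n => insCol k (σ.rowB k q n,
      (q.2.2.1 *ᵥ inp (σ.rowA k) (σ.ψA k) q) n) := by
  funext q n
  rw [rowB, run_succ, vec_of_side h]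
  simp only [revealStep, h, if_true, insCol_row]
  rfl

lemma rowB_succ_of_not_side {k : ℕ} (h : σ.side k = false) :
    σ.rowB (k + 1) = fun q n => insCol k (σ.rowB k q n, σ.ψB k (σ.rowB k q n)) := by
  funext q n
  rw [rowB, run_succ, vec_of_not_side h]
  simp only [revealStep, h, Bool.false_eq_true, if_false, insCol_row]
  rfl

lemma rowA_succ_of_not_side {k : ℕ} (h : σ.side k = false) :
    σ.rowA (k + 1) = fun q n => insCol k (σ.rowA k q n,
      ((q.2.2⁻¹).1 *ᵥ inp (σ.rowB k) (σ.ψB k) q) n) := by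
  funext q n
  rw [rowA, run_succ, vec_of_not_side h]
  simp only [revealStep, h, Bool.false_eq_true, if_false, insCol_row, orth_inv_val]
  rfl

variable (ρ : Measure (RowData WA WB)) [IsProbabilityMeasure ρ]

instance (N : ℕ) : IsProbabilityMeasure (canonLaw ρ N) := by unfold canonLaw; infer_instance

/-- Laws on the canonical space can be compared for fixed data of the positions. -/
lemma canonLaw_map_eq {D : Type*} [MeasurableSpace D] {N : ℕ} {f₁ : Canon WA WB N → D}
    {f₂ : Canon WA WB N × (Fin N → ℝ) → D} (h1 : Measurable f₁) (h2 : Measurable f₂)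
    (h : ∀ (d : Fin N → RowData WA WB) (G : D → ℝ≥0∞), Measurable G →
      ∫⁻ V, G (f₁ (d, V)) ∂(orthHaar N) =
        ∫⁻ V, ∫⁻ z, G (f₂ ((d, V), z)) ∂(stdG (Fin N)) ∂(orthHaar N)) :
    (canonLaw ρ N).map f₁ = (withGauss (canonLaw ρ) N).map f₂ := by
  refine Measure.ext fun O hO => ?_
  have hind : Measurable (O.indicator (1 : D → ℝ≥0∞)) := measurable_one.indicator hO
  rw [← lintegral_indicator_one hO, ← lintegral_indicator_one hO, lintegral_map hind h1,
    lintegral_map hind h2, withGauss,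
    lintegral_prod (fun z => O.indicator (1 : D → ℝ≥0∞) (f₂ z)) (hind.comp h2).aemeasurable,
    canonLaw, lintegral_prod (fun z => O.indicator (1 : D → ℝ≥0∞) (f₁ z))
      (hind.comp h1).aemeasurable,
    lintegral_prod (fun x => ∫⁻ y, O.indicator (1 : D → ℝ≥0∞) (f₂ (x, y)) ∂(stdG (Fin N)))
      (Measurable.lintegral_prod_right' (hind.comp h2)).aemeasurable]
  exact lintegral_congr fun d => h d _ hind

lemma rowMeas_inp {D : Type*} [MeasurableSpace D] {Ω : ℕ → Type*} [∀ N, MeasurableSpace (Ω N)]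
    {r : ∀ q : Σ N, Ω N, Fin q.1 → D × (ℕ → ℝ)} (hr : RowMeas r) {ψ : D × (ℕ → ℝ) → ℝ}
    (hψ : Measurable ψ) (N : ℕ) : Measurable (β := Fin N → ℝ) fun ω : Ω N => inp r ψ ⟨N, ω⟩ :=
  measurable_pi_lambda _ fun n : Fin N => hψ.comp (hr.apply N n)

lemma measurable_cols_rowA (k N : ℕ) : Measurable (β := ℕ → Fin N → ℝ)
    fun ω : Canon WA WB N => cols (σ.rowA k) ⟨N, ω⟩ := (measurable_run k N).fst

lemma measurable_cols_rowB (k N : ℕ) : Measurable (β := ℕ → Fin N → ℝ)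
    fun ω : Canon WA WB N => cols (σ.rowB k) ⟨N, ω⟩ := (measurable_run k N).snd

/-- In a step from the first to the second side, the image can be resampled. -/
lemma rowLaw_of_side {k : ℕ} {ψ : (WA × ℝ) × (ℕ → ℝ) → ℝ} (hψ : Measurable ψ) (N : ℕ) :
    rowLaw (canonLaw ρ) (fun q n => insCol k (σ.rowB k q n,
        (q.2.2.1 *ᵥ inp (σ.rowA k) ψ q) n)) N =
      rowLaw (withGauss (canonLaw ρ)) (fun q n => insCol k (σ.rowB k (base q) n,
        fresh (σ.rowA k) (σ.rowB k) (fun _ ω => ω.2) k ψ q n)) N := by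
  have hi := rowMeas_inp (rowMeas_rowA (σ := σ) k) hψ N
  have hA := measurable_cols_rowA (σ := σ) k N
  have hB := measurable_cols_rowB (σ := σ) k N
  have hrow := rowMeas_rowB (σ := σ) k
  refine canonLaw_map_eq ρ ?_ ?_ fun d G hG => ?_
  · exact measurable_pi_lambda _ fun n : Fin N => (measurable_insCol k).comp
      ((hrow.apply N n).prodMk
        ((measurable_pi_apply n).comp (measurable_orth_mulVec measurable_snd hi)))
  · exact measurable_pi_lambda _ fun n : Fin N => (measurable_insCol k).comp
      (((hrow.apply N n).comp measurable_fst).prodMk ((measurable_pi_apply n).comp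
        (measurable_freshImage measurable_fst.snd (hA.comp measurable_fst)
          (hB.comp measurable_fst) k (hi.comp measurable_fst) measurable_snd)))
  · -- for fixed data `d` of the positions, only the columns depend on the matrix
    let a : (ℕ → Fin N → ℝ) × (ℕ → Fin N → ℝ) → Fin N → ℝ := fun s n =>
      ψ ((d n).noiseA, fun l => s.1 l n)
    let F : ((ℕ → Fin N → ℝ) × (ℕ → Fin N → ℝ)) × (Fin N → ℝ) → ℝ≥0∞ := fun p =>
      G fun n => insCol k (((d n).noiseB, fun l => p.1.2 l n), p.2 n)
    have ha : Measurable a := measurable_pi_lambda _ fun n => hψ.comp (measurable_const.prodMk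
      (measurable_pi_lambda _ fun l =>
        (measurable_pi_apply n).comp ((measurable_pi_apply l).comp measurable_fst)))
    have hF : Measurable F := hG.comp (measurable_pi_lambda _ fun n =>
      (measurable_insCol k).comp ((measurable_const.prodMk (measurable_pi_lambda _ fun l =>
        (measurable_pi_apply n).comp ((measurable_pi_apply l).comp measurable_fst.snd))).prodMk
        ((measurable_pi_apply n).comp measurable_snd)))
    have h3 := (cosetHaar_orthHaar N (start d).1 (start d).2).lintegral_resample σ.side
      (strat := σ.vec d) (fun m => (measurable_vec m).comp (measurable_const.prodMk measurable_id))
      hF ha k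
    simp only [zero_add] at h3
    exact h3

/-- In a step from the second to the first side, the image can be resampled. -/
lemma rowLaw_of_not_side {k : ℕ} {ψ : (WB × ℝ) × (ℕ → ℝ) → ℝ} (hψ : Measurable ψ) (N : ℕ) :
    rowLaw (canonLaw ρ) (fun q n => insCol k (σ.rowA k q n,
        ((q.2.2⁻¹).1 *ᵥ inp (σ.rowB k) ψ q) n)) N =
      rowLaw (withGauss (canonLaw ρ)) (fun q n => insCol k (σ.rowA k (base q) n,
        fresh (σ.rowB k) (σ.rowA k) (fun _ ω => ω.2⁻¹) k ψ q n)) N := by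
  have hi := rowMeas_inp (rowMeas_rowB (σ := σ) k) hψ N
  have hA := measurable_cols_rowA (σ := σ) k N
  have hB := measurable_cols_rowB (σ := σ) k N
  have hrow := rowMeas_rowA (σ := σ) k
  refine canonLaw_map_eq ρ ?_ ?_ fun d G hG => ?_
  · exact measurable_pi_lambda _ fun n : Fin N => (measurable_insCol k).comp
      ((hrow.apply N n).prodMk ((measurable_pi_apply n).comp
        (measurable_orth_mulVec (measurable_orth_inv.comp measurable_snd) hi)))
  · exact measurable_pi_lambda _ fun n : Fin N => (measurable_insCol k).comp
      (((hrow.apply N n).comp measurable_fst).prodMk ((measurable_pi_apply n).comp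
        (measurable_freshImage (measurable_orth_inv.comp measurable_fst.snd)
          (hB.comp measurable_fst) (hA.comp measurable_fst) k (hi.comp measurable_fst)
          measurable_snd)))
  · let a : (ℕ → Fin N → ℝ) × (ℕ → Fin N → ℝ) → Fin N → ℝ := fun s n =>
      ψ ((d n).noiseB, fun l => s.2 l n)
    let F : ((ℕ → Fin N → ℝ) × (ℕ → Fin N → ℝ)) × (Fin N → ℝ) → ℝ≥0∞ := fun p =>
      G fun n => insCol k (((d n).noiseA, fun l => p.1.1 l n), p.2 n)
    have ha : Measurable a := measurable_pi_lambda _ fun n => hψ.comp (measurable_const.prodMk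
      (measurable_pi_lambda _ fun l =>
        (measurable_pi_apply n).comp ((measurable_pi_apply l).comp measurable_snd)))
    have hF : Measurable F := hG.comp (measurable_pi_lambda _ fun n =>
      (measurable_insCol k).comp ((measurable_const.prodMk (measurable_pi_lambda _ fun l =>
        (measurable_pi_apply n).comp ((measurable_pi_apply l).comp measurable_fst.fst))).prodMk
        ((measurable_pi_apply n).comp measurable_snd)))
    have h3 := (cosetHaar_orthHaar N (start d).1 (start d).2).lintegral_resample_transpose σ.side
      (strat := σ.vec d) (fun m => (measurable_vec m).comp (measurable_const.prodMk measurable_id))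
      hF ha k
    simp only [zero_add] at h3
    exact h3

end Strategy

end Canonical

/-! ### Limits of expectations -/

section Mean

variable {Ω : ℕ → Type*} [∀ N, MeasurableSpace (Ω N)] {P : ∀ N, Measure (Ω N)}

/-- Uniform integrability of a sequence of random variables on different probability spaces: up to
a part of small expectation they are bounded. -/
def MeanUI (P : ∀ N, Measure (Ω N)) (Z : (Σ N, Ω N) → ℝ) : Prop :=
  ∀ ε > 0, ∃ (M : ℝ) (T : ∀ N, Ω N → ℝ≥0∞), 0 ≤ M ∧ (∀ N, Measurable (T N)) ∧
    (∀ N ω, ENNReal.ofReal |Z ⟨N, ω⟩| ≤ ENNReal.ofReal M + T N ω) ∧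
    ∀ N, ∫⁻ ω, T N ω ∂(P N) ≤ ENNReal.ofReal ε

variable {Z Z' : (Σ N, Ω N) → ℝ}

lemma MeanUI.mono (h : MeanUI P Z') (hle : ∀ q, |Z q| ≤ |Z' q|) : MeanUI P Z := by
  intro ε hε
  obtain ⟨M, T, hM, hT, hZ, hI⟩ := h ε hε
  exact ⟨M, T, hM, hT, fun N ω => (ENNReal.ofReal_le_ofReal (hle _)).trans (hZ N ω), hI⟩

lemma MeanUI.add (h : MeanUI P Z) (h' : MeanUI P Z') : MeanUI P fun q => Z q + Z' q := by
  intro ε hε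
  obtain ⟨M, T, hM, hT, hZ, hI⟩ := h (ε / 2) (by positivity)
  obtain ⟨M', T', hM', hT', hZ', hI'⟩ := h' (ε / 2) (by positivity)
  refine ⟨M + M', fun N ω => T N ω + T' N ω, by positivity, fun N => (hT N).add (hT' N),
    fun N ω => ?_, fun N => ?_⟩
  · refine (ENNReal.ofReal_le_ofReal (abs_add_le _ _)).trans ?_
    rw [ENNReal.ofReal_add (abs_nonneg _) (abs_nonneg _), ENNReal.ofReal_add hM hM']
    refine (add_le_add (hZ N ω) (hZ' N ω)).trans (le_of_eq ?_)
    ring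
  · rw [lintegral_add_left (hT N), ← add_halves ε, ENNReal.ofReal_add (by positivity)
      (by positivity)]
    exact add_le_add (hI N) (hI' N)

lemma MeanUI.const_mul (h : MeanUI P Z) (t : ℝ) : MeanUI P fun q => t * Z q := by
  intro ε hε
  have ht : 0 < |t| + 1 := by positivity
  obtain ⟨M, T, hM, hT, hZ, hI⟩ := h (ε / (|t| + 1)) (by positivity)
  refine ⟨(|t| + 1) * M, fun N ω => ENNReal.ofReal (|t| + 1) * T N ω, by positivity,
    fun N => (hT N).const_mul _, fun N ω => ?_, fun N => ?_⟩
  · rw [ENNReal.ofReal_mul ht.le, ← mul_add]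
    calc ENNReal.ofReal |t * Z ⟨N, ω⟩| ≤ ENNReal.ofReal ((|t| + 1) * |Z ⟨N, ω⟩|) := by
          refine ENNReal.ofReal_le_ofReal ?_
          rw [abs_mul]
          gcongr
          linarith
      _ = ENNReal.ofReal (|t| + 1) * ENNReal.ofReal |Z ⟨N, ω⟩| := ENNReal.ofReal_mul ht.le
      _ ≤ _ := by gcongr; exact hZ N ω
  · rw [lintegral_const_mul _ (hT N)]
    calc _ ≤ ENNReal.ofReal (|t| + 1) * ENNReal.ofReal (ε / (|t| + 1)) := by gcongr; exact hI N
      _ = ENNReal.ofReal ε := by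
        rw [← ENNReal.ofReal_mul ht.le]
        congr 1
        field_simp

/-- Averages of a uniformly integrable array are uniformly integrable. -/
lemma MeanUIArr.meanUI {y : ∀ q : Σ N, Ω N, Fin q.1 → ℝ} (h : MeanUIArr P y)
    (hm : ∀ N (n : Fin N), Measurable fun ω => y ⟨N, ω⟩ n) : MeanUI P fun q => avg (y q) := by
  intro ε hε
  obtain ⟨M, hM, hI⟩ := h ε hε
  refine ⟨M, fun N ω => ENNReal.ofReal (avg fun n : Fin N => tailPart M (y ⟨N, ω⟩ n)), hM,
    fun N => (measurable_avg' fun n => (measurable_tailPart M).comp (hm N n)).ennreal_ofReal,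
    fun N ω => ?_, hI⟩
  rw [← ENNReal.ofReal_add hM (avg_nonneg fun n => tailPart_nonneg _ _)]
  refine ENNReal.ofReal_le_ofReal ((abs_avg_le _).trans
    ((avg_mono fun n => abs_le_add_tailPart hM _).trans ?_))
  rw [avg_add]
  gcongr
  exact avg_le_of_le hM fun _ => le_rfl

lemma MeanUI.integrable [∀ N, IsProbabilityMeasure (P N)] (h : MeanUI P Z)
    (hm : ∀ N, Measurable fun ω => Z ⟨N, ω⟩) (N : ℕ) : Integrable (fun ω => Z ⟨N, ω⟩) (P N) := by
  obtain ⟨M, T, hM, hT, hZ, hI⟩ := h 1 one_pos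
  refine ⟨(hm N).aestronglyMeasurable, ?_⟩
  rw [hasFiniteIntegral_iff_norm]
  calc ∫⁻ ω, ENNReal.ofReal ‖Z ⟨N, ω⟩‖ ∂(P N) ≤ ∫⁻ ω, (ENNReal.ofReal M + T N ω) ∂(P N) :=
        lintegral_mono fun ω => hZ N ω
    _ ≤ ENNReal.ofReal M + ENNReal.ofReal 1 := by
        rw [lintegral_add_left measurable_const, lintegral_const, measure_univ, mul_one]
        gcongr
        exact hI N
    _ < ⊤ := by simp

/-- Uniformly integrable variables that converge in probability converge in mean. -/
lemma MeanUI.tendsto_integral [∀ N, IsProbabilityMeasure (P N)] (h : MeanUI P Z)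
    (hm : ∀ N, Measurable fun ω => Z ⟨N, ω⟩) {c : ℝ} (hc : Tendsto Z (whp P) (𝓝 c)) :
    Tendsto (fun N => ∫ ω, Z ⟨N, ω⟩ ∂(P N)) atTop (𝓝 c) := by
  rw [Metric.tendsto_nhds]
  intro ε hε
  obtain ⟨M, T, hM, hT, hZ, hI⟩ := h (ε / 4) (by positivity)
  have hK : 0 < M + |c| + 1 := by positivity
  filter_upwards [eventually_whp_iff.1 (tendsto_whp_iff.1 hc (ε / 4) (by positivity))
    (ε / 4 / (M + |c| + 1)) (by positivity)] with N hN
  have hint := h.integrable hm N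
  -- split off the unlikely event of a large deviation, on which `Z` is bounded up to `T`
  set E : Set (Ω N) := {ω | ¬ |Z ⟨N, ω⟩ - c| < ε / 4} with hE
  have hEm : MeasurableSet E :=
    (measurableSet_lt ((hm N).sub_const c).abs measurable_const).compl
  have hpt : ∀ ω, ENNReal.ofReal ‖Z ⟨N, ω⟩ - c‖ ≤
      (ENNReal.ofReal (ε / 4) + E.indicator (fun _ => ENNReal.ofReal (M + |c| + 1)) ω) + T N ω := by
    intro ω
    by_cases hω : ω ∈ E
    · rw [Set.indicator_of_mem hω]
      calc ENNReal.ofReal ‖Z ⟨N, ω⟩ - c‖ ≤ ENNReal.ofReal (|Z ⟨N, ω⟩| + |c|) :=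
            ENNReal.ofReal_le_ofReal (abs_sub _ _)
        _ = ENNReal.ofReal |Z ⟨N, ω⟩| + ENNReal.ofReal |c| :=
            ENNReal.ofReal_add (abs_nonneg _) (abs_nonneg _)
        _ ≤ (ENNReal.ofReal M + T N ω) + ENNReal.ofReal |c| := by gcongr; exact hZ N ω
        _ = ENNReal.ofReal (M + |c|) + T N ω := by
            rw [ENNReal.ofReal_add hM (abs_nonneg _)]; ring
        _ ≤ _ := by
            gcongr
            refine le_add_left (ENNReal.ofReal_le_ofReal (by linarith))
    · have hω' : |Z ⟨N, ω⟩ - c| < ε / 4 := not_not.1 hω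
      refine le_add_right (le_add_right (ENNReal.ofReal_le_ofReal ?_))
      rw [Real.norm_eq_abs]
      exact hω'.le
  have hlin : ∫⁻ ω, ENNReal.ofReal ‖Z ⟨N, ω⟩ - c‖ ∂(P N) ≤ ENNReal.ofReal (3 * ε / 4) := by
    refine (lintegral_mono hpt).trans ?_
    rw [lintegral_add_right _ (hT N), lintegral_add_left measurable_const, lintegral_const,
      measure_univ, mul_one, lintegral_indicator_const hEm]
    calc _ ≤ ENNReal.ofReal (ε / 4) + ENNReal.ofReal (M + |c| + 1) *
            ENNReal.ofReal (ε / 4 / (M + |c| + 1)) + ENNReal.ofReal (ε / 4) := by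
          gcongr
          exact hI N
      _ = ENNReal.ofReal (3 * ε / 4) := by
          rw [← ENNReal.ofReal_mul hK.le, ← ENNReal.ofReal_add (by positivity) (by positivity),
            ← ENNReal.ofReal_add (by positivity) (by positivity)]
          congr 1
          field_simp
          ring
  have h1 : (∫ ω, Z ⟨N, ω⟩ ∂(P N)) - c = ∫ ω, (Z ⟨N, ω⟩ - c) ∂(P N) := by
    rw [integral_sub hint (integrable_const c)]
    simp
  rw [Real.dist_eq, h1]
  refine lt_of_le_of_lt ((norm_integral_le_lintegral_norm _).trans
    (ENNReal.toReal_mono ENNReal.ofReal_ne_top hlin)) ?_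
  rw [ENNReal.toReal_ofReal (by positivity)]
  linarith

/-- Random vectors whose normalized squared norms are uniformly integrable. -/
structure SqUI (P : ∀ N, Measure (Ω N)) (u : ∀ q : Σ N, Ω N, Fin q.1 → ℝ) : Prop where
  meas : RowMeas u
  ui : MeanUI P fun q => (q.1 : ℝ)⁻¹ * (u q ⬝ᵥ u q)

variable {u v s : ∀ q : Σ N, Ω N, Fin q.1 → ℝ}

lemma normalized_dot_self_nonneg {N : ℕ} (v : Fin N → ℝ) : 0 ≤ (N : ℝ)⁻¹ * (v ⬝ᵥ v) := by
  rw [← nn_sq]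
  positivity

lemma SqUI.meanUI_dot (hu : SqUI P u) (hv : SqUI P v) :
    MeanUI P fun q => (q.1 : ℝ)⁻¹ * (u q ⬝ᵥ v q) := by
  refine (hu.ui.add hv.ui).mono fun q => ?_
  rw [abs_of_nonneg (add_nonneg (normalized_dot_self_nonneg _) (normalized_dot_self_nonneg _)), ← nn_sq, ← nn_sq,
    ← avg_mul_eq_dot, nn_sq, nn_sq, ← avg_mul_eq_dot, ← avg_mul_eq_dot, ← avg_add]
  refine (abs_avg_le _).trans (avg_mono fun n => ?_)
  rw [abs_mul]
  nlinarith [sq_nonneg (|u q n| - |v q n|), abs_mul_abs_self (u q n), abs_mul_abs_self (v q n),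
    mul_self_nonneg (u q n), mul_self_nonneg (v q n)]

lemma SqUI.measurable_dot (hu : SqUI P u) (hv : SqUI P v) (N : ℕ) :
    Measurable fun ω : Ω N => u ⟨N, ω⟩ ⬝ᵥ v ⟨N, ω⟩ := OAMP.measurable_dot (hu.meas N) (hv.meas N)

lemma SqUI.measurable_normalized_dot (hu : SqUI P u) (hv : SqUI P v) (N : ℕ) :
    Measurable fun ω : Ω N => ((⟨N, ω⟩ : Σ N, Ω N).1 : ℝ)⁻¹ * (u ⟨N, ω⟩ ⬝ᵥ v ⟨N, ω⟩) :=
  (hu.measurable_dot hv N).const_mul (N : ℝ)⁻¹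

lemma SqUI.integrable_dot [∀ N, IsProbabilityMeasure (P N)] (hu : SqUI P u) (hv : SqUI P v)
    (N : ℕ) : Integrable (fun ω => u ⟨N, ω⟩ ⬝ᵥ v ⟨N, ω⟩) (P N) := by
  rcases Nat.eq_zero_or_pos N with rfl | hN
  · simp
  · have h1 := (hu.meanUI_dot hv).integrable (hu.measurable_normalized_dot hv) N
    have h2 := h1.const_mul (N : ℝ)
    have hN' : (N : ℝ) ≠ 0 := by exact_mod_cast hN.ne'
    simpa only [mul_inv_cancel_left₀ hN'] using h2

lemma SqUI.tendsto_integral_dot [∀ N, IsProbabilityMeasure (P N)] (hu : SqUI P u)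
    (hv : SqUI P v) {c : ℝ}
    (h : Tendsto (fun q => (q.1 : ℝ)⁻¹ * (u q ⬝ᵥ v q)) (whp P) (𝓝 c)) :
    Tendsto (fun N : ℕ => (N : ℝ)⁻¹ * ∫ ω, u ⟨N, ω⟩ ⬝ᵥ v ⟨N, ω⟩ ∂(P N)) atTop (𝓝 c) := by
  have h1 := (hu.meanUI_dot hv).tendsto_integral (hu.measurable_normalized_dot hv) h
  exact h1.congr fun N => integral_const_mul (N : ℝ)⁻¹ _

lemma SqUI.add (hu : SqUI P u) (hv : SqUI P v) : SqUI P fun q => u q + v q := by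
  refine ⟨fun N => (hu.meas N).add (hv.meas N), ?_⟩
  refine ((hu.ui.add hv.ui).const_mul 2).mono fun q => ?_
  have h0 := normalized_dot_self_nonneg (u q)
  have h1 := normalized_dot_self_nonneg (v q)
  rw [abs_of_nonneg (normalized_dot_self_nonneg (u q + v q)), abs_of_nonneg (by positivity), ← nn_sq,
    ← nn_sq, ← nn_sq]
  have h2 := nn_add_le (u q) (v q)
  have h3 := nn_nonneg (u q + v q)
  nlinarith [sq_nonneg (nn (u q) - nn (v q)), nn_nonneg (u q), nn_nonneg (v q)]

lemma SqUI.const_smul (hu : SqUI P u) (t : ℝ) : SqUI P fun q => t • u q := by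
  refine ⟨fun N => (hu.meas N).const_smul t, ?_⟩
  refine (hu.ui.const_mul (t ^ 2)).mono fun q => le_of_eq ?_
  rw [smul_dotProduct, dotProduct_smul, smul_eq_mul, smul_eq_mul]
  congr 1
  ring

lemma SqUI.of_array {y : ∀ q : Σ N, Ω N, Fin q.1 → ℝ} (hm : RowMeas y)
    (h : MeanUIArr P fun q n => y q n ^ 2) : SqUI P y := by
  refine ⟨hm, (h.meanUI fun N n => (hm.apply N n).pow_const 2).mono fun q => le_of_eq ?_⟩
  rw [← avg_mul_eq_dot]
  simp only [sq]

lemma SqUI.mulVec (hu : SqUI P u) {V : ∀ N, Ω N → Matrix.orthogonalGroup (Fin N) ℝ}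
    (hV : ∀ N, Measurable (V N)) : SqUI P fun q => (V q.1 q.2).1 *ᵥ u q := by
  refine ⟨fun N => measurable_orth_mulVec (hV N) (hu.meas N), hu.ui.mono fun q => le_of_eq ?_⟩
  rw [dot_mulVec_of_orth (orth_transpose_mul _)]

end Mean

section GramSchmidtLimit

variable {Ω : ℕ → Type*} [∀ N, MeasurableSpace (Ω N)] {P : ∀ N, Measure (Ω N)}
  [∀ N, IsProbabilityMeasure (P N)] {u v s : ∀ q : Σ N, Ω N, Fin q.1 → ℝ} {a b c : ℝ}

/-- The Gram-Schmidt error of `u` with respect to `s`, for every length. -/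
noncomputable def gsErr (P : ∀ N, Measure (Ω N)) (s u : ∀ q : Σ N, Ω N, Fin q.1 → ℝ)
    (q : Σ N, Ω N) : Fin q.1 → ℝ :=
  gsError (P q.1) (fun ω => s ⟨q.1, ω⟩) (fun ω => u ⟨q.1, ω⟩) q.2

lemma tendsto_gsCoeff (hu : SqUI P u) (hs : SqUI P s)
    (h : Tendsto (fun q => (q.1 : ℝ)⁻¹ * (u q ⬝ᵥ s q)) (whp P) (𝓝 a)) :
    Tendsto (fun N : ℕ => gsCoeff (P N) (fun ω => s ⟨N, ω⟩) (fun ω => u ⟨N, ω⟩)) atTop (𝓝 a) := by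
  refine (hu.tendsto_integral_dot hs h).congr fun N => ?_
  rw [gsCoeff, one_div]

/-- The inner product of two Gram-Schmidt errors, in terms of the original vectors. -/
lemma gsErr_dot_gsErr (q : Σ N, Ω N) : gsErr P s u q ⬝ᵥ gsErr P s v q =
    u q ⬝ᵥ v q
      - gsCoeff (P q.1) (fun ω => s ⟨q.1, ω⟩) (fun ω => v ⟨q.1, ω⟩) * (u q ⬝ᵥ s q)
      - gsCoeff (P q.1) (fun ω => s ⟨q.1, ω⟩) (fun ω => u ⟨q.1, ω⟩) * (v q ⬝ᵥ s q)
      + gsCoeff (P q.1) (fun ω => s ⟨q.1, ω⟩) (fun ω => u ⟨q.1, ω⟩) *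
        gsCoeff (P q.1) (fun ω => s ⟨q.1, ω⟩) (fun ω => v ⟨q.1, ω⟩) * (s q ⬝ᵥ s q) := by
  simp only [gsErr, gsError, sub_dotProduct, dotProduct_sub, smul_dotProduct, dotProduct_smul,
    smul_eq_mul, dotProduct_comm (s q) (v q)]
  ring

/-- Normalized inner products of Gram-Schmidt errors converge in probability, if those of the
vectors do. -/
lemma tendsto_gsErr_dot (hu : SqUI P u) (hv : SqUI P v) (hs : SqUI P s)
    (hss : Tendsto (fun q => (q.1 : ℝ)⁻¹ * (s q ⬝ᵥ s q)) (whp P) (𝓝 1))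
    (hus : Tendsto (fun q => (q.1 : ℝ)⁻¹ * (u q ⬝ᵥ s q)) (whp P) (𝓝 a))
    (hvs : Tendsto (fun q => (q.1 : ℝ)⁻¹ * (v q ⬝ᵥ s q)) (whp P) (𝓝 b))
    (huv : Tendsto (fun q => (q.1 : ℝ)⁻¹ * (u q ⬝ᵥ v q)) (whp P) (𝓝 c)) :
    Tendsto (fun q => (q.1 : ℝ)⁻¹ * (gsErr P s u q ⬝ᵥ gsErr P s v q)) (whp P)
      (𝓝 (c - a * b)) := by
  have ha := (tendsto_gsCoeff hu hs hus).comp (tendsto_whp_fst (P := P))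
  have hb := (tendsto_gsCoeff hv hs hvs).comp (tendsto_whp_fst (P := P))
  have h := ((huv.sub (hb.mul hus)).sub (ha.mul hvs)).add ((ha.mul hb).mul hss)
  rw [show c - b * a - a * b + a * b * 1 = c - a * b by ring] at h
  refine h.congr fun q => ?_
  rw [gsErr_dot_gsErr]
  simp only [Function.comp_apply]
  ring

lemma integral_comb {α : Type*} [MeasurableSpace α] {μ : Measure α} {f g h k : α → ℝ}
    (hf : Integrable f μ) (hg : Integrable g μ) (hh : Integrable h μ) (hk : Integrable k μ)
    (x y z : ℝ) : ∫ ω, (f ω - x * g ω - y * h ω + z * k ω) ∂μ =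
      ∫ ω, f ω ∂μ - x * ∫ ω, g ω ∂μ - y * ∫ ω, h ω ∂μ + z * ∫ ω, k ω ∂μ := by
  have h1 : Integrable (fun ω => f ω - x * g ω) μ := hf.sub (hg.const_mul x)
  have h2 : Integrable (fun ω => f ω - x * g ω - y * h ω) μ := h1.sub (hh.const_mul y)
  rw [integral_add h2 (hk.const_mul z), integral_sub h1 (hh.const_mul y),
    integral_sub hf (hg.const_mul x), integral_const_mul, integral_const_mul, integral_const_mul]

/-- Normalized inner products of Gram-Schmidt errors converge in mean to the same limit. -/
lemma tendsto_integral_gsErr_dot (hu : SqUI P u) (hv : SqUI P v) (hs : SqUI P s)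
    (hss : Tendsto (fun q => (q.1 : ℝ)⁻¹ * (s q ⬝ᵥ s q)) (whp P) (𝓝 1))
    (hus : Tendsto (fun q => (q.1 : ℝ)⁻¹ * (u q ⬝ᵥ s q)) (whp P) (𝓝 a))
    (hvs : Tendsto (fun q => (q.1 : ℝ)⁻¹ * (v q ⬝ᵥ s q)) (whp P) (𝓝 b))
    (huv : Tendsto (fun q => (q.1 : ℝ)⁻¹ * (u q ⬝ᵥ v q)) (whp P) (𝓝 c)) :
    Tendsto (fun N : ℕ => (N : ℝ)⁻¹ *
      ∫ ω, gsErr P s u ⟨N, ω⟩ ⬝ᵥ gsErr P s v ⟨N, ω⟩ ∂(P N)) atTop (𝓝 (c - a * b)) := by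
  have ha := tendsto_gsCoeff hu hs hus
  have hb := tendsto_gsCoeff hv hs hvs
  have h := (((hu.tendsto_integral_dot hv huv).sub (hb.mul (hu.tendsto_integral_dot hs hus))).sub
    (ha.mul (hv.tendsto_integral_dot hs hvs))).add
      ((ha.mul hb).mul (hs.tendsto_integral_dot hs hss))
  rw [show c - b * a - a * b + a * b * 1 = c - a * b by ring] at h
  refine h.congr fun N => ?_
  have h1 := integral_comb (hu.integrable_dot hv N) (hu.integrable_dot hs N)
    (hv.integrable_dot hs N) (hs.integrable_dot hs N)
    (gsCoeff (P N) (fun ω => s ⟨N, ω⟩) fun ω => v ⟨N, ω⟩)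
    (gsCoeff (P N) (fun ω => s ⟨N, ω⟩) fun ω => u ⟨N, ω⟩)
    ((gsCoeff (P N) (fun ω => s ⟨N, ω⟩) fun ω => u ⟨N, ω⟩) *
      gsCoeff (P N) (fun ω => s ⟨N, ω⟩) fun ω => v ⟨N, ω⟩)
  have h2 : ∫ ω, gsErr P s u ⟨N, ω⟩ ⬝ᵥ gsErr P s v ⟨N, ω⟩ ∂(P N) = _ :=
    (integral_congr_ae (Eventually.of_forall fun ω => gsErr_dot_gsErr ⟨N, ω⟩)).trans h1
  rw [h2]
  ring

end GramSchmidtLimit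

/-! ### Orthogonal estimators -/

section OrthStep

variable {Ω : ℕ → Type*} [∀ N, MeasurableSpace (Ω N)] {P : ∀ N, Measure (Ω N)}
  [∀ N, IsProbabilityMeasure (P N)]

lemma RowState.tendsto_dot {D : Type*} [MeasurableSpace D]
    {r : ∀ q : Σ N, Ω N, Fin q.1 → D × (ℕ → ℝ)} {μ : Measure (D × (ℕ → ℝ))}
    (h : RowState P r μ) {f g : D × (ℕ → ℝ) → ℝ} (hf : Measurable f) (hg : Measurable g)
    (hfu : UIArr P fun q n => f (r q n) ^ 2) (hgu : UIArr P fun q n => g (r q n) ^ 2) :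
    Tendsto (fun q => (q.1 : ℝ)⁻¹ * (inp r f q ⬝ᵥ inp r g q)) (whp P)
      (𝓝 (∫ x, f x * g x ∂μ)) := by
  have hprob := h.prob
  exact h.lln.tendsto_avg (ψ := fun x => f x * g x) (hf.mul hg) (hfu.mul_of_sq hgu)

variable {W : Type*} [MeasurableSpace W]

/-- A Gaussian variable is uncorrelated with the signal. -/
lemma GaussRep.integral_gvec_mul_sig {μ : Measure ((W × ℝ) × (ℕ → ℝ))} {I : Finset ℕ}
    {β : ℕ → ℝ} (h : GaussRep μ I β) (i : ℕ) : ∫ x, gvec I β x i * x.2 0 ∂μ = 0 := by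
  obtain ⟨θ, k, e, hθ, he⟩ := h
  have hΦ : Measurable fun x : (W × ℝ) × (ℕ → ℝ) => (sigNoise x, gvec I β x) :=
    measurable_sigNoise.prodMk (measurable_gvec I β)
  have hF : Measurable fun q : (ℝ × W) × (ℕ → ℝ) => q.2 i * q.1.1 :=
    (measurable_coord i).mul measurable_fst.fst
  have hE := measurable_gaussMap (Θ := ℝ × W) e
  have h1 := integral_map (μ := μ) hΦ.aemeasurable hF.aestronglyMeasurable
  have h2 := integral_map (μ := θ.prod (stdG (Fin k))) hE.aemeasurable hF.aestronglyMeasurable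
  have h3 := integral_dot_mul_eq_zero θ (dotProduct_zero (e i)) (H := fun p => p.2.1)
    measurable_snd.fst
  rw [he] at h1
  exact h1.symm.trans (h2.trans h3)

/-- The input message of an estimator, on one position: the initial message `α σ + n₀` for `p = 0`,
column `p` otherwise. -/
def inMsg (α : ℝ) (p : ℕ) (x : (W × ℝ) × (ℕ → ℝ)) : ℝ :=
  if p = 0 then α * x.2 0 + x.1.2 else x.2 p

/-- The correlation of the input message with the signal. -/
def inCoef (α : ℝ) (β : ℕ → ℝ) (p : ℕ) : ℝ := if p = 0 then α else β p

lemma measurable_inMsg (α : ℝ) (p : ℕ) : Measurable (inMsg (W := W) α p) := by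
  unfold inMsg
  split_ifs
  · exact (measurable_const.mul (measurable_coord 0)).add measurable_fst.snd
  · exact measurable_coord p

lemma gvec_eq_inMsg_sub {I : Finset ℕ} {p : ℕ} (hp : p = 0 ∨ p ∈ I) (h0 : 0 ∉ I) (α : ℝ)
    (β : ℕ → ℝ) (x : (W × ℝ) × (ℕ → ℝ)) :
    gvec I β x p = inMsg α p x - inCoef α β p * x.2 0 := by
  rcases hp with rfl | hp
  · simp [gvec, inMsg, inCoef]
  · have hp0 : p ≠ 0 := fun h => h0 (h ▸ hp)
    simp [gvec, inMsg, inCoef, hp0, hp, gcoord]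

variable {WA WB : Type*} [MeasurableSpace WA] [MeasurableSpace WB]
variable {rA : ∀ q : Σ N, Ω N, Fin q.1 → (WA × ℝ) × (ℕ → ℝ)}
  {rB : ∀ q : Σ N, Ω N, Fin q.1 → (WB × ℝ) × (ℕ → ℝ)}
  {V : ∀ N, Ω N → Matrix.orthogonalGroup (Fin N) ℝ} {μA : Measure ((WA × ℝ) × (ℕ → ℝ))}
  {μB : Measure ((WB × ℝ) × (ℕ → ℝ))} {j : ℕ} {IA IB : Finset ℕ} {β : ℕ → ℝ}

lemma Inv.zero_notMem (h : Inv P rA rB V μA μB j IA IB β) : 0 ∉ IA := fun h0 =>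
  (h.subA 0 h0).1.ne rfl

lemma Inv.ui_inMsg (h : Inv P rA rB V μA μB j IA IB β) (α : ℝ) (p : ℕ) :
    UIArr P fun q n => inMsg α p (rA q n) ^ 2 := by
  unfold inMsg
  split_ifs
  · exact ((h.stA.ui 0).sq_const_mul α).sq_add h.noiseA
  · exact h.stA.ui p

lemma Inv.memLp_inMsg (h : Inv P rA rB V μA μB j IA IB β) (α : ℝ) (p : ℕ) :
    MemLp (inMsg α p) 2 μA := h.stA.memLp_of_ui (measurable_inMsg α p) (h.ui_inMsg α p)

lemma Inv.integral_sig_mul_sig (h : Inv P rA rB V μA μB j IA IB β) :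
    ∫ x, x.2 0 * x.2 0 ∂μA = 1 := (h.beta 0 h.pos).trans h.beta_zero

lemma Inv.integral_inMsg_mul_sig (h : Inv P rA rB V μA μB j IA IB β) {p : ℕ}
    (hp : p = 0 ∨ p ∈ IA) (α : ℝ) : ∫ x, inMsg α p x * x.2 0 ∂μA = inCoef α β p := by
  have h1 := h.gaussA.integral_gvec_mul_sig p
  have h0 := h.stA.memLp_coord 0
  have h2 : Integrable (fun x => inMsg α p x * x.2 0) μA := (h.memLp_inMsg α p).integrable_mul h0
  have h3 : Integrable (fun x : (WA × ℝ) × (ℕ → ℝ) => x.2 0 * x.2 0) μA := h0.integrable_mul h0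
  have h4 : ∀ x : (WA × ℝ) × (ℕ → ℝ), gvec IA β x p * x.2 0 =
      inMsg α p x * x.2 0 - inCoef α β p * (x.2 0 * x.2 0) := by
    intro x
    rw [gvec_eq_inMsg_sub hp h.zero_notMem α β]
    ring
  simp only [h4] at h1
  rw [integral_sub h2 (h3.const_mul _), integral_const_mul, h.integral_sig_mul_sig] at h1
  linarith

/-- The normalized inner products of the Gram-Schmidt errors of an input message and of a function
of the rows converge to the covariance in the limit law of the part of the input orthogonal to the
signal and of the function, in probability and in mean. -/
lemma Inv.tendsto_gsErr (h : Inv P rA rB V μA μB j IA IB β) {ψ : (WA × ℝ) × (ℕ → ℝ) → ℝ}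
    (hψ : Measurable ψ) (hui : UIArr P fun q n => ψ (rA q n) ^ 2) {p : ℕ} (hp : p = 0 ∨ p ∈ IA)
    (α : ℝ) (hin : SqUI P (inp rA (inMsg α p))) (hout : SqUI P (inp rA ψ))
    (hsig : SqUI P fun q => cols rA q 0) :
    Tendsto (fun q => (q.1 : ℝ)⁻¹ * (gsErr P (fun q => cols rA q 0) (inp rA (inMsg α p)) q ⬝ᵥ
        gsErr P (fun q => cols rA q 0) (inp rA ψ) q)) (whp P)
      (𝓝 (∫ x, gvec IA β x p * (ψ x - (∫ y, ψ y * y.2 0 ∂μA) * x.2 0) ∂μA)) ∧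
    Tendsto (fun N : ℕ => (N : ℝ)⁻¹ *
        ∫ ω, gsErr P (fun q => cols rA q 0) (inp rA (inMsg α p)) ⟨N, ω⟩ ⬝ᵥ
          gsErr P (fun q => cols rA q 0) (inp rA ψ) ⟨N, ω⟩ ∂(P N)) atTop
      (𝓝 (∫ x, gvec IA β x p * (ψ x - (∫ y, ψ y * y.2 0 ∂μA) * x.2 0) ∂μA)) := by
  have hss := h.stA.tendsto_dot (measurable_coord 0) (measurable_coord 0) (h.stA.ui 0) (h.stA.ui 0)
  have hus := h.stA.tendsto_dot (measurable_inMsg α p) (measurable_coord 0) (h.ui_inMsg α p)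
    (h.stA.ui 0)
  have hvs := h.stA.tendsto_dot hψ (measurable_coord 0) hui (h.stA.ui 0)
  have huv := h.stA.tendsto_dot (measurable_inMsg α p) hψ (h.ui_inMsg α p) hui
  rw [h.integral_sig_mul_sig] at hss
  rw [h.integral_inMsg_mul_sig hp] at hus
  have hψ2 : MemLp ψ 2 μA := h.stA.memLp_of_ui hψ hui
  have h0 := h.stA.memLp_coord 0
  have i1 : Integrable (fun x => inMsg α p x * ψ x) μA := (h.memLp_inMsg α p).integrable_mul hψ2
  have i2 : Integrable (fun x => inMsg α p x * x.2 0) μA := (h.memLp_inMsg α p).integrable_mul h0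
  have i3 : Integrable (fun x => ψ x * x.2 0) μA := hψ2.integrable_mul h0
  have i4 : Integrable (fun x : (WA × ℝ) × (ℕ → ℝ) => x.2 0 * x.2 0) μA := h0.integrable_mul h0
  set b := ∫ y, ψ y * y.2 0 ∂μA with hb
  have hlim : ∫ x, gvec IA β x p * (ψ x - b * x.2 0) ∂μA =
      ∫ x, inMsg α p x * ψ x ∂μA - inCoef α β p * b := by
    have e : ∀ x : (WA × ℝ) × (ℕ → ℝ), gvec IA β x p * (ψ x - b * x.2 0) = inMsg α p x * ψ x -
        b * (inMsg α p x * x.2 0) - inCoef α β p * (ψ x * x.2 0) +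
          inCoef α β p * b * (x.2 0 * x.2 0) := by
      intro x
      rw [gvec_eq_inMsg_sub hp h.zero_notMem α β]
      ring
    simp only [e]
    rw [integral_comb i1 i2 i3 i4, h.integral_inMsg_mul_sig hp, h.integral_sig_mul_sig, ← hb]
    ring
  rw [hlim]
  exact ⟨tendsto_gsErr_dot hin hout hsig hss hus hvs huv,
    tendsto_integral_gsErr_dot hin hout hsig hss hus hvs huv⟩

/-- The state of the process is preserved by an orthogonal estimator. -/
lemma Inv.step_of_orth (h : Inv P rA rB V μA μB j IA IB β) {g : ℝ → ℝ × WA → ℝ}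
    (hg : Measurable (Function.uncurry g)) {ψ : (WA × ℝ) × (ℕ → ℝ) → ℝ} {p : ℕ}
    (hp : p = 0 ∨ p ∈ IA) (α : ℝ) (hψ : ψ = fun x => g (inMsg α p x) (sigNoise x))
    (hui : UIArr P fun q n => ψ (rA q n) ^ 2)
    (hin : SqUI P (inp rA (inMsg α p))) (hout : SqUI P (inp rA ψ))
    (hsig : SqUI P fun q => cols rA q 0)
    (horth : Tendsto (fun N : ℕ => (N : ℝ)⁻¹ *
        ∫ ω, gsErr P (fun q => cols rA q 0) (inp rA (inMsg α p)) ⟨N, ω⟩ ⬝ᵥ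
          gsErr P (fun q => cols rA q 0) (inp rA ψ) ⟨N, ω⟩ ∂(P N)) atTop (𝓝 0))
    (hres : ∀ N, rowLaw P (fun q n => insCol j (rB q n, ((V q.1 q.2).1 *ᵥ inp rA ψ q) n)) N =
      rowLaw (withGauss P) (fun q n => insCol j (rB (base q) n, fresh rA rB V j ψ q n)) N) :
    ∃ μA' μB' β', Inv P (fun q n => insCol j (rA q n, ψ (rA q n)))
      (fun q n => insCol j (rB q n, ((V q.1 q.2).1 *ᵥ inp rA ψ q) n)) V μA' μB' (j + 1) IA
      (insert j IB) β' := by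
  have hψm : Measurable ψ := by
    rw [hψ]
    exact hg.comp ((measurable_inMsg α p).prodMk measurable_sigNoise)
  have h1 := tendsto_nhds_unique
    (h.tendsto_gsErr hψm hui hp α hin hout hsig).2 horth
  obtain ⟨μA', μB', h2⟩ := h.step hψm
    (H := fun y => g (y.1 + inCoef α β p * y.2.1) y.2)
    (hg.comp ((measurable_fst.add (measurable_const.mul measurable_snd.fst)).prodMk
      measurable_snd)) p
    (fun x => by
      simp only [hψ, gvec_eq_inMsg_sub hp h.zero_notMem α β, sigNoise, sub_add_cancel])
    hui h1 hres
  exact ⟨μA', μB', _, h2⟩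

end OrthStep

/-! ### The initial state -/

section Initial

lemma measurePreserving_stdG_one (v : ℝ≥0) :
    MeasurePreserving (fun z : Fin 1 → ℝ => √(v : ℝ) * z 0) (stdG (Fin 1)) (gaussianReal 0 v) := by
  have h1 : MeasurePreserving (fun x : ℝ => √(v : ℝ) * x) (gaussianReal 0 1) (gaussianReal 0 v) := by
    refine ⟨measurable_const.mul measurable_id, ?_⟩
    rw [gaussianReal_map_const_mul]
    congr 1
    · simp
    · ext
      simp
  exact h1.comp (measurePreserving_eval (fun _ : Fin 1 => gaussianReal 0 1) 0)

/-- Without Gaussian columns, the representation only concerns the initial noise. -/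
lemma GaussRep.of_map {W : Type*} [MeasurableSpace W] {μ : Measure ((W × ℝ) × (ℕ → ℝ))}
    (θ : Measure (ℝ × W)) [IsProbabilityMeasure θ] (v : ℝ≥0)
    (h : μ.map (fun x => (sigNoise x, x.1.2)) = θ.prod (gaussianReal 0 v)) (β : ℕ → ℝ) :
    GaussRep μ ∅ β := by
  refine ⟨θ, 1, fun i => if i = 0 then fun _ => √(v : ℝ) else 0, inferInstance, ?_⟩
  let T : (ℝ × W) × ℝ → (ℝ × W) × (ℕ → ℝ) := fun p => (p.1, fun i => if i = 0 then p.2 else 0)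
  have hT : Measurable T := by
    refine measurable_fst.prodMk (measurable_pi_lambda _ fun i => ?_)
    by_cases hi : i = 0
    · simpa only [hi, if_true] using measurable_snd
    · simpa only [hi, if_false] using measurable_const
  have h1 : Measurable fun x : (W × ℝ) × (ℕ → ℝ) => (sigNoise x, x.1.2) :=
    measurable_sigNoise.prodMk measurable_fst.snd
  have h2 := ((MeasurePreserving.id θ).prod (measurePreserving_stdG_one v))
  have e1 : (fun x : (W × ℝ) × (ℕ → ℝ) => (sigNoise x, gvec ∅ β x)) =
      T ∘ fun x => (sigNoise x, x.1.2) := by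
    funext x
    simp [T]
    rfl
  have e2 : (fun p : (ℝ × W) × (Fin 1 → ℝ) =>
      (p.1, fun i : ℕ => (if i = 0 then (fun _ => √(v : ℝ)) else 0 : Fin 1 → ℝ) ⬝ᵥ p.2)) =
      T ∘ Prod.map id fun z : Fin 1 → ℝ => √(v : ℝ) * z 0 := by
    funext p
    refine Prod.ext rfl (funext fun i => ?_)
    by_cases hi : i = 0
    · simp [T, hi, dotProduct]
    · simp [T, hi]
  rw [e1, e2, ← Measure.map_map hT h1, ← Measure.map_map hT h2.measurable, h, h2.map_eq]

variable {WA WB : Type*} [MeasurableSpace WA] [MeasurableSpace WB]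

/-- The law of the data of one position. -/
noncomputable def dataLaw (μx : Measure ℝ) (νA : Measure WA) (νB : Measure WB) (vA vB : ℝ≥0) :
    Measure (RowData WA WB) :=
  μx.prod (νA.prod ((gaussianReal 0 vA).prod (νB.prod (gaussianReal 0 vB))))

variable (μx : Measure ℝ) [IsProbabilityMeasure μx] (νA : Measure WA) [IsProbabilityMeasure νA]
  (νB : Measure WB) [IsProbabilityMeasure νB] (vA vB : ℝ≥0)

instance : IsProbabilityMeasure (dataLaw μx νA νB vA vB) := by unfold dataLaw; infer_instance

lemma measurePreserving_dataA : MeasurePreserving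
    (fun d : RowData WA WB => ((d.1, d.2.1), d.2.2.1)) (dataLaw μx νA νB vA vB)
    ((μx.prod νA).prod (gaussianReal 0 vA)) :=
  ((MeasurePreserving.id _).prod measurePreserving_fst).comp
    (measurePreserving_prodAssoc _ _ _).symm

lemma measurePreserving_noiseB : MeasurePreserving (RowData.noiseB (WA := WA) (WB := WB))
    (dataLaw μx νA νB vA vB) (νB.prod (gaussianReal 0 vB)) :=
  measurePreserving_snd.comp (measurePreserving_snd.comp measurePreserving_snd)

variable {μx νA νB vA vB}

lemma measurePreserving_canon (ρ : Measure (RowData WA WB)) [IsProbabilityMeasure ρ] (N : ℕ) :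
    MeasurePreserving (fun ω : Canon WA WB N => ω.1) (canonLaw ρ N)
      (Measure.pi fun _ : Fin N => ρ) := measurePreserving_fst

lemma measurePreserving_canon_apply (ρ : Measure (RowData WA WB)) [IsProbabilityMeasure ρ] (N : ℕ)
    (n : Fin N) : MeasurePreserving (fun ω : Canon WA WB N => ω.1 n) (canonLaw ρ N) ρ :=
  (measurePreserving_eval (fun _ : Fin N => ρ) n).comp (measurePreserving_canon ρ N)

lemma memLp_gaussianReal (v : ℝ≥0) : MemLp (fun x : ℝ => x) 2 (gaussianReal 0 v) :=
  memLp_id_gaussianReal 2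

lemma meanUIArr_noiseA : MeanUIArr (canonLaw (dataLaw μx νA νB vA vB))
    fun q n => (q.2.1 n).noiseA.2 ^ 2 := by
  refine MeanUIArr.of_measurePreserving (f := fun d : RowData WA WB => d.noiseA.2 ^ 2)
    (measurable_noiseA.snd.pow_const 2) ?_
    fun N n => measurePreserving_canon_apply (dataLaw μx νA νB vA vB) N n
  exact (((memLp_gaussianReal vA).comp_measurePreserving measurePreserving_snd).comp_measurePreserving
    (measurePreserving_dataA μx νA νB vA vB)).integrable_sq

lemma meanUIArr_noiseB : MeanUIArr (canonLaw (dataLaw μx νA νB vA vB))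
    fun q n => (q.2.1 n).noiseB.2 ^ 2 := by
  refine MeanUIArr.of_measurePreserving (f := fun d : RowData WA WB => d.noiseB.2 ^ 2)
    (measurable_noiseB.snd.pow_const 2) ?_
    fun N n => measurePreserving_canon_apply (dataLaw μx νA νB vA vB) N n
  exact (((memLp_gaussianReal vB).comp_measurePreserving measurePreserving_snd).comp_measurePreserving
    (measurePreserving_noiseB μx νA νB vA vB)).integrable_sq

lemma meanUIArr_signal (hx : MemLp (fun s : ℝ => s) 2 μx) :
    MeanUIArr (canonLaw (dataLaw μx νA νB vA vB)) fun q n => (q.2.1 n).1 ^ 2 := by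
  refine MeanUIArr.of_measurePreserving (f := fun d : RowData WA WB => d.1 ^ 2)
    (measurable_fst.pow_const 2) ?_
    fun N n => measurePreserving_canon_apply (dataLaw μx νA νB vA vB) N n
  exact (hx.comp_measurePreserving measurePreserving_fst).integrable_sq

/-- The rows of the first side before the first step. -/
def startA (d : RowData WA WB) : (WA × ℝ) × (ℕ → ℝ) :=
  (d.noiseA, fun l => if l = 0 then d.1 else 0)

/-- The rows of the second side before the first step. -/
def startB (d : RowData WA WB) : (WB × ℝ) × (ℕ → ℝ) := (d.noiseB, fun _ => 0)

lemma measurable_startA : Measurable (startA (WA := WA) (WB := WB)) := by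
  refine measurable_noiseA.prodMk (measurable_pi_lambda _ fun l => ?_)
  by_cases hl : l = 0
  · simpa only [hl, if_true] using measurable_fst
  · simpa only [hl, if_false] using measurable_const

lemma measurable_startB : Measurable (startB (WA := WA) (WB := WB)) :=
  measurable_noiseB.prodMk measurable_const

/-- The state of the process after the image of the signal has been revealed. -/
lemma inv_one (σ : Strategy WA WB) (h0 : σ.side 0 = true) (hψ0 : σ.ψA 0 = fun x => x.2 0)
    (hx1 : ∫ s, s ^ 2 ∂μx = 1) (hx2 : MemLp (fun s : ℝ => s) 2 μx) :
    ∃ μA μB, Inv (canonLaw (dataLaw μx νA νB vA vB)) (σ.rowA 1) (σ.rowB 1) (fun _ ω => ω.2)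
      μA μB 1 ∅ ∅ fun _ => 1 := by
  set ρ := dataLaw μx νA νB vA vB with hρ
  have hcan := measurePreserving_canon ρ
  have eA : σ.rowA 0 = fun q n => startA (q.2.1 n) := rfl
  have eB : σ.rowB 0 = fun q n => startB (q.2.1 n) := rfl
  have hstA : RowState (canonLaw ρ) (σ.rowA 0) (ρ.map startA) := by
    rw [eA]
    refine RowState.of_iid ρ hcan measurable_startA fun i => ?_
    by_cases hi : i = 0
    · simp only [startA, hi, if_true]
      exact hx2.comp_measurePreserving measurePreserving_fst
    · simp only [startA, hi, if_false]
      exact memLp_const 0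
  have hstB : RowState (canonLaw ρ) (σ.rowB 0) (ρ.map startB) := by
    rw [eB]
    exact RowState.of_iid ρ hcan measurable_startB fun i => memLp_const 0
  -- column `0` contains the signal from the start, so revealing it does not change these rows
  have hrow : σ.rowA 1 = σ.rowA 0 := by
    rw [Strategy.rowA_succ_of_side h0, hψ0]
    funext q n
    simp [insCol]
  have hint : ∀ f : (WA × ℝ) × (ℕ → ℝ) → ℝ, Measurable f →
      ∫ x, f x ∂(ρ.map startA) = ∫ d, f (startA d) ∂ρ := fun f hf =>
    integral_map measurable_startA.aemeasurable hf.aestronglyMeasurable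
  have hx1' : ∫ d : RowData WA WB, d.1 ^ 2 ∂ρ = 1 := by
    rw [← hx1]
    have h1 : MeasurePreserving (fun d : RowData WA WB => d.1) ρ μx := measurePreserving_fst
    rw [← h1.map_eq, integral_map h1.aemeasurable]
    exact (measurable_id.pow_const 2).aestronglyMeasurable
  -- there are no earlier columns, so the residual of the signal is the signal, of second moment one
  have hsd : StepData (canonLaw ρ) (σ.rowA 0) (σ.rowB 0) (ρ.map startA) (ρ.map startB)
      (fun _ ω => ω.2) 0 (σ.ψA 0) 0 1 :=
    { stA := hstA, stB := hstB, gram := GramBound.zero, measV := fun N => measurable_snd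
      maps := fun q l hl => absurd hl (Nat.not_lt_zero l)
      measψ := σ.measurable_ψA 0
      uiψ := by rw [hψ0]; exact hstA.ui 0
      s_nonneg := zero_le_one
      normal := fun i hi => absurd hi (Nat.not_lt_zero i)
      dist := by
        have h1 := hint (fun x => (x.2 0) ^ 2) ((measurable_coord 0).pow_const 2)
        simp only [hψ0, linForm, Finset.range_zero, Finset.sum_empty, sub_zero, one_pow]
        rw [h1]
        simpa [startA] using hx1' }
  have hstB1 : RowState (canonLaw ρ) (σ.rowB 1) (stepLaw 0 1 0 (ρ.map startB)) := by
    rw [Strategy.rowB_succ_of_side h0]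
    exact hsd.rowState_image fun N => Strategy.rowLaw_of_side ρ (σ.measurable_ψA 0) N
  have hgram := hsd.gram_succ
  rw [← Strategy.rowA_succ_of_side h0] at hgram
  refine ⟨ρ.map startA, stepLaw 0 1 0 (ρ.map startB), ?_⟩
  refine
    { stA := by rw [hrow]; exact hstA
      stB := hstB1
      gram := hgram
      measV := fun N => measurable_snd
      maps := ?_
      noiseA := meanUIArr_noiseA.uiArr fun N n => ?_
      noiseB := meanUIArr_noiseB.uiArr fun N n => ?_
      gaussA := GaussRep.of_map (μx.prod νA) vA ?_ _
      gaussB := GaussRep.of_map ((gaussianReal 0 1).prod νB) vB ?_ _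
      pos := one_pos
      subA := by simp
      subB := by simp
      cover := fun i hi => Or.inl (Nat.lt_one_iff.1 hi)
      beta_zero := rfl
      beta := ?_
      cross := by simp
      initA := by simp
      initB := by simp }
  · intro q l hl
    obtain rfl : l = 0 := Nat.lt_one_iff.1 hl
    have h1 : cols (σ.rowA 1) q 0 = inp (σ.rowA 0) (σ.ψA 0) q := by
      rw [hrow, hψ0]
      rfl
    rw [h1, Strategy.rowB_succ_of_side h0]
    funext n
    simp [cols, insCol]
  · exact (measurable_noiseA.snd.pow_const 2).comp
      ((measurable_pi_apply n).comp measurable_fst)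
  · exact (measurable_noiseB.snd.pow_const 2).comp
      ((measurable_pi_apply n).comp measurable_fst)
  · rw [Measure.map_map (measurable_sigNoise.prodMk measurable_fst.snd) measurable_startA]
    exact (measurePreserving_dataA μx νA νB vA vB).map_eq
  · -- on the second side the limit law of the signal is standard Gaussian
    have h1 : MeasurePreserving (fun p : (WB × ℝ) × ℝ => ((p.2, p.1.1), p.1.2))
        ((νB.prod (gaussianReal 0 vB)).prod (gaussianReal 0 1))
        (((gaussianReal 0 1).prod νB).prod (gaussianReal 0 vB)) :=
      (measurePreserving_prodAssoc (gaussianReal 0 1) νB (gaussianReal 0 vB)).symm.comp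
        Measure.measurePreserving_swap
    have h2 : MeasurePreserving (fun p : RowData WA WB × ℝ => (p.1.noiseB, p.2))
        (ρ.prod (gaussianReal 0 1)) ((νB.prod (gaussianReal 0 vB)).prod (gaussianReal 0 1)) :=
      (measurePreserving_noiseB μx νA νB vA vB).prod (MeasurePreserving.id _)
    have h3 : (ρ.map startB).prod (gaussianReal 0 1) =
        (ρ.prod (gaussianReal 0 1)).map fun p => (startB p.1, p.2) := by
      conv_lhs => rw [← Measure.map_id (μ := gaussianReal 0 1)]
      rw [Measure.map_prod_map _ _ measurable_startB measurable_id]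
      rfl
    have h4 : Measurable fun p : RowData WA WB × ℝ => (startB p.1, p.2) :=
      (measurable_startB.comp measurable_fst).prodMk measurable_snd
    have h5 : Measurable fun x : (WB × ℝ) × (ℕ → ℝ) => (sigNoise x, x.1.2) :=
      measurable_sigNoise.prodMk measurable_fst.snd
    rw [stepLaw, pairLaw, h3, Measure.map_map (measurable_pairMap _ _ _) h4,
      Measure.map_map (measurable_insCol 0) ((measurable_pairMap _ _ _).comp h4),
      Measure.map_map h5 ((measurable_insCol 0).comp ((measurable_pairMap _ _ _).comp h4)),
      ← (h1.comp h2).map_eq]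
    congr 1
    funext p
    simp [sigNoise, insCol, pairMap, linForm, startB]
  · intro i hi
    obtain rfl : i = 0 := Nat.lt_one_iff.1 hi
    have h1 := hint (fun x => x.2 0 * x.2 0) ((measurable_coord 0).mul (measurable_coord 0))
    rw [h1, ← hx1']
    simp [startA, sq]

end Initial

/-! ### The iterative process as a revealing process -/

section RevealingProcess

variable {WA WB : Type*} [MeasurableSpace WA] [MeasurableSpace WB]

/-- The estimators and the initial coefficients of the two sides. -/
structure Estimators (WA WB : Type*) [MeasurableSpace WA] [MeasurableSpace WB] where
  gA : ℕ → ℝ → ℝ × WA → ℝ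
  gB : ℕ → ℝ → ℝ × WB → ℝ
  αA : ℝ
  αB : ℝ
  measurable_gA : ∀ t, Measurable (Function.uncurry (gA t))
  measurable_gB : ∀ t, Measurable (Function.uncurry (gB t))

namespace Estimators

/-- The iterative process reveals the image of the signal, then alternately (iteration `t`) in
column `2 t - 1` the image under `V` of the output of the first side, and in column `2 t` the
image under `Vᵀ` of the output of the second side.  Hence the input of iteration `t + 1` is in
column `2 t` on the first side and in column `2 t - 1` on the second side, for `t ≥ 1`; for
`t = 0` both numbers are zero, and `inMsg` is the initial message. -/
def strategy (e : Estimators WA WB) : Strategy WA WB where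
  side m := decide (m = 0 ∨ m % 2 = 1)
  ψA m := if m = 0 then fun x => x.2 0 else
    fun x => e.gA (m / 2 + 1) (inMsg e.αA (m - 1) x) (sigNoise x)
  ψB m := fun x => e.gB (m / 2) (inMsg e.αB (m - 3) x) (sigNoise x)
  measurable_ψA m := by
    split_ifs
    · exact measurable_coord 0
    · exact (e.measurable_gA _).comp ((measurable_inMsg _ _).prodMk measurable_sigNoise)
  measurable_ψB m := (e.measurable_gB _).comp ((measurable_inMsg _ _).prodMk measurable_sigNoise)

variable (e : Estimators WA WB)

lemma side_zero : e.strategy.side 0 = true := by simp [strategy]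

lemma side_odd (t : ℕ) : e.strategy.side (2 * t + 1) = true := by simp [strategy]

lemma side_even (t : ℕ) : e.strategy.side (2 * t + 2) = false := by simp [strategy]

lemma ψA_zero : e.strategy.ψA 0 = fun x => x.2 0 := by simp [strategy]

lemma ψA_odd (t : ℕ) : e.strategy.ψA (2 * t + 1) =
    fun x => e.gA (t + 1) (inMsg e.αA (2 * t) x) (sigNoise x) := by
  have h1 : (2 * t + 1) / 2 = t := by omega
  simp [strategy, h1]

lemma ψB_even (t : ℕ) : e.strategy.ψB (2 * t + 2) =
    fun x => e.gB (t + 1) (inMsg e.αB (2 * t - 1) x) (sigNoise x) := by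
  have h1 : (2 * t + 2) / 2 = t + 1 := by omega
  have h2 : 2 * t + 2 - 3 = 2 * t - 1 := by omega
  simp [strategy, h1, h2]

/-- Column `l` of the first side, after it has been revealed. -/
def colA (l : ℕ) (q : Σ N, Canon WA WB N) : Fin q.1 → ℝ := cols (e.strategy.rowA (l + 1)) q l

/-- Column `l` of the second side, after it has been revealed. -/
def colB (l : ℕ) (q : Σ N, Canon WA WB N) : Fin q.1 → ℝ := cols (e.strategy.rowB (l + 1)) q l

/-- The input message in column `p` of the first side, or the initial message for `p = 0`. -/
def inA (p : ℕ) (q : Σ N, Canon WA WB N) : Fin q.1 → ℝ :=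
  if p = 0 then e.αA • e.colA 0 q + fun n => (q.2.1 n).noiseA.2 else e.colA p q

/-- The input message in column `p` of the second side, or the initial message for `p = 0`. -/
def inB (p : ℕ) (q : Σ N, Canon WA WB N) : Fin q.1 → ℝ :=
  if p = 0 then e.αB • e.colB 0 q + fun n => (q.2.1 n).noiseB.2 else e.colB p q

variable {e}

lemma cols_rowA_succ {k l : ℕ} (h : l ≠ k) (q : Σ N, Canon WA WB N) :
    cols (e.strategy.rowA (k + 1)) q l = cols (e.strategy.rowA k) q l := by
  cases hs : e.strategy.side k
  · rw [Strategy.rowA_succ_of_not_side hs]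
    funext n
    simp [cols, insCol, Function.update_of_ne h]
  · rw [Strategy.rowA_succ_of_side hs]
    funext n
    simp [cols, insCol, Function.update_of_ne h]

lemma cols_rowB_succ {k l : ℕ} (h : l ≠ k) (q : Σ N, Canon WA WB N) :
    cols (e.strategy.rowB (k + 1)) q l = cols (e.strategy.rowB k) q l := by
  cases hs : e.strategy.side k
  · rw [Strategy.rowB_succ_of_not_side hs]
    funext n
    simp [cols, insCol, Function.update_of_ne h]
  · rw [Strategy.rowB_succ_of_side hs]
    funext n
    simp [cols, insCol, Function.update_of_ne h]

lemma cols_rowA {k l : ℕ} (h : l < k) (q : Σ N, Canon WA WB N) :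
    cols (e.strategy.rowA k) q l = e.colA l q := by
  induction k with
  | zero => exact absurd h (Nat.not_lt_zero l)
  | succ k ih =>
    rcases Nat.lt_succ_iff_lt_or_eq.1 h with h | rfl
    · rw [cols_rowA_succ h.ne, ih h]
    · rfl

lemma cols_rowB {k l : ℕ} (h : l < k) (q : Σ N, Canon WA WB N) :
    cols (e.strategy.rowB k) q l = e.colB l q := by
  induction k with
  | zero => exact absurd h (Nat.not_lt_zero l)
  | succ k ih =>
    rcases Nat.lt_succ_iff_lt_or_eq.1 h with h | rfl
    · rw [cols_rowB_succ h.ne, ih h]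
    · rfl

lemma colA_of_side {l : ℕ} (h : e.strategy.side l = true) (q : Σ N, Canon WA WB N) :
    e.colA l q = inp (e.strategy.rowA l) (e.strategy.ψA l) q := by
  rw [colA, Strategy.rowA_succ_of_side h]
  funext n
  simp [cols, insCol, inp]

lemma colB_of_side {l : ℕ} (h : e.strategy.side l = true) (q : Σ N, Canon WA WB N) :
    e.colB l q = q.2.2.1 *ᵥ e.colA l q := by
  rw [colA_of_side h, colB, Strategy.rowB_succ_of_side h]
  funext n
  simp [cols, insCol]

lemma colB_of_not_side {l : ℕ} (h : e.strategy.side l = false) (q : Σ N, Canon WA WB N) :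
    e.colB l q = inp (e.strategy.rowB l) (e.strategy.ψB l) q := by
  rw [colB, Strategy.rowB_succ_of_not_side h]
  funext n
  simp [cols, insCol, inp]

lemma colA_of_not_side {l : ℕ} (h : e.strategy.side l = false) (q : Σ N, Canon WA WB N) :
    e.colA l q = (q.2.2⁻¹).1 *ᵥ e.colB l q := by
  rw [colB_of_not_side h, colA, Strategy.rowA_succ_of_not_side h]
  funext n
  simp [cols, insCol]

lemma colA_zero (q : Σ N, Canon WA WB N) : e.colA 0 q = fun n => (q.2.1 n).1 := by
  rw [colA_of_side e.side_zero, ψA_zero]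
  rfl

lemma inp_inMsg_rowA {k p : ℕ} (hk : 0 < k) (hp : p < k) (q : Σ N, Canon WA WB N) :
    inp (e.strategy.rowA k) (inMsg e.αA p) q = e.inA p q := by
  unfold inA
  split_ifs with h0
  · subst h0
    rw [← cols_rowA hk]
    funext n
    simp [inp, inMsg, cols, Strategy.rowA]
  · rw [← cols_rowA hp]
    funext n
    simp [inp, inMsg, h0, cols]

lemma inp_inMsg_rowB {k p : ℕ} (hk : 0 < k) (hp : p < k) (q : Σ N, Canon WA WB N) :
    inp (e.strategy.rowB k) (inMsg e.αB p) q = e.inB p q := by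
  unfold inB
  split_ifs with h0
  · subst h0
    rw [← cols_rowB hk]
    funext n
    simp [inp, inMsg, cols, Strategy.rowB]
  · rw [← cols_rowB hp]
    funext n
    simp [inp, inMsg, h0, cols]

/-- The output of iteration `t + 1` on the first side. -/
lemma colA_odd_apply (t : ℕ) (q : Σ N, Canon WA WB N) (n : Fin q.1) :
    e.colA (2 * t + 1) q n =
      e.gA (t + 1) (e.inA (2 * t) q n) (e.colA 0 q n, (q.2.1 n).noiseA.1) := by
  rw [colA_of_side (e.side_odd t), ψA_odd, ← inp_inMsg_rowA (k := 2 * t + 1) (by omega) (by omega),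
    ← cols_rowA (k := 2 * t + 1) (l := 0) (by omega)]
  rfl

/-- The output of iteration `t + 1` on the second side. -/
lemma colB_even_apply (t : ℕ) (q : Σ N, Canon WA WB N) (n : Fin q.1) :
    e.colB (2 * t + 2) q n =
      e.gB (t + 1) (e.inB (2 * t - 1) q n) (e.colB 0 q n, (q.2.1 n).noiseB.1) := by
  rw [colB_of_not_side (e.side_even t), ψB_even,
    ← inp_inMsg_rowB (k := 2 * t + 2) (by omega) (by omega),
    ← cols_rowB (k := 2 * t + 2) (l := 0) (by omega)]
  rfl

variable (e)

lemma rowMeas_colA (l : ℕ) : RowMeas (e.colA l) := fun N =>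
  (measurable_pi_apply l).comp (Strategy.measurable_cols_rowA (σ := e.strategy) (l + 1) N)

lemma rowMeas_colB (l : ℕ) : RowMeas (e.colB l) := fun N =>
  (measurable_pi_apply l).comp (Strategy.measurable_cols_rowB (σ := e.strategy) (l + 1) N)

lemma rowMeas_noiseA : RowMeas fun (q : Σ N, Canon WA WB N) n => (q.2.1 n).noiseA.2 := fun N =>
  measurable_pi_lambda _ fun n : Fin N =>
    measurable_noiseA.snd.comp ((measurable_pi_apply n).comp measurable_fst)

lemma rowMeas_noiseB : RowMeas fun (q : Σ N, Canon WA WB N) n => (q.2.1 n).noiseB.2 := fun N =>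
  measurable_pi_lambda _ fun n : Fin N =>
    measurable_noiseB.snd.comp ((measurable_pi_apply n).comp measurable_fst)

lemma inA_cases (p : ℕ) :
    e.inA p = (fun q => e.αA • e.colA 0 q + fun n => (q.2.1 n).noiseA.2) ∨ e.inA p = e.colA p := by
  by_cases hp : p = 0
  · exact Or.inl (funext fun q => if_pos hp)
  · exact Or.inr (funext fun q => if_neg hp)

lemma inB_cases (p : ℕ) :
    e.inB p = (fun q => e.αB • e.colB 0 q + fun n => (q.2.1 n).noiseB.2) ∨ e.inB p = e.colB p := by
  by_cases hp : p = 0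
  · exact Or.inl (funext fun q => if_pos hp)
  · exact Or.inr (funext fun q => if_neg hp)

lemma rowMeas_inA (p : ℕ) : RowMeas (e.inA p) := by
  rcases e.inA_cases p with h | h
  · rw [h]
    exact fun N => ((e.rowMeas_colA 0 N).const_smul e.αA).add (rowMeas_noiseA N)
  · rw [h]
    exact e.rowMeas_colA p

lemma rowMeas_inB (p : ℕ) : RowMeas (e.inB p) := by
  rcases e.inB_cases p with h | h
  · rw [h]
    exact fun N => ((e.rowMeas_colB 0 N).const_smul e.αB).add (rowMeas_noiseB N)
  · rw [h]
    exact e.rowMeas_colB p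

end Estimators

end RevealingProcess

/-! ### Orthogonality along the process -/

section Orthogonality

variable {WA WB : Type*} [MeasurableSpace WA] [MeasurableSpace WB]
  {μx : Measure ℝ} [IsProbabilityMeasure μx] {νA : Measure WA} [IsProbabilityMeasure νA]
  {νB : Measure WB} [IsProbabilityMeasure νB] {vA vB : ℝ≥0}

/-- The probability measures of the process. -/
noncomputable abbrev procLaw (μx : Measure ℝ) (νA : Measure WA) (νB : Measure WB) (vA vB : ℝ≥0)
    (N : ℕ) : Measure (Canon WA WB N) := canonLaw (dataLaw μx νA νB vA vB) N

/-- The assumptions on the process: a normalized signal, uniformly integrable outputs and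
orthogonal estimators. -/
structure Estimators.IsOrthogonal (e : Estimators WA WB) (μx : Measure ℝ) (νA : Measure WA)
    (νB : Measure WB) (vA vB : ℝ≥0) : Prop where
  normalized : ∫ s, s ^ 2 ∂μx = 1
  memLp : MemLp (fun s : ℝ => s) 2 μx
  uiA : ∀ t, MeanUIArr (procLaw μx νA νB vA vB) fun q n => e.colA (2 * t + 1) q n ^ 2
  uiB : ∀ t, MeanUIArr (procLaw μx νA νB vA vB) fun q n => e.colB (2 * t + 2) q n ^ 2
  orthA : ∀ t, Tendsto (fun N : ℕ => (N : ℝ)⁻¹ *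
    ∫ ω, gsErr (procLaw μx νA νB vA vB) (e.colA 0) (e.inA (2 * t)) ⟨N, ω⟩ ⬝ᵥ
      gsErr (procLaw μx νA νB vA vB) (e.colA 0) (e.colA (2 * t + 1)) ⟨N, ω⟩
        ∂(procLaw μx νA νB vA vB N)) atTop (𝓝 0)
  orthB : ∀ t, Tendsto (fun N : ℕ => (N : ℝ)⁻¹ *
    ∫ ω, gsErr (procLaw μx νA νB vA vB) (e.colB 0) (e.inB (2 * t - 1)) ⟨N, ω⟩ ⬝ᵥ
      gsErr (procLaw μx νA νB vA vB) (e.colB 0) (e.colB (2 * t + 2)) ⟨N, ω⟩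
        ∂(procLaw μx νA νB vA vB N)) atTop (𝓝 0)

/-- The positive even numbers below `k`. -/
def evens (k : ℕ) : Finset ℕ := (Finset.range k).filter fun i => i ≠ 0 ∧ i % 2 = 0

/-- The odd numbers below `k`. -/
def odds (k : ℕ) : Finset ℕ := (Finset.range k).filter fun i => i % 2 = 1

lemma mem_evens {k i : ℕ} : i ∈ evens k ↔ i < k ∧ i ≠ 0 ∧ i % 2 = 0 := by simp [evens]

lemma mem_odds {k i : ℕ} : i ∈ odds k ↔ i < k ∧ i % 2 = 1 := by simp [odds]

namespace Estimators.IsOrthogonal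

variable {e : Estimators WA WB} (he : e.IsOrthogonal μx νA νB vA vB)
include he

lemma sqUI_noiseA : SqUI (procLaw μx νA νB vA vB) fun q n => (q.2.1 n).noiseA.2 :=
  SqUI.of_array rowMeas_noiseA meanUIArr_noiseA

lemma sqUI_noiseB : SqUI (procLaw μx νA νB vA vB) fun q n => (q.2.1 n).noiseB.2 :=
  SqUI.of_array rowMeas_noiseB meanUIArr_noiseB

/-- All columns have uniformly integrable normalized squared norms: one of the two vectors of a step
is the signal or an output, the other one is its image under an isometry. -/
lemma sqUI_col (l : ℕ) : SqUI (procLaw μx νA νB vA vB) (e.colA l) ∧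
    SqUI (procLaw μx νA νB vA vB) (e.colB l) := by
  have hV : ∀ N, Measurable fun ω : Canon WA WB N => ω.2 := fun N => measurable_snd
  have hfwd : e.strategy.side l = true → SqUI (procLaw μx νA νB vA vB) (e.colA l) →
      SqUI (procLaw μx νA νB vA vB) (e.colA l) ∧ SqUI (procLaw μx νA νB vA vB) (e.colB l) := by
    intro hs h
    have h1 := h.mulVec hV
    refine ⟨h, ?_⟩
    convert h1 using 2 with q
    exact colB_of_side hs q
  have hl : l = 0 ∨ (∃ t, l = 2 * t + 1) ∨ ∃ t, l = 2 * t + 2 := by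
    rcases Nat.even_or_odd' l with ⟨t, h | h⟩
    · rcases t with - | t
      · exact Or.inl h
      · exact Or.inr (Or.inr ⟨t, by omega⟩)
    · exact Or.inr (Or.inl ⟨t, h⟩)
  rcases hl with rfl | ⟨t, rfl⟩ | ⟨t, rfl⟩
  · refine hfwd e.side_zero (SqUI.of_array (e.rowMeas_colA 0) ?_)
    simp only [colA_zero]
    exact meanUIArr_signal he.memLp
  · exact hfwd (e.side_odd t) (SqUI.of_array (e.rowMeas_colA _) (he.uiA t))
  · have h := SqUI.of_array (e.rowMeas_colB _) (he.uiB t)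
    have h1 := h.mulVec fun N => measurable_orth_inv.comp (hV N)
    refine ⟨?_, h⟩
    convert h1 using 2 with q
    exact colA_of_not_side (e.side_even t) q

lemma sqUI_inA (p : ℕ) : SqUI (procLaw μx νA νB vA vB) (e.inA p) := by
  rcases e.inA_cases p with h | h
  · rw [h]
    exact ((he.sqUI_col 0).1.const_smul _).add he.sqUI_noiseA
  · rw [h]
    exact (he.sqUI_col p).1

lemma sqUI_inB (p : ℕ) : SqUI (procLaw μx νA νB vA vB) (e.inB p) := by
  rcases e.inB_cases p with h | h
  · rw [h]
    exact ((he.sqUI_col 0).2.const_smul _).add he.sqUI_noiseB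
  · rw [h]
    exact (he.sqUI_col p).2

/-- The state of the process after `k` columns have been revealed: the positive even columns are
Gaussian on the first side, the odd columns on the second side. -/
theorem exists_inv (k : ℕ) : ∃ μA μB β, Inv (procLaw μx νA νB vA vB) (e.strategy.rowA (k + 1))
    (e.strategy.rowB (k + 1)) (fun _ ω => ω.2) μA μB (k + 1) (evens (k + 1)) (odds (k + 1)) β := by
  induction k with
  | zero =>
    obtain ⟨μA, μB, h⟩ := inv_one (νA := νA) (νB := νB) (vA := vA) (vB := vB) e.strategy
      e.side_zero e.ψA_zero he.normalized he.memLp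
    exact ⟨μA, μB, _, h⟩
  | succ k ih =>
    obtain ⟨μA, μB, β, h⟩ := ih
    rcases Nat.even_or_odd' k with ⟨t, rfl | rfl⟩
    · -- a step from the first to the second side
      have hs := e.side_odd t
      have hin : inp (e.strategy.rowA (2 * t + 1)) (inMsg e.αA (2 * t)) = e.inA (2 * t) :=
        funext fun q => inp_inMsg_rowA (by omega) (by omega) q
      have hout : inp (e.strategy.rowA (2 * t + 1)) (e.strategy.ψA (2 * t + 1)) =
          e.colA (2 * t + 1) := funext fun q => (colA_of_side hs q).symm
      have hsig : (fun q => cols (e.strategy.rowA (2 * t + 1)) q 0) = e.colA 0 :=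
        funext fun q => cols_rowA (by omega) q
      have hui : UIArr (procLaw μx νA νB vA vB) fun q n =>
          e.strategy.ψA (2 * t + 1) (e.strategy.rowA (2 * t + 1) q n) ^ 2 := by
        have h1 : UIArr (procLaw μx νA νB vA vB) fun q n => e.colA (2 * t + 1) q n ^ 2 :=
          (he.uiA t).uiArr fun N n => ((e.rowMeas_colA _).apply N n).pow_const 2
        rw [← hout] at h1
        exact h1
      obtain ⟨μA', μB', β', h'⟩ := h.step_of_orth (e.measurable_gA (t + 1)) (p := 2 * t)
        (by by_cases ht : t = 0
            · exact Or.inl (by omega)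
            · exact Or.inr (mem_evens.2 (by omega))) e.αA (e.ψA_odd t) hui
        (by rw [hin]; exact he.sqUI_inA _) (by rw [hout]; exact (he.sqUI_col _).1)
        (by rw [hsig]; exact (he.sqUI_col 0).1) (by rw [hin, hout, hsig]; exact he.orthA t)
        (fun N => Strategy.rowLaw_of_side _ (e.strategy.measurable_ψA _) N)
      refine ⟨μA', μB', β', ?_⟩
      rw [Strategy.rowA_succ_of_side hs, Strategy.rowB_succ_of_side hs]
      have e1 : evens (2 * t + 1 + 1) = evens (2 * t + 1) := by
        ext i
        simp only [mem_evens]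
        omega
      have e2 : odds (2 * t + 1 + 1) = insert (2 * t + 1) (odds (2 * t + 1)) := by
        ext i
        simp only [mem_odds, Finset.mem_insert]
        omega
      rw [e1, e2]
      exact h'
    · -- a step from the second to the first side, with the sides exchanged by `Inv.swap`
      have hs := e.side_even t
      have hin : inp (e.strategy.rowB (2 * t + 2)) (inMsg e.αB (2 * t - 1)) = e.inB (2 * t - 1) :=
        funext fun q => inp_inMsg_rowB (by omega) (by omega) q
      have hout : inp (e.strategy.rowB (2 * t + 2)) (e.strategy.ψB (2 * t + 2)) =
          e.colB (2 * t + 2) := funext fun q => (colB_of_not_side hs q).symm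
      have hsig : (fun q => cols (e.strategy.rowB (2 * t + 2)) q 0) = e.colB 0 :=
        funext fun q => cols_rowB (by omega) q
      have hui : UIArr (procLaw μx νA νB vA vB) fun q n =>
          e.strategy.ψB (2 * t + 2) (e.strategy.rowB (2 * t + 2) q n) ^ 2 := by
        have h1 : UIArr (procLaw μx νA νB vA vB) fun q n => e.colB (2 * t + 2) q n ^ 2 :=
          (he.uiB t).uiArr fun N n => ((e.rowMeas_colB _).apply N n).pow_const 2
        rw [← hout] at h1
        exact h1
      obtain ⟨μB', μA', β', h'⟩ := h.swap.step_of_orth (e.measurable_gB (t + 1)) (p := 2 * t - 1)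
        (by by_cases ht : t = 0
            · exact Or.inl (by omega)
            · exact Or.inr (mem_odds.2 (by omega))) e.αB (e.ψB_even t) hui
        (by rw [hin]; exact he.sqUI_inB _) (by rw [hout]; exact (he.sqUI_col _).2)
        (by rw [hsig]; exact (he.sqUI_col 0).2) (by rw [hin, hout, hsig]; exact he.orthB t)
        (fun N => Strategy.rowLaw_of_not_side _ (e.strategy.measurable_ψB _) N)
      have h'' := h'.swap
      simp only [inv_inv] at h''
      refine ⟨μA', μB', β', ?_⟩
      rw [Strategy.rowA_succ_of_not_side hs, Strategy.rowB_succ_of_not_side hs]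
      have e1 : evens (2 * t + 1 + 1 + 1) = insert (2 * t + 1 + 1) (evens (2 * t + 1 + 1)) := by
        ext i
        simp only [mem_evens, Finset.mem_insert]
        omega
      have e2 : odds (2 * t + 1 + 1 + 1) = odds (2 * t + 1 + 1) := by
        ext i
        simp only [mem_odds]
        omega
      rw [e1, e2]
      exact h''

end Estimators.IsOrthogonal

end Orthogonality

/-! ### Asymptotic orthogonality of the Gram-Schmidt errors -/

section AsympOrth

variable {Ω : ℕ → Type*} [∀ N, MeasurableSpace (Ω N)] {P : ∀ N, Measure (Ω N)}

/-- The normalized inner products tend to zero in probability and in mean. -/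
def AsympOrth (P : ∀ N, Measure (Ω N)) (u v : ∀ q : Σ N, Ω N, Fin q.1 → ℝ) : Prop :=
  Tendsto (fun q => (q.1 : ℝ)⁻¹ * (u q ⬝ᵥ v q)) (whp P) (𝓝 0) ∧
  Tendsto (fun N : ℕ => (N : ℝ)⁻¹ * ∫ ω, u ⟨N, ω⟩ ⬝ᵥ v ⟨N, ω⟩ ∂(P N)) atTop (𝓝 0)

variable [∀ N, IsProbabilityMeasure (P N)] {v s : ∀ q : Σ N, Ω N, Fin q.1 → ℝ} {b : ℝ}

lemma dot_gsErr (q : Σ N, Ω N) : s q ⬝ᵥ gsErr P s v q = v q ⬝ᵥ s q -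
    gsCoeff (P q.1) (fun ω => s ⟨q.1, ω⟩) (fun ω => v ⟨q.1, ω⟩) * (s q ⬝ᵥ s q) := by
  simp only [gsErr, gsError, dotProduct_sub, dotProduct_smul, smul_eq_mul,
    dotProduct_comm (s q) (v q)]

/-- A Gram-Schmidt error is asymptotically orthogonal to the normalized signal. -/
lemma asympOrth_signal (hv : SqUI P v) (hs : SqUI P s)
    (hss : Tendsto (fun q => (q.1 : ℝ)⁻¹ * (s q ⬝ᵥ s q)) (whp P) (𝓝 1))
    (hvs : Tendsto (fun q => (q.1 : ℝ)⁻¹ * (v q ⬝ᵥ s q)) (whp P) (𝓝 b)) :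
    AsympOrth P s (gsErr P s v) := by
  have hb := tendsto_gsCoeff hv hs hvs
  constructor
  · have h := hvs.sub ((hb.comp (tendsto_whp_fst (P := P))).mul hss)
    rw [mul_one, sub_self] at h
    refine h.congr fun q => ?_
    rw [dot_gsErr]
    simp only [Function.comp_apply]
    ring
  · have h := (hv.tendsto_integral_dot hs hvs).sub (hb.mul (hs.tendsto_integral_dot hs hss))
    rw [mul_one, sub_self] at h
    refine h.congr fun N => ?_
    have h1 : ∫ ω, s ⟨N, ω⟩ ⬝ᵥ gsErr P s v ⟨N, ω⟩ ∂(P N) = ∫ ω, v ⟨N, ω⟩ ⬝ᵥ s ⟨N, ω⟩ ∂(P N) -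
        gsCoeff (P N) (fun ω => s ⟨N, ω⟩) (fun ω => v ⟨N, ω⟩) *
          ∫ ω, s ⟨N, ω⟩ ⬝ᵥ s ⟨N, ω⟩ ∂(P N) := by
      rw [← integral_const_mul, ← integral_sub (hv.integrable_dot hs N)
        ((hs.integrable_dot hs N).const_mul _)]
      exact integral_congr_ae (Eventually.of_forall fun ω => dot_gsErr ⟨N, ω⟩)
    rw [h1]
    ring

variable {WA WB : Type*} [MeasurableSpace WA] [MeasurableSpace WB]
variable {rA : ∀ q : Σ N, Ω N, Fin q.1 → (WA × ℝ) × (ℕ → ℝ)}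
  {rB : ∀ q : Σ N, Ω N, Fin q.1 → (WB × ℝ) × (ℕ → ℝ)}
  {V : ∀ N, Ω N → Matrix.orthogonalGroup (Fin N) ℝ} {μA : Measure ((WA × ℝ) × (ℕ → ℝ))}
  {μB : Measure ((WB × ℝ) × (ℕ → ℝ))} {j : ℕ} {IA IB : Finset ℕ} {β : ℕ → ℝ}

/-- On the first side, the error of an input message is orthogonal to the errors of the columns
that originate on this side. -/
lemma Inv.asympOrth (h : Inv P rA rB V μA μB j IA IB β) {p l : ℕ} (hp : p = 0 ∨ p ∈ IA)
    (hl : l ∈ IB) (α : ℝ) (hin : SqUI P (inp rA (inMsg α p)))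
    (hout : SqUI P fun q => cols rA q l) (hsig : SqUI P fun q => cols rA q 0) :
    AsympOrth P (gsErr P (fun q => cols rA q 0) (inp rA (inMsg α p)))
      (gsErr P (fun q => cols rA q 0) fun q => cols rA q l) := by
  have h1 := h.tendsto_gsErr (measurable_coord l) (h.stA.ui l) hp α hin hout hsig
  have hzero : ∫ x : (WA × ℝ) × (ℕ → ℝ), gvec IA β x p *
      (x.2 l - (∫ y : (WA × ℝ) × (ℕ → ℝ), y.2 l * y.2 0 ∂μA) * x.2 0) ∂μA = 0 := by
    rw [h.beta l (h.subB l hl).2]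
    rcases hp with rfl | hp
    · exact h.initA l hl
    · have hp0 : p ≠ 0 := fun h' => h.zero_notMem (h' ▸ hp)
      simp only [gvec, hp0, hp, if_true, if_false]
      exact h.cross p hp l hl
  rw [hzero] at h1
  exact h1

/-- On the first side, the signal is orthogonal to the errors of all columns. -/
lemma Inv.asympOrth_signal (h : Inv P rA rB V μA μB j IA IB β) (l : ℕ)
    (hout : SqUI P fun q => cols rA q l) (hsig : SqUI P fun q => cols rA q 0) :
    AsympOrth P (fun q => cols rA q 0)
      (gsErr P (fun q => cols rA q 0) fun q => cols rA q l) := by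
  have hss := h.stA.tendsto_dot (measurable_coord 0) (measurable_coord 0) (h.stA.ui 0) (h.stA.ui 0)
  have hvs := h.stA.tendsto_dot (measurable_coord l) (measurable_coord 0) (h.stA.ui l) (h.stA.ui 0)
  rw [h.integral_sig_mul_sig] at hss
  exact OAMP.asympOrth_signal hout hsig hss hvs

end AsympOrth

section ProcessAsympOrth

variable {WA WB : Type*} [MeasurableSpace WA] [MeasurableSpace WB]
  {μx : Measure ℝ} [IsProbabilityMeasure μx] {νA : Measure WA} [IsProbabilityMeasure νA]
  {νB : Measure WB} [IsProbabilityMeasure νB] {vA vB : ℝ≥0}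

namespace Estimators.IsOrthogonal

variable {e : Estimators WA WB} (he : e.IsOrthogonal μx νA νB vA vB)
include he

/-- On the first side, the errors of the outputs are orthogonal to those of the inputs of the same
and of all earlier iterations. -/
lemma asympOrth_colA {t' t : ℕ} (ht : t' ≤ t) : AsympOrth (procLaw μx νA νB vA vB)
    (gsErr (procLaw μx νA νB vA vB) (e.colA 0) (e.inA (2 * t')))
    (gsErr (procLaw μx νA νB vA vB) (e.colA 0) (e.colA (2 * t + 1))) := by
  obtain ⟨μA, μB, β, h⟩ := he.exists_inv (2 * t + 1)
  have hin : inp (e.strategy.rowA (2 * t + 1 + 1)) (inMsg e.αA (2 * t')) = e.inA (2 * t') :=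
    funext fun q => inp_inMsg_rowA (by omega) (by omega) q
  have hout : (fun q => cols (e.strategy.rowA (2 * t + 1 + 1)) q (2 * t + 1)) =
      e.colA (2 * t + 1) := rfl
  have hsig : (fun q => cols (e.strategy.rowA (2 * t + 1 + 1)) q 0) = e.colA 0 :=
    funext fun q => cols_rowA (by omega) q
  have h1 := h.asympOrth (p := 2 * t') (l := 2 * t + 1)
    (by by_cases h0 : t' = 0
        · exact Or.inl (by omega)
        · exact Or.inr (mem_evens.2 (by omega)))
    (mem_odds.2 (by omega)) e.αA (by rw [hin]; exact he.sqUI_inA _)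
    (by rw [hout]; exact (he.sqUI_col _).1) (by rw [hsig]; exact (he.sqUI_col 0).1)
  rwa [hin, hout, hsig] at h1

/-- On the second side, the errors of the outputs are orthogonal to those of the inputs of the same
and of all earlier iterations. -/
lemma asympOrth_colB {t' t : ℕ} (ht : t' ≤ t) : AsympOrth (procLaw μx νA νB vA vB)
    (gsErr (procLaw μx νA νB vA vB) (e.colB 0) (e.inB (2 * t' - 1)))
    (gsErr (procLaw μx νA νB vA vB) (e.colB 0) (e.colB (2 * t + 2))) := by
  obtain ⟨μA, μB, β, h⟩ := he.exists_inv (2 * t + 2)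
  have hin : inp (e.strategy.rowB (2 * t + 2 + 1)) (inMsg e.αB (2 * t' - 1)) =
      e.inB (2 * t' - 1) := funext fun q => inp_inMsg_rowB (by omega) (by omega) q
  have hout : (fun q => cols (e.strategy.rowB (2 * t + 2 + 1)) q (2 * t + 2)) =
      e.colB (2 * t + 2) := rfl
  have hsig : (fun q => cols (e.strategy.rowB (2 * t + 2 + 1)) q 0) = e.colB 0 :=
    funext fun q => cols_rowB (by omega) q
  have h1 := h.swap.asympOrth (p := 2 * t' - 1) (l := 2 * t + 2)
    (by by_cases h0 : t' = 0
        · exact Or.inl (by omega)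
        · exact Or.inr (mem_odds.2 (by omega)))
    (mem_evens.2 (by omega)) e.αB (by rw [hin]; exact he.sqUI_inB _)
    (by rw [hout]; exact (he.sqUI_col _).2) (by rw [hsig]; exact (he.sqUI_col 0).2)
  rwa [hin, hout, hsig] at h1

lemma asympOrth_signalA (l : ℕ) : AsympOrth (procLaw μx νA νB vA vB) (e.colA 0)
    (gsErr (procLaw μx νA νB vA vB) (e.colA 0) (e.colA l)) := by
  obtain ⟨μA, μB, β, h⟩ := he.exists_inv l
  have hout : (fun q => cols (e.strategy.rowA (l + 1)) q l) = e.colA l := rfl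
  have hsig : (fun q => cols (e.strategy.rowA (l + 1)) q 0) = e.colA 0 :=
    funext fun q => cols_rowA (by omega) q
  have h1 := h.asympOrth_signal l (by rw [hout]; exact (he.sqUI_col _).1)
    (by rw [hsig]; exact (he.sqUI_col 0).1)
  rwa [hout, hsig] at h1

lemma asympOrth_signalB (l : ℕ) : AsympOrth (procLaw μx νA νB vA vB) (e.colB 0)
    (gsErr (procLaw μx νA νB vA vB) (e.colB 0) (e.colB l)) := by
  obtain ⟨μA, μB, β, h⟩ := he.exists_inv l
  have hout : (fun q => cols (e.strategy.rowB (l + 1)) q l) = e.colB l := rfl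
  have hsig : (fun q => cols (e.strategy.rowB (l + 1)) q 0) = e.colB 0 :=
    funext fun q => cols_rowB (by omega) q
  have h1 := h.swap.asympOrth_signal l (by rw [hout]; exact (he.sqUI_col _).2)
    (by rw [hsig]; exact (he.sqUI_col 0).2)
  rwa [hout, hsig] at h1

end Estimators.IsOrthogonal

end ProcessAsympOrth

/-! ### Exchangeability of the positions -/

section Exchangeable

variable {WA WB : Type*} [MeasurableSpace WA] [MeasurableSpace WB]

/-- The permutation matrix, as an orthogonal matrix. -/
def permOrth {N : ℕ} (σ : Equiv.Perm (Fin N)) : Matrix.orthogonalGroup (Fin N) ℝ :=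
  ⟨σ.permMatrix ℝ, by
    rw [Matrix.mem_orthogonalGroup_iff, Matrix.transpose_permMatrix, ← Matrix.permMatrix_mul, inv_mul_cancel,
      Matrix.permMatrix_one]⟩

lemma permOrth_mulVec {N : ℕ} (σ : Equiv.Perm (Fin N)) (v : Fin N → ℝ) :
    (permOrth σ).1 *ᵥ v = v ∘ σ := Matrix.permMatrix_mulVec σ

/-- Renumbering the positions. -/
def permAct {N : ℕ} (σ : Equiv.Perm (Fin N)) (ω : Canon WA WB N) : Canon WA WB N :=
  (fun n => ω.1 (σ n), permOrth σ * ω.2 * (permOrth σ)⁻¹)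

lemma orth_mul_mulVec {N : ℕ} (U V : Matrix.orthogonalGroup (Fin N) ℝ) (v : Fin N → ℝ) :
    (U * V).1 *ᵥ v = U.1 *ᵥ (V.1 *ᵥ v) := (Matrix.mulVec_mulVec v U.1 V.1).symm

lemma permOrth_inv_mulVec {N : ℕ} (σ : Equiv.Perm (Fin N)) (v : Fin N → ℝ) :
    ((permOrth σ)⁻¹).1 *ᵥ (v ∘ σ) = v := by
  rw [← permOrth_mulVec, ← orth_mul_mulVec, inv_mul_cancel]
  exact Matrix.one_mulVec v

lemma permAct_mulVec {N : ℕ} (σ : Equiv.Perm (Fin N)) (ω : Canon WA WB N) (v : Fin N → ℝ) :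
    (permAct σ ω).2.1 *ᵥ (v ∘ σ) = (ω.2.1 *ᵥ v) ∘ σ := by
  rw [permAct, orth_mul_mulVec, orth_mul_mulVec, permOrth_inv_mulVec, permOrth_mulVec]

lemma permAct_inv_mulVec {N : ℕ} (σ : Equiv.Perm (Fin N)) (ω : Canon WA WB N) (v : Fin N → ℝ) :
    ((permAct σ ω).2⁻¹).1 *ᵥ (v ∘ σ) = ((ω.2⁻¹).1 *ᵥ v) ∘ σ := by
  have h1 : (permAct σ ω).2⁻¹ = permOrth σ * ω.2⁻¹ * (permOrth σ)⁻¹ := by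
    simp only [permAct]
    group
  rw [h1, orth_mul_mulVec, orth_mul_mulVec, permOrth_inv_mulVec, permOrth_mulVec]

lemma measurePreserving_permAct (ρ : Measure (RowData WA WB)) [IsProbabilityMeasure ρ] {N : ℕ}
    (σ : Equiv.Perm (Fin N)) :
    MeasurePreserving (permAct σ) (canonLaw ρ N) (canonLaw ρ N) := by
  have h1 : MeasurePreserving (fun (d : Fin N → RowData WA WB) n => d (σ n))
      (Measure.pi fun _ => ρ) (Measure.pi fun _ => ρ) :=
    (measurePreserving_piCongrLeft (fun _ : Fin N => ρ) σ).symm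
  have hl : MeasurePreserving (fun V => permOrth σ * V) (orthHaar N) (orthHaar N) :=
    ⟨measurable_orth_mul measurable_const measurable_id, orthHaar_map_mul_left _⟩
  have hr : MeasurePreserving (fun V => V * (permOrth σ)⁻¹) (orthHaar N) (orthHaar N) :=
    ⟨measurable_orth_mul measurable_id measurable_const, orthHaar_map_mul_right _⟩
  exact h1.prod (hr.comp hl)

/-- An array of rows that is renumbered together with the positions. -/
def Equivariant {R : Type*} (r : ∀ q : Σ N, Canon WA WB N, Fin q.1 → R) : Prop :=
  ∀ (N : ℕ) (σ : Equiv.Perm (Fin N)) (ω : Canon WA WB N) (n : Fin N),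
    r ⟨N, permAct σ ω⟩ n = r ⟨N, ω⟩ (σ n)

variable {R : Type*} {r : ∀ q : Σ N, Canon WA WB N, Fin q.1 → R}

lemma Equivariant.map {R' : Type*} (h : Equivariant r) (f : R → R') :
    Equivariant fun q n => f (r q n) := fun N σ ω n => congrArg f (h N σ ω n)

lemma Equivariant.prodMk {R' : Type*} {r' : ∀ q : Σ N, Canon WA WB N, Fin q.1 → R'}
    (h : Equivariant r) (h' : Equivariant r') : Equivariant fun q n => (r q n, r' q n) :=
  fun N σ ω n => Prod.ext (h N σ ω n) (h' N σ ω n)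

lemma equivariant_data : Equivariant fun (q : Σ N, Canon WA WB N) n => q.2.1 n :=
  fun _ _ _ _ => rfl

variable {u v : ∀ q : Σ N, Canon WA WB N, Fin q.1 → ℝ}

lemma Equivariant.mulVec (h : Equivariant u) : Equivariant fun q => q.2.2.1 *ᵥ u q := by
  intro N σ ω n
  have h1 : u ⟨N, permAct σ ω⟩ = u ⟨N, ω⟩ ∘ σ := funext fun m => h N σ ω m
  have h2 := permAct_mulVec σ ω (u ⟨N, ω⟩)
  rw [← h1] at h2
  exact congrFun h2 n

lemma Equivariant.inv_mulVec (h : Equivariant u) : Equivariant fun q => (q.2.2⁻¹).1 *ᵥ u q := by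
  intro N σ ω n
  have h1 : u ⟨N, permAct σ ω⟩ = u ⟨N, ω⟩ ∘ σ := funext fun m => h N σ ω m
  have h2 := permAct_inv_mulVec σ ω (u ⟨N, ω⟩)
  rw [← h1] at h2
  exact congrFun h2 n

lemma Equivariant.gsErr (P : ∀ N, Measure (Canon WA WB N)) (hu : Equivariant u)
    (hv : Equivariant v) : Equivariant (gsErr P u v) := by
  intro N σ ω n
  simp only [OAMP.gsErr, gsError, Pi.sub_apply, Pi.smul_apply]
  rw [hu N σ ω n, hv N σ ω n]

/-- The expectation of the product of two entries does not depend on the position. -/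
lemma Equivariant.integral_mul_eq (ρ : Measure (RowData WA WB)) [IsProbabilityMeasure ρ]
    (hu : Equivariant u) (hv : Equivariant v) (hum : RowMeas u) (hvm : RowMeas v) (N : ℕ)
    (n m : Fin N) : ∫ ω, u ⟨N, ω⟩ n * v ⟨N, ω⟩ n ∂(canonLaw ρ N) =
      ∫ ω, u ⟨N, ω⟩ m * v ⟨N, ω⟩ m ∂(canonLaw ρ N) := by
  have h1 := measurePreserving_permAct ρ (Equiv.swap n m)
  have hf : Measurable fun ω : Canon WA WB N => u ⟨N, ω⟩ n * v ⟨N, ω⟩ n :=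
    (hum.apply N n).mul (hvm.apply N n)
  have h2 := integral_map h1.aemeasurable hf.aestronglyMeasurable
  rw [h1.map_eq] at h2
  rw [h2]
  refine integral_congr_ae (Eventually.of_forall fun ω => ?_)
  simp only [hu N _ ω n, hv N _ ω n, Equiv.swap_apply_left]

lemma Strategy.equivariant_row (s : Strategy WA WB) (k : ℕ) :
    Equivariant (s.rowA k) ∧ Equivariant (s.rowB k) := by
  induction k with
  | zero => exact ⟨equivariant_data.map startA, equivariant_data.map startB⟩
  | succ k ih =>
    cases hs : s.side k
    · have h1 : Equivariant (inp (s.rowB k) (s.ψB k)) := ih.2.map _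
      rw [Strategy.rowA_succ_of_not_side hs, Strategy.rowB_succ_of_not_side hs]
      exact ⟨(ih.1.prodMk h1.inv_mulVec).map _, ih.2.map fun x => insCol k (x, s.ψB k x)⟩
    · have h1 : Equivariant (inp (s.rowA k) (s.ψA k)) := ih.1.map _
      rw [Strategy.rowA_succ_of_side hs, Strategy.rowB_succ_of_side hs]
      exact ⟨ih.1.map fun x => insCol k (x, s.ψA k x), (ih.2.prodMk h1.mulVec).map _⟩

namespace Estimators

variable (e : Estimators WA WB)

lemma equivariant_colA (l : ℕ) : Equivariant (e.colA l) :=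
  (e.strategy.equivariant_row (l + 1)).1.map fun x => x.2 l

lemma equivariant_colB (l : ℕ) : Equivariant (e.colB l) :=
  (e.strategy.equivariant_row (l + 1)).2.map fun x => x.2 l

lemma equivariant_inA (p : ℕ) : Equivariant (e.inA p) := by
  rcases e.inA_cases p with h | h
  · rw [h]
    exact ((e.equivariant_colA 0).prodMk equivariant_data).map fun x => e.αA * x.1 + x.2.noiseA.2
  · rw [h]
    exact e.equivariant_colA p

lemma equivariant_inB (p : ℕ) : Equivariant (e.inB p) := by
  rcases e.inB_cases p with h | h
  · rw [h]
    exact ((e.equivariant_colB 0).prodMk equivariant_data).map fun x => e.αB * x.1 + x.2.noiseB.2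
  · rw [h]
    exact e.equivariant_colB p

end Estimators

end Exchangeable

/-! ### The law of a random system -/

section Haar

lemma measurableEmbedding_orth_entries (N : ℕ) : MeasurableEmbedding
    fun (V : Matrix.orthogonalGroup (Fin N) ℝ) (i j : Fin N) => V.1 i j := by
  have hc : Continuous fun (V : Matrix.orthogonalGroup (Fin N) ℝ) (i j : Fin N) => V.1 i j :=
    continuous_pi fun i => continuous_pi fun j =>
      (continuous_apply j).comp ((continuous_apply i).comp continuous_orth_val)
  refine (hc.isClosedEmbedding fun V W h => ?_).measurableEmbedding
  exact Subtype.ext (Matrix.ext fun i j => congrFun (congrFun h i) j)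

/-- A left invariant and a right invariant probability measure on a group agree. -/
lemma eq_of_mul_invariant {G : Type*} [Group G] [MeasurableSpace G] [MeasurableMul₂ G]
    {μ ν : Measure G} [IsProbabilityMeasure μ] [IsProbabilityMeasure ν]
    (hμ : ∀ g, μ.map (fun x => g * x) = μ) (hν : ∀ g, ν.map (fun x => x * g) = ν) : μ = ν := by
  refine Measure.ext fun s hs => ?_
  have hind : Measurable (s.indicator (1 : G → ℝ≥0∞)) := measurable_one.indicator hs
  have h1 : ∀ g, ∫⁻ x, s.indicator (1 : G → ℝ≥0∞) (g * x) ∂μ = μ s := by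
    intro g
    rw [← lintegral_map hind (measurable_const_mul g), hμ g, lintegral_indicator_one hs]
  have h2 : ∀ g, ∫⁻ x, s.indicator (1 : G → ℝ≥0∞) (x * g) ∂ν = ν s := by
    intro g
    rw [← lintegral_map hind (measurable_mul_const g), hν g, lintegral_indicator_one hs]
  have h3 := lintegral_lintegral_swap (μ := ν) (ν := μ)
    (f := fun x y => s.indicator (1 : G → ℝ≥0∞) (x * y)) (hind.comp measurable_mul).aemeasurable
  simpa [h1, h2] using h3

variable {Ω : Type*} [MeasurableSpace Ω] {P : Measure Ω} [IsProbabilityMeasure P] {N : ℕ}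
  {V : Ω → Matrix.orthogonalGroup (Fin N) ℝ}

lemma IsHaarDistributed.aemeasurable (h : IsHaarDistributed P V) : AEMeasurable V P :=
  (measurableEmbedding_orth_entries N).aemeasurable_comp_iff.1 h.1

/-- A Haar distributed random matrix has the law `orthHaar`. -/
lemma IsHaarDistributed.map_eq (h : IsHaarDistributed P V) : P.map V = orthHaar N := by
  have hV := h.aemeasurable
  have hE := measurableEmbedding_orth_entries N
  have hprob : IsProbabilityMeasure (P.map V) := Measure.isProbabilityMeasure_map hV
  refine eq_of_mul_invariant (fun U => ?_) orthHaar_map_mul_right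
  have hm : Measurable fun W : Matrix.orthogonalGroup (Fin N) ℝ => U * W := measurable_const_mul U
  rw [AEMeasurable.map_map_of_aemeasurable hm.aemeasurable hV]
  refine Measure.ext fun s hs => ?_
  -- invariance is given for the law of the matrix entries, so sets of matrices are compared through
  -- their images under the embedding into arrays of entries
  have h1 : ∀ W : Ω → Matrix.orthogonalGroup (Fin N) ℝ, AEMeasurable W P →
      (P.map fun ω i j => (W ω).1 i j) ((fun (V : Matrix.orthogonalGroup (Fin N) ℝ) i j =>
        V.1 i j) '' s) = P.map W s := by
    intro W hW
    have h2 := AEMeasurable.map_map_of_aemeasurable hE.measurable.aemeasurable hW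
    rw [← hE.injective.preimage_image s, ← hE.map_apply, h2, hE.injective.preimage_image]
    rfl
  rw [← h1 _ hV, ← h1 _ (hm.comp_aemeasurable hV)]
  exact congrFun (congrArg _ (h.2 U)) _

end Haar

namespace System

variable {Ω WΓ WΦ RΓ RΦ : Type*} [MeasurableSpace Ω] [MeasurableSpace WΓ] [MeasurableSpace WΦ]
  [MeasurableSpace RΓ] [MeasurableSpace RΦ] {P : Measure Ω} [IsProbabilityMeasure P]
  {μx : Measure ℝ} [IsProbabilityMeasure μx] {νΓ : Measure WΓ} [IsProbabilityMeasure νΓ]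
  {νΦ : Measure WΦ} [IsProbabilityMeasure νΦ] {vΓ vΦ : ℝ≥0} {S : System Ω WΓ WΦ RΓ RΦ}

/-- The data of all positions and the orthogonal matrix of the system; the first side is that of
`x`, the second side that of `𝒳`. -/
def canon (S : System Ω WΓ WΦ RΓ RΦ) (N : ℕ) (ω : Ω) : Canon WΦ WΓ N :=
  (fun n => (S.x N ω n, S.wΦ N ω n, S.f0 N ω n, S.wΓ N ω n, S.g0 N ω n), S.V N ω)

lemma IsModel.aemeasurable_canon (hS : S.IsModel P μx νΓ νΦ vΓ vΦ) (N : ℕ) :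
    AEMeasurable (S.canon N) P := (hS.iid N).aemeasurable.prodMk (hS.haar N).aemeasurable

/-- The data and the matrix of a random system have the law of the canonical process. -/
lemma IsModel.map_canon (hS : S.IsModel P μx νΓ νΦ vΓ vΦ) (N : ℕ) :
    P.map (S.canon N) = procLaw μx νΦ νΓ vΦ vΓ N := by
  have hE := measurableEmbedding_orth_entries N
  have h1 : IndepFun (fun ω (n : Fin N) =>
      (S.x N ω n, S.wΦ N ω n, S.f0 N ω n, S.wΓ N ω n, S.g0 N ω n)) (S.V N) P := by
    have h2 := (hS.indep N).symm
    rw [IndepFun_iff_Indep] at h2 ⊢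
    have h3 : MeasurableSpace.comap (S.V N) inferInstance = MeasurableSpace.comap
        (fun ω i j => (S.V N ω : Matrix (Fin N) (Fin N) ℝ) i j) inferInstance := by
      conv_lhs => rw [← hE.comap_eq, MeasurableSpace.comap_comp]
      rfl
    rwa [h3]
  rw [indepFun_iff_map_prod_eq_prod_map_map (hS.iid N).aemeasurable (hS.haar N).aemeasurable,
    (hS.iid N).map_eq, (hS.haar N).map_eq] at h1
  exact h1

/-- The estimators of the system. -/
def IsModel.estimators (hS : S.IsModel P μx νΓ νΦ vΓ vΦ) : Estimators WΦ WΓ where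
  gA t a p := S.φ t a (S.obsΦ p.1 p.2)
  gB t a p := S.γ t a (S.obsΓ p.1 p.2)
  αA := S.αΦ
  αB := S.αΓ
  measurable_gA t := (hS.measurable_φ t).comp
    (measurable_fst.prodMk (hS.measurable_obsΦ.comp measurable_snd))
  measurable_gB t := (hS.measurable_γ t).comp
    (measurable_fst.prodMk (hS.measurable_obsΓ.comp measurable_snd))

/-! ### The messages of a random system as columns of the revealing process -/

variable (hS : S.IsModel P μx νΓ νΦ vΓ vΦ)
include hS

namespace IsModel

lemma colA_canon_zero (N : ℕ) (ω : Ω) : hS.estimators.colA 0 ⟨N, S.canon N ω⟩ = S.x N ω :=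
  Estimators.colA_zero _

lemma colB_canon_zero (N : ℕ) (ω : Ω) : hS.estimators.colB 0 ⟨N, S.canon N ω⟩ = S.X N ω := by
  rw [Estimators.colB_of_side (Estimators.side_zero _), hS.colA_canon_zero]
  rfl

lemma colA_canon_odd {t N : ℕ} {ω : Ω}
    (h : hS.estimators.inA (2 * t) ⟨N, S.canon N ω⟩ = S.xIn t N ω) :
    hS.estimators.colA (2 * t + 1) ⟨N, S.canon N ω⟩ = S.xOut (t + 1) N ω := by
  funext n
  rw [Estimators.colA_odd_apply, h, hS.colA_canon_zero]
  rfl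

lemma colB_canon_even {t N : ℕ} {ω : Ω}
    (h : hS.estimators.inB (2 * t - 1) ⟨N, S.canon N ω⟩ = S.XIn t N ω) :
    hS.estimators.colB (2 * t + 2) ⟨N, S.canon N ω⟩ = S.XOut (t + 1) N ω := by
  funext n
  rw [Estimators.colB_even_apply, h, hS.colB_canon_zero]
  rfl

/-- The input messages of the system are columns of the revealing process. -/
lemma in_canon (t N : ℕ) (ω : Ω) :
    hS.estimators.inA (2 * t) ⟨N, S.canon N ω⟩ = S.xIn t N ω ∧
      hS.estimators.inB (2 * t - 1) ⟨N, S.canon N ω⟩ = S.XIn t N ω := by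
  induction t with
  | zero =>
    constructor
    · simp only [Estimators.inA, mul_zero, if_true, hS.colA_canon_zero]
      rfl
    · simp only [Estimators.inB, mul_zero, Nat.zero_sub, if_true, hS.colB_canon_zero]
      rfl
  | succ t ih =>
    constructor
    · rw [Estimators.inA, if_neg (by omega), show 2 * (t + 1) = 2 * t + 2 by ring,
        Estimators.colA_of_not_side (Estimators.side_even _ t), orth_inv_val,
        hS.colB_canon_even ih.2]
      rfl
    · rw [Estimators.inB, if_neg (by omega), show 2 * (t + 1) - 1 = 2 * t + 1 by omega,
        Estimators.colB_of_side (Estimators.side_odd _ t), hS.colA_canon_odd ih.1]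
      rfl

lemma xIn_eq (t N : ℕ) (ω : Ω) : S.xIn t N ω =
    hS.estimators.inA (2 * t) ⟨N, S.canon N ω⟩ := (hS.in_canon t N ω).1.symm

lemma XIn_eq (t N : ℕ) (ω : Ω) : S.XIn t N ω =
    hS.estimators.inB (2 * t - 1) ⟨N, S.canon N ω⟩ := (hS.in_canon t N ω).2.symm

lemma xOut_eq (t N : ℕ) (ω : Ω) : S.xOut (t + 1) N ω =
    hS.estimators.colA (2 * t + 1) ⟨N, S.canon N ω⟩ :=
  (hS.colA_canon_odd (hS.in_canon t N ω).1).symm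

lemma XOut_eq (t N : ℕ) (ω : Ω) : S.XOut (t + 1) N ω =
    hS.estimators.colB (2 * t + 2) ⟨N, S.canon N ω⟩ :=
  (hS.colB_canon_even (hS.in_canon t N ω).2).symm

end IsModel

end System

/-! ### Transfer from the law to the random system -/

section Transfer

variable {Ω' : ℕ → Type*} [∀ N, MeasurableSpace (Ω' N)] {P' : ∀ N, Measure (Ω' N)}

/-- A bound at every position, uniform in the position, gives uniform integrability in mean. -/
lemma MeanUIArr.of_forall_position {y : ∀ q : Σ N, Ω' N, Fin q.1 → ℝ} (hm : RowMeas y)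
    (h : ∀ ε > 0, ∃ M : ℝ, 0 ≤ M ∧ ∀ (N : ℕ) (n : Fin N),
      ∫⁻ ω, ENNReal.ofReal (tailPart M (y ⟨N, ω⟩ n)) ∂(P' N) ≤ ENNReal.ofReal ε) :
    MeanUIArr P' y := by
  intro ε hε
  obtain ⟨M, hM, hI⟩ := h ε hε
  refine ⟨M, hM, fun N => ?_⟩
  have hmt : ∀ n : Fin N, Measurable fun ω : Ω' N => ENNReal.ofReal (tailPart M (y ⟨N, ω⟩ n)) :=
    fun n => ((measurable_tailPart M).comp (hm.apply N n)).ennreal_ofReal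
  have h1 : ∀ ω : Ω' N, ENNReal.ofReal (avg fun n : Fin N => tailPart M (y ⟨N, ω⟩ n)) =
      ENNReal.ofReal (N : ℝ)⁻¹ * ∑ n : Fin N, ENNReal.ofReal (tailPart M (y ⟨N, ω⟩ n)) := by
    intro ω
    rw [avg, ENNReal.ofReal_mul (by positivity),
      ENNReal.ofReal_sum_of_nonneg fun n _ => tailPart_nonneg _ _]
  simp only [h1]
  rw [lintegral_const_mul _ (Finset.measurable_fun_sum _ fun n _ => hmt n),
    lintegral_finsetSum _ fun n _ => hmt n]
  calc ENNReal.ofReal (N : ℝ)⁻¹ *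
        ∑ n : Fin N, ∫⁻ ω, ENNReal.ofReal (tailPart M (y ⟨N, ω⟩ n)) ∂(P' N)
      ≤ ENNReal.ofReal (N : ℝ)⁻¹ * ∑ _n : Fin N, ENNReal.ofReal ε := by
        gcongr with n
        exact hI N n
    _ = ENNReal.ofReal ((N : ℝ)⁻¹ * (N * ε)) := by
        rw [Finset.sum_const, Finset.card_univ, Fintype.card_fin, nsmul_eq_mul,
          ENNReal.ofReal_mul (by positivity), ENNReal.ofReal_mul (by positivity),
          ENNReal.ofReal_natCast]
    _ ≤ ENNReal.ofReal ε := by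
        refine ENNReal.ofReal_le_ofReal ?_
        rcases Nat.eq_zero_or_pos N with rfl | hN
        · simpa using hε.le
        · have hN' : (N : ℝ) ≠ 0 := by exact_mod_cast hN.ne'
          rw [inv_mul_cancel_left₀ hN']

variable {Ω : Type*} [MeasurableSpace Ω] {P : Measure Ω} {Y : ∀ N, Ω → Ω' N}
  {u v : ∀ q : Σ N, Ω' N, Fin q.1 → ℝ}

/-- Uniformly integrable entries have uniformly integrable mean squares. -/
lemma MeanUIArr.of_uniformIntegrable (hY : ∀ N, HasLaw (Y N) (P' N) P)
    {f : (Σ N : ℕ, Fin N) → Ω → ℝ} (hf : UniformIntegrable f 2 P) (hu : RowMeas u)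
    (h : ∀ N (n : Fin N) ω, f ⟨N, n⟩ ω = u ⟨N, Y N ω⟩ n) :
    MeanUIArr P' fun q n => u q n ^ 2 := by
  refine MeanUIArr.of_forall_position (fun N => measurable_pi_lambda _ fun n : Fin N =>
    (hu.apply N n).pow_const 2) fun ε hε => ?_
  obtain ⟨C, hC⟩ := hf.spec two_ne_zero ENNReal.ofNat_ne_top (Real.sqrt_pos.2 hε)
  refine ⟨(C : ℝ) ^ 2, by positivity, fun N n => ?_⟩
  have hm : Measurable fun ω : Ω' N => ENNReal.ofReal (tailPart ((C : ℝ) ^ 2) (u ⟨N, ω⟩ n ^ 2)) :=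
    ((measurable_tailPart _).comp ((hu.apply N n).pow_const 2)).ennreal_ofReal
  rw [← (hY N).map_eq, lintegral_map' hm.aemeasurable (hY N).aemeasurable]
  set g := {ω | C ≤ ‖f ⟨N, n⟩ ω‖₊}.indicator (f ⟨N, n⟩) with hg
  have h1 : ∀ ω, ENNReal.ofReal (tailPart ((C : ℝ) ^ 2) (u ⟨N, Y N ω⟩ n ^ 2)) ≤
      ‖g ω‖ₑ ^ (2 : ℝ) := by
    intro ω
    rw [← h N n ω, tailPart]
    split_ifs with hlt
    · rw [abs_of_nonneg (sq_nonneg _), ← sq_abs (f _ _)] at hlt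
      have hmem : ω ∈ {ω | C ≤ ‖f ⟨N, n⟩ ω‖₊} := by
        change (C : ℝ) ≤ ‖f ⟨N, n⟩ ω‖
        exact (lt_of_pow_lt_pow_left₀ 2 (abs_nonneg _) hlt).le
      rw [hg, Set.indicator_of_mem hmem, abs_of_nonneg (sq_nonneg _), ← ofReal_norm,
        ENNReal.rpow_two, ← ENNReal.ofReal_pow (norm_nonneg _), Real.norm_eq_abs, sq_abs]
    · simp
  have h2 := eLpNorm_nnreal_pow_eq_lintegral (μ := P) (f := g) (p := 2) two_ne_zero
  have h3 : eLpNorm g ((2 : ℝ≥0) : ℝ≥0∞) P ≤ ENNReal.ofReal √ε := hC ⟨N, n⟩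
  refine (lintegral_mono h1).trans ?_
  refine (le_of_eq h2.symm).trans ((ENNReal.rpow_le_rpow h3 (by positivity)).trans (le_of_eq ?_))
  rw [NNReal.coe_ofNat, ENNReal.rpow_two, ← ENNReal.ofReal_pow (Real.sqrt_nonneg _),
    Real.sq_sqrt hε.le]

lemma integral_dot_pullback (hY : ∀ N, HasLaw (Y N) (P' N) P) (hu : RowMeas u) (hv : RowMeas v)
    (N : ℕ) : ∫ ω, u ⟨N, Y N ω⟩ ⬝ᵥ v ⟨N, Y N ω⟩ ∂P = ∫ ω, u ⟨N, ω⟩ ⬝ᵥ v ⟨N, ω⟩ ∂(P' N) := by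
  have hm : Measurable fun ω : Ω' N => u ⟨N, ω⟩ ⬝ᵥ v ⟨N, ω⟩ := measurable_dot (hu N) (hv N)
  exact (hY N).integral_comp hm.aestronglyMeasurable

lemma gsError_pullback (hY : ∀ N, HasLaw (Y N) (P' N) P) (hu : RowMeas u) (hv : RowMeas v)
    (N : ℕ) : gsError P (fun ω => u ⟨N, Y N ω⟩) (fun ω => v ⟨N, Y N ω⟩) =
      fun ω => gsErr P' u v ⟨N, Y N ω⟩ := by
  funext ω
  simp only [gsErr, gsError, gsCoeff]
  rw [integral_dot_pullback hY hv hu]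

lemma rowMeas_gsErr (P' : ∀ N, Measure (Ω' N)) (hu : RowMeas u) (hv : RowMeas v) :
    RowMeas (gsErr P' u v) := fun N => (hv N).sub
    ((hu N).const_smul (gsCoeff (P' N) (fun ω => u ⟨N, ω⟩) fun ω => v ⟨N, ω⟩))

/-- Asymptotic orthogonality only depends on the law. -/
lemma AsympOrth.tendstoInMeasure (h : AsympOrth P' u v) (hY : ∀ N, HasLaw (Y N) (P' N) P)
    (hu : RowMeas u) (hv : RowMeas v) : TendstoInMeasure P
      (fun (N : ℕ) ω => (1 / (N : ℝ)) * (u ⟨N, Y N ω⟩ ⬝ᵥ v ⟨N, Y N ω⟩)) atTop fun _ => 0 := by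
  rw [tendstoInMeasure_iff_dist]
  intro ε hε
  refine (eventually_whp.1 (tendsto_whp_iff.1 h.1 ε hε)).congr fun N => ?_
  have hm : Measurable fun ω : Ω' N => (N : ℝ)⁻¹ * (u ⟨N, ω⟩ ⬝ᵥ v ⟨N, ω⟩) :=
    (measurable_dot (hu N) (hv N)).const_mul _
  have hs : MeasurableSet {ω : Ω' N | ¬ |(N : ℝ)⁻¹ * (u ⟨N, ω⟩ ⬝ᵥ v ⟨N, ω⟩) - 0| < ε} :=
    (measurableSet_lt (hm.sub_const 0).abs measurable_const).compl
  refine ((hY N).measure_eq (p := fun ω : Ω' N =>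
    ¬ |(N : ℝ)⁻¹ * (u ⟨N, ω⟩ ⬝ᵥ v ⟨N, ω⟩) - 0| < ε) hs).symm.trans ?_
  simp only [not_lt, one_div, Real.dist_eq]

lemma AsympOrth.tendsto_integral (h : AsympOrth P' u v) (hY : ∀ N, HasLaw (Y N) (P' N) P)
    (hu : RowMeas u) (hv : RowMeas v) : Tendsto (fun N : ℕ => (1 / (N : ℝ)) *
      ∫ ω, u ⟨N, Y N ω⟩ ⬝ᵥ v ⟨N, Y N ω⟩ ∂P) atTop (𝓝 0) := by
  refine h.2.congr fun N => ?_
  rw [integral_dot_pullback hY hu hv, one_div]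

end Transfer

/-! ### LLN-orthogonality -/

section LLN

variable {Ω : Type*} [MeasurableSpace Ω] {P : Measure Ω} [IsProbabilityMeasure P]
  {a b : ∀ N, Ω → Fin N → ℝ}

/-- If the entrywise expectations do not depend on the position, they are equal to the
normalized expected inner product. -/
lemma integral_mul_eq_of_exchangeable
    (hex : ∀ (N : ℕ) (n m : Fin N), ∫ ω, a N ω n * b N ω n ∂P = ∫ ω, a N ω m * b N ω m ∂P)
    (ha : ∀ N (n : Fin N), MemLp (fun ω => a N ω n) 4 P)
    (hb : ∀ N (n : Fin N), MemLp (fun ω => b N ω n) 4 P) (N : ℕ) (n : Fin N) :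
    ∫ ω, a N ω n * b N ω n ∂P = (1 / (N : ℝ)) * ∫ ω, a N ω ⬝ᵥ b N ω ∂P := by
  have h24 : (2 : ℝ≥0∞) ≤ 4 := by norm_num
  have hint : ∀ m : Fin N, Integrable (fun ω => a N ω m * b N ω m) P := fun m =>
    ((ha N m).mono_exponent h24).integrable_mul ((hb N m).mono_exponent h24)
  have hN : (N : ℝ) ≠ 0 := by exact_mod_cast (Fin.pos n).ne'
  have h1 : ∫ ω, a N ω ⬝ᵥ b N ω ∂P = ∑ m : Fin N, ∫ ω, a N ω m * b N ω m ∂P :=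
    integral_finsetSum _ fun m _ => hint m
  rw [h1, Finset.sum_congr rfl fun m _ => hex N m n, Finset.sum_const, Finset.card_univ,
    Fintype.card_fin, nsmul_eq_mul, one_div, inv_mul_cancel_left₀ hN]

lemma NonvanishingPower.power_ne_zero (h : NonvanishingPower P a) :
    ∀ᶠ N : ℕ in atTop, power P (a N) ≠ 0 := by
  obtain ⟨c, hc, h⟩ := h
  filter_upwards [h] with N hN h0
  rw [h0, mul_zero] at hN
  exact absurd hN (not_le.2 hc)

/-- Convergence in probability of the normalized inner product bounds the normalized squared
inner product, if the powers do not vanish. -/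
lemma tendsto_sq_dot_div_power
    (h1 : TendstoInMeasure P (fun (N : ℕ) ω => (1 / (N : ℝ)) * (a N ω ⬝ᵥ b N ω)) atTop fun _ => 0)
    (ha : NonvanishingPower P a) (hb : NonvanishingPower P b) {δ ε : ℝ} (hδ : 0 < δ) (hε : 0 < ε) :
    ∃ N' : ℕ, ∀ N : ℕ, N' < N →
      1 - δ ≤ P.real {ω | (a N ω ⬝ᵥ b N ω) ^ 2 / (power P (a N) * power P (b N)) < ε} := by
  obtain ⟨ca, hca, ha⟩ := ha
  obtain ⟨cb, hcb, hb⟩ := hb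
  have hη : 0 < √(ε * (ca * cb)) := by positivity
  rw [tendstoInMeasure_iff_measureReal_dist] at h1
  have h2 := (h1 _ hη).eventually (gt_mem_nhds hδ)
  obtain ⟨N', hN'⟩ := eventually_atTop.1 ((ha.and hb).and (h2.and (eventually_gt_atTop 0)))
  refine ⟨N', fun N hN => ?_⟩
  obtain ⟨⟨hpa, hpb⟩, hP, hN0⟩ := hN' N hN.le
  have hNr : (0 : ℝ) < N := by exact_mod_cast hN0
  set A := {ω | (a N ω ⬝ᵥ b N ω) ^ 2 / (power P (a N) * power P (b N)) < ε} with hA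
  set B := {ω | √(ε * (ca * cb)) ≤ dist ((1 / (N : ℝ)) * (a N ω ⬝ᵥ b N ω)) 0} with hB
  have hcover : (Set.univ : Set Ω) ⊆ A ∪ B := by
    intro ω _
    by_contra hω
    rw [Set.mem_union, not_or] at hω
    obtain ⟨hωA, hωB⟩ := hω
    have hωA : ε ≤ (a N ω ⬝ᵥ b N ω) ^ 2 / (power P (a N) * power P (b N)) := not_lt.1 hωA
    have hωB : dist ((1 / (N : ℝ)) * (a N ω ⬝ᵥ b N ω)) 0 < √(ε * (ca * cb)) := not_le.1 hωB
    rw [Real.dist_eq, sub_zero, Real.lt_sqrt (abs_nonneg _), sq_abs] at hωB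
    rw [one_div, ← div_eq_inv_mul, le_div_iff₀ hNr] at hpa hpb
    have hpp : ca * cb * (N : ℝ) ^ 2 ≤ power P (a N) * power P (b N) := by
      calc ca * cb * (N : ℝ) ^ 2 = (ca * N) * (cb * N) := by ring
        _ ≤ _ := mul_le_mul hpa hpb (by positivity) ((by positivity : 0 ≤ ca * N).trans hpa)
    have hpp0 : 0 < power P (a N) * power P (b N) := lt_of_lt_of_le (by positivity) hpp
    rw [le_div_iff₀ hpp0] at hωA
    have h4 : (1 / (N : ℝ) * (a N ω ⬝ᵥ b N ω)) ^ 2 * (N : ℝ) ^ 2 = (a N ω ⬝ᵥ b N ω) ^ 2 := by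
      field_simp
    have h5 := mul_lt_mul_of_pos_right hωB (by positivity : (0 : ℝ) < (N : ℝ) ^ 2)
    rw [h4] at h5
    have h6 := mul_le_mul_of_nonneg_left hpp hε.le
    linarith
  have h3 := (measureReal_mono hcover).trans (measureReal_union_le (μ := P) A B)
  rw [probReal_univ] at h3
  linarith

/-- The criterion for the LLN limit zero of exchangeable sequences with fourth moments. -/
lemma LLNLimitZero.of_tendsto
    (h1 : TendstoInMeasure P (fun (N : ℕ) ω => (1 / (N : ℝ)) * (a N ω ⬝ᵥ b N ω)) atTop fun _ => 0)
    (h2 : Tendsto (fun N : ℕ => (1 / (N : ℝ)) * ∫ ω, a N ω ⬝ᵥ b N ω ∂P) atTop (𝓝 0))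
    (hex : ∀ (N : ℕ) (n m : Fin N), ∫ ω, a N ω n * b N ω n ∂P = ∫ ω, a N ω m * b N ω m ∂P)
    (ha : ∀ N (n : Fin N), MemLp (fun ω => a N ω n) 4 P)
    (hb : ∀ N (n : Fin N), MemLp (fun ω => b N ω n) 4 P) : LLNLimitZero P a b := by
  refine ⟨h1, fun hpa hpb => ⟨hpa.power_ne_zero, hpb.power_ne_zero, fun ε hε => ?_, fun N n => ?_,
    fun δ hδ ε hε => tendsto_sq_dot_div_power h1 hpa hpb hδ hε⟩⟩
  · filter_upwards [Metric.tendsto_nhds.1 h2 ε hε] with N hN n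
    rw [Real.dist_eq, sub_zero] at hN
    rwa [integral_mul_eq_of_exchangeable hex ha hb N n]
  · have : ENNReal.HolderTriple 4 4 2 := ⟨by
      rw [show (4 : ℝ≥0∞) = 2 * 2 by norm_num,
        ENNReal.mul_inv (Or.inl two_ne_zero) (Or.inl ENNReal.ofNat_ne_top), ← mul_add,
        ENNReal.inv_two_add_inv_two, mul_one]⟩
    exact (hb N n).mul' (ha N n)

end LLN

/-! ### Fourth moments of the messages -/

section FourthMoments

variable {Ω : Type*} [MeasurableSpace Ω] {P : Measure Ω} {N : ℕ}

lemma memLp_orth_mulVec {V : Ω → Matrix.orthogonalGroup (Fin N) ℝ} (hV : AEMeasurable V P)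
    {u : Ω → Fin N → ℝ} {p : ℝ≥0∞} (hu : ∀ n, MemLp (fun ω => u ω n) p P) (n : Fin N) :
    MemLp (fun ω => ((V ω).1 *ᵥ u ω) n) p P := by
  have h1 : ∀ m, MemLp (fun ω => (V ω).1 n m * u ω m) p P := by
    intro m
    refine (hu m).mono (((measurable_orth_apply n m).comp_aemeasurable hV).aestronglyMeasurable.mul
      (hu m).1) (Eventually.of_forall fun ω => ?_)
    rw [norm_mul]
    exact mul_le_of_le_one_left (norm_nonneg _) (entry_norm_bound_of_unitary (V ω).2 n m)
  have h2 : MemLp (fun ω => ∑ m, (V ω).1 n m * u ω m) p P :=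
    memLp_finsetSum Finset.univ fun m _ => h1 m
  exact h2

lemma memLp_gsError {s u : Ω → Fin N → ℝ} {p : ℝ≥0∞} (hs : ∀ n, MemLp (fun ω => s ω n) p P)
    (hu : ∀ n, MemLp (fun ω => u ω n) p P) (n : Fin N) :
    MemLp (fun ω => gsError P s u ω n) p P := (hu n).sub ((hs n).const_mul _)

end FourthMoments

namespace System.IsModel

variable {Ω WΓ WΦ RΓ RΦ : Type*} [MeasurableSpace Ω] [MeasurableSpace WΓ] [MeasurableSpace WΦ]
  [MeasurableSpace RΓ] [MeasurableSpace RΦ] {P : Measure Ω} [IsProbabilityMeasure P]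
  {μx : Measure ℝ} [IsProbabilityMeasure μx] {νΓ : Measure WΓ} [IsProbabilityMeasure νΓ]
  {νΦ : Measure WΦ} [IsProbabilityMeasure νΦ] {vΓ vΦ : ℝ≥0} {S : System Ω WΓ WΦ RΓ RΦ}
  (hS : S.IsModel P μx νΓ νΦ vΓ vΦ)
include hS

lemma hasLaw_canon (N : ℕ) : HasLaw (S.canon N) (procLaw μx νΦ νΓ vΦ vΓ N) P :=
  ⟨hS.aemeasurable_canon N, hS.map_canon N⟩

lemma hasLaw_data (N : ℕ) (n : Fin N) :
    HasLaw (fun ω => (S.canon N ω).1 n) (dataLaw μx νΦ νΓ vΦ vΓ) P := by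
  have h := measurePreserving_canon_apply (WA := WΦ) (WB := WΓ) (dataLaw μx νΦ νΓ vΦ vΓ) N n
  refine ⟨h.measurable.comp_aemeasurable (hS.aemeasurable_canon N), ?_⟩
  have h2 : P.map (S.canon N) = canonLaw (dataLaw μx νΦ νΓ vΦ vΓ) N := hS.map_canon N
  rw [← h.map_eq, ← h2,
    AEMeasurable.map_map_of_aemeasurable h.measurable.aemeasurable (hS.aemeasurable_canon N)]
  rfl

lemma memLp_data {f : RowData WΦ WΓ → ℝ} {p : ℝ≥0∞} (hf : MemLp f p (dataLaw μx νΦ νΓ vΦ vΓ))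
    (N : ℕ) (n : Fin N) : MemLp (fun ω => f ((S.canon N ω).1 n)) p P := by
  have h := hS.hasLaw_data N n
  rw [← h.map_eq] at hf
  exact hf.comp_of_map h.aemeasurable

lemma memLp_x (N : ℕ) (n : Fin N) : MemLp (fun ω => S.x N ω n) 4 P :=
  hS.memLp_data (f := fun d => d.1)
    (hS.fourth_moment.comp_measurePreserving measurePreserving_fst) N n

lemma memLp_f0 (N : ℕ) (n : Fin N) : MemLp (fun ω => S.f0 N ω n) 4 P :=
  hS.memLp_data (f := fun d => d.2.2.1) (((memLp_id_gaussianReal 4).comp_measurePreserving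
    measurePreserving_snd).comp_measurePreserving (measurePreserving_dataA μx νΦ νΓ vΦ vΓ)) N n

lemma memLp_g0 (N : ℕ) (n : Fin N) : MemLp (fun ω => S.g0 N ω n) 4 P :=
  hS.memLp_data (f := fun d => d.noiseB.2) (((memLp_id_gaussianReal 4).comp_measurePreserving
    measurePreserving_snd).comp_measurePreserving (measurePreserving_noiseB μx νΦ νΓ vΦ vΓ)) N n

lemma memLp_X (N : ℕ) (n : Fin N) : MemLp (fun ω => S.X N ω n) 4 P :=
  memLp_orth_mulVec (hS.haar N).aemeasurable (hS.memLp_x N) n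

lemma memLp_xIn (t N : ℕ) (n : Fin N) : MemLp (fun ω => S.xIn t N ω n) 4 P := by
  cases t with
  | zero => exact ((hS.memLp_x N n).const_mul S.αΦ).add (hS.memLp_f0 N n)
  | succ t => exact memLp_orth_mulVec (measurable_orth_inv.comp_aemeasurable
      (hS.haar N).aemeasurable) (hS.memLp_XOut (t + 1) N) n

lemma memLp_XIn (t N : ℕ) (n : Fin N) : MemLp (fun ω => S.XIn t N ω n) 4 P := by
  cases t with
  | zero => exact ((hS.memLp_X N n).const_mul S.αΓ).add (hS.memLp_g0 N n)
  | succ t => exact memLp_orth_mulVec (hS.haar N).aemeasurable (hS.memLp_xOut (t + 1) N) n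

/-! ### Orthogonality for a random system -/

/-- Two arrays of functions of the data of the system that are asymptotically orthogonal and
compatible with renumbering the positions have LLN limit zero. -/
lemma llnLimitZero {u v : ∀ q : Σ N, Canon WΦ WΓ N, Fin q.1 → ℝ}
    (h : AsympOrth (procLaw μx νΦ νΓ vΦ vΓ) u v) (hu : RowMeas u) (hv : RowMeas v)
    (hue : Equivariant u) (hve : Equivariant v) {a b : ∀ N, Ω → Fin N → ℝ}
    (ha : ∀ N, a N = fun ω => u ⟨N, S.canon N ω⟩) (hb : ∀ N, b N = fun ω => v ⟨N, S.canon N ω⟩)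
    (ha4 : ∀ N (n : Fin N), MemLp (fun ω => a N ω n) 4 P)
    (hb4 : ∀ N (n : Fin N), MemLp (fun ω => b N ω n) 4 P) : LLNLimitZero P a b := by
  refine LLNLimitZero.of_tendsto ?_ ?_ (fun N n m => ?_) ha4 hb4
  · simp only [ha, hb]
    exact h.tendstoInMeasure hS.hasLaw_canon hu hv
  · simp only [ha, hb]
    exact h.tendsto_integral hS.hasLaw_canon hu hv
  · simp only [ha, hb]
    have h1 : ∀ i : Fin N, ∫ ω, u ⟨N, S.canon N ω⟩ i * v ⟨N, S.canon N ω⟩ i ∂P =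
        ∫ ω, u ⟨N, ω⟩ i * v ⟨N, ω⟩ i ∂(procLaw μx νΦ νΓ vΦ vΓ N) := by
      intro i
      have hm : Measurable fun ω : Canon WΦ WΓ N => u ⟨N, ω⟩ i * v ⟨N, ω⟩ i :=
        (hu.apply N i).mul (hv.apply N i)
      exact (hS.hasLaw_canon N).integral_comp hm.aestronglyMeasurable
    rw [h1, h1]
    exact hue.integral_mul_eq _ hve hu hv N n m

lemma x_eq_canon (N : ℕ) : S.x N = fun ω => hS.estimators.colA 0 ⟨N, S.canon N ω⟩ :=
  funext fun ω => (hS.colA_canon_zero N ω).symm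

lemma X_eq_canon (N : ℕ) : S.X N = fun ω => hS.estimators.colB 0 ⟨N, S.canon N ω⟩ :=
  funext fun ω => (hS.colB_canon_zero N ω).symm

lemma fIn_eq (t N : ℕ) : S.fIn P t N = fun ω => gsErr (procLaw μx νΦ νΓ vΦ vΓ)
    (hS.estimators.colA 0) (hS.estimators.inA (2 * t)) ⟨N, S.canon N ω⟩ := by
  rw [← gsError_pullback hS.hasLaw_canon (Estimators.rowMeas_colA _ 0)
    (Estimators.rowMeas_inA _ _), ← hS.x_eq_canon, fIn, funext fun ω => hS.xIn_eq t N ω]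

lemma gIn_eq (t N : ℕ) : S.gIn P t N = fun ω => gsErr (procLaw μx νΦ νΓ vΦ vΓ)
    (hS.estimators.colB 0) (hS.estimators.inB (2 * t - 1)) ⟨N, S.canon N ω⟩ := by
  rw [← gsError_pullback hS.hasLaw_canon (Estimators.rowMeas_colB _ 0)
    (Estimators.rowMeas_inB _ _), ← hS.X_eq_canon, gIn, funext fun ω => hS.XIn_eq t N ω]

lemma fOut_eq (t N : ℕ) : S.fOut P (t + 1) N = fun ω => gsErr (procLaw μx νΦ νΓ vΦ vΓ)
    (hS.estimators.colA 0) (hS.estimators.colA (2 * t + 1)) ⟨N, S.canon N ω⟩ := by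
  rw [← gsError_pullback hS.hasLaw_canon (Estimators.rowMeas_colA _ 0)
    (Estimators.rowMeas_colA _ _), ← hS.x_eq_canon, fOut, funext fun ω => hS.xOut_eq t N ω]

lemma gOut_eq (t N : ℕ) : S.gOut P (t + 1) N = fun ω => gsErr (procLaw μx νΦ νΓ vΦ vΓ)
    (hS.estimators.colB 0) (hS.estimators.colB (2 * t + 2)) ⟨N, S.canon N ω⟩ := by
  rw [← gsError_pullback hS.hasLaw_canon (Estimators.rowMeas_colB _ 0)
    (Estimators.rowMeas_colB _ _), ← hS.X_eq_canon, gOut, funext fun ω => hS.XOut_eq t N ω]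

/-- The assumptions on a random system with orthogonal estimators, in terms of the law of the
data. -/
lemma isOrthogonal (hγ : ∀ t, IsOrthogonalEstimator P S.X (S.XIn t) (S.XOut (t + 1)))
    (hφ : ∀ t, IsOrthogonalEstimator P S.x (S.xIn t) (S.xOut (t + 1))) :
    hS.estimators.IsOrthogonal μx νΦ νΓ vΦ vΓ where
  normalized := hS.normalized
  memLp := hS.fourth_moment.mono_exponent (by norm_num)
  uiA t := MeanUIArr.of_uniformIntegrable hS.hasLaw_canon (hS.unifInt_xOut (t + 1))
    (Estimators.rowMeas_colA _ _) fun N n ω => congrFun (hS.xOut_eq t N ω) n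
  uiB t := MeanUIArr.of_uniformIntegrable hS.hasLaw_canon (hS.unifInt_XOut (t + 1))
    (Estimators.rowMeas_colB _ _) fun N n ω => congrFun (hS.XOut_eq t N ω) n
  orthA t := by
    refine (hφ t).congr fun N => ?_
    rw [← integral_dot_pullback hS.hasLaw_canon
      (rowMeas_gsErr _ (Estimators.rowMeas_colA _ 0) (Estimators.rowMeas_inA _ _))
      (rowMeas_gsErr _ (Estimators.rowMeas_colA _ 0) (Estimators.rowMeas_colA _ _)), one_div]
    have h1 := hS.fIn_eq t N
    have h2 := hS.fOut_eq t N
    simp only [fIn, fOut] at h1 h2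
    rw [h1, h2]
  orthB t := by
    refine (hγ t).congr fun N => ?_
    rw [← integral_dot_pullback hS.hasLaw_canon
      (rowMeas_gsErr _ (Estimators.rowMeas_colB _ 0) (Estimators.rowMeas_inB _ _))
      (rowMeas_gsErr _ (Estimators.rowMeas_colB _ 0) (Estimators.rowMeas_colB _ _)), one_div]
    have h1 := hS.gIn_eq t N
    have h2 := hS.gOut_eq t N
    simp only [gIn, gOut] at h1 h2
    rw [h1, h2]

end System.IsModel

end OAMP

theorem mainTheorem2
    {Ω WΓ WΦ RΓ RΦ : Type*} [MeasurableSpace Ω] [MeasurableSpace WΓ] [MeasurableSpace WΦ]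
    [MeasurableSpace RΓ] [MeasurableSpace RΦ]
    (P : Measure Ω) [IsProbabilityMeasure P]
    (μx : Measure ℝ) [IsProbabilityMeasure μx]
    (νΓ : Measure WΓ) [IsProbabilityMeasure νΓ] (νΦ : Measure WΦ) [IsProbabilityMeasure νΦ]
    (vΓ vΦ : ℝ≥0) (S : OAMP.System Ω WΓ WΦ RΓ RΦ)
    (hS : S.IsModel P μx νΓ νΦ vΓ vΦ)
    (hγ : ∀ t, OAMP.IsOrthogonalEstimator P S.X (S.XIn t) (S.XOut (t + 1)))
    (hφ : ∀ t, OAMP.IsOrthogonalEstimator P S.x (S.xIn t) (S.xOut (t + 1))) :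
    ∀ t, 1 ≤ t →
      (∀ t', t' < t →
        OAMP.LLNLimitZero P (S.gIn P t') (S.gOut P t) ∧
        OAMP.LLNLimitZero P (S.fIn P t') (S.fOut P t)) ∧
      OAMP.LLNLimitZero P S.X (S.gOut P t) ∧
      OAMP.LLNLimitZero P S.x (S.fOut P t) := by
  intro t ht
  obtain ⟨t, rfl⟩ : ∃ k, t = k + 1 := ⟨t - 1, by omega⟩
  have he := hS.isOrthogonal hγ hφ
  set e := hS.estimators
  have mA0 := e.rowMeas_colA 0
  have mB0 := e.rowMeas_colB 0
  have mA := OAMP.rowMeas_gsErr (OAMP.procLaw μx νΦ νΓ vΦ vΓ) mA0 (e.rowMeas_colA (2 * t + 1))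
  have mB := OAMP.rowMeas_gsErr (OAMP.procLaw μx νΦ νΓ vΦ vΓ) mB0 (e.rowMeas_colB (2 * t + 2))
  have qA0 := e.equivariant_colA 0
  have qB0 := e.equivariant_colB 0
  have qA := qA0.gsErr (OAMP.procLaw μx νΦ νΓ vΦ vΓ) (e.equivariant_colA (2 * t + 1))
  have qB := qB0.gsErr (OAMP.procLaw μx νΦ νΓ vΦ vΓ) (e.equivariant_colB (2 * t + 2))
  have LA := fun N => OAMP.memLp_gsError (hS.memLp_x N) (hS.memLp_xOut (t + 1) N)
  have LB := fun N => OAMP.memLp_gsError (hS.memLp_X N) (hS.memLp_XOut (t + 1) N)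
  refine ⟨fun t' ht' => ⟨?_, ?_⟩, ?_, ?_⟩
  · exact hS.llnLimitZero (he.asympOrth_colB (Nat.lt_succ_iff.1 ht'))
      (OAMP.rowMeas_gsErr _ mB0 (e.rowMeas_inB _)) mB (qB0.gsErr _ (e.equivariant_inB _)) qB
      (hS.gIn_eq t') (hS.gOut_eq t)
      (fun N => OAMP.memLp_gsError (hS.memLp_X N) (hS.memLp_XIn t' N)) LB
  · exact hS.llnLimitZero (he.asympOrth_colA (Nat.lt_succ_iff.1 ht'))
      (OAMP.rowMeas_gsErr _ mA0 (e.rowMeas_inA _)) mA (qA0.gsErr _ (e.equivariant_inA _)) qA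
      (hS.fIn_eq t') (hS.fOut_eq t)
      (fun N => OAMP.memLp_gsError (hS.memLp_x N) (hS.memLp_xIn t' N)) LA
  · exact hS.llnLimitZero (he.asympOrth_signalB (2 * t + 2)) mB0 mB qB0 qB
      hS.X_eq_canon (hS.gOut_eq t) hS.memLp_X LB
  · exact hS.llnLimitZero (he.asympOrth_signalA (2 * t + 1)) mA0 mA qA0 qA
      hS.x_eq_canon (hS.fOut_eq t) hS.memLp_x LA
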